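/- Let $\mathcal K>1$ and let $c:\mathbb R\to[\mathcal K^{-1},\mathcal K]$ be smooth. Consider the Cauchy problem $$v_{tt}-c(v)\,(c(v)v_x)_x+\tfrac12(v+v^3)=0,\qquad v(0,\cdot)=v_0,\quad v_t(0,\cdot)=v_1, \qquad (*)$$ for initial data such that $v_0$ is absolutely continuous, $v_0\in L^2\cap L^4$, $(v_0)_x\in H^1\cap L^4$ and $v_1\in H^1\cap L^4$ on $\mathbb R$ (elements of $H^1(\mathbb R)$ are identified with their continuous representatives). Put $$\mathcal E_0=\frac12\int_{\mathbb R}\Big\{v_1^2+c^2(v_0)\,[(v_0)_x]^2+\frac{v_0^2}{2}+\frac{v_0^4}{4}\Big\}dx ,\qquad \mathcal E(t)=\frac12\int_{\mathbb R}\Big\{v_t^2+c^2(v)v_x^2+\frac{v^2}{2}+\frac{v^4}{4}\Big\}(t,x)\,dx .$$ **Construction.** Let $R_0=v_1+c(v_0)(v_0)_x$, $S_0=v_1-c(v_0)(v_0)_x$, and let $\gamma$ be the curve $s\mapsto\big(\int_0^s(1+R_0^2)\,dy,\ \int_s^0(1+S_0^2)\,dy\big)$, $s\in\mathbb R$, in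 the $(X,Y)$-plane. A function $u:\mathbb R^2\to\mathbb R$ is called *constructed* from $(v_0,v_1)$ if there are continuous functions $w,z,p,q,v$ on the whole $(X,Y)$-plane with (where $c=c(v)$, $c'=c'(v)$) $$w_Y=\tfrac{c'}{8c^2}(\cos z-\cos w)q-\tfrac{q}{8c}(v+v^3)(1+\cos z)(1+\cos w),\qquad z_X=\tfrac{c'}{8c^2}(\cos w-\cos z)p-\tfrac{p}{8c}(v+v^3)(1+\cos z)(1+\cos w),$$ $$p_Y=\tfrac{c'}{8c^2}(\sin z-\sin w)pq-\tfrac{1}{8c}pq\sin w\,(v+v^3)(1+\cos z),\qquad q_X=\tfrac{c'}{8c^2}(\sin w-\sin z)pq-\tfrac{1}{8c}pq\sin z\,(v+v^3)(1+\cos w),$$ $$v_X=\tfrac{p}{4c}\sin w,\qquad v_Y=\tfrac{q}{4c}\sin z,$$ and with $w=2\arctan R_0(s)$, $z=2\arctan S_0(s)$, $p=q=1$, $v=v_0(s)$ at the point $\gamma(s)$, and functions $t,x$ of $(X,Y)$ with $$t_X=\tfrac{(1+\cos w)p}{4c},\quad t_Y=\tfrac{(1+\cos z)q}{4c},\quad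 x_X=\tfrac{(1+\cos w)p}{4},\quad x_Y=-\tfrac{(1+\cos z)q}{4},\qquad t=0,\ x=s \text{ at }\gamma(s),$$ such that $u(t(X,Y),x(X,Y))=v(X,Y)$ for all $(X,Y)$. **Theorem.** 1. For all such data there is exactly one constructed function $u$ on $\mathbb R\times\mathbb R$. It is a weak solution of $(*)$: it is continuous; $u$, $u_t$, $u_x$ are in $L^2$ and $u$ is in $L^4$ on every strip $[-T,T]\times\mathbb R$, where $u_t,u_x$ are the a.e. classical partial derivatives and are also the weak derivatives of $u$; for every $t$, $u(t,\cdot)\in H^1\cap L^4$ and $u_t(t,\cdot)\in L^2$; $u(0,x)=v_0(x)$ and $u_t(0,x)=v_1(x)$ for all $x$; and for all $\phi\in C^1_c(\mathbb R^2)$ $$\iint \phi_t u_t-[c(u)\phi]_x\,[c(u)u_x]-\frac{\phi}{2}(u+u^3)\,dx\,dt=0$$ with an integrable integrand. 2. For every $t\in\mathbb R$, $u$ is differentiable at $(t,x)$ for almost every $x$, and the energy of $u$ satisfies $\mathcal E(t)\le\mathcal E_0<\infty$. 3. The constructed solutions depend continuously on the data: let $(v_0^n,v_1^n)$ and $(v_0,v_1)$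 be data as above with $$\|(v_0^n)_x-(v_0)_x\|_{L^2}\to0,\qquad \|v_1^n-v_1\|_{L^2}\to0,\qquad v_0^n\to v_0\ \text{ uniformly on compact sets}.$$ Then the corresponding constructed solutions satisfy $u^n\to u$ uniformly on bounded subsets of the $t$-$x$ plane. -/

import Mathlib

open MeasureTheory Set Filter Topology
open scoped ContDiff ENNReal

noncomputable section

/-- `f` belongs to the Sobolev space `H¹(ℝ)`; an element of `H¹(ℝ)` is represented by its
continuous representative, which is locally absolutely continuous, and `deriv f` is its
derivative (defined almost everywhere). -/
structure MemH1 (f : ℝ → ℝ) : Prop where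
  memLp : MemLp f 2 volume
  absolutelyContinuous : ∀ a b : ℝ, AbsolutelyContinuousOnInterval f a b
  memLp_deriv : MemLp (deriv f) 2 volume

/-- The class of initial data `v(0,·) = v₀`, `v_t(0,·) = v₁`: `v₀` is absolutely continuous, and
`v₀`, `(v₀)_x`, `v₁` belong to `L²`, `H¹`, `H¹` respectively, and all of them to `L⁴`. -/
structure AdmissibleData (v₀ v₁ : ℝ → ℝ) : Prop where
  absolutelyContinuous : ∀ a b : ℝ, AbsolutelyContinuousOnInterval v₀ a b
  memLp_two : MemLp v₀ 2 volume
  memLp_four : MemLp v₀ 4 volume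
  deriv_memH1 : MemH1 (deriv v₀)
  deriv_memLp_four : MemLp (deriv v₀) 4 volume
  vel_memH1 : MemH1 v₁
  vel_memLp_four : MemLp v₁ 4 volume

/-- The partial derivative `∂_t f (t,x)` of a function of `(t,x)`. -/
def dt (f : ℝ → ℝ → ℝ) (t x : ℝ) : ℝ := deriv (fun s => f s x) t

/-- The partial derivative `∂_x f (t,x)` of a function of `(t,x)`. -/
def dx (f : ℝ → ℝ → ℝ) (t x : ℝ) : ℝ := deriv (fun y => f t y) x

/-- The energy `𝓔(t) = ½ ∫ (u_t² + c(u)² u_x² + u²/2 + u⁴/4) dx`, with values in `[0,∞]`. -/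
def energy (c : ℝ → ℝ) (u : ℝ → ℝ → ℝ) (t : ℝ) : ℝ≥0∞ :=
  ∫⁻ x, ENNReal.ofReal
    ((1 / 2) * (dt u t x ^ 2 + c (u t x) ^ 2 * dx u t x ^ 2 + u t x ^ 2 / 2 + u t x ^ 4 / 4))

/-- The energy `𝓔₀ = ½ ∫ (v₁² + c(v₀)² ((v₀)_x)² + v₀²/2 + v₀⁴/4) dx` of the initial data. -/
def initialEnergy (c v₀ v₁ : ℝ → ℝ) : ℝ≥0∞ :=
  ∫⁻ x, ENNReal.ofReal
    ((1 / 2) * (v₁ x ^ 2 + c (v₀ x) ^ 2 * deriv v₀ x ^ 2 + v₀ x ^ 2 / 2 + v₀ x ^ 4 / 4))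

/-- The integrand `φ_t u_t - [c(u) φ]_x [c(u) u_x] - (φ/2) (u + u³)` of the weak formulation. -/
def weakIntegrand (c : ℝ → ℝ) (u φ : ℝ → ℝ → ℝ) (t x : ℝ) : ℝ :=
  dt φ t x * dt u t x
    - dx (fun s y => c (u s y) * φ s y) t x * (c (u t x) * dx u t x)
    - φ t x / 2 * (u t x + u t x ^ 3)

/-- The space-time strip `[-T,T] × ℝ`. -/
def strip (T : ℝ) : Set (ℝ × ℝ) := Icc (-T) T ×ˢ univ

/-- `u` is a weak solution, defined for all `(t,x) ∈ ℝ × ℝ`, of the Cauchy problem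
`v_tt - c(v) (c(v) v_x)_x + ½ (v + v³) = 0`, `v(0,·) = v₀`, `v_t(0,·) = v₁`.
It belongs to `H¹ ∩ L⁴` on every strip `[-T,T] × ℝ` and on every line `{t} × ℝ`; the classical
partial derivatives `dt u`, `dx u` are its weak derivatives. -/
structure IsWeakSolution (c v₀ v₁ : ℝ → ℝ) (u : ℝ → ℝ → ℝ) : Prop where
  continuous : Continuous (fun p : ℝ × ℝ => u p.1 p.2)
  memLp_two : ∀ T, MemLp (fun p : ℝ × ℝ => u p.1 p.2) 2 (volume.restrict (strip T))
  memLp_four : ∀ T, MemLp (fun p : ℝ × ℝ => u p.1 p.2) 4 (volume.restrict (strip T))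
  memLp_dt : ∀ T, MemLp (fun p : ℝ × ℝ => dt u p.1 p.2) 2 (volume.restrict (strip T))
  memLp_dx : ∀ T, MemLp (fun p : ℝ × ℝ => dx u p.1 p.2) 2 (volume.restrict (strip T))
  weak_dt : ∀ φ : ℝ → ℝ → ℝ, ContDiff ℝ 1 (fun p : ℝ × ℝ => φ p.1 p.2) →
    HasCompactSupport (fun p : ℝ × ℝ => φ p.1 p.2) →
    ∫ p : ℝ × ℝ, u p.1 p.2 * dt φ p.1 p.2 = - ∫ p : ℝ × ℝ, dt u p.1 p.2 * φ p.1 p.2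
  weak_dx : ∀ φ : ℝ → ℝ → ℝ, ContDiff ℝ 1 (fun p : ℝ × ℝ => φ p.1 p.2) →
    HasCompactSupport (fun p : ℝ × ℝ => φ p.1 p.2) →
    ∫ p : ℝ × ℝ, u p.1 p.2 * dx φ p.1 p.2 = - ∫ p : ℝ × ℝ, dx u p.1 p.2 * φ p.1 p.2
  slice_memH1 : ∀ t, MemH1 (u t)
  slice_memLp_four : ∀ t, MemLp (u t) 4 volume
  slice_memLp_dt : ∀ t, MemLp (dt u t) 2 volume
  initial_value : ∀ x, u 0 x = v₀ x
  initial_velocity : ∀ x, HasDerivAt (fun t => u t x) (v₁ x) 0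
  equation : ∀ φ : ℝ → ℝ → ℝ, ContDiff ℝ 1 (fun p : ℝ × ℝ => φ p.1 p.2) →
    HasCompactSupport (fun p : ℝ × ℝ => φ p.1 p.2) →
    Integrable (fun p : ℝ × ℝ => weakIntegrand c u φ p.1 p.2) ∧
      ∫ p : ℝ × ℝ, weakIntegrand c u φ p.1 p.2 = 0

/-- The initial value of `R = v_t + c(v) v_x`. -/
def initR (c v₀ v₁ : ℝ → ℝ) (s : ℝ) : ℝ := v₁ s + c (v₀ s) * deriv v₀ s

/-- The initial value of `S = v_t - c(v) v_x`. -/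
def initS (c v₀ v₁ : ℝ → ℝ) (s : ℝ) : ℝ := v₁ s - c (v₀ s) * deriv v₀ s

/-- The coordinate `X = ∫₀ˢ (1 + R²) dy` of the point `(0,s)` of the initial line. -/
def initX (c v₀ v₁ : ℝ → ℝ) (s : ℝ) : ℝ := ∫ y in (0 : ℝ)..s, (1 + initR c v₀ v₁ y ^ 2)

/-- The coordinate `Y = ∫ₛ⁰ (1 + S²) dy` of the point `(0,s)` of the initial line. -/
def initY (c v₀ v₁ : ℝ → ℝ) (s : ℝ) : ℝ := ∫ y in s..(0 : ℝ), (1 + initS c v₀ v₁ y ^ 2)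

/-- `(w,z,p,q,v)` is a solution on the whole `(X,Y)` plane of the semilinear system in
characteristic coordinates, with the boundary data on the curve
`{(initX s, initY s) : s ∈ ℝ}` given by `v₀`, `v₁`. -/
structure IsCharacteristicSolution (c v₀ v₁ : ℝ → ℝ) (w z p q v : ℝ → ℝ → ℝ) : Prop where
  continuous_w : Continuous (fun P : ℝ × ℝ => w P.1 P.2)
  continuous_z : Continuous (fun P : ℝ × ℝ => z P.1 P.2)
  continuous_p : Continuous (fun P : ℝ × ℝ => p P.1 P.2)
  continuous_q : Continuous (fun P : ℝ × ℝ => q P.1 P.2)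
  continuous_v : Continuous (fun P : ℝ × ℝ => v P.1 P.2)
  w_Y : ∀ X Y, HasDerivAt (fun y => w X y)
    (deriv c (v X Y) / (8 * c (v X Y) ^ 2) * (Real.cos (z X Y) - Real.cos (w X Y)) * q X Y
      - q X Y / (8 * c (v X Y)) * (v X Y + v X Y ^ 3)
        * (1 + Real.cos (z X Y)) * (1 + Real.cos (w X Y))) Y
  z_X : ∀ X Y, HasDerivAt (fun x => z x Y)
    (deriv c (v X Y) / (8 * c (v X Y) ^ 2) * (Real.cos (w X Y) - Real.cos (z X Y)) * p X Y
      - p X Y / (8 * c (v X Y)) * (v X Y + v X Y ^ 3)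
        * (1 + Real.cos (z X Y)) * (1 + Real.cos (w X Y))) X
  p_Y : ∀ X Y, HasDerivAt (fun y => p X y)
    (deriv c (v X Y) / (8 * c (v X Y) ^ 2) * (Real.sin (z X Y) - Real.sin (w X Y))
        * (p X Y * q X Y)
      - 1 / (8 * c (v X Y)) * (p X Y * q X Y) * Real.sin (w X Y) * (v X Y + v X Y ^ 3)
        * (1 + Real.cos (z X Y))) Y
  q_X : ∀ X Y, HasDerivAt (fun x => q x Y)
    (deriv c (v X Y) / (8 * c (v X Y) ^ 2) * (Real.sin (w X Y) - Real.sin (z X Y))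
        * (p X Y * q X Y)
      - 1 / (8 * c (v X Y)) * (p X Y * q X Y) * Real.sin (z X Y) * (v X Y + v X Y ^ 3)
        * (1 + Real.cos (w X Y))) X
  v_X : ∀ X Y, HasDerivAt (fun x => v x Y) (p X Y / (4 * c (v X Y)) * Real.sin (w X Y)) X
  v_Y : ∀ X Y, HasDerivAt (fun y => v X y) (q X Y / (4 * c (v X Y)) * Real.sin (z X Y)) Y
  boundary_w : ∀ s, w (initX c v₀ v₁ s) (initY c v₀ v₁ s) = 2 * Real.arctan (initR c v₀ v₁ s)
  boundary_z : ∀ s, z (initX c v₀ v₁ s) (initY c v₀ v₁ s) = 2 * Real.arctan (initS c v₀ v₁ s)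
  boundary_p : ∀ s, p (initX c v₀ v₁ s) (initY c v₀ v₁ s) = 1
  boundary_q : ∀ s, q (initX c v₀ v₁ s) (initY c v₀ v₁ s) = 1
  boundary_v : ∀ s, v (initX c v₀ v₁ s) (initY c v₀ v₁ s) = v₀ s

/-- `(X,Y) ↦ (t,x)` is the map from characteristic to physical coordinates that belongs to a
solution `(w,z,p,q,v)` of the semilinear system. -/
structure IsCoordinateMap (c v₀ v₁ : ℝ → ℝ) (w z p q v t x : ℝ → ℝ → ℝ) : Prop where
  t_X : ∀ X Y, HasDerivAt (fun ξ => t ξ Y)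
    ((1 + Real.cos (w X Y)) * p X Y / (4 * c (v X Y))) X
  t_Y : ∀ X Y, HasDerivAt (fun η => t X η)
    ((1 + Real.cos (z X Y)) * q X Y / (4 * c (v X Y))) Y
  x_X : ∀ X Y, HasDerivAt (fun ξ => x ξ Y) ((1 + Real.cos (w X Y)) * p X Y / 4) X
  x_Y : ∀ X Y, HasDerivAt (fun η => x X η) (-((1 + Real.cos (z X Y)) * q X Y / 4)) Y
  boundary_t : ∀ s, t (initX c v₀ v₁ s) (initY c v₀ v₁ s) = 0
  boundary_x : ∀ s, x (initX c v₀ v₁ s) (initY c v₀ v₁ s) = s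

/-- `u` is the function of `(t,x)` constructed from the data `v₀`, `v₁` by the method of
characteristics: `u (t(X,Y), x(X,Y)) = v(X,Y)` for all `(X,Y)`, where `v`, `t`, `x` come from a
solution of the semilinear system. -/
def IsConstructedSolution (c v₀ v₁ : ℝ → ℝ) (u : ℝ → ℝ → ℝ) : Prop :=
  ∃ w z p q v t x : ℝ → ℝ → ℝ,
    IsCharacteristicSolution c v₀ v₁ w z p q v ∧
    IsCoordinateMap c v₀ v₁ w z p q v t x ∧
    ∀ X Y, u (t X Y) (x X Y) = v X Y

end

/-! The singularities of the equation are those of R = v_t + c v_x and S = v_t - c v_x, which may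
become infinite along characteristics. In characteristic coordinates they are replaced by the angles
w = 2 arctan R, z = 2 arctan S and by densities p, q, and the system is semilinear: a blow-up of R
is only a passage of w through π, where the map to the (t,x) plane degenerates. The work is done in
coordinates (α, β) that make the initial curve the diagonal, with m = p(1 + cos w)/2, l = p sin w/2,
n = p(1 - cos w)/2 and their analogues m', l', n' (`CharFlow`). These satisfy l² = m n, and for
given v the system is bilinear in the two triples.

The main tool is the closed form (n + F m) dα + (n' + F m') dβ with F = v²/2 + v⁴/4
(`exists_isEnergy`). Its potential E is monotone in both variables, and its increments are bounded
by the energy of the data.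

The functions t and x are monotone in each coordinate. Where they are constant, m or m' vanishes,
hence l or l' does, and v is constant too; so v descends to a function u, which is continuous
because the map is proper and onto (`v_eq_of_coord_eq`, `continuous_solution`). A line t = τ is
covered by a monotone curve. At almost every x this curve is differentiable, which forces m, m' > 0
there, and the derivative of E/4 along it is the energy density; since a monotone function may
exceed the integral of its derivative, the energy satisfies an inequality (`exists_slice`,
`energy_le`). The weak equation is the integral of a divergence in (α, β); the degenerate set
contributes nothing because l and its derivative vanish together almost everywhere where l = 0
(`weak_equation`).

Uniqueness and continuous dependence follow from one estimate for two flows on a triangle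
(`stability`). One flow is bounded in the supremum norm, the other enters only through integrals
controlled by its energy, so that L² convergence of the data suffices; a Gronwall argument with an
exponential weight closes the estimate.

For existence the densities and v are truncated, and the truncated system is solved by a contraction
in a weighted norm (`exists_diagonal_problem`). Green's identity for the energy form bounds v and
the integrals of the densities along characteristics, and a continuity argument shows that the
truncation is never active (`inactive_of_le`). -/

open scoped BoundedContinuousFunction

/-! ### Calculus in the plane: partial derivatives, Gronwall, Green's identity -/

section Calculus

/-- A function with continuous partial derivatives is strictly differentiable. -/
lemma hasStrictFDerivAt_of_partials {f fa fb : ℝ → ℝ → ℝ}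
    (ha : ∀ a b, HasDerivAt (fun x => f x b) (fa a b) a)
    (hb : ∀ a b, HasDerivAt (fun y => f a y) (fb a b) b)
    (ca : Continuous fun P : ℝ × ℝ => fa P.1 P.2) (cb : Continuous fun P : ℝ × ℝ => fb P.1 P.2)
    (P : ℝ × ℝ) :
    HasStrictFDerivAt (fun P : ℝ × ℝ => f P.1 P.2)
      (fa P.1 P.2 • ContinuousLinearMap.fst ℝ ℝ ℝ + fb P.1 P.2 • ContinuousLinearMap.snd ℝ ℝ ℝ)
      P := by
  have key := hasStrictFDerivAt_uncurry_coprod (𝕜 := ℝ) (u := P) (f := f)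
    (f₁ := fun a b => ContinuousLinearMap.toSpanSingleton ℝ (fa a b))
    (f₂ := fun a b => ContinuousLinearMap.toSpanSingleton ℝ (fb a b))
    (Eventually.of_forall fun v => (ha v.1 v.2).hasFDerivAt)
    (Eventually.of_forall fun v => (hb v.1 v.2).hasFDerivAt)
    ((ContinuousLinearMap.toSpanSingletonCLE (𝕜 := ℝ) (E := ℝ)).continuous.comp ca).continuousAt
    ((ContinuousLinearMap.toSpanSingletonCLE (𝕜 := ℝ) (E := ℝ)).continuous.comp cb).continuousAt
  refine HasStrictFDerivAt.congr_fderiv (f := fun P : ℝ × ℝ => f P.1 P.2) key ?_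
  ext <;> simp [Function.HasUncurry.uncurry]

lemma continuous_of_partials {f fa fb : ℝ → ℝ → ℝ}
    (ha : ∀ a b, HasDerivAt (fun x => f x b) (fa a b) a)
    (hb : ∀ a b, HasDerivAt (fun y => f a y) (fb a b) b)
    (ca : Continuous fun P : ℝ × ℝ => fa P.1 P.2) (cb : Continuous fun P : ℝ × ℝ => fb P.1 P.2) :
    Continuous fun P : ℝ × ℝ => f P.1 P.2 :=
  continuous_iff_continuousAt.2 fun P =>
    (hasStrictFDerivAt_of_partials ha hb ca cb P).hasFDerivAt.continuousAt

lemma continuous_fst_slice {f : ℝ → ℝ → ℝ} (h : Continuous fun P : ℝ × ℝ => f P.1 P.2) (b : ℝ) :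
    Continuous fun x => f x b :=
  h.comp (continuous_id.prodMk continuous_const)

lemma continuous_snd_slice {f : ℝ → ℝ → ℝ} (h : Continuous fun P : ℝ × ℝ => f P.1 P.2) (a : ℝ) :
    Continuous fun y => f a y :=
  h.comp (continuous_const.prodMk continuous_id)

lemma integral_eq_sub_of_continuous_deriv {f f' : ℝ → ℝ} (h : ∀ x, HasDerivAt f (f' x) x)
    (hc : Continuous f') (a b : ℝ) : ∫ s in a..b, f' s = f b - f a :=
  intervalIntegral.integral_eq_sub_of_hasDerivAt (fun x _ => h x) (hc.intervalIntegrable _ _)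

/-- Gronwall's inequality in integral form with a variable coefficient. -/
lemma le_mul_exp_of_le_integral {φ k h : ℝ → ℝ} (hφ : Continuous φ) (hk : Continuous k)
    (hh : Continuous h) {a b A : ℝ} (hab : a ≤ b) (hk0 : ∀ x ∈ Icc a b, 0 ≤ k x)
    (hh0 : ∀ x ∈ Icc a b, 0 ≤ h x)
    (H : ∀ x ∈ Icc a b, φ x ≤ A + ∫ s in a..x, (k s * φ s + h s)) :
    φ b ≤ (A + ∫ s in a..b, h s) * Real.exp (∫ s in a..b, k s) := by
  set W : ℝ → ℝ := fun x => A + ∫ s in a..x, (k s * φ s + h s) with hW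
  set κ : ℝ → ℝ := fun x => ∫ s in a..x, k s with hκ
  set I : ℝ → ℝ := fun x => ∫ s in a..x, h s with hI
  have dW : ∀ x, HasDerivAt W (k x * φ x + h x) x := fun x =>
    (((hk.mul hφ).add hh).integral_hasStrictDerivAt a x).hasDerivAt.const_add A
  have dκ : ∀ x, HasDerivAt κ (k x) x := fun x => (hk.integral_hasStrictDerivAt a x).hasDerivAt
  have dI : ∀ x, HasDerivAt I (h x) x := fun x => (hh.integral_hasStrictDerivAt a x).hasDerivAt
  have κ0 : ∀ x ∈ Icc a b, 0 ≤ κ x := fun x hx =>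
    intervalIntegral.integral_nonneg hx.1 fun s hs => hk0 s ⟨hs.1, hs.2.trans hx.2⟩
  -- Subtracting the primitive of h keeps the integrating-factor expression decreasing, since h
  -- enters its derivative with the weight exp(-κ) ≤ 1.
  have dG : ∀ x, HasDerivAt (fun x => Real.exp (-κ x) * W x - I x)
      (Real.exp (-κ x) * (-k x) * W x + Real.exp (-κ x) * (k x * φ x + h x) - h x) x := fun x =>
    (((dκ x).neg.exp).mul (dW x)).sub (dI x)
  have anti : AntitoneOn (fun x => Real.exp (-κ x) * W x - I x) (Icc a b) := by
    refine antitoneOn_of_deriv_nonpos (convex_Icc a b)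
      (fun x _ => (dG x).continuousAt.continuousWithinAt)
      (fun x _ => (dG x).differentiableAt.differentiableWithinAt) fun x hx => ?_
    rw [(dG x).deriv]
    have hx' := interior_subset hx
    have e1 : Real.exp (-κ x) ≤ 1 := Real.exp_le_one_iff.2 (by linarith [κ0 x hx'])
    have e0 := (Real.exp_pos (-κ x)).le
    have h1 : Real.exp (-κ x) * k x * φ x ≤ Real.exp (-κ x) * k x * W x :=
      mul_le_mul_of_nonneg_left (H x hx') (mul_nonneg e0 (hk0 x hx'))
    have h2 : Real.exp (-κ x) * h x ≤ 1 * h x := mul_le_mul_of_nonneg_right e1 (hh0 x hx')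
    nlinarith
  have hG := anti (left_mem_Icc.2 hab) (right_mem_Icc.2 hab) hab
  have hWa : W a = A := by simp [hW]
  have hκa : κ a = 0 := by simp [hκ]
  have hIa : I a = 0 := by simp [hI]
  simp only [hWa, hκa, hIa, neg_zero, Real.exp_zero] at hG
  have h3 : Real.exp (-κ b) * W b ≤ A + I b := by linarith
  calc φ b ≤ W b := H b (right_mem_Icc.2 hab)
    _ = (Real.exp (-κ b) * W b) * Real.exp (κ b) := by
        rw [mul_right_comm, ← Real.exp_add]; simp
    _ ≤ _ := mul_le_mul_of_nonneg_right h3 (Real.exp_pos _).le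

/-- Gronwall's inequality in integral form, integrating towards the left end point. -/
lemma le_mul_exp_of_le_integral_left {φ k h : ℝ → ℝ} (hφ : Continuous φ) (hk : Continuous k)
    (hh : Continuous h) {a b A : ℝ} (hab : a ≤ b) (hk0 : ∀ x ∈ Icc a b, 0 ≤ k x)
    (hh0 : ∀ x ∈ Icc a b, 0 ≤ h x)
    (H : ∀ x ∈ Icc a b, φ x ≤ A + ∫ s in x..b, (k s * φ s + h s)) :
    φ a ≤ (A + ∫ s in a..b, h s) * Real.exp (∫ s in a..b, k s) := by
  have := le_mul_exp_of_le_integral (φ := fun x => φ (-x)) (k := fun x => k (-x))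
    (h := fun x => h (-x)) (a := -b) (b := -a) (A := A) (by fun_prop) (by fun_prop) (by fun_prop)
    (by linarith) (fun x hx => hk0 _ ⟨by linarith [hx.2], by linarith [hx.1]⟩)
    (fun x hx => hh0 _ ⟨by linarith [hx.2], by linarith [hx.1]⟩) (fun x hx => by
      have h1 := H (-x) ⟨by linarith [hx.2], by linarith [hx.1]⟩
      rwa [intervalIntegral.integral_comp_neg (fun s => k s * φ s + h s), neg_neg])
  simpa using this

/-- Green's identity on the triangle `a ≤ η ≤ ξ ≤ b`. -/
lemma integral_legs_eq_integral_diagonal {A B C : ℝ → ℝ → ℝ}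
    (cA : Continuous fun P : ℝ × ℝ => A P.1 P.2) (cB : Continuous fun P : ℝ × ℝ => B P.1 P.2)
    (cC : Continuous fun P : ℝ × ℝ => C P.1 P.2) {a b : ℝ} (hab : a ≤ b)
    (hA : ∀ ξ η, a ≤ η → η ≤ ξ → ξ ≤ b → HasDerivAt (fun y => A ξ y) (C ξ η) η)
    (hB : ∀ ξ η, a ≤ η → η ≤ ξ → ξ ≤ b → HasDerivAt (fun x => B x η) (C ξ η) ξ) :
    (∫ ξ in a..b, A ξ a) + ∫ η in a..b, B b η = ∫ s in a..b, (A s s + B s s) := by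
  have h1 : ∀ ξ ∈ Icc a b, A ξ ξ - A ξ a = ∫ η in a..ξ, C ξ η := fun ξ hξ => by
    rw [intervalIntegral.integral_eq_sub_of_hasDerivAt (f := fun y => A ξ y)]
    · intro η hη
      rw [uIcc_of_le hξ.1] at hη
      exact hA ξ η hη.1 hη.2 hξ.2
    · exact (continuous_snd_slice cC ξ).intervalIntegrable _ _
  have h2 : ∀ η ∈ Icc a b, B b η - B η η = ∫ ξ in η..b, C ξ η := fun η hη => by
    rw [intervalIntegral.integral_eq_sub_of_hasDerivAt (f := fun x => B x η)]
    · intro ξ hξ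
      rw [uIcc_of_le hη.2] at hξ
      exact hB ξ η hη.1 hξ.1 hξ.2
    · exact (continuous_fst_slice cC η).intervalIntegrable _ _
  -- Extending C by zero outside the triangle turns both iterated integrals into integrals over the
  -- square, where Fubini applies.
  set T : Set (ℝ × ℝ) := {P | P.2 ≤ P.1} with hT
  have hTm : MeasurableSet T := measurableSet_le measurable_snd measurable_fst
  set D : ℝ → ℝ → ℝ := fun ξ η => T.indicator (fun P => C P.1 P.2) (ξ, η) with hD
  have h3 : ∀ ξ ∈ Icc a b, ∫ η in a..ξ, C ξ η = ∫ η in a..b, D ξ η := fun ξ hξ => by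
    rw [intervalIntegral.integral_of_le hξ.1, intervalIntegral.integral_of_le hab]
    have : (fun η => D ξ η) = (Iic ξ).indicator (fun η => C ξ η) := by
      ext η; simp [hD, hT, indicator]
    rw [this, setIntegral_indicator measurableSet_Iic, Ioc_inter_Iic, inf_eq_right.2 hξ.2]
  have h4 : ∀ η ∈ Icc a b, ∫ ξ in η..b, C ξ η = ∫ ξ in a..b, D ξ η := fun η hη => by
    rw [intervalIntegral.integral_of_le hη.2, intervalIntegral.integral_of_le hab]
    have : (fun ξ => D ξ η) = (Ici η).indicator (fun ξ => C ξ η) := by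
      ext ξ; simp [hD, hT, indicator]
    rw [this, setIntegral_indicator measurableSet_Ici, ← integral_Icc_eq_integral_Ioc]
    have hs : (Ioc a b ∩ Ici η : Set ℝ) =ᵐ[volume] (Icc η b : Set ℝ) := by
      have : Icc a b ∩ Ici η = Icc η b := by
        ext x; simp only [mem_inter_iff, mem_Icc, mem_Ici]
        exact ⟨fun h => ⟨h.2, h.1.2⟩, fun h => ⟨⟨hη.1.trans h.1, h.2⟩, h.1⟩⟩
      rw [← this]
      exact ae_eq_set_inter Ioc_ae_eq_Icc (ae_eq_refl (Ici η))
    exact (setIntegral_congr_set hs).symm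
  have hint : IntegrableOn (Function.uncurry D) (uIoc a b ×ˢ uIoc a b) := by
    have : Function.uncurry D = T.indicator (fun P => C P.1 P.2) := by ext ⟨x, y⟩; rfl
    rw [this]
    refine IntegrableOn.indicator ?_ hTm
    refine (cC.continuousOn.integrableOn_compact (K := uIcc a b ×ˢ uIcc a b)
      (isCompact_uIcc.prod isCompact_uIcc)).mono_set ?_
    exact prod_mono uIoc_subset_uIcc uIoc_subset_uIcc
  have h5 := intervalIntegral_intervalIntegral_swap hint
  have h6 : ∫ ξ in a..b, (A ξ ξ - A ξ a) = ∫ ξ in a..b, ∫ η in a..b, D ξ η :=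
    intervalIntegral.integral_congr fun ξ hξ => by
      rw [uIcc_of_le hab] at hξ
      exact (h1 ξ hξ).trans (h3 ξ hξ)
  have h7 : ∫ η in a..b, (B b η - B η η) = ∫ η in a..b, ∫ ξ in a..b, D ξ η :=
    intervalIntegral.integral_congr fun η hη => by
      rw [uIcc_of_le hab] at hη
      exact (h2 η hη).trans (h4 η hη)
  have i1 : IntervalIntegrable (fun s => A s s) volume a b :=
    (cA.comp (continuous_id.prodMk continuous_id)).intervalIntegrable _ _
  have i2 : IntervalIntegrable (fun s => B s s) volume a b :=
    (cB.comp (continuous_id.prodMk continuous_id)).intervalIntegrable _ _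
  have i3 := (continuous_fst_slice cA a).intervalIntegrable (μ := volume) a b
  have i4 := (continuous_snd_slice cB b).intervalIntegrable (μ := volume) a b
  rw [intervalIntegral.integral_sub i1 i3] at h6
  rw [intervalIntegral.integral_sub i4 i2] at h7
  rw [intervalIntegral.integral_add i1 i2]
  linarith

/-- A closed form `A dα + B dβ` with continuous coefficients and continuous mixed derivative
has a potential. -/
lemma exists_potential {A B C : ℝ → ℝ → ℝ}
    (cA : Continuous fun P : ℝ × ℝ => A P.1 P.2) (cB : Continuous fun P : ℝ × ℝ => B P.1 P.2)
    (cC : Continuous fun P : ℝ × ℝ => C P.1 P.2)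
    (hA : ∀ a b, HasDerivAt (fun y => A a y) (C a b) b)
    (hB : ∀ a b, HasDerivAt (fun x => B x b) (C a b) a) :
    ∃ Θ : ℝ → ℝ → ℝ, (∀ a b, HasDerivAt (fun x => Θ x b) (A a b) a) ∧
      ∀ a b, HasDerivAt (fun y => Θ a y) (B a b) b := by
  -- Integration along the two pairs of sides of a rectangle gives the same value; each of the two
  -- expressions makes one partial derivative evident.
  have key : ∀ a b, (∫ ξ in (0:ℝ)..a, A ξ 0) + ∫ η in (0:ℝ)..b, B a η
      = (∫ ξ in (0:ℝ)..a, A ξ b) + ∫ η in (0:ℝ)..b, B 0 η := fun a b => by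
    have h1 : ∀ ξ, A ξ b - A ξ 0 = ∫ η in (0:ℝ)..b, C ξ η := fun ξ =>
      (integral_eq_sub_of_continuous_deriv (hA ξ) (continuous_snd_slice cC ξ) 0 b).symm
    have h2 : ∀ η, B a η - B 0 η = ∫ ξ in (0:ℝ)..a, C ξ η := fun η =>
      (integral_eq_sub_of_continuous_deriv (fun x => hB x η) (continuous_fst_slice cC η) 0 a).symm
    have hint : IntegrableOn (Function.uncurry C) (uIoc 0 a ×ˢ uIoc 0 b) := by
      refine (Continuous.continuousOn cC).integrableOn_compact (K := uIcc 0 a ×ˢ uIcc 0 b)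
        (isCompact_uIcc.prod isCompact_uIcc) |>.mono_set ?_
      exact prod_mono uIoc_subset_uIcc uIoc_subset_uIcc
    have h3 := intervalIntegral_intervalIntegral_swap hint
    simp_rw [← h1, ← h2] at h3
    rw [intervalIntegral.integral_sub ((continuous_fst_slice cA b).intervalIntegrable _ _)
        ((continuous_fst_slice cA 0).intervalIntegrable _ _),
      intervalIntegral.integral_sub ((continuous_snd_slice cB a).intervalIntegrable _ _)
        ((continuous_snd_slice cB 0).intervalIntegrable _ _)] at h3
    linarith
  refine ⟨fun a b => (∫ ξ in (0:ℝ)..a, A ξ 0) + ∫ η in (0:ℝ)..b, B a η, fun a b => ?_,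
    fun a b => ?_⟩
  · simp_rw [key]
    exact (((continuous_fst_slice cA b).integral_hasStrictDerivAt 0 a).hasDerivAt).add_const _
  · exact (((continuous_snd_slice cB a).integral_hasStrictDerivAt 0 b).hasDerivAt).const_add _

lemma hasDerivAt_diagonal_of_partials {f fa fb : ℝ → ℝ → ℝ}
    (ha : ∀ a b, HasDerivAt (fun x => f x b) (fa a b) a)
    (hb : ∀ a b, HasDerivAt (fun y => f a y) (fb a b) b)
    (ca : Continuous fun P : ℝ × ℝ => fa P.1 P.2) (cb : Continuous fun P : ℝ × ℝ => fb P.1 P.2)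
    (s : ℝ) : HasDerivAt (fun s => f s s) (fa s s + fb s s) s := by
  have h := (hasStrictFDerivAt_of_partials ha hb ca cb (s, s)).hasFDerivAt
  have h2 := HasFDerivAt.comp_hasDerivAt (f := fun s : ℝ => (s, s)) s h
    ((hasDerivAt_id s).prodMk (hasDerivAt_id s))
  refine HasDerivAt.congr_deriv (f := fun s => f s s) h2 ?_
  simp

end Calculus

/-! ### The bilinear system in normalized characteristic coordinates -/

/-- The coefficient `∂_β m = ∂_α m'` of the system in the coordinates `(α,β)`. -/
noncomputable def flowΩ (c : ℝ → ℝ) (v m l m' l' : ℝ) : ℝ :=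
  deriv c v / (4 * c v ^ 2) * (l * m' - m * l')

/-- The coefficient `∂_α l' = - ∂_β l` of the system in the coordinates `(α,β)`. -/
noncomputable def flowΛ (c : ℝ → ℝ) (v m l n m' l' n' : ℝ) : ℝ :=
  deriv c v / (8 * c v ^ 2) * (2 * l * l' - m * n' - n * m') - (v + v ^ 3) / (4 * c v) * (m * m')

/-- The transport part of `∂_β n` and `∂_α n'`. -/
noncomputable def flowN (c : ℝ → ℝ) (v l n l' n' : ℝ) : ℝ :=
  deriv c v / (4 * c v ^ 2) * (l * n' - n * l')

/-- The potential energy density `v²/2 + v⁴/4`. -/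
noncomputable def potentialF (v : ℝ) : ℝ := v ^ 2 / 2 + v ^ 4 / 4

/-- A global solution of the semilinear system, in characteristic coordinates `(α,β)` normalized
so that the initial line is the diagonal and in variables that make the system bilinear:
`m dα`, `l dα`, `n dα` stand for `(1, R, R²) · 2 dx` along one family of characteristics and
`m' dβ`, `l' dβ`, `n' dβ` for `(1, S, S²) · 2 dx` along the other one. -/
structure CharFlow (c R S v₀ : ℝ → ℝ) where
  (m l n m' l' n' v t x : ℝ → ℝ → ℝ)
  cont_m : Continuous fun P : ℝ × ℝ => m P.1 P.2
  cont_l : Continuous fun P : ℝ × ℝ => l P.1 P.2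
  cont_n : Continuous fun P : ℝ × ℝ => n P.1 P.2
  cont_m' : Continuous fun P : ℝ × ℝ => m' P.1 P.2
  cont_l' : Continuous fun P : ℝ × ℝ => l' P.1 P.2
  cont_n' : Continuous fun P : ℝ × ℝ => n' P.1 P.2
  cont_v : Continuous fun P : ℝ × ℝ => v P.1 P.2
  m_nonneg : ∀ a b, 0 ≤ m a b
  n_nonneg : ∀ a b, 0 ≤ n a b
  m'_nonneg : ∀ a b, 0 ≤ m' a b
  n'_nonneg : ∀ a b, 0 ≤ n' a b
  l_sq : ∀ a b, l a b ^ 2 = m a b * n a b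
  l'_sq : ∀ a b, l' a b ^ 2 = m' a b * n' a b
  pos : ∀ a b, 0 < m a b + n a b
  pos' : ∀ a b, 0 < m' a b + n' a b
  m_b : ∀ a b, HasDerivAt (fun y => m a y) (flowΩ c (v a b) (m a b) (l a b) (m' a b) (l' a b)) b
  m'_a : ∀ a b, HasDerivAt (fun y => m' y b) (flowΩ c (v a b) (m a b) (l a b) (m' a b) (l' a b)) a
  l_b : ∀ a b, HasDerivAt (fun y => l a y)
    (-flowΛ c (v a b) (m a b) (l a b) (n a b) (m' a b) (l' a b) (n' a b)) b
  l'_a : ∀ a b, HasDerivAt (fun y => l' y b)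
    (flowΛ c (v a b) (m a b) (l a b) (n a b) (m' a b) (l' a b) (n' a b)) a
  n_b : ∀ a b, HasDerivAt (fun y => n a y)
    (flowN c (v a b) (l a b) (n a b) (l' a b) (n' a b)
      + (v a b + v a b ^ 3) / (2 * c (v a b)) * (l a b * m' a b)) b
  n'_a : ∀ a b, HasDerivAt (fun y => n' y b)
    (flowN c (v a b) (l a b) (n a b) (l' a b) (n' a b)
      - (v a b + v a b ^ 3) / (2 * c (v a b)) * (l' a b * m a b)) a
  v_a : ∀ a b, HasDerivAt (fun y => v y b) (l a b / (2 * c (v a b))) a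
  v_b : ∀ a b, HasDerivAt (fun y => v a y) (-(l' a b / (2 * c (v a b)))) b
  t_a : ∀ a b, HasDerivAt (fun y => t y b) (m a b / (2 * c (v a b))) a
  t_b : ∀ a b, HasDerivAt (fun y => t a y) (-(m' a b / (2 * c (v a b)))) b
  x_a : ∀ a b, HasDerivAt (fun y => x y b) (m a b / 2) a
  x_b : ∀ a b, HasDerivAt (fun y => x a y) (m' a b / 2) b
  m_diag : ∀ s, m s s = 1
  l_diag : ∀ s, l s s = R s
  n_diag : ∀ s, n s s = R s ^ 2
  m'_diag : ∀ s, m' s s = 1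
  l'_diag : ∀ s, l' s s = S s
  n'_diag : ∀ s, n' s s = S s ^ 2
  v_diag : ∀ s, v s s = v₀ s
  t_diag : ∀ s, t s s = 0
  x_diag : ∀ s, x s s = s

/-- Hypotheses on the wave speed. -/
structure IsSpeed (K : ℝ) (c : ℝ → ℝ) : Prop where
  one_lt : 1 < K
  smooth : ContDiff ℝ ∞ c
  mem : ∀ s, c s ∈ Icc K⁻¹ K

namespace IsSpeed
variable {K : ℝ} {c : ℝ → ℝ} (h : IsSpeed K c)
include h

lemma K_pos : 0 < K := by linarith [h.one_lt]
lemma pos (s : ℝ) : 0 < c s := (inv_pos.2 h.K_pos).trans_le (h.mem s).1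
lemma le (s : ℝ) : c s ≤ K := (h.mem s).2
lemma inv_le (s : ℝ) : (c s)⁻¹ ≤ K := inv_le_of_inv_le₀ h.K_pos (h.mem s).1
lemma continuous : Continuous c := h.smooth.continuous
lemma continuous_deriv : Continuous (deriv c) := h.smooth.continuous_deriv (by simp)
lemma hasDerivAt (s : ℝ) : HasDerivAt c (deriv c s) s :=
  (h.smooth.differentiable (by simp) s).hasDerivAt

end IsSpeed

/-- A function whose derivative vanishes wherever that of a monotone function does is constant
where the monotone function is. -/
lemma eq_of_monotone_eq {f f' g g' : ℝ → ℝ} (hf : ∀ x, HasDerivAt f (f' x) x)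
    (hg : ∀ x, HasDerivAt g (g' x) x) (h0 : ∀ x, 0 ≤ f' x) (h : ∀ x, f' x = 0 → g' x = 0)
    {a b : ℝ} (hab : a ≤ b) (hfab : f b ≤ f a) : g a = g b := by
  rcases hab.eq_or_lt with rfl | hlt
  · rfl
  have hm : Monotone f := monotone_of_hasDerivAt_nonneg hf h0
  -- The mean value point ξ is interior, and f is constant near it, so f' and hence g' vanish at ξ.
  obtain ⟨ξ, hξ, he⟩ := exists_hasDerivAt_eq_slope g g' hlt
    (fun x _ => (hg x).continuousAt.continuousWithinAt) (fun x _ => hg x)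
  have hc : f =ᶠ[𝓝 ξ] fun _ => f a := by
    filter_upwards [Ioo_mem_nhds hξ.1 hξ.2] with y hy
    exact le_antisymm ((hm hy.2.le).trans hfab) (hm hy.1.le)
  have hz : f' ξ = 0 := ((hf ξ).congr_of_eventuallyEq hc.symm).unique (hasDerivAt_const ξ (f a))
  rw [h ξ hz, eq_comm, div_eq_zero_iff] at he
  rcases he with he | he <;> linarith

/-! ### The map to physical coordinates and the function it defines -/

namespace CharFlow

variable {K : ℝ} {c R S v₀ : ℝ → ℝ}

lemma l_eq_zero (U : CharFlow c R S v₀) {a b : ℝ} (h : U.m a b = 0) : U.l a b = 0 := by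
  have := U.l_sq a b
  rw [h, zero_mul] at this
  exact pow_eq_zero_iff (two_ne_zero) |>.1 this

lemma l'_eq_zero (U : CharFlow c R S v₀) {a b : ℝ} (h : U.m' a b = 0) : U.l' a b = 0 := by
  have := U.l'_sq a b
  rw [h, zero_mul] at this
  exact pow_eq_zero_iff (two_ne_zero) |>.1 this

/-- Time reversal. -/
def rev (U : CharFlow c R S v₀) : CharFlow c (fun s => -S s) (fun s => -R s) v₀ where
  -- Reversing time exchanges the two families of characteristics and sends (R, S) to (-S, -R).
  -- Statements for β ≤ α thereby give those for α ≤ β.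
  m a b := U.m' b a
  l a b := -U.l' b a
  n a b := U.n' b a
  m' a b := U.m b a
  l' a b := -U.l b a
  n' a b := U.n b a
  v a b := U.v b a
  t a b := -U.t b a
  x a b := U.x b a
  cont_m := U.cont_m'.comp continuous_swap
  cont_l := (U.cont_l'.comp continuous_swap).neg
  cont_n := U.cont_n'.comp continuous_swap
  cont_m' := U.cont_m.comp continuous_swap
  cont_l' := (U.cont_l.comp continuous_swap).neg
  cont_n' := U.cont_n.comp continuous_swap
  cont_v := U.cont_v.comp continuous_swap
  m_nonneg a b := U.m'_nonneg b a
  n_nonneg a b := U.n'_nonneg b a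
  m'_nonneg a b := U.m_nonneg b a
  n'_nonneg a b := U.n_nonneg b a
  l_sq a b := by rw [neg_sq]; exact U.l'_sq b a
  l'_sq a b := by rw [neg_sq]; exact U.l_sq b a
  pos a b := U.pos' b a
  pos' a b := U.pos b a
  m_b a b := (U.m'_a b a).congr_deriv (by simp only [flowΩ]; ring)
  m'_a a b := (U.m_b b a).congr_deriv (by simp only [flowΩ]; ring)
  l_b a b := (U.l'_a b a).neg.congr_deriv (by simp only [flowΛ]; ring)
  l'_a a b := (U.l_b b a).neg.congr_deriv (by simp only [flowΛ]; ring)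
  n_b a b := (U.n'_a b a).congr_deriv (by simp only [flowN]; ring)
  n'_a a b := (U.n_b b a).congr_deriv (by simp only [flowN]; ring)
  v_a a b := (U.v_b b a).congr_deriv (by ring)
  v_b a b := (U.v_a b a).congr_deriv (by ring)
  t_a a b := (U.t_b b a).neg.congr_deriv (by ring)
  t_b a b := (U.t_a b a).neg
  x_a a b := U.x_b b a
  x_b a b := U.x_a b a
  m_diag := U.m'_diag
  l_diag s := by rw [U.l'_diag]
  n_diag s := by rw [U.n'_diag]; ring
  m'_diag := U.m_diag
  l'_diag s := by rw [U.l_diag]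
  n'_diag s := by rw [U.n_diag]; ring
  v_diag := U.v_diag
  t_diag s := by rw [U.t_diag, neg_zero]
  x_diag := U.x_diag

variable (h : IsSpeed K c) (U : CharFlow c R S v₀)

lemma continuous_R (U : CharFlow c R S v₀) : Continuous R := by
  have := U.cont_l.comp (continuous_id.prodMk continuous_id)
  refine this.congr fun s => U.l_diag s

lemma continuous_S (U : CharFlow c R S v₀) : Continuous S := by
  have := U.cont_l'.comp (continuous_id.prodMk continuous_id)
  refine this.congr fun s => U.l'_diag s

lemma continuous_v₀ (U : CharFlow c R S v₀) : Continuous v₀ := by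
  have := U.cont_v.comp (continuous_id.prodMk continuous_id)
  refine this.congr fun s => U.v_diag s

lemma x_mono_left (b : ℝ) : Monotone fun a => U.x a b :=
  monotone_of_hasDerivAt_nonneg (fun a => U.x_a a b) fun a => div_nonneg (U.m_nonneg a b) two_pos.le

lemma x_mono_right (a : ℝ) : Monotone fun b => U.x a b :=
  monotone_of_hasDerivAt_nonneg (fun b => U.x_b a b)
    fun b => div_nonneg (U.m'_nonneg a b) two_pos.le

lemma x_mono {a b a' b' : ℝ} (ha : a ≤ a') (hb : b ≤ b') : U.x a b ≤ U.x a' b' :=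
  (U.x_mono_left b ha).trans (U.x_mono_right a' hb)

include h

lemma cont_c : Continuous fun P : ℝ × ℝ => c (U.v P.1 P.2) := h.continuous.comp U.cont_v

lemma cont_t_a : Continuous fun P : ℝ × ℝ => U.m P.1 P.2 / (2 * c (U.v P.1 P.2)) :=
  U.cont_m.div (continuous_const.mul (U.cont_c h)) fun _ => (mul_pos two_pos (h.pos _)).ne'

lemma cont_t_b : Continuous fun P : ℝ × ℝ => -(U.m' P.1 P.2 / (2 * c (U.v P.1 P.2))) :=
  (U.cont_m'.div (continuous_const.mul (U.cont_c h)) fun _ => (mul_pos two_pos (h.pos _)).ne').neg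

lemma cont_v_a : Continuous fun P : ℝ × ℝ => U.l P.1 P.2 / (2 * c (U.v P.1 P.2)) :=
  U.cont_l.div (continuous_const.mul (U.cont_c h)) fun _ => (mul_pos two_pos (h.pos _)).ne'

lemma cont_v_b : Continuous fun P : ℝ × ℝ => -(U.l' P.1 P.2 / (2 * c (U.v P.1 P.2))) :=
  (U.cont_l'.div (continuous_const.mul (U.cont_c h)) fun _ => (mul_pos two_pos (h.pos _)).ne').neg

lemma cont_Λ : Continuous fun P : ℝ × ℝ => flowΛ c (U.v P.1 P.2) (U.m P.1 P.2) (U.l P.1 P.2)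
    (U.n P.1 P.2) (U.m' P.1 P.2) (U.l' P.1 P.2) (U.n' P.1 P.2) := by
  have h1 := h.continuous
  have h2 := h.continuous_deriv.comp U.cont_v
  have h3 := fun P : ℝ × ℝ => (h.pos (U.v P.1 P.2)).ne'
  have := U.cont_m; have := U.cont_l; have := U.cont_n
  have := U.cont_m'; have := U.cont_l'; have := U.cont_n'; have := U.cont_v
  unfold flowΛ
  refine ((h2.div (by fun_prop) fun P => ?_).mul (by fun_prop)).sub
    ((Continuous.div (by fun_prop) (by fun_prop) fun P => ?_).mul (by fun_prop))
  · have := h3 P; positivity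
  · have := h3 P; positivity

lemma cont_Ω : Continuous fun P : ℝ × ℝ => flowΩ c (U.v P.1 P.2) (U.m P.1 P.2) (U.l P.1 P.2)
    (U.m' P.1 P.2) (U.l' P.1 P.2) := by
  have h1 := h.continuous
  have h2 := h.continuous_deriv.comp U.cont_v
  have h3 := fun P : ℝ × ℝ => (h.pos (U.v P.1 P.2)).ne'
  have := U.cont_m; have := U.cont_l; have := U.cont_v
  have := U.cont_m'; have := U.cont_l'
  unfold flowΩ
  refine ((h2.div (by fun_prop) fun P => ?_).mul (by fun_prop))
  have := h3 P; positivity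

lemma strict_t (P : ℝ × ℝ) : HasStrictFDerivAt (fun P : ℝ × ℝ => U.t P.1 P.2)
    ((U.m P.1 P.2 / (2 * c (U.v P.1 P.2))) • ContinuousLinearMap.fst ℝ ℝ ℝ
      + (-(U.m' P.1 P.2 / (2 * c (U.v P.1 P.2)))) • ContinuousLinearMap.snd ℝ ℝ ℝ) P :=
  hasStrictFDerivAt_of_partials U.t_a U.t_b (U.cont_t_a h) (U.cont_t_b h) P

omit h in
lemma strict_x (P : ℝ × ℝ) : HasStrictFDerivAt (fun P : ℝ × ℝ => U.x P.1 P.2)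
    ((U.m P.1 P.2 / 2) • ContinuousLinearMap.fst ℝ ℝ ℝ
      + (U.m' P.1 P.2 / 2) • ContinuousLinearMap.snd ℝ ℝ ℝ) P :=
  hasStrictFDerivAt_of_partials U.x_a U.x_b (U.cont_m.div_const 2) (U.cont_m'.div_const 2) P

lemma strict_v (P : ℝ × ℝ) : HasStrictFDerivAt (fun P : ℝ × ℝ => U.v P.1 P.2)
    ((U.l P.1 P.2 / (2 * c (U.v P.1 P.2))) • ContinuousLinearMap.fst ℝ ℝ ℝ
      + (-(U.l' P.1 P.2 / (2 * c (U.v P.1 P.2)))) • ContinuousLinearMap.snd ℝ ℝ ℝ) P :=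
  hasStrictFDerivAt_of_partials U.v_a U.v_b (U.cont_v_a h) (U.cont_v_b h) P

lemma cont_t : Continuous fun P : ℝ × ℝ => U.t P.1 P.2 :=
  continuous_of_partials U.t_a U.t_b (U.cont_t_a h) (U.cont_t_b h)

omit h in
lemma cont_x : Continuous fun P : ℝ × ℝ => U.x P.1 P.2 :=
  continuous_of_partials U.x_a U.x_b (U.cont_m.div_const 2) (U.cont_m'.div_const 2)

lemma t_a_nonneg (a b : ℝ) : 0 ≤ U.m a b / (2 * c (U.v a b)) :=
  div_nonneg (U.m_nonneg a b) (mul_pos two_pos (h.pos _)).le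

lemma t_b_nonneg (a b : ℝ) : 0 ≤ U.m' a b / (2 * c (U.v a b)) :=
  div_nonneg (U.m'_nonneg a b) (mul_pos two_pos (h.pos _)).le

lemma t_mono_left (b : ℝ) : Monotone fun a => U.t a b :=
  monotone_of_hasDerivAt_nonneg (fun a => U.t_a a b) fun a => U.t_a_nonneg h a b

lemma t_anti_right (a : ℝ) : Antitone fun b => U.t a b :=
  antitone_of_hasDerivAt_nonpos (fun b => U.t_b a b) fun b => neg_nonpos.2 (U.t_b_nonneg h a b)

lemma t_nonneg {a b : ℝ} (hba : b ≤ a) : 0 ≤ U.t a b :=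
  (U.t_diag b).symm.le.trans (U.t_mono_left h b hba)

/-- Finite speed of propagation. -/
lemma le_x_add {a b : ℝ} (hba : b ≤ a) : a ≤ U.x a b + K * U.t a b := by
  have anti : Antitone fun b => U.x a b + K * U.t a b :=
    antitone_of_hasDerivAt_nonpos (fun b => (U.x_b a b).add ((U.t_b a b).const_mul K)) fun b => by
      have h1 : (1:ℝ) / 2 ≤ K * (1 / (2 * c (U.v a b))) := by
        rw [mul_one_div, div_le_div_iff₀ two_pos (mul_pos two_pos (h.pos _))]
        linarith [h.le (U.v a b)]
      have h2 := mul_le_mul_of_nonneg_left h1 (U.m'_nonneg a b)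
      have e : U.m' a b / 2 + K * -(U.m' a b / (2 * c (U.v a b)))
        = U.m' a b * (1 / 2) - U.m' a b * (K * (1 / (2 * c (U.v a b)))) := by ring
      show _ ≤ (0:ℝ)
      rw [e]; linarith
  have := anti hba
  simp only [U.x_diag, U.t_diag] at this
  linarith

/-- As c ≤ K, the function x - K t does not increase along the characteristic that leaves the
diagonal at (b, b), where its value is b. -/
lemma x_sub_le {a b : ℝ} (hba : b ≤ a) : U.x a b - K * U.t a b ≤ b := by
  have anti : Antitone fun a => U.x a b - K * U.t a b :=
    antitone_of_hasDerivAt_nonpos (fun a => (U.x_a a b).sub ((U.t_a a b).const_mul K)) fun a => by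
      have h1 : (1:ℝ) / 2 ≤ K * (1 / (2 * c (U.v a b))) := by
        rw [mul_one_div, div_le_div_iff₀ two_pos (mul_pos two_pos (h.pos _))]
        linarith [h.le (U.v a b)]
      have h2 := mul_le_mul_of_nonneg_left h1 (U.m_nonneg a b)
      have e : U.m a b / 2 - K * (U.m a b / (2 * c (U.v a b)))
        = U.m a b * (1 / 2) - U.m a b * (K * (1 / (2 * c (U.v a b)))) := by ring
      show _ ≤ (0:ℝ)
      rw [e]; linarith
  have := anti hba
  simp only [U.x_diag, U.t_diag] at this
  linarith

omit h in
lemma x_le {a b : ℝ} (hba : b ≤ a) : U.x a b ≤ a :=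
  (U.x_mono_right a hba).trans (U.x_diag a).le

omit h in
lemma le_x {a b : ℝ} (hba : b ≤ a) : b ≤ U.x a b :=
  (U.x_diag b).symm.le.trans (U.x_mono_left b hba)

lemma abs_le_of_le {a b : ℝ} (hba : b ≤ a) :
    |a| ≤ |U.x a b| + K * |U.t a b| ∧ |b| ≤ |U.x a b| + K * |U.t a b| := by
  have h1 := U.le_x_add h hba
  have h2 := U.x_sub_le h hba
  have h3 := U.x_le hba
  have h4 := U.le_x hba
  have h5 := U.t_nonneg h hba
  have h6 := mul_nonneg h.K_pos.le h5
  rw [abs_of_nonneg h5]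
  have := neg_abs_le (U.x a b)
  have := le_abs_self (U.x a b)
  exact ⟨abs_le.2 ⟨by linarith, by linarith⟩, abs_le.2 ⟨by linarith, by linarith⟩⟩

/-- Characteristics have speed at most K, so they meet the initial line within the cone of
dependence of (t, x). This bound makes the map proper. -/
lemma abs_le_of_coord (a b : ℝ) :
    |a| ≤ |U.x a b| + K * |U.t a b| ∧ |b| ≤ |U.x a b| + K * |U.t a b| := by
  rcases le_total b a with hba | hba
  · exact U.abs_le_of_le h hba
  · have := U.rev.abs_le_of_le h hba
    simp only [rev, abs_neg] at this
    exact this.symm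

/-- Among the points with β ≤ α, x = ξ and t ≤ T, which form a compact set, one with maximal α - β
has t = T: otherwise α - β could still be increased. -/
lemma exists_preimage_nonneg {T : ℝ} (hT : 0 ≤ T) (ξ : ℝ) :
    ∃ a b, b ≤ a ∧ U.t a b = T ∧ U.x a b = ξ := by
  set D : Set (ℝ × ℝ) := {P | P.2 ≤ P.1 ∧ U.x P.1 P.2 = ξ ∧ U.t P.1 P.2 ≤ T} with hD
  have hDc : IsClosed D := (isClosed_le continuous_snd continuous_fst).inter
    ((isClosed_eq U.cont_x continuous_const).inter (isClosed_le (U.cont_t h) continuous_const))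
  have hDb : D ⊆ Icc (-(|ξ| + K * T), -(|ξ| + K * T)) (|ξ| + K * T, |ξ| + K * T) := by
    rintro ⟨a, b⟩ ⟨h1, h2, h3⟩
    simp only at h1 h2 h3
    have h4 := U.abs_le_of_coord h a b
    rw [h2, abs_of_nonneg (U.t_nonneg h h1)] at h4
    have h5 := mul_le_mul_of_nonneg_left h3 h.K_pos.le
    have h6 := abs_le.1 (h4.1.trans (by linarith : _ ≤ |ξ| + K * T))
    have h7 := abs_le.1 (h4.2.trans (by linarith : _ ≤ |ξ| + K * T))
    exact ⟨⟨h6.1, h7.1⟩, ⟨h6.2, h7.2⟩⟩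
  have hDk : IsCompact D := isCompact_Icc.of_isClosed_subset hDc hDb
  have hne : D.Nonempty := ⟨(ξ, ξ), le_rfl, U.x_diag ξ, by simpa [U.t_diag] using hT⟩
  obtain ⟨⟨a, b⟩, ⟨h1, h2, h3⟩, hmax⟩ :=
    hDk.exists_isMaxOn hne (continuous_fst.sub continuous_snd).continuousOn
  simp only at h1 h2 h3
  refine ⟨a, b, h1, ?_, h2⟩
  by_contra hne
  have hlt : U.t a b < T := lt_of_le_of_ne h3 hne
  have hev : ∀ᶠ P : ℝ × ℝ in 𝓝 (a, b), U.t P.1 P.2 < T :=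
    (U.cont_t h).continuousAt.eventually_lt_const hlt
  obtain ⟨ε, hε, hball⟩ := Metric.eventually_nhds_iff.1 hev
  -- On the segment from (a, b - δ) to (a + δ, b) the difference α - β equals a - b + δ, while x
  -- passes from at most ξ to at least ξ. A point there with x = ξ contradicts maximality, because t
  -- is still below T.
  set δ := ε / 2 with hδ
  have hδ0 : 0 < δ := half_pos hε
  have hcont : ContinuousOn (fun s => U.x (a + s) (b - δ + s)) (Icc 0 δ) :=
    (U.cont_x.comp ((continuous_const.add continuous_id).prodMk
      (continuous_const.add continuous_id))).continuousOn
  have hx0 : U.x (a + 0) (b - δ + 0) ≤ ξ := by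
    rw [← h2]; exact U.x_mono (by simp) (by linarith)
  have hx1 : ξ ≤ U.x (a + δ) (b - δ + δ) := by
    rw [← h2]; exact U.x_mono (by linarith) (by linarith)
  obtain ⟨s, hs, hsx⟩ := intermediate_value_Icc hδ0.le hcont ⟨hx0, hx1⟩
  have hmem : (a + s, b - δ + s) ∈ D := by
    refine ⟨?_, hsx, ?_⟩
    · simp only; linarith
    · refine (hball (y := (a + s, b - δ + s)) ?_).le
      rw [Prod.dist_eq, max_lt_iff, Real.dist_eq, Real.dist_eq]
      exact ⟨by rw [abs_lt]; constructor <;> linarith [hs.1, hs.2],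
        by rw [abs_lt]; constructor <;> linarith [hs.1, hs.2]⟩
  have := hmax hmem
  change a + s - (b - δ + s) ≤ a - b at this
  linarith

lemma exists_preimage (T ξ : ℝ) : ∃ a b, U.t a b = T ∧ U.x a b = ξ := by
  rcases le_total 0 T with hT | hT
  · obtain ⟨a, b, -, h1, h2⟩ := U.exists_preimage_nonneg h hT ξ
    exact ⟨a, b, h1, h2⟩
  · obtain ⟨a, b, -, h1, h2⟩ := U.rev.exists_preimage_nonneg h (neg_nonneg.2 hT) ξ
    exact ⟨b, a, neg_injective h1, h2⟩

/-- Points on a common level set of `t` with different `x` are ordered. -/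
lemma order_of_lt {a b a' b' : ℝ} (ht : U.t a b = U.t a' b') (hx : U.x a b < U.x a' b') :
    a ≤ a' ∧ b ≤ b' := by
  -- From (a, b) through (a', b) to (a', b') the function t does not decrease on either leg. Equal
  -- end values force t to be constant, so m vanishes on the first leg and m' on the second, and x
  -- is constant as well.
  have key : ∀ {a b a' b' : ℝ}, U.t a b = U.t a' b' → a ≤ a' → b' ≤ b → U.x a b = U.x a' b' := by
    intro a b a' b' ht ha hb
    have h1 := U.t_mono_left h b ha
    have h2 := U.t_anti_right h a' hb
    simp only at h1 h2
    have h3 : U.t a' b ≤ U.t a b := by linarith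
    have h4 : U.t a' b' ≤ U.t a' b := by linarith
    have e1 := eq_of_monotone_eq (fun y => U.t_a y b) (fun y => U.x_a y b)
      (fun y => U.t_a_nonneg h y b) (fun y hy => by
        rw [div_eq_zero_iff] at hy
        rcases hy with hy | hy
        · rw [hy, zero_div]
        · exact absurd hy (mul_pos two_pos (h.pos _)).ne') ha h3
    have e2 := eq_of_monotone_eq (f := fun y => -U.t a' y) (fun y => (U.t_b a' y).neg)
      (fun y => U.x_b a' y)
      (fun y => by rw [neg_neg]; exact U.t_b_nonneg h a' y) (fun y hy => by
        rw [neg_neg, div_eq_zero_iff] at hy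
        rcases hy with hy | hy
        · rw [hy, zero_div]
        · exact absurd hy (mul_pos two_pos (h.pos _)).ne') hb (by linarith)
    rw [e1, e2]
  rcases le_total a a' with ha | ha <;> rcases le_total b b' with hb | hb
  · exact ⟨ha, hb⟩
  · exact absurd (key ht ha hb) hx.ne
  · exact absurd (key ht.symm ha hb) hx.ne'
  · exact absurd (U.x_mono ha hb) (not_le.2 hx)

/-- `v` is constant on the fibres of the map to physical coordinates. -/
lemma v_eq_of_coord_eq {a b a' b' : ℝ} (ht : U.t a b = U.t a' b') (hx : U.x a b = U.x a' b') :
    U.v a b = U.v a' b' := by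
  have dz : ∀ {r s w : ℝ}, r / (2 * c w) = 0 → r = 0 := fun {r s w} hy => by
    rcases div_eq_zero_iff.1 hy with hy | hy
    · exact hy
    · exact absurd hy (mul_pos two_pos (h.pos _)).ne'
  -- Points ordered alike in both coordinates are joined by legs on which x is monotone, the others
  -- (`key2`) by legs on which t is. Where x or t is constant along a leg, m or m' vanishes, hence l
  -- or l', and v is constant.
  have key1 : ∀ {a b a' b' : ℝ}, U.x a b = U.x a' b' → a ≤ a' → b ≤ b' →
      U.v a b = U.v a' b' := by
    intro a b a' b' hx ha hb
    have h1 := U.x_mono_left b ha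
    have h2 := U.x_mono_right a' hb
    simp only at h1 h2
    have e1 := eq_of_monotone_eq (fun y => U.x_a y b) (fun y => U.v_a y b)
      (fun y => div_nonneg (U.m_nonneg y b) two_pos.le) (fun y hy => by
        rw [U.l_eq_zero (by linarith : U.m y b = 0), zero_div]) ha (by linarith)
    have e2 := eq_of_monotone_eq (fun y => U.x_b a' y) (fun y => U.v_b a' y)
      (fun y => div_nonneg (U.m'_nonneg a' y) two_pos.le) (fun y hy => by
        rw [U.l'_eq_zero (by linarith : U.m' a' y = 0), zero_div, neg_zero]) hb (by linarith)
    rw [e1, e2]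
  have key2 : ∀ {a b a' b' : ℝ}, U.t a b = U.t a' b' → a ≤ a' → b' ≤ b →
      U.v a b = U.v a' b' := by
    intro a b a' b' ht ha hb
    have h1 := U.t_mono_left h b ha
    have h2 := U.t_anti_right h a' hb
    simp only at h1 h2
    have e1 := eq_of_monotone_eq (fun y => U.t_a y b) (fun y => U.v_a y b)
      (fun y => U.t_a_nonneg h y b) (fun y hy => by
        rw [U.l_eq_zero (dz (s := 0) hy), zero_div]) ha (by linarith)
    have e2 := eq_of_monotone_eq (f := fun y => -U.t a' y) (fun y => (U.t_b a' y).neg)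
      (fun y => U.v_b a' y)
      (fun y => by rw [neg_neg]; exact U.t_b_nonneg h a' y) (fun y hy => by
        rw [neg_neg] at hy
        rw [U.l'_eq_zero (dz (s := 0) hy), zero_div, neg_zero]) hb (by linarith)
    rw [e1, e2]
  rcases le_total a a' with ha | ha <;> rcases le_total b b' with hb | hb
  · exact key1 hx ha hb
  · exact key2 ht ha hb
  · exact (key2 ht.symm ha hb).symm
  · exact (key1 hx.symm ha hb).symm

/-- The map to physical coordinates. -/
def coord (U : CharFlow c R S v₀) (P : ℝ × ℝ) : ℝ × ℝ := (U.t P.1 P.2, U.x P.1 P.2)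

lemma continuous_coord : Continuous U.coord := (U.cont_t h).prodMk U.cont_x

lemma surjective_coord : Function.Surjective U.coord := fun Q => by
  obtain ⟨a, b, h1, h2⟩ := U.exists_preimage h Q.1 Q.2
  exact ⟨(a, b), Prod.ext h1 h2⟩

lemma norm_le_coord (P : ℝ × ℝ) : ‖P‖ ≤ (1 + K) * ‖U.coord P‖ := by
  have h1 := U.abs_le_of_coord h P.1 P.2
  have h2 : |U.t P.1 P.2| ≤ ‖U.coord P‖ := norm_fst_le (U.coord P)
  have h3 : |U.x P.1 P.2| ≤ ‖U.coord P‖ := norm_snd_le (U.coord P)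
  have h4 := mul_le_mul_of_nonneg_left h2 h.K_pos.le
  rw [Prod.norm_def, max_le_iff, Real.norm_eq_abs, Real.norm_eq_abs]
  constructor <;> nlinarith [h1.1, h1.2]

/-- Properness serves twice: the map is closed, hence a quotient map onto the plane, which transfers
continuity from v to u; and pull-backs of test functions have compact support. -/
lemma isProperMap_coord : IsProperMap U.coord := by
  rw [isProperMap_iff_tendsto_cocompact]
  refine ⟨U.continuous_coord h, ?_⟩
  rw [← Metric.cobounded_eq_cocompact, ← tendsto_norm_atTop_iff_cobounded]
  have hK : 0 < 1 + K := by linarith [h.K_pos]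
  refine tendsto_atTop_mono (f := fun P : ℝ × ℝ => ‖P‖ / (1 + K)) (fun P => ?_) ?_
  · rw [div_le_iff₀' hK]; exact U.norm_le_coord h P
  · exact tendsto_norm_cobounded_atTop.atTop_div_const hK

/-- The solution in physical coordinates. -/
lemma exists_solution : ∃ u : ℝ → ℝ → ℝ, ∀ a b, u (U.t a b) (U.x a b) = U.v a b := by
  choose A B hA hB using U.exists_preimage h
  exact ⟨fun t x => U.v (A t x) (B t x), fun a b => U.v_eq_of_coord_eq h (hA _ _) (hB _ _)⟩

lemma continuous_solution {u : ℝ → ℝ → ℝ} (hu : ∀ a b, u (U.t a b) (U.x a b) = U.v a b) :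
    Continuous fun p : ℝ × ℝ => u p.1 p.2 := by
  have hq := (U.isProperMap_coord h).isClosedMap.isQuotientMap (U.continuous_coord h)
    (U.surjective_coord h)
  rw [hq.continuous_iff]
  exact U.cont_v.congr fun P => (hu P.1 P.2).symm

end CharFlow

/-! ### Monotone functions and absolute continuity -/

section RealAnalysis

/-- The increments of a monotone function over disjoint intervals. -/
lemma Monotone.sum_dist_le {G : ℝ → ℝ} (hG : Monotone G) {a b : ℝ} {E : ℕ × (ℕ → ℝ × ℝ)}
    (hE : E ∈ AbsolutelyContinuousOnInterval.disjWithin a b) :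
    ∑ i ∈ Finset.range E.1, dist (G (E.2 i).1) (G (E.2 i).2) ≤ G (max a b) - G (min a b) := by
  obtain ⟨h1, h2⟩ := hE
  -- The open intervals between the values of G at the end points are disjoint again, so their total
  -- length is at most that of the interval containing them all.
  set J : ℕ → Set ℝ := fun i =>
    Ioo (min (G (E.2 i).1) (G (E.2 i).2)) (max (G (E.2 i).1) (G (E.2 i).2)) with hJ
  have hdisj : (↑(Finset.range E.1) : Set ℕ).PairwiseDisjoint J := by
    intro i hi j hj hij
    have hd := h2 hi hj hij
    rw [Function.onFun, Set.disjoint_left] at hd ⊢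
    intro y hyi hyj
    simp only [hJ, mem_Ioo, ← hG.map_min, ← hG.map_max] at hyi hyj
    have k1 : min (E.2 i).1 (E.2 i).2 < max (E.2 j).1 (E.2 j).2 :=
      hG.reflect_lt (hyi.1.trans hyj.2)
    have k2 : min (E.2 j).1 (E.2 j).2 < max (E.2 i).1 (E.2 i).2 :=
      hG.reflect_lt (hyj.1.trans hyi.2)
    have k3 : min (E.2 i).1 (E.2 i).2 < max (E.2 i).1 (E.2 i).2 :=
      hG.reflect_lt (hyi.1.trans hyi.2)
    have k4 : min (E.2 j).1 (E.2 j).2 < max (E.2 j).1 (E.2 j).2 :=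
      hG.reflect_lt (hyj.1.trans hyj.2)
    exact hd (a := min (max (E.2 i).1 (E.2 i).2) (max (E.2 j).1 (E.2 j).2))
      ⟨lt_min k3 k1, min_le_left _ _⟩ ⟨lt_min k2 k4, min_le_right _ _⟩
  have hvol : ∀ i, volume (J i) = ENNReal.ofReal (dist (G (E.2 i).1) (G (E.2 i).2)) := fun i => by
    rw [hJ, Real.volume_Ioo, max_sub_min_eq_abs', Real.dist_eq]
  have hsub : (⋃ i ∈ Finset.range E.1, J i) ⊆ Icc (G (min a b)) (G (max a b)) := by
    simp only [iUnion_subset_iff]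
    intro i hi y hy
    obtain ⟨m1, m2⟩ := h1 i hi
    simp only [hJ, mem_Ioo, ← hG.map_min, ← hG.map_max] at hy
    exact ⟨(hG (le_min m1.1 m2.1)).trans hy.1.le, hy.2.le.trans (hG (max_le m1.2 m2.2))⟩
  have := measure_mono (μ := volume) hsub
  rw [measure_biUnion_finset hdisj fun i _ => measurableSet_Ioo, Real.volume_Icc] at this
  simp_rw [hvol] at this
  rw [← ENNReal.ofReal_sum_of_nonneg fun _ _ => dist_nonneg] at this
  exact (ENNReal.ofReal_le_ofReal_iff (sub_nonneg.2 (hG min_le_max))).1 this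

/-- A function whose increments are controlled, with arbitrarily small constant, by those of a
monotone function up to a Lipschitz term is absolutely continuous. -/
lemma absolutelyContinuousOnInterval_of_le {f G : ℝ → ℝ} (hG : Monotone G) {C : ℝ}
    (hC : 0 ≤ C)
    (h : ∀ lam > 0, ∀ x y, dist (f x) (f y) ≤ C * (lam * dist x y + dist (G x) (G y) / lam))
    (a b : ℝ) : AbsolutelyContinuousOnInterval f a b := by
  rw [absolutelyContinuousOnInterval_iff]
  intro ε hε
  set D := G (max a b) - G (min a b) with hD
  have hD0 : 0 ≤ D := sub_nonneg.2 (hG min_le_max)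
  -- The parameter is fixed first, so large that C D / lam stays below ε/2. The admissible total
  -- length is then chosen so that the Lipschitz part stays below ε/2 as well.
  set lam := (2 * (C + 1) * (D + 1)) / ε with hlam
  have hlam0 : 0 < lam := by positivity
  refine ⟨ε / (2 * (C + 1) * lam), by positivity, fun E hE hs => ?_⟩
  have h1 := hG.sum_dist_le hE
  calc ∑ i ∈ Finset.range E.1, dist (f (E.2 i).1) (f (E.2 i).2)
      ≤ ∑ i ∈ Finset.range E.1, C * (lam * dist (E.2 i).1 (E.2 i).2
          + dist (G (E.2 i).1) (G (E.2 i).2) / lam) :=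
        Finset.sum_le_sum fun i _ => h lam hlam0 _ _
    _ = C * (lam * ∑ i ∈ Finset.range E.1, dist (E.2 i).1 (E.2 i).2
          + (∑ i ∈ Finset.range E.1, dist (G (E.2 i).1) (G (E.2 i).2)) / lam) := by
        rw [← Finset.mul_sum, Finset.sum_add_distrib, ← Finset.mul_sum, Finset.sum_div]
    _ ≤ C * (lam * (ε / (2 * (C + 1) * lam)) + D / lam) := by gcongr
    _ = C / (C + 1) * (ε / 2) + C / (C + 1) * (D / (D + 1)) * (ε / 2) := by
        rw [hlam]; field_simp
    _ < 1 * (ε / 2) + 1 * 1 * (ε / 2) := by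
        have e1 : C / (C + 1) < 1 := by rw [div_lt_one (by positivity)]; linarith
        have e2 : D / (D + 1) ≤ 1 := by rw [div_le_one (by positivity)]; linarith
        have e3 : C / (C + 1) * (D / (D + 1)) ≤ 1 * 1 := by gcongr
        have := mul_lt_mul_of_pos_right e1 (half_pos hε)
        have := mul_le_mul_of_nonneg_right e3 (half_pos hε).le
        linarith
    _ = ε := by ring

lemma memLp_of_pow_le {α : Type*} [MeasurableSpace α] {μ : Measure α} {f g : α → ℝ} {p : ℕ}
    (hp : p ≠ 0) (hf : AEStronglyMeasurable f μ) (hg : ∫⁻ x, ENNReal.ofReal (g x) ∂μ < ⊤) {C : ℝ}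
    (hC : 0 ≤ C) (h : ∀ x, |f x| ^ p ≤ C * g x) : MemLp f p μ := by
  refine ⟨hf, ?_⟩
  rw [eLpNorm_lt_top_iff_lintegral_rpow_enorm_lt_top (by exact_mod_cast hp) (by simp)]
  calc ∫⁻ x, ‖f x‖ₑ ^ (p : ℝ≥0∞).toReal ∂μ
      ≤ ∫⁻ x, ENNReal.ofReal C * ENNReal.ofReal (g x) ∂μ := by
        refine lintegral_mono fun x => ?_
        rw [← ENNReal.ofReal_mul hC, ENNReal.toReal_natCast, ENNReal.rpow_natCast,
          ← ofReal_norm, ← ENNReal.ofReal_pow (norm_nonneg _)]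
        exact ENNReal.ofReal_le_ofReal (h x)
    _ = ENNReal.ofReal C * ∫⁻ x, ENNReal.ofReal (g x) ∂μ :=
        lintegral_const_mul' _ _ ENNReal.ofReal_ne_top
    _ < ⊤ := ENNReal.mul_lt_top ENNReal.ofReal_lt_top hg

/-- The total integral of the derivative of a bounded monotone function. -/
lemma Monotone.lintegral_deriv_le {G : ℝ → ℝ} (hG : Monotone G) {e : ℝ}
    (he : ∀ x y, G y - G x ≤ e) :
    ∫⁻ x, ENNReal.ofReal (deriv G x) ≤ ENNReal.ofReal e := by
  have hcov := aecover_Icc (μ := volume) (tendsto_neg_atTop_atBot.comp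
    (tendsto_natCast_atTop_atTop (R := ℝ))) (tendsto_natCast_atTop_atTop (R := ℝ))
  refine _root_.le_of_tendsto (hcov.lintegral_tendsto_of_countably_generated
    (measurable_deriv G).ennreal_ofReal.aemeasurable) (Eventually.of_forall fun k => ?_)
  have hk : (-(k : ℝ)) ≤ k := by linarith [Nat.cast_nonneg (α := ℝ) k]
  have hm := (hG.monotoneOn (uIcc (-(k : ℝ)) k))
  have hi := hm.intervalIntegrable_deriv
  have h0 : ∀ x, 0 ≤ deriv G x := fun x => hG.deriv_nonneg
  have hle := hm.intervalIntegral_deriv_mem_uIcc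
  rw [uIcc_of_le (sub_nonneg.2 (hG hk))] at hle
  have h2 := hle.2.trans (he _ _)
  rw [intervalIntegral.integral_of_le hk, ← integral_Icc_eq_integral_Ioc] at h2
  have hi' : IntegrableOn (deriv G) (Icc (-(k : ℝ)) k) :=
    (intervalIntegrable_iff_integrableOn_Icc_of_le hk).1 hi
  simp only [Function.comp]
  rw [← ofReal_integral_eq_lintegral_ofReal hi' (Eventually.of_forall h0)]
  exact ENNReal.ofReal_le_ofReal h2

lemma abs_sub_le_of_abs_deriv_le {f f' g g' : ℝ → ℝ} (hf : ∀ x, HasDerivAt f (f' x) x)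
    (hg : ∀ x, HasDerivAt g (g' x) x) (hfg : ∀ x, |f' x| ≤ g' x) {a b : ℝ} (hab : a ≤ b) :
    |f b - f a| ≤ g b - g a := by
  have h1 : Monotone fun x => g x - f x :=
    monotone_of_hasDerivAt_nonneg (fun x => (hg x).sub (hf x))
      fun x => sub_nonneg.2 (le_of_abs_le (hfg x))
  have h2 : Monotone fun x => g x + f x :=
    monotone_of_hasDerivAt_nonneg (fun x => (hg x).add (hf x))
      fun x => show (0:ℝ) ≤ _ by linarith [neg_le_of_abs_le (hfg x)]
  have h3 := h1 hab
  have h4 := h2 hab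
  simp only at h3 h4
  exact abs_le.2 ⟨by linarith, by linarith⟩

end RealAnalysis

/-! ### The energy form and the lines of constant time -/

lemma potentialF_nonneg (v : ℝ) : 0 ≤ potentialF v := by unfold potentialF; positivity

lemma continuous_potentialF : Continuous potentialF := by unfold potentialF; fun_prop

lemma hasDerivAt_potentialF (v : ℝ) : HasDerivAt potentialF (v + v ^ 3) v := by
  have := (((hasDerivAt_id v).pow 2).div_const 2).add (((hasDerivAt_id v).pow 4).div_const 4)
  refine HasDerivAt.congr_deriv (f := potentialF) this ?_
  simp

namespace CharFlow

variable {K : ℝ} {c R S v₀ : ℝ → ℝ} (h : IsSpeed K c) (U : CharFlow c R S v₀)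

/-- `E` is a potential of the energy form. -/
structure IsEnergy (U : CharFlow c R S v₀) (E : ℝ → ℝ → ℝ) : Prop where
  hasDerivAt_left : ∀ a b, HasDerivAt (fun y => E y b)
    (U.n a b + potentialF (U.v a b) * U.m a b) a
  hasDerivAt_right : ∀ a b, HasDerivAt (fun y => E a y)
    (U.n' a b + potentialF (U.v a b) * U.m' a b) b

lemma cont_N : Continuous fun P : ℝ × ℝ => U.n P.1 P.2 + potentialF (U.v P.1 P.2) * U.m P.1 P.2 :=
  U.cont_n.add ((continuous_potentialF.comp U.cont_v).mul U.cont_m)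

lemma cont_N' :
    Continuous fun P : ℝ × ℝ => U.n' P.1 P.2 + potentialF (U.v P.1 P.2) * U.m' P.1 P.2 :=
  U.cont_n'.add ((continuous_potentialF.comp U.cont_v).mul U.cont_m')

lemma N_nonneg (a b : ℝ) : 0 ≤ U.n a b + potentialF (U.v a b) * U.m a b :=
  add_nonneg (U.n_nonneg a b) (mul_nonneg (potentialF_nonneg _) (U.m_nonneg a b))

lemma N'_nonneg (a b : ℝ) : 0 ≤ U.n' a b + potentialF (U.v a b) * U.m' a b :=
  add_nonneg (U.n'_nonneg a b) (mul_nonneg (potentialF_nonneg _) (U.m'_nonneg a b))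

include h in
-- The form is closed: differentiating F(v) m along β produces the term in l' m that occurs in the
-- equation for n', and F(v) m' along α the term in l m' from the equation for n. The remaining
-- parts of the two mixed derivatives agree.
lemma exists_isEnergy : ∃ E, U.IsEnergy E := by
  have h1 := h.continuous
  have h2 := h.continuous_deriv.comp U.cont_v
  have h3 := fun P : ℝ × ℝ => (h.pos (U.v P.1 P.2)).ne'
  have := U.cont_m; have := U.cont_l; have := U.cont_n
  have := U.cont_m'; have := U.cont_l'; have := U.cont_n'; have := U.cont_v
  have cF := continuous_potentialF
  have cΩ := U.cont_Ω h
  refine (fun ⟨E, hE1, hE2⟩ => ⟨E, hE1, hE2⟩) (exists_potential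
    (A := fun a b => U.n a b + potentialF (U.v a b) * U.m a b)
    (B := fun a b => U.n' a b + potentialF (U.v a b) * U.m' a b) U.cont_N U.cont_N'
    (C := fun a b => flowN c (U.v a b) (U.l a b) (U.n a b) (U.l' a b) (U.n' a b)
      + (U.v a b + U.v a b ^ 3) / (2 * c (U.v a b)) * (U.l a b * U.m' a b - U.l' a b * U.m a b)
      + potentialF (U.v a b) * flowΩ c (U.v a b) (U.m a b) (U.l a b) (U.m' a b) (U.l' a b))
    ?_ (fun a b => ?_) (fun a b => ?_))
  · refine (Continuous.add ?_ ((Continuous.div (by fun_prop) (by fun_prop) fun P => ?_).mul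
      (by fun_prop))).add ((cF.comp U.cont_v).mul cΩ)
    · unfold flowN
      refine (h2.div (by fun_prop) fun P => ?_).mul (by fun_prop)
      have := h3 P; positivity
    · have := h3 P; positivity
  · have hF := (hasDerivAt_potentialF (U.v a b)).comp b (U.v_b a b)
    exact ((U.n_b a b).add (hF.mul (U.m_b a b))).congr_deriv (by
      simp only [Function.comp]; ring)
  · have hF := (hasDerivAt_potentialF (U.v a b)).comp a (U.v_a a b)
    exact ((U.n'_a a b).add (hF.mul (U.m'_a a b))).congr_deriv (by
      simp only [Function.comp]; ring)

variable {U} {E : ℝ → ℝ → ℝ}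

lemma IsEnergy.mono (hE : U.IsEnergy E) {a b a' b' : ℝ} (ha : a ≤ a') (hb : b ≤ b') :
    E a b ≤ E a' b' := by
  have h1 : Monotone fun y => E y b :=
    monotone_of_hasDerivAt_nonneg (fun a => hE.hasDerivAt_left a b) fun a => U.N_nonneg a b
  have h2 : Monotone fun y => E a' y :=
    monotone_of_hasDerivAt_nonneg (fun b => hE.hasDerivAt_right a' b) fun b => U.N'_nonneg a' b
  exact (h1 ha).trans (h2 hb)

lemma IsEnergy.diag_sub (hE : U.IsEnergy E) (r s : ℝ) :
    E s s - E r r = ∫ y in r..s, (R y ^ 2 + S y ^ 2 + 2 * potentialF (v₀ y)) := by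
  have hR := U.continuous_R
  have hS := U.continuous_S
  have hv := U.continuous_v₀
  have cF := continuous_potentialF
  rw [integral_eq_sub_of_continuous_deriv (f := fun s => E s s) (fun s => ?_) (by fun_prop)]
  refine (hasDerivAt_diagonal_of_partials hE.hasDerivAt_left hE.hasDerivAt_right U.cont_N
    U.cont_N' s).congr_deriv ?_
  rw [U.n_diag, U.n'_diag, U.v_diag, U.m_diag, U.m'_diag]; ring

/-- The energy density of the data. -/
noncomputable def dataEnergy (R S v₀ : ℝ → ℝ) (y : ℝ) : ℝ :=
  (R y ^ 2 + S y ^ 2 + 2 * potentialF (v₀ y)) / 4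

lemma dataEnergy_nonneg (y : ℝ) : 0 ≤ dataEnergy R S v₀ y := by
  have := potentialF_nonneg (v₀ y)
  unfold dataEnergy; positivity

/-- By monotonicity in both variables an increment of E is dominated by one between two diagonal
points, which is an integral of the data. For the Riemann data R² + S² = 2(v₁² + c² (v₀)_x²), so the
factor 1/4 gives the energy density. -/
lemma IsEnergy.sub_le (hE : U.IsEnergy E) (hI : Integrable (dataEnergy R S v₀)) (a b a' b' : ℝ) :
    E a' b' / 4 - E a b / 4 ≤ ∫ y, dataEnergy R S v₀ y := by
  set r := min (min a b) (min a' b')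
  set s := max (max a b) (max a' b')
  have hrs : r ≤ s := (min_le_left _ _).trans ((min_le_left _ _).trans
    ((le_max_left _ _).trans (le_max_left _ _)))
  have h1 : E a' b' ≤ E s s := hE.mono ((le_max_left _ _).trans (le_max_right _ _))
    ((le_max_right _ _).trans (le_max_right _ _))
  have h2 : E r r ≤ E a b := hE.mono ((min_le_left _ _).trans (min_le_left _ _))
    ((min_le_left _ _).trans (min_le_right _ _))
  have h3 : (E s s - E r r) / 4 = ∫ y in r..s, dataEnergy R S v₀ y := by
    rw [hE.diag_sub, ← intervalIntegral.integral_div]; rfl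
  have h4 : ∫ y in r..s, dataEnergy R S v₀ y ≤ ∫ y, dataEnergy R S v₀ y := by
    rw [intervalIntegral.integral_of_le hrs]
    exact setIntegral_le_integral hI (Eventually.of_forall dataEnergy_nonneg)
  linarith

include h

/-- Control of the increments of `v` between ordered points. -/
lemma IsEnergy.dist_v_le (hE : U.IsEnergy E) {lam : ℝ} (hlam : 0 < lam) {a b a' b' : ℝ}
    (ha : a ≤ a') (hb : b ≤ b') :
    |U.v a' b' - U.v a b| ≤ K * (lam * (U.x a' b' - U.x a b) + (E a' b' - E a b) / lam) := by
  -- From l² = m n one has |l| ≤ lam m + n / lam for every lam > 0. The potential term may be added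
  -- because it is nonnegative.
  have base : ∀ {l m n F w : ℝ}, 0 ≤ m → 0 ≤ n → 0 ≤ F → l ^ 2 = m * n →
      |l / (2 * c w)| ≤ K * (lam * (m / 2) + (n + F * m) / lam) := by
    intro l m n F w hm hn hF hl
    have h1 : |l| ≤ lam * m + n / lam := by
      refine abs_le_of_sq_le_sq ?_ (by positivity)
      have e : (lam * m + n / lam) ^ 2 = (lam * m) ^ 2 + (n / lam) ^ 2 + 2 * (m * n) := by
        field_simp; ring
      rw [e, hl]
      nlinarith [sq_nonneg (lam * m), sq_nonneg (n / lam), mul_nonneg hm hn]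
    rw [abs_div, abs_of_pos (mul_pos two_pos (h.pos w)), div_eq_mul_inv, mul_inv]
    have h2 := h.inv_le w
    have h3 : 0 ≤ (c w)⁻¹ := (inv_pos.2 (h.pos w)).le
    have h4 : 0 ≤ F * m / lam := by positivity
    have h5 : |l| * (c w)⁻¹ ≤ (lam * m + n / lam) * K := by
      apply mul_le_mul h1 h2 h3; positivity
    have h6 : 0 ≤ n / lam := by positivity
    have e : (n + F * m) / lam = n / lam + F * m / lam := add_div _ _ _
    rw [e]
    nlinarith [h.K_pos, mul_nonneg h.K_pos.le h4, mul_nonneg h.K_pos.le h6]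
  have h1 := abs_sub_le_of_abs_deriv_le (fun y => U.v_a y b)
    (fun y => (((U.x_a y b).const_mul lam).add ((hE.hasDerivAt_left y b).div_const lam)).const_mul K)
    (fun y => base (U.m_nonneg y b) (U.n_nonneg y b) (potentialF_nonneg _) (U.l_sq y b)) ha
  have h2 := abs_sub_le_of_abs_deriv_le (fun y => U.v_b a' y)
    (fun y =>
      (((U.x_b a' y).const_mul lam).add ((hE.hasDerivAt_right a' y).div_const lam)).const_mul K)
    (fun y => by
      rw [abs_neg]
      exact base (U.m'_nonneg a' y) (U.n'_nonneg a' y) (potentialF_nonneg _) (U.l'_sq a' y)) hb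
  simp only [Pi.add_apply] at h1 h2
  calc |U.v a' b' - U.v a b| = |(U.v a' b' - U.v a' b) + (U.v a' b - U.v a b)| := by ring_nf
    _ ≤ _ := abs_add_le _ _
    _ ≤ _ := add_le_add h2 h1
    _ = _ := by ring

/-- At a point where the map to physical coordinates is nondegenerate, the solution is
differentiable at the image point. -/
lemma hasFDerivAt_solution {u : ℝ → ℝ → ℝ} (hu : ∀ a b, u (U.t a b) (U.x a b) = U.v a b)
    {a b : ℝ} (hm : 0 < U.m a b) (hm' : 0 < U.m' a b) :
    HasFDerivAt (fun p : ℝ × ℝ => u p.1 p.2)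
      (((U.l a b / U.m a b + U.l' a b / U.m' a b) / 2) • ContinuousLinearMap.fst ℝ ℝ ℝ
        + ((U.l a b / U.m a b - U.l' a b / U.m' a b) / (2 * c (U.v a b))) •
          ContinuousLinearMap.snd ℝ ℝ ℝ) (U.t a b, U.x a b) := by
  have hc := h.pos (U.v a b)
  set F := ContinuousLinearMap.fst ℝ ℝ ℝ
  set G := ContinuousLinearMap.snd ℝ ℝ ℝ
  set L : ℝ × ℝ →L[ℝ] ℝ × ℝ :=
    ((U.m a b / (2 * c (U.v a b))) • F + (-(U.m' a b / (2 * c (U.v a b)))) • G).prod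
      ((U.m a b / 2) • F + (U.m' a b / 2) • G) with hL
  -- The inverse is read off from m dα = dx + c dt and m' dβ = dx - c dt.
  set L' : ℝ × ℝ →L[ℝ] ℝ × ℝ :=
    ((c (U.v a b) / U.m a b) • F + (1 / U.m a b) • G).prod
      ((-(c (U.v a b) / U.m' a b)) • F + (1 / U.m' a b) • G) with hL'
  have e1 : Function.LeftInverse L' L := fun p => by
    ext <;> simp [hL, hL', F, G] <;> field_simp <;> ring
  have e2 : Function.RightInverse L' L := fun p => by
    ext <;> simp [hL, hL', F, G] <;> field_simp <;> ring
  set e := ContinuousLinearEquiv.equivOfInverse L L' e1 e2 with he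
  have hs : HasStrictFDerivAt U.coord (e : ℝ × ℝ →L[ℝ] ℝ × ℝ) (a, b) :=
    (U.strict_t h (a, b)).prodMk (U.strict_x (a, b))
  have hinv := hs.to_localInverse.hasFDerivAt
  have hright := hs.eventually_right_inverse
  have hv : HasFDerivAt (fun P : ℝ × ℝ => U.v P.1 P.2)
      ((U.l a b / (2 * c (U.v a b))) • F + (-(U.l' a b / (2 * c (U.v a b)))) • G)
      (hs.localInverse U.coord e (a, b) (U.coord (a, b))) := by
    rw [hs.localInverse_apply_image]
    exact (U.strict_v h (a, b)).hasFDerivAt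
  have hcomp := hv.comp (U.coord (a, b)) hinv
  have hcongr : (fun p : ℝ × ℝ => u p.1 p.2) =ᶠ[𝓝 (U.coord (a, b))]
      (fun P : ℝ × ℝ => U.v P.1 P.2) ∘ hs.localInverse U.coord e (a, b) := by
    filter_upwards [hright] with p hp
    simp only [Function.comp]
    rw [← hu]
    conv_lhs => rw [← hp]
    rfl
  refine (hcomp.congr_of_eventuallyEq hcongr).congr_fderiv ?_
  have hsym : (e.symm : ℝ × ℝ →L[ℝ] ℝ × ℝ) = L' := rfl
  rw [hsym]
  ext <;> simp [hL', F, G] <;> field_simp <;> ring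

lemma dt_solution {u : ℝ → ℝ → ℝ} (hu : ∀ a b, u (U.t a b) (U.x a b) = U.v a b)
    {a b : ℝ} (hm : 0 < U.m a b) (hm' : 0 < U.m' a b) :
    HasDerivAt (fun s => u s (U.x a b)) ((U.l a b / U.m a b + U.l' a b / U.m' a b) / 2)
      (U.t a b) := by
  have := HasFDerivAt.comp_hasDerivAt (f := fun s : ℝ => (s, U.x a b)) (U.t a b)
    (hasFDerivAt_solution h hu hm hm') ((hasDerivAt_id _).prodMk (hasDerivAt_const _ _))
  refine HasDerivAt.congr_deriv (f := fun s => u s (U.x a b)) this ?_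
  simp

lemma dx_solution {u : ℝ → ℝ → ℝ} (hu : ∀ a b, u (U.t a b) (U.x a b) = U.v a b)
    {a b : ℝ} (hm : 0 < U.m a b) (hm' : 0 < U.m' a b) :
    HasDerivAt (fun y => u (U.t a b) y)
      ((U.l a b / U.m a b - U.l' a b / U.m' a b) / (2 * c (U.v a b))) (U.x a b) := by
  have := HasFDerivAt.comp_hasDerivAt (f := fun y : ℝ => (U.t a b, y)) (U.x a b)
    (hasFDerivAt_solution h hu hm hm') ((hasDerivAt_const _ _).prodMk (hasDerivAt_id _))
  refine HasDerivAt.congr_deriv (f := fun y => u (U.t a b) y) this ?_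
  simp

/-- Choice of a preimage of every point of the line `{τ} × ℝ`. -/
lemma exists_slice (U : CharFlow c R S v₀) (τ : ℝ) : ∃ A B : ℝ → ℝ, Monotone A ∧ Monotone B ∧
    (∀ x, U.t (A x) (B x) = τ) ∧ (∀ x, U.x (A x) (B x) = x) ∧
    ∀ᵐ x, ∃ a' b', HasDerivAt A a' x ∧ HasDerivAt B b' x ∧ U.m (A x) (B x) * a' = 1 ∧
      U.m' (A x) (B x) * b' = 1 := by
  choose A B hA hB using fun x => U.exists_preimage h τ x
  -- Any choice of preimages is monotone, since points with equal t and increasing x are ordered.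
  have ord : ∀ x y, x < y → A x ≤ A y ∧ B x ≤ B y := fun x y hxy =>
    U.order_of_lt h ((hA x).trans (hA y).symm) (by rwa [hB, hB])
  have mA : Monotone A := monotone_iff_forall_lt.2 fun x y hxy => (ord x y hxy).1
  have mB : Monotone B := monotone_iff_forall_lt.2 fun x y hxy => (ord x y hxy).2
  refine ⟨A, B, mA, mB, hA, hB, ?_⟩
  filter_upwards [mA.ae_differentiableAt, mB.ae_differentiableAt] with x dA dB
  refine ⟨deriv A x, deriv B x, dA.hasDerivAt, dB.hasDerivAt, ?_⟩
  have hc := h.pos (U.v (A x) (B x))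
  have k1 := HasFDerivAt.comp_hasDerivAt (f := fun x : ℝ => (A x, B x)) x
    (U.strict_t h (A x, B x)).hasFDerivAt (dA.hasDerivAt.prodMk dB.hasDerivAt)
  have k2 := HasFDerivAt.comp_hasDerivAt (f := fun x : ℝ => (A x, B x)) x
    (U.strict_x (A x, B x)).hasFDerivAt (dA.hasDerivAt.prodMk dB.hasDerivAt)
  have f1 : ((fun P : ℝ × ℝ => U.t P.1 P.2) ∘ fun x : ℝ => (A x, B x)) = fun _ => τ := funext hA
  have f2 : ((fun P : ℝ × ℝ => U.x P.1 P.2) ∘ fun x : ℝ => (A x, B x)) = id := funext hB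
  rw [f1] at k1
  rw [f2] at k2
  -- Differentiating t(A, B) = τ and x(A, B) = x gives m A' = m' B' and m A' + m' B' = 2.
  have r1 := k1.unique (hasDerivAt_const x τ)
  have r2 := k2.unique (hasDerivAt_id x)
  simp only [_root_.add_apply, _root_.smul_apply,
    ContinuousLinearMap.coe_fst', ContinuousLinearMap.coe_snd', smul_eq_mul] at r1 r2
  have r3 : U.m (A x) (B x) * deriv A x - U.m' (A x) (B x) * deriv B x = 0 := by
    have : U.m (A x) (B x) * deriv A x - U.m' (A x) (B x) * deriv B x
      = 2 * c (U.v (A x) (B x)) * (U.m (A x) (B x) / (2 * c (U.v (A x) (B x))) * deriv A x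
        + -(U.m' (A x) (B x) / (2 * c (U.v (A x) (B x)))) * deriv B x) := by
      field_simp; ring
    rw [this, r1, mul_zero]
  constructor <;> linarith

omit h in
lemma pos_of_slice {A B : ℝ → ℝ} {x a' b' : ℝ}
    (h1 : U.m (A x) (B x) * a' = 1) (h2 : U.m' (A x) (B x) * b' = 1) :
    0 < U.m (A x) (B x) ∧ 0 < U.m' (A x) (B x) :=
  ⟨(U.m_nonneg _ _).lt_of_ne fun h0 => by rw [← h0, zero_mul] at h1; exact zero_ne_one h1,
    (U.m'_nonneg _ _).lt_of_ne fun h0 => by rw [← h0, zero_mul] at h2; exact zero_ne_one h2⟩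

/-- Almost every point of a line `{τ} × ℝ` is the image of a nondegenerate point. -/
lemma ae_exists_nondegenerate (U : CharFlow c R S v₀) (τ : ℝ) : ∀ᵐ x, ∃ a b, U.t a b = τ ∧
    U.x a b = x ∧ 0 < U.m a b ∧ 0 < U.m' a b := by
  obtain ⟨A, B, -, -, hA, hB, hae⟩ := exists_slice h U τ
  filter_upwards [hae] with x hx
  obtain ⟨a', b', -, -, h1, h2⟩ := hx
  exact ⟨A x, B x, hA x, hB x, pos_of_slice h1 h2⟩

/-- The energy density. -/
noncomputable def _root_.energyDensity (c : ℝ → ℝ) (u : ℝ → ℝ → ℝ) (t x : ℝ) : ℝ :=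
  (1 / 2) * (dt u t x ^ 2 + c (u t x) ^ 2 * dx u t x ^ 2 + u t x ^ 2 / 2 + u t x ^ 4 / 4)

/-- The energy inequality. -/
lemma energy_le (U : CharFlow c R S v₀) {u : ℝ → ℝ → ℝ}
    (hu : ∀ a b, u (U.t a b) (U.x a b) = U.v a b)
    (hI : Integrable (dataEnergy R S v₀)) (τ : ℝ) :
    energy c u τ ≤ ENNReal.ofReal (∫ y, dataEnergy R S v₀ y) := by
  obtain ⟨E, hE⟩ := U.exists_isEnergy h
  obtain ⟨A, B, mA, mB, hA, hB, hae⟩ := exists_slice h U τ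
  have hG : Monotone fun x => E (A x) (B x) / 4 := fun x y hxy =>
    div_le_div_of_nonneg_right (hE.mono (mA hxy) (mB hxy)) (by norm_num)
  -- Only an inequality results: the monotone function E(A, B)/4 may have a jump or singular part
  -- that its almost everywhere derivative does not see.
  refine le_trans (le_of_eq ?_) (hG.lintegral_deriv_le fun x y => hE.sub_le hI _ _ _ _)
  refine lintegral_congr_ae ?_
  filter_upwards [hae] with x hx
  obtain ⟨a', b', dA, dB, h1, h2⟩ := hx
  obtain ⟨p1, p2⟩ := pos_of_slice h1 h2
  have e1 := (dt_solution h hu p1 p2).deriv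
  have e2 := (dx_solution h hu p1 p2).deriv
  have e3 := hu (A x) (B x)
  rw [hA, hB] at e1 e2 e3
  have hc := (h.pos (U.v (A x) (B x))).ne'
  have k := HasFDerivAt.comp_hasDerivAt (f := fun x : ℝ => (A x, B x)) x
    (hasStrictFDerivAt_of_partials hE.hasDerivAt_left hE.hasDerivAt_right U.cont_N
    U.cont_N' (A x, B x)).hasFDerivAt (dA.prodMk dB)
  have k' : HasDerivAt (fun x => E (A x) (B x) / 4) _ x := k.div_const 4
  rw [k'.deriv]
  congr 1
  simp only [dt, dx, e1, e2, e3, _root_.add_apply, _root_.smul_apply,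
    ContinuousLinearMap.coe_fst', ContinuousLinearMap.coe_snd', smul_eq_mul]
  -- Now A' = 1/m and n/m = (l/m)², and likewise for the other family. The derivative becomes (R² +
  -- S² + 2F)/4 with R = l/m and S = l'/m'.
  have ha' : a' = 1 / U.m (A x) (B x) := by field_simp; linarith
  have hb' : b' = 1 / U.m' (A x) (B x) := by field_simp; linarith
  have q1 : U.n (A x) (B x) = U.l (A x) (B x) ^ 2 / U.m (A x) (B x) := by
    rw [U.l_sq]; field_simp
  have q2 : U.n' (A x) (B x) = U.l' (A x) (B x) ^ 2 / U.m' (A x) (B x) := by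
    rw [U.l'_sq]; field_simp
  rw [ha', hb', q1, q2, potentialF]
  field_simp
  ring

/-- The solution is absolutely continuous on lines `{τ} × ℝ`. -/
lemma absolutelyContinuous_slice (U : CharFlow c R S v₀) {u : ℝ → ℝ → ℝ}
    (hu : ∀ a b, u (U.t a b) (U.x a b) = U.v a b) (τ a b : ℝ) :
    AbsolutelyContinuousOnInterval (u τ) a b := by
  obtain ⟨E, hE⟩ := U.exists_isEnergy h
  obtain ⟨A, B, mA, mB, hA, hB, -⟩ := exists_slice h U τ
  have hG : Monotone fun x => E (A x) (B x) := fun x y hxy => hE.mono (mA hxy) (mB hxy)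
  refine absolutelyContinuousOnInterval_of_le hG h.K_pos.le (fun lam hlam x y => ?_) a b
  have key : ∀ x y, x ≤ y →
      dist (u τ x) (u τ y) ≤ K * (lam * dist x y + dist (E (A x) (B x)) (E (A y) (B y)) / lam) := by
    intro x y hxy
    have e1 := hu (A x) (B x)
    have e2 := hu (A y) (B y)
    rw [hA, hB] at e1 e2
    have := hE.dist_v_le h hlam (mA hxy) (mB hxy)
    rw [hB, hB] at this
    rw [dist_comm, dist_comm x, dist_comm (E _ _), e1, e2, Real.dist_eq, Real.dist_eq, Real.dist_eq,
      abs_of_nonneg (sub_nonneg.2 hxy), abs_of_nonneg (sub_nonneg.2 (hG hxy))]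
    exact this
  rcases le_total x y with hxy | hxy
  · exact key x y hxy
  · have := key y x hxy
    rwa [dist_comm (u τ x), dist_comm x, dist_comm (E (A x) (B x))]

end CharFlow

/-! ### Null sets, divergences and test functions -/

section RealAnalysis

/-- A monotone function is not constant on an interval that contains a point of positive
derivative. -/
lemma Monotone.lt_of_hasDerivAt_pos {f : ℝ → ℝ} (hf : Monotone f) {a b ξ f' : ℝ}
    (hd : HasDerivAt f f' ξ) (hpos : 0 < f') (hab : a < b) (hξ : ξ ∈ Icc a b) : f a < f b := by
  by_contra hle
  rw [not_lt] at hle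
  have hc : ∀ y ∈ Icc a b, f y = f a := fun y hy =>
    le_antisymm ((hf hy.2).trans hle) (hf hy.1)
  have h0 : HasDerivWithinAt f 0 (Icc a b) ξ :=
    (hasDerivWithinAt_const ξ (Icc a b) (f a)).congr hc (hc ξ hξ)
  exact hpos.ne ((uniqueDiffOn_Icc hab ξ hξ).eq_deriv _ h0 hd.hasDerivWithinAt)

/-- A zero with nonvanishing derivative is isolated, and a discrete subset of the line is countable.
-/
lemma countable_setOf_zero_and_deriv_ne_zero {f f' : ℝ → ℝ} (hf : ∀ x, HasDerivAt f (f' x) x) :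
    {x | f x = 0 ∧ f' x ≠ 0}.Countable := by
  have hd : DiscreteTopology {x | f x = 0 ∧ f' x ≠ 0} := by
    rw [discreteTopology_subtype_iff]
    intro x hx
    have h1 := (hf x).eventually_ne (c := 0) hx.2
    rw [← disjoint_iff, disjoint_principal_right]
    filter_upwards [h1] with z hz hz'
    exact hz hz'.1
  exact (countable_coe_iff).1 (TopologicalSpace.separableSpace_iff_countable.1 inferInstance)

/-- Applied to l and l': on the degenerate set one of them vanishes, and then so does its derivative
∓Λ at almost every point, although Λ need not vanish for algebraic reasons. -/
lemma ae_deriv_eq_zero_of_eq_zero {f f' : ℝ → ℝ → ℝ}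
    (hf : ∀ a b, HasDerivAt (fun y => f a y) (f' a b) b)
    (cf : Continuous fun P : ℝ × ℝ => f P.1 P.2) (cf' : Continuous fun P : ℝ × ℝ => f' P.1 P.2) :
    ∀ᵐ P : ℝ × ℝ, f P.1 P.2 = 0 → f' P.1 P.2 = 0 := by
  have hm : MeasurableSet {P : ℝ × ℝ | f P.1 P.2 = 0 → f' P.1 P.2 = 0} :=
    (measurableSet_eq_fun cf.measurable measurable_const).imp
      (measurableSet_eq_fun cf'.measurable measurable_const)
  rw [Measure.volume_eq_prod, Measure.ae_prod_iff_ae_ae hm]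
  refine Eventually.of_forall fun a => ?_
  have := (countable_setOf_zero_and_deriv_ne_zero (hf a)).measure_zero volume
  rw [ae_iff]
  convert this using 2
  ext b
  simp

/-- The integral of a partial derivative of a function with compact support vanishes. -/
lemma integral_partial_left_eq_zero {A A' : ℝ → ℝ → ℝ}
    (hA : ∀ a b, HasDerivAt (fun y => A y b) (A' a b) a)
    (cA : Continuous fun P : ℝ × ℝ => A P.1 P.2) (cA' : Continuous fun P : ℝ × ℝ => A' P.1 P.2)
    {k : Set (ℝ × ℝ)} (hk : IsCompact k) (h0 : ∀ P ∉ k, A P.1 P.2 = 0) :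
    Integrable (fun P : ℝ × ℝ => A' P.1 P.2) ∧ ∫ P : ℝ × ℝ, A' P.1 P.2 = 0 := by
  have h0' : ∀ P ∉ k, A' P.1 P.2 = 0 := fun P hP => by
    have hev : ∀ᶠ Q in 𝓝 P, A Q.1 Q.2 = 0 := by
      filter_upwards [hk.isClosed.isOpen_compl.mem_nhds hP] with Q hQ using h0 Q hQ
    have ht : Tendsto (fun y => (y, P.2)) (𝓝 P.1) (𝓝 P) :=
      (continuous_id.prodMk continuous_const).tendsto P.1
    have hev' : (fun y => A y P.2) =ᶠ[𝓝 P.1] fun _ => 0 := ht.eventually hev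
    exact ((hA P.1 P.2).congr_of_eventuallyEq hev'.symm).unique (hasDerivAt_const _ _)
  have hint : Integrable fun P : ℝ × ℝ => A' P.1 P.2 :=
    cA'.integrable_of_hasCompactSupport (HasCompactSupport.intro hk h0')
  refine ⟨hint, ?_⟩
  have slice : ∀ {B : ℝ → ℝ → ℝ}, Continuous (fun P : ℝ × ℝ => B P.1 P.2) →
      (∀ P ∉ k, B P.1 P.2 = 0) → ∀ b, Integrable fun a => B a b := by
    intro B cB hB b
    refine (continuous_fst_slice cB b).integrable_of_hasCompactSupport
      (HasCompactSupport.intro (hk.image continuous_fst) fun a ha => ?_)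
    exact hB (a, b) fun hab => ha ⟨(a, b), hab, rfl⟩
  rw [Measure.volume_eq_prod] at hint ⊢
  rw [integral_prod_symm _ hint]
  have : ∀ b, ∫ a, A' a b = 0 := fun b =>
    integral_eq_zero_of_hasDerivAt_of_integrable (fun a => hA a b) (slice cA' h0' b)
      (slice cA h0 b)
  simp [this]

lemma integral_partial_right_eq_zero {A A' : ℝ → ℝ → ℝ}
    (hA : ∀ a b, HasDerivAt (fun y => A a y) (A' a b) b)
    (cA : Continuous fun P : ℝ × ℝ => A P.1 P.2) (cA' : Continuous fun P : ℝ × ℝ => A' P.1 P.2)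
    {k : Set (ℝ × ℝ)} (hk : IsCompact k) (h0 : ∀ P ∉ k, A P.1 P.2 = 0) :
    Integrable (fun P : ℝ × ℝ => A' P.1 P.2) ∧ ∫ P : ℝ × ℝ, A' P.1 P.2 = 0 := by
  obtain ⟨h1, h2⟩ := integral_partial_left_eq_zero (A := fun a b => A b a)
    (A' := fun a b => A' b a) (fun a b => hA b a) (cA.comp continuous_swap)
    (cA'.comp continuous_swap) (hk.image continuous_swap)
    (fun P hP => h0 P.swap fun hP' => hP ⟨_, hP', P.swap_swap⟩)
  rw [Measure.volume_eq_prod] at h1 h2 ⊢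
  refine ⟨h1.swap, ?_⟩
  rw [← h2]
  exact integral_prod_swap (μ := volume) (ν := volume) (fun P : ℝ × ℝ => A' P.2 P.1)

lemma det_prod_coord (p q r s : ℝ) :
    (((p • ContinuousLinearMap.fst ℝ ℝ ℝ + q • ContinuousLinearMap.snd ℝ ℝ ℝ).prod
      (r • ContinuousLinearMap.fst ℝ ℝ ℝ + s • ContinuousLinearMap.snd ℝ ℝ ℝ)) :
        ℝ × ℝ →L[ℝ] ℝ × ℝ).det = p * s - q * r := by
  rw [← Matrix.toLin_finTwoProd_toContinuousLinearMap, ContinuousLinearMap.det]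
  simp [Matrix.det_fin_two]

lemma hasFDerivAt_of_contDiff {φ : ℝ → ℝ → ℝ} (hφ : ContDiff ℝ 1 fun p : ℝ × ℝ => φ p.1 p.2)
    (t x : ℝ) : HasFDerivAt (fun p : ℝ × ℝ => φ p.1 p.2)
      (dt φ t x • ContinuousLinearMap.fst ℝ ℝ ℝ + dx φ t x • ContinuousLinearMap.snd ℝ ℝ ℝ)
      (t, x) := by
  have hd := (hφ.differentiable one_ne_zero (t, x)).hasFDerivAt
  have h1 := HasFDerivAt.comp_hasDerivAt (f := fun s : ℝ => (s, x)) t hd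
    ((hasDerivAt_id _).prodMk (hasDerivAt_const _ _))
  have h2 := HasFDerivAt.comp_hasDerivAt (f := fun y : ℝ => (t, y)) x hd
    ((hasDerivAt_const _ _).prodMk (hasDerivAt_id _))
  have e1 : dt φ t x = _ := h1.deriv
  have e2 : dx φ t x = _ := h2.deriv
  refine hd.congr_fderiv ?_
  rw [e1, e2]
  ext <;> simp

lemma continuous_dt_of_contDiff {φ : ℝ → ℝ → ℝ}
    (hφ : ContDiff ℝ 1 fun p : ℝ × ℝ => φ p.1 p.2) :
    Continuous fun p : ℝ × ℝ => dt φ p.1 p.2 := by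
  have := (hφ.continuous_fderiv one_ne_zero).clm_apply (continuous_const (y := ((1, 0) : ℝ × ℝ)))
  refine this.congr fun p => ?_
  rw [(hasFDerivAt_of_contDiff hφ p.1 p.2).fderiv]; simp

lemma continuous_dx_of_contDiff {φ : ℝ → ℝ → ℝ}
    (hφ : ContDiff ℝ 1 fun p : ℝ × ℝ => φ p.1 p.2) :
    Continuous fun p : ℝ × ℝ => dx φ p.1 p.2 := by
  have := (hφ.continuous_fderiv one_ne_zero).clm_apply (continuous_const (y := ((0, 1) : ℝ × ℝ)))
  refine this.congr fun p => ?_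
  rw [(hasFDerivAt_of_contDiff hφ p.1 p.2).fderiv]; simp

end RealAnalysis

/-! ### Change of variables and the weak formulation -/

namespace CharFlow

variable {K : ℝ} {c R S v₀ : ℝ → ℝ} (h : IsSpeed K c) (U : CharFlow c R S v₀)

/-- The set of points where the map to physical coordinates is nondegenerate. -/
def good (U : CharFlow c R S v₀) : Set (ℝ × ℝ) := {P | 0 < U.m P.1 P.2 ∧ 0 < U.m' P.1 P.2}

lemma isOpen_good : IsOpen U.good :=
  (isOpen_lt continuous_const U.cont_m).inter (isOpen_lt continuous_const U.cont_m')

include h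

/-- At a nondegenerate point (a, b) both t and x are strictly monotone in either coordinate. Against
a point with a' > a the functions x differ if b ≤ b' and the functions t differ if b' ≤ b; if a = a'
and b ≠ b', x differs. -/
lemma injOn_coord : InjOn U.coord U.good := by
  have key : ∀ a b a' b', 0 < U.m a b → 0 < U.m' a b → U.t a b = U.t a' b' → U.x a b = U.x a' b' →
      a ≤ a' → a = a' ∧ b = b' := by
    intro a b a' b' hm hm' ht hx ha
    have pt : 0 < U.m a b / (2 * c (U.v a b)) := div_pos hm (mul_pos two_pos (h.pos _))
    have pt' : 0 < -(-(U.m' a b / (2 * c (U.v a b)))) := by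
      rw [neg_neg]; exact div_pos hm' (mul_pos two_pos (h.pos _))
    have aeq : a = a' := by
      by_contra hne
      have hlt := lt_of_le_of_ne ha hne
      rcases le_total b b' with hb | hb
      · have := (U.x_mono_left b).lt_of_hasDerivAt_pos (U.x_a a b) (half_pos hm) hlt
          (left_mem_Icc.2 ha)
        have h2 := U.x_mono_right a' hb
        simp only at h2
        linarith
      · have := (U.t_mono_left h b).lt_of_hasDerivAt_pos (U.t_a a b) pt hlt (left_mem_Icc.2 ha)
        have h2 := U.t_anti_right h a' hb
        simp only at h2
        linarith
    subst aeq
    refine ⟨rfl, ?_⟩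
    rcases lt_trichotomy b b' with hb | hb | hb
    · have := (U.x_mono_right a).lt_of_hasDerivAt_pos (U.x_b a b) (half_pos hm') hb
        (left_mem_Icc.2 hb.le)
      linarith
    · exact hb
    · have := (U.x_mono_right a).lt_of_hasDerivAt_pos (U.x_b a b) (half_pos hm') hb
        (right_mem_Icc.2 hb.le)
      linarith
  rintro ⟨a, b⟩ hP ⟨a', b'⟩ hQ hPQ
  have ht : U.t a b = U.t a' b' := congrArg Prod.fst hPQ
  have hx : U.x a b = U.x a' b' := congrArg Prod.snd hPQ
  rcases le_total a a' with ha | ha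
  · obtain ⟨h1, h2⟩ := key a b a' b' hP.1 hP.2 ht hx ha
    rw [h1, h2]
  · obtain ⟨h1, h2⟩ := key a' b' a b hQ.1 hQ.2 ht.symm hx.symm ha
    rw [h1, h2]

/-- Fubini reduces the claim to the lines {τ} × ℝ. The image is measurable because the map is
continuous and injective on the open set `good`. -/
lemma ae_mem_image_good : ∀ᵐ Q : ℝ × ℝ, Q ∈ U.coord '' U.good := by
  have hm : MeasurableSet (U.coord '' U.good) :=
    U.isOpen_good.measurableSet.image_of_continuousOn_injOn (U.continuous_coord h).continuousOn
      (U.injOn_coord h)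
  rw [Measure.volume_eq_prod, Measure.ae_prod_mem_iff_ae_ae_mem hm]
  refine Eventually.of_forall fun τ => ?_
  filter_upwards [ae_exists_nondegenerate h U τ] with x hx
  obtain ⟨a, b, h1, h2, h3, h4⟩ := hx
  exact ⟨(a, b), ⟨h3, h4⟩, Prod.ext h1 h2⟩

/-- Change of variables from physical to characteristic coordinates. -/
lemma integral_eq_of_coord {H Ψ : ℝ × ℝ → ℝ} (hΨ : Integrable Ψ)
    (hgood : ∀ a b, 0 < U.m a b → 0 < U.m' a b →
      U.m a b * U.m' a b / (2 * c (U.v a b)) * H (U.t a b, U.x a b) = Ψ (a, b))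
    (hbad : ∀ᵐ P : ℝ × ℝ, P ∉ U.good → Ψ P = 0) :
    Integrable H ∧ ∫ Q, H Q = ∫ P, Ψ P := by
  have hfull : U.coord '' U.good =ᵐ[volume] (univ : Set (ℝ × ℝ)) :=
    eventuallyEq_univ.2 (U.ae_mem_image_good h)
  set L : ℝ × ℝ → (ℝ × ℝ →L[ℝ] ℝ × ℝ) := fun P =>
    ((U.m P.1 P.2 / (2 * c (U.v P.1 P.2))) • ContinuousLinearMap.fst ℝ ℝ ℝ
      + (-(U.m' P.1 P.2 / (2 * c (U.v P.1 P.2)))) • ContinuousLinearMap.snd ℝ ℝ ℝ).prod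
    ((U.m P.1 P.2 / 2) • ContinuousLinearMap.fst ℝ ℝ ℝ
      + (U.m' P.1 P.2 / 2) • ContinuousLinearMap.snd ℝ ℝ ℝ) with hL
  have hd : ∀ P ∈ U.good, HasFDerivWithinAt U.coord (L P) U.good P := fun P _ =>
    ((U.strict_t h P).hasFDerivAt.prodMk (U.strict_x P).hasFDerivAt).hasFDerivWithinAt
  have hdet : ∀ P ∈ U.good, |(L P).det| • H (U.coord P) = Ψ P := fun P hP => by
    have hc := h.pos (U.v P.1 P.2)
    rw [← hgood P.1 P.2 hP.1 hP.2, hL, det_prod_coord, smul_eq_mul]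
    have e : U.m P.1 P.2 / (2 * c (U.v P.1 P.2)) * (U.m' P.1 P.2 / 2)
      - -(U.m' P.1 P.2 / (2 * c (U.v P.1 P.2))) * (U.m P.1 P.2 / 2)
      = U.m P.1 P.2 * U.m' P.1 P.2 / (2 * c (U.v P.1 P.2)) := by ring
    rw [e, abs_of_nonneg (div_nonneg (mul_pos hP.1 hP.2).le (mul_pos two_pos hc).le)]
    rfl
  have hgm := U.isOpen_good.measurableSet
  have hΨs : ∫ P in U.good, Ψ P = ∫ P, Ψ P :=
    setIntegral_eq_integral_of_ae_compl_eq_zero hbad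
  constructor
  · rw [← integrableOn_univ, ← integrableOn_congr_set_ae hfull,
      integrableOn_image_iff_integrableOn_abs_det_fderiv_smul volume hgm hd (U.injOn_coord h)]
    exact hΨ.integrableOn.congr_fun (fun P hP => (hdet P hP).symm) hgm
  · rw [← setIntegral_univ, ← setIntegral_congr_set hfull,
      integral_image_eq_integral_abs_det_fderiv_smul volume hgm hd (U.injOn_coord h),
      setIntegral_congr_fun hgm hdet, hΨs]

variable {φ : ℝ → ℝ → ℝ} (hφ : ContDiff ℝ 1 fun p : ℝ × ℝ => φ p.1 p.2)
  (hφs : HasCompactSupport fun p : ℝ × ℝ => φ p.1 p.2)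
include hφ

omit h in
/-- The pull-back of a test function, differentiated along the first characteristic coordinate. -/
lemma hasDerivAt_test_left (a b : ℝ) : HasDerivAt (fun y => φ (U.t y b) (U.x y b))
    (dt φ (U.t a b) (U.x a b) * (U.m a b / (2 * c (U.v a b)))
      + dx φ (U.t a b) (U.x a b) * (U.m a b / 2)) a := by
  have := HasFDerivAt.comp_hasDerivAt (f := fun y => (U.t y b, U.x y b)) a
    (hasFDerivAt_of_contDiff hφ (U.t a b) (U.x a b)) ((U.t_a a b).prodMk (U.x_a a b))
  refine HasDerivAt.congr_deriv (f := fun y => φ (U.t y b) (U.x y b)) this ?_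
  simp

omit h in
lemma hasDerivAt_test_right (a b : ℝ) : HasDerivAt (fun y => φ (U.t a y) (U.x a y))
    (dt φ (U.t a b) (U.x a b) * (-(U.m' a b / (2 * c (U.v a b))))
      + dx φ (U.t a b) (U.x a b) * (U.m' a b / 2)) b := by
  have := HasFDerivAt.comp_hasDerivAt (f := fun y => (U.t a y, U.x a y)) b
    (hasFDerivAt_of_contDiff hφ (U.t a b) (U.x a b)) ((U.t_b a b).prodMk (U.x_b a b))
  refine HasDerivAt.congr_deriv (f := fun y => φ (U.t a y) (U.x a y)) this ?_
  simp

lemma cont_test : Continuous fun P : ℝ × ℝ => φ (U.t P.1 P.2) (U.x P.1 P.2) :=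
  hφ.continuous.comp (U.continuous_coord h)

lemma cont_test_left : Continuous fun P : ℝ × ℝ => dt φ (U.t P.1 P.2) (U.x P.1 P.2) *
    (U.m P.1 P.2 / (2 * c (U.v P.1 P.2))) + dx φ (U.t P.1 P.2) (U.x P.1 P.2) * (U.m P.1 P.2 / 2) :=
  (((continuous_dt_of_contDiff hφ).comp (U.continuous_coord h)).mul (U.cont_t_a h)).add
    (((continuous_dx_of_contDiff hφ).comp (U.continuous_coord h)).mul (U.cont_m.div_const 2))

lemma cont_test_right : Continuous fun P : ℝ × ℝ => dt φ (U.t P.1 P.2) (U.x P.1 P.2) *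
    (-(U.m' P.1 P.2 / (2 * c (U.v P.1 P.2))))
      + dx φ (U.t P.1 P.2) (U.x P.1 P.2) * (U.m' P.1 P.2 / 2) :=
  (((continuous_dt_of_contDiff hφ).comp (U.continuous_coord h)).mul (U.cont_t_b h)).add
    (((continuous_dx_of_contDiff hφ).comp (U.continuous_coord h)).mul (U.cont_m'.div_const 2))

include hφs

omit hφ in
lemma exists_isCompact_test : ∃ k : Set (ℝ × ℝ), IsCompact k ∧
    ∀ P ∉ k, φ (U.t P.1 P.2) (U.x P.1 P.2) = 0 := by
  refine ⟨_, (U.isProperMap_coord h).isCompact_preimage hφs, fun P hP => ?_⟩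
  exact image_eq_zero_of_notMem_tsupport (f := fun p : ℝ × ℝ => φ p.1 p.2) hP

omit hφ hφs in
/-- The general weak identity: a function that corresponds to a divergence in characteristic
coordinates has integral zero. -/
lemma integral_eq_zero_of_divergence {A A' B B' : ℝ → ℝ → ℝ} {H : ℝ × ℝ → ℝ}
    (hA : ∀ a b, HasDerivAt (fun y => A y b) (A' a b) a)
    (hB : ∀ a b, HasDerivAt (fun y => B a y) (B' a b) b)
    (cA : Continuous fun P : ℝ × ℝ => A P.1 P.2) (cB : Continuous fun P : ℝ × ℝ => B P.1 P.2)
    (cA' : Continuous fun P : ℝ × ℝ => A' P.1 P.2) (cB' : Continuous fun P : ℝ × ℝ => B' P.1 P.2)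
    {k : Set (ℝ × ℝ)} (hk : IsCompact k) (hA0 : ∀ P ∉ k, A P.1 P.2 = 0)
    (hB0 : ∀ P ∉ k, B P.1 P.2 = 0)
    (hgood : ∀ a b, 0 < U.m a b → 0 < U.m' a b →
      U.m a b * U.m' a b / (2 * c (U.v a b)) * H (U.t a b, U.x a b) = A' a b + B' a b)
    (hbad : ∀ᵐ P : ℝ × ℝ, P ∉ U.good → A' P.1 P.2 + B' P.1 P.2 = 0) :
    Integrable H ∧ ∫ Q, H Q = 0 := by
  obtain ⟨i1, z1⟩ := integral_partial_left_eq_zero hA cA cA' hk hA0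
  obtain ⟨i2, z2⟩ := integral_partial_right_eq_zero hB cB cB' hk hB0
  obtain ⟨h1, h2⟩ := U.integral_eq_of_coord h (i1.add i2) hgood hbad
  refine ⟨h1, h2.trans ?_⟩
  simp only [Pi.add_apply]
  rw [integral_add i1 i2, z1, z2, add_zero]

variable {u : ℝ → ℝ → ℝ} (hu : ∀ a b, u (U.t a b) (U.x a b) = U.v a b)
include hu

/-- Let ψ be the pull-back of φ. Since x_α = m/2 and x_β = m'/2, the Jacobian times (uφ)_t is ∂_α(vψ
m'/2) - ∂_β(vψ m/2), the mixed derivatives of x cancelling. This expression vanishes where m or m'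
does. -/
lemma weak_dt : Integrable (fun p : ℝ × ℝ => u p.1 p.2 * dt φ p.1 p.2 + dt u p.1 p.2 * φ p.1 p.2) ∧
    ∫ p : ℝ × ℝ, (u p.1 p.2 * dt φ p.1 p.2 + dt u p.1 p.2 * φ p.1 p.2) = 0 := by
  obtain ⟨k, hk, h0⟩ := exists_isCompact_test h U hφs
  have cv := U.cont_v
  have cψ := cont_test h U hφ
  have cva := U.cont_v_a h
  have cvb := U.cont_v_b h
  have cψa := cont_test_left h U hφ
  have cψb := cont_test_right h U hφ
  have cm := U.cont_m
  have cm' := U.cont_m'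
  have cΩ := U.cont_Ω h
  refine integral_eq_zero_of_divergence h U
    (fun a b => ((U.v_a a b).mul (hasDerivAt_test_left U hφ a b)).mul
      ((U.m'_a a b).div_const 2))
    (fun a b => (((U.v_b a b).mul (hasDerivAt_test_right U hφ a b)).mul
      ((U.m_b a b).div_const 2)).neg)
    ((cv.mul cψ).mul (cm'.div_const 2)) ((cv.mul cψ).mul (cm.div_const 2)).neg
    ((((cva.mul cψ).add (cv.mul cψa)).mul (cm'.div_const 2)).add
      ((cv.mul cψ).mul (cΩ.div_const 2)))
    ((((cvb.mul cψ).add (cv.mul cψb)).mul (cm.div_const 2)).add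
      ((cv.mul cψ).mul (cΩ.div_const 2))).neg hk
    (fun P hP => by simp [h0 P hP]) (fun P hP => by simp [h0 P hP]) (fun a b hm hm' => ?_)
    (Eventually.of_forall fun P hP => ?_)
  · have e1 : dt u (U.t a b) (U.x a b) = _ := (dt_solution h hu hm hm').deriv
    have hc := (h.pos (U.v a b)).ne'
    simp only [e1, hu, Pi.mul_apply]
    field_simp
    ring
  · have hc := (h.pos (U.v P.1 P.2)).ne'
    have hz : U.m P.1 P.2 = 0 ∨ U.m' P.1 P.2 = 0 := by
      by_contra! hne
      exact hP ⟨(U.m_nonneg _ _).lt_of_ne hne.1.symm, (U.m'_nonneg _ _).lt_of_ne hne.2.symm⟩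
    simp only [Pi.mul_apply]
    rcases hz with hz | hz
    · rw [U.l_eq_zero hz, hz]; simp
    · rw [U.l'_eq_zero hz, hz]; simp

/-- The analogue with t in place of x: the Jacobian times (uφ)_x is ∂_α(vψ m'/(2c)) + ∂_β(vψ
m/(2c)). The derivatives of c(v) that now appear cancel against Ω, which expresses that dt is
closed. -/
lemma weak_dx : Integrable (fun p : ℝ × ℝ => u p.1 p.2 * dx φ p.1 p.2 + dx u p.1 p.2 * φ p.1 p.2) ∧
    ∫ p : ℝ × ℝ, (u p.1 p.2 * dx φ p.1 p.2 + dx u p.1 p.2 * φ p.1 p.2) = 0 := by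
  obtain ⟨k, hk, h0⟩ := exists_isCompact_test h U hφs
  have cv := U.cont_v
  have cψ := cont_test h U hφ
  have cva := U.cont_v_a h
  have cvb := U.cont_v_b h
  have cψa := cont_test_left h U hφ
  have cψb := cont_test_right h U hφ
  have cm := U.cont_m
  have cm' := U.cont_m'
  have cΩ := U.cont_Ω h
  have cc := U.cont_c h
  have cdc := h.continuous_deriv.comp U.cont_v
  have c0 : ∀ w, 2 * c w ≠ 0 := fun w => (mul_pos two_pos (h.pos w)).ne'
  refine integral_eq_zero_of_divergence h U
    (fun a b => ((U.v_a a b).mul (hasDerivAt_test_left U hφ a b)).mul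
      ((U.m'_a a b).div
        (((h.hasDerivAt (U.v a b)).comp (h := fun y => U.v y b) a (U.v_a a b)).const_mul 2) (c0 _)))
    (fun a b => (((U.v_b a b).mul (hasDerivAt_test_right U hφ a b)).mul
      ((U.m_b a b).div
        (((h.hasDerivAt (U.v a b)).comp (h := fun y => U.v a y) b (U.v_b a b)).const_mul 2)
          (c0 _))))
    ((cv.mul cψ).mul (cm'.div (cc.const_mul 2) fun _ => c0 _))
    ((cv.mul cψ).mul (cm.div (cc.const_mul 2) fun _ => c0 _))
    ((((cva.mul cψ).add (cv.mul cψa)).mul (cm'.div (cc.const_mul 2) fun _ => c0 _)).add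
      ((cv.mul cψ).mul (((cΩ.mul (cc.const_mul 2)).sub (cm'.mul ((cdc.mul cva).const_mul 2))).div
        ((cc.const_mul 2).pow 2) fun _ => pow_ne_zero 2 (c0 _))))
    ((((cvb.mul cψ).add (cv.mul cψb)).mul (cm.div (cc.const_mul 2) fun _ => c0 _)).add
      ((cv.mul cψ).mul (((cΩ.mul (cc.const_mul 2)).sub (cm.mul ((cdc.mul cvb).const_mul 2))).div
        ((cc.const_mul 2).pow 2) fun _ => pow_ne_zero 2 (c0 _)))) hk
    (fun P hP => by simp [h0 P hP]) (fun P hP => by simp [h0 P hP]) (fun a b hm hm' => ?_)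
    (Eventually.of_forall fun P hP => ?_)
  · have e1 : dx u (U.t a b) (U.x a b) = _ := (dx_solution h hu hm hm').deriv
    have hc := (h.pos (U.v a b)).ne'
    simp only [e1, hu, Pi.mul_apply, Pi.div_apply, Function.comp, flowΩ]
    field_simp
    ring
  · have hc := (h.pos (U.v P.1 P.2)).ne'
    have hz : U.m P.1 P.2 = 0 ∨ U.m' P.1 P.2 = 0 := by
      by_contra! hne
      exact hP ⟨(U.m_nonneg _ _).lt_of_ne hne.1.symm, (U.m'_nonneg _ _).lt_of_ne hne.2.symm⟩
    simp only [Pi.mul_apply, Pi.div_apply, Function.comp, flowΩ]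
    rcases hz with hz | hz
    · rw [U.l_eq_zero hz, hz]; field_simp; ring
    · rw [U.l'_eq_zero hz, hz]; field_simp; ring

/-- With ψ the pull-back of φ, the integrand times the Jacobian is (∂_α(ψ l') - ∂_β(ψ l))/2 = (ψ_α
l' - ψ_β l)/2 + ψ Λ. At a point with m = 0 the first part vanishes, but Λ retains a term in n m'; it
is null only almost everywhere, as a derivative of l on the zero set of l. -/
lemma weak_equation : Integrable (fun p : ℝ × ℝ => weakIntegrand c u φ p.1 p.2) ∧
    ∫ p : ℝ × ℝ, weakIntegrand c u φ p.1 p.2 = 0 := by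
  obtain ⟨k, hk, h0⟩ := exists_isCompact_test h U hφs
  have cψ := cont_test h U hφ
  have cψa := cont_test_left h U hφ
  have cψb := cont_test_right h U hφ
  have cl := U.cont_l
  have cl' := U.cont_l'
  have cΛ := U.cont_Λ h
  have null1 := ae_deriv_eq_zero_of_eq_zero U.l_b cl cΛ.neg
  have null2 : ∀ᵐ P : ℝ × ℝ, U.l' P.1 P.2 = 0 → flowΛ c (U.v P.1 P.2) (U.m P.1 P.2) (U.l P.1 P.2)
      (U.n P.1 P.2) (U.m' P.1 P.2) (U.l' P.1 P.2) (U.n' P.1 P.2) = 0 := by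
    have := ae_deriv_eq_zero_of_eq_zero (fun a b => U.l'_a b a) (cl'.comp continuous_swap)
      (cΛ.comp continuous_swap)
    rw [Measure.volume_eq_prod] at this ⊢
    exact Measure.measurePreserving_swap.quasiMeasurePreserving.ae this
  refine integral_eq_zero_of_divergence h U
    (fun a b => ((hasDerivAt_test_left U hφ a b).mul (U.l'_a a b)).div_const 2)
    (fun a b => (((hasDerivAt_test_right U hφ a b).mul (U.l_b a b)).div_const 2).neg)
    ((cψ.mul cl').div_const 2) ((cψ.mul cl).div_const 2).neg
    (((cψa.mul cl').add (cψ.mul cΛ)).div_const 2)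
    ((((cψb.mul cl).add (cψ.mul cΛ.neg)).div_const 2)).neg hk
    (fun P hP => by simp [h0 P hP]) (fun P hP => by simp [h0 P hP]) (fun a b hm hm' => ?_) ?_
  · have e1 : dt u (U.t a b) (U.x a b) = _ := (dt_solution h hu hm hm').deriv
    have d2 := dx_solution h hu hm hm'
    have e2 : dx u (U.t a b) (U.x a b) = _ := d2.deriv
    have d3 : HasDerivAt (fun y => φ (U.t a b) y) (dx φ (U.t a b) (U.x a b)) (U.x a b) := by
      have := HasFDerivAt.comp_hasDerivAt (f := fun y => (U.t a b, y)) (U.x a b)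
        (hasFDerivAt_of_contDiff hφ (U.t a b) (U.x a b))
        ((hasDerivAt_const _ _).prodMk (hasDerivAt_id _))
      refine HasDerivAt.congr_deriv (f := fun y => φ (U.t a b) y) this ?_
      simp
    have d4 := ((h.hasDerivAt (u (U.t a b) (U.x a b))).comp (h := fun y => u (U.t a b) y)
      (U.x a b) d2).mul d3
    have e4 : dx (fun s y => c (u s y) * φ s y) (U.t a b) (U.x a b) = _ := d4.deriv
    have hc := (h.pos (U.v a b)).ne'
    have q1 : U.n a b = U.l a b ^ 2 / U.m a b := by rw [U.l_sq]; field_simp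
    have q2 : U.n' a b = U.l' a b ^ 2 / U.m' a b := by rw [U.l'_sq]; field_simp
    simp only [weakIntegrand, e1, e2, e4, hu, Function.comp, flowΛ]
    rw [q1, q2]
    field_simp
    ring
  · filter_upwards [null1, null2] with P n1 n2 hP
    have hz : U.m P.1 P.2 = 0 ∨ U.m' P.1 P.2 = 0 := by
      by_contra! hne
      exact hP ⟨(U.m_nonneg _ _).lt_of_ne hne.1.symm, (U.m'_nonneg _ _).lt_of_ne hne.2.symm⟩
    rcases hz with hz | hz
    · have hl := U.l_eq_zero hz
      rw [neg_eq_zero.1 (n1 hl), hl, hz]; ring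
    · have hl := U.l'_eq_zero hz
      rw [n2 hl, hl, hz]; ring

end CharFlow

/-! ### Initial data and the energy density -/

lemma continuous_of_absolutelyContinuous {f : ℝ → ℝ}
    (hf : ∀ a b, AbsolutelyContinuousOnInterval f a b) : Continuous f :=
  continuous_iff_continuousAt.2 fun x =>
    ((hf (x - 1) (x + 1)).continuousOn).continuousAt (by
      rw [uIcc_of_le (by linarith)]; exact Icc_mem_nhds (by linarith) (by linarith))

namespace AdmissibleData

variable {v₀ v₁ : ℝ → ℝ} (hd : AdmissibleData v₀ v₁)
include hd

lemma continuous : Continuous v₀ := continuous_of_absolutelyContinuous hd.absolutelyContinuous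
lemma continuous_deriv : Continuous (deriv v₀) :=
  continuous_of_absolutelyContinuous hd.deriv_memH1.absolutelyContinuous
lemma continuous_vel : Continuous v₁ :=
  continuous_of_absolutelyContinuous hd.vel_memH1.absolutelyContinuous

/-- As an H¹ function the derivative of v₀ is continuous, so the integral formula for absolutely
continuous functions makes v₀ differentiable at every point. -/
lemma hasDerivAt (x : ℝ) : HasDerivAt v₀ (deriv v₀ x) x := by
  have h1 : v₀ = fun y => v₀ 0 + ∫ s in (0:ℝ)..y, deriv v₀ s := funext fun y => by
    rw [(hd.absolutelyContinuous 0 y).integral_deriv_eq_sub]; ring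
  have h2 := ((hd.continuous_deriv.integral_hasStrictDerivAt 0 x).hasDerivAt).const_add (v₀ 0)
  rwa [← h1] at h2

variable {K : ℝ} {c : ℝ → ℝ} (h : IsSpeed K c)
include h

lemma continuous_initR : Continuous (initR c v₀ v₁) :=
  hd.continuous_vel.add ((h.continuous.comp hd.continuous).mul hd.continuous_deriv)

lemma continuous_initS : Continuous (initS c v₀ v₁) :=
  hd.continuous_vel.sub ((h.continuous.comp hd.continuous).mul hd.continuous_deriv)

lemma integrable_dataEnergy :
    Integrable (CharFlow.dataEnergy (initR c v₀ v₁) (initS c v₀ v₁) v₀) := by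
  have i1 := hd.vel_memH1.memLp.integrable_sq
  have i2 := hd.deriv_memH1.memLp.integrable_sq
  have i3 := hd.memLp_two.integrable_sq
  have i4 : Integrable fun x => v₀ x ^ 4 := by
    have := hd.memLp_four.integrable_norm_pow (p := 4) (by norm_num)
    refine this.congr (Eventually.of_forall fun x => ?_)
    simp only [Real.norm_eq_abs]
    exact Even.pow_abs (by decide) _
  have i5 : Integrable fun x => c (v₀ x) ^ 2 * deriv v₀ x ^ 2 := by
    refine i2.bdd_mul (c := K ^ 2) ((h.continuous.comp hd.continuous).pow 2).aestronglyMeasurable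
      (Eventually.of_forall fun x => ?_)
    rw [Real.norm_eq_abs, abs_of_nonneg (sq_nonneg _)]
    exact pow_le_pow_left₀ (h.pos _).le (h.le _) 2
  have := ((i1.add i5).add ((i3.div_const 2).add (i4.div_const 4))).const_mul (1 / 2)
  refine this.congr (Eventually.of_forall fun x => ?_)
  simp only [Pi.add_apply, CharFlow.dataEnergy, initR, initS, potentialF]
  ring

omit hd h in
lemma _root_.initialEnergy_eq : initialEnergy c v₀ v₁ = ∫⁻ x, ENNReal.ofReal
    (CharFlow.dataEnergy (initR c v₀ v₁) (initS c v₀ v₁) v₀ x) := by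
  unfold initialEnergy
  congr 1
  ext x
  congr 1
  simp only [CharFlow.dataEnergy, initR, initS, potentialF]
  ring

lemma initialEnergy_eq_ofReal : initialEnergy c v₀ v₁ = ENNReal.ofReal
    (∫ x, CharFlow.dataEnergy (initR c v₀ v₁) (initS c v₀ v₁) v₀ x) := by
  rw [initialEnergy_eq, ofReal_integral_eq_lintegral_ofReal (hd.integrable_dataEnergy h)
    (Eventually.of_forall CharFlow.dataEnergy_nonneg)]

end AdmissibleData

section Measurability

variable {u : ℝ → ℝ → ℝ} (hu : Continuous fun p : ℝ × ℝ => u p.1 p.2)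
include hu

lemma measurable_dx : Measurable fun p : ℝ × ℝ => dx u p.1 p.2 :=
  measurable_deriv_with_param (f := u) hu

lemma measurable_dt : Measurable fun p : ℝ × ℝ => dt u p.1 p.2 :=
  (measurable_deriv_with_param (f := fun x t => u t x) (hu.comp continuous_swap)).comp
    measurable_swap

lemma measurable_energyDensity {K : ℝ} {c : ℝ → ℝ} (h : IsSpeed K c) :
    Measurable fun p : ℝ × ℝ => energyDensity c u p.1 p.2 := by
  have h1 := measurable_dx hu
  have h2 := measurable_dt hu
  have h3 := hu.measurable
  have h4 := (h.continuous.comp hu).measurable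
  unfold energyDensity
  exact ((((h2.pow_const 2).add ((h4.pow_const 2).mul (h1.pow_const 2))).add
    ((h3.pow_const 2).div_const 2)).add ((h3.pow_const 4).div_const 4)).const_mul _

end Measurability

section DensityBounds

variable {K : ℝ} {c : ℝ → ℝ} (h : IsSpeed K c) (u : ℝ → ℝ → ℝ) (t x : ℝ)

lemma sq_le_energyDensity : |u t x| ^ 2 ≤ 4 * energyDensity c u t x := by
  rw [sq_abs, energyDensity]
  nlinarith [sq_nonneg (dt u t x), sq_nonneg (c (u t x) * dx u t x), sq_nonneg (u t x ^ 2)]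

lemma pow_four_le_energyDensity : |u t x| ^ 4 ≤ 8 * energyDensity c u t x := by
  rw [Even.pow_abs (by decide), energyDensity]
  nlinarith [sq_nonneg (dt u t x), sq_nonneg (c (u t x) * dx u t x), sq_nonneg (u t x)]

lemma dt_sq_le_energyDensity : |dt u t x| ^ 2 ≤ 2 * energyDensity c u t x := by
  rw [sq_abs, energyDensity]
  nlinarith [sq_nonneg (u t x), sq_nonneg (c (u t x) * dx u t x), sq_nonneg (u t x ^ 2)]

include h in
lemma dx_sq_le_energyDensity : |dx u t x| ^ 2 ≤ 2 * K ^ 2 * energyDensity c u t x := by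
  rw [sq_abs, energyDensity]
  have h1 : 1 ≤ K * c (u t x) := by
    have := (h.mem (u t x)).1
    calc (1:ℝ) = K * K⁻¹ := (mul_inv_cancel₀ h.K_pos.ne').symm
      _ ≤ _ := mul_le_mul_of_nonneg_left this h.K_pos.le
  have h2 : 1 * dx u t x ^ 2 ≤ (K * c (u t x)) ^ 2 * dx u t x ^ 2 :=
    mul_le_mul_of_nonneg_right (one_le_pow₀ h1) (sq_nonneg _)
  have h3 : 0 ≤ K ^ 2 * (dt u t x ^ 2 + u t x ^ 2 / 2 + u t x ^ 4 / 4) := by positivity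
  nlinarith

end DensityBounds

/-! ### The constructed function is a weak solution -/

namespace CharFlow

variable {K : ℝ} {c v₀ v₁ : ℝ → ℝ} (h : IsSpeed K c)
  (U : CharFlow c (initR c v₀ v₁) (initS c v₀ v₁) v₀) {u : ℝ → ℝ → ℝ}
  (hu : ∀ a b, u (U.t a b) (U.x a b) = U.v a b)
include h hu

lemma ae_differentiableAt (t : ℝ) :
    ∀ᵐ x : ℝ, DifferentiableAt ℝ (fun p : ℝ × ℝ => u p.1 p.2) (t, x) := by
  filter_upwards [ae_exists_nondegenerate h U t] with x hx
  obtain ⟨a, b, h1, h2, h3, h4⟩ := hx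
  rw [← h1, ← h2]
  exact (hasFDerivAt_solution h hu h3 h4).differentiableAt

lemma isWeakSolution (hd : AdmissibleData v₀ v₁) : IsWeakSolution c v₀ v₁ u := by
  have hI := hd.integrable_dataEnergy h
  have hcont := U.continuous_solution h hu
  have hen : ∀ t, ∫⁻ x, ENNReal.ofReal (energyDensity c u t x) ≤ ENNReal.ofReal
      (∫ y, dataEnergy (initR c v₀ v₁) (initS c v₀ v₁) v₀ y) := fun t => U.energy_le h hu hI t
  have hfin : ∀ t, ∫⁻ x, ENNReal.ofReal (energyDensity c u t x) < ⊤ := fun t =>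
    (hen t).trans_lt ENNReal.ofReal_lt_top
  have hfin2 : ∀ T, ∫⁻ p in strip T, ENNReal.ofReal (energyDensity c u p.1 p.2) < ⊤ := fun T => by
    have hm := (measurable_energyDensity hcont h).ennreal_ofReal
    rw [Measure.volume_eq_prod, strip, ← Measure.prod_restrict, Measure.restrict_univ,
      lintegral_prod _ hm.aemeasurable]
    calc _ ≤ ∫⁻ _ in Icc (-T) T, ENNReal.ofReal
          (∫ y, dataEnergy (initR c v₀ v₁) (initS c v₀ v₁) v₀ y) := lintegral_mono fun t => hen t
      _ < ⊤ := by
        rw [lintegral_const]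
        refine ENNReal.mul_lt_top ENNReal.ofReal_lt_top ?_
        rw [Measure.restrict_apply_univ]
        exact isCompact_Icc.measure_lt_top
  have mdt := measurable_dt hcont
  have mdx := measurable_dx hcont
  have sdt : ∀ t, Measurable (dt u t) := fun t => mdt.comp measurable_prodMk_left
  have sdx : ∀ t, Measurable (dx u t) := fun t => mdx.comp measurable_prodMk_left
  have su : ∀ t, Continuous (u t) := fun t => continuous_snd_slice hcont t
  have hK : 0 ≤ 2 * K ^ 2 := by positivity
  have cast4 : ((4 : ℕ) : ℝ≥0∞) = 4 := by norm_num
  have cast2 : ((2 : ℕ) : ℝ≥0∞) = 2 := by norm_num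
  -- The change of variables yields integrability of the sum only. The summand with the derivative
  -- of φ is continuous with compact support, which separates the two.
  have split : ∀ φ : ℝ → ℝ → ℝ, ContDiff ℝ 1 (fun p : ℝ × ℝ => φ p.1 p.2) →
      HasCompactSupport (fun p : ℝ × ℝ => φ p.1 p.2) →
      Integrable (fun p : ℝ × ℝ => u p.1 p.2 * dt φ p.1 p.2) ∧
      Integrable (fun p : ℝ × ℝ => u p.1 p.2 * dx φ p.1 p.2) := by
    intro φ hφ hφs
    have hk := (hφs.fderiv (𝕜 := ℝ)).isCompact
    have hz : ∀ p ∉ tsupport (fderiv ℝ fun p : ℝ × ℝ => φ p.1 p.2),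
        dt φ p.1 p.2 = 0 ∧ dx φ p.1 p.2 = 0 := by
      intro p hp
      have e := image_eq_zero_of_notMem_tsupport hp
      rw [(hasFDerivAt_of_contDiff hφ p.1 p.2).fderiv] at e
      have e1 := DFunLike.congr_fun e ((1, 0) : ℝ × ℝ)
      have e2 := DFunLike.congr_fun e ((0, 1) : ℝ × ℝ)
      simpa using And.intro e1 e2
    exact ⟨(hcont.mul (continuous_dt_of_contDiff hφ)).integrable_of_hasCompactSupport
        (HasCompactSupport.intro hk fun p hp => by
          change u p.1 p.2 * dt φ p.1 p.2 = 0
          rw [(hz p hp).1, mul_zero]),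
      (hcont.mul (continuous_dx_of_contDiff hφ)).integrable_of_hasCompactSupport
        (HasCompactSupport.intro hk fun p hp => by
          change u p.1 p.2 * dx φ p.1 p.2 = 0
          rw [(hz p hp).2, mul_zero])⟩
  refine
  { continuous := hcont
    memLp_two := fun T => ?_
    memLp_four := fun T => ?_
    memLp_dt := fun T => ?_
    memLp_dx := fun T => ?_
    weak_dt := fun φ hφ hφs => ?_
    weak_dx := fun φ hφ hφs => ?_
    slice_memH1 := fun t => ⟨?_, fun a b => U.absolutelyContinuous_slice h hu t a b, ?_⟩
    slice_memLp_four := fun t => ?_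
    slice_memLp_dt := fun t => ?_
    initial_value := fun x => ?_
    initial_velocity := fun x => ?_
    equation := fun φ hφ hφs => weak_equation h U hφ hφs hu }
  · rw [← cast2]
    exact memLp_of_pow_le two_ne_zero hcont.aestronglyMeasurable (hfin2 T) (by norm_num)
      fun p => sq_le_energyDensity u p.1 p.2
  · rw [← cast4]
    exact memLp_of_pow_le four_ne_zero hcont.aestronglyMeasurable (hfin2 T) (by norm_num)
      fun p => pow_four_le_energyDensity u p.1 p.2
  · rw [← cast2]
    exact memLp_of_pow_le two_ne_zero mdt.aestronglyMeasurable (hfin2 T) (by norm_num)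
      fun p => dt_sq_le_energyDensity u p.1 p.2
  · rw [← cast2]
    exact memLp_of_pow_le two_ne_zero mdx.aestronglyMeasurable (hfin2 T) hK
      fun p => dx_sq_le_energyDensity h u p.1 p.2
  · obtain ⟨i, z⟩ := weak_dt h U hφ hφs hu
    have i1 := (split φ hφ hφs).1
    have i2 : Integrable fun p : ℝ × ℝ => dt u p.1 p.2 * φ p.1 p.2 :=
      (i.sub i1).congr (Eventually.of_forall fun p => by simp)
    rw [integral_add i1 i2] at z
    linarith
  · obtain ⟨i, z⟩ := weak_dx h U hφ hφs hu
    have i1 := (split φ hφ hφs).2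
    have i2 : Integrable fun p : ℝ × ℝ => dx u p.1 p.2 * φ p.1 p.2 :=
      (i.sub i1).congr (Eventually.of_forall fun p => by simp)
    rw [integral_add i1 i2] at z
    linarith
  · rw [← cast2]
    exact memLp_of_pow_le two_ne_zero (su t).aestronglyMeasurable (hfin t) (by norm_num)
      fun x => sq_le_energyDensity u t x
  · rw [← cast2]
    exact memLp_of_pow_le two_ne_zero (sdx t).aestronglyMeasurable (hfin t) hK
      fun x => dx_sq_le_energyDensity h u t x
  · rw [← cast4]
    exact memLp_of_pow_le four_ne_zero (su t).aestronglyMeasurable (hfin t) (by norm_num)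
      fun x => pow_four_le_energyDensity u t x
  · rw [← cast2]
    exact memLp_of_pow_le two_ne_zero (sdt t).aestronglyMeasurable (hfin t) (by norm_num)
      fun x => dt_sq_le_energyDensity u t x
  · have := hu x x
    rwa [U.t_diag, U.x_diag, U.v_diag] at this
  -- On the diagonal m = m' = 1, so every point of the initial line is the image of a nondegenerate
  -- point, and the velocity (R + S)/2 = v₁ is attained everywhere and not just almost everywhere.
  · have := dt_solution h hu (a := x) (b := x) (by rw [U.m_diag]; exact one_pos)
      (by rw [U.m'_diag]; exact one_pos)
    rw [U.t_diag, U.x_diag, U.m_diag, U.m'_diag, U.l_diag, U.l'_diag] at this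
    refine this.congr_deriv ?_
    simp only [initR, initS]; ring

end CharFlow

/-! ### Lipschitz bounds and a Gronwall inequality on triangles -/

section RealAnalysis

/-- A `C¹` function is bounded and Lipschitz on bounded sets. -/
lemma exists_bound_lipschitz {g : ℝ → ℝ} (hg : ContDiff ℝ 1 g) (V : ℝ) :
    ∃ C, 0 ≤ C ∧ ∀ v w, |v| ≤ V → |w| ≤ V → |g v| ≤ C ∧ |g v - g w| ≤ C * |v - w| := by
  obtain ⟨C₁, h1⟩ := (isCompact_Icc (a := -V) (b := V)).exists_bound_of_continuousOn
    hg.continuous.continuousOn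
  obtain ⟨C₂, h2⟩ := (isCompact_Icc (a := -V) (b := V)).exists_bound_of_continuousOn
    (hg.continuous_deriv le_rfl).continuousOn
  refine ⟨max 0 (max C₁ C₂), le_max_left _ _, fun v w hv hw => ⟨?_, ?_⟩⟩
  · exact (h1 v (abs_le.1 hv)).trans ((le_max_left _ _).trans (le_max_right _ _))
  · have := (convex_Icc (-V) V).norm_image_sub_le_of_norm_deriv_le (C := max 0 (max C₁ C₂))
      (fun x _ => hg.differentiable one_ne_zero x)
      (fun x hx => (h2 x hx).trans ((le_max_right C₁ C₂).trans (le_max_right 0 _)))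
      (abs_le.1 hw) (abs_le.1 hv)
    simpa using this

/-- The telescoping keeps X from the first product and Y' from the second. Later X belongs to a flow
bounded in the supremum norm, and Y' to one bounded only by an integrable function. -/
lemma abs_mul_mul_sub_le {k k' X X' Y Y' B a b d p q : ℝ} (hk : |k| ≤ B) (hk' : |k'| ≤ B)
    (hkk : |k - k'| ≤ B * d) (hX : |X| ≤ p) (hY' : |Y'| ≤ q) (hXX : |X - X'| ≤ a)
    (hYY : |Y - Y'| ≤ b) :
    |k * (X * Y) - k' * (X' * Y')| ≤ B * (p * b + d * (p * q) + a * q) := by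
  have hB : 0 ≤ B := (abs_nonneg k).trans hk
  have hp : 0 ≤ p := (abs_nonneg X).trans hX
  have ha : 0 ≤ a := (abs_nonneg _).trans hXX
  have e : k * (X * Y) - k' * (X' * Y')
    = k * (X * (Y - Y')) + (k - k') * (X * Y') + k' * ((X - X') * Y') := by ring
  rw [e]
  refine (abs_add_three _ _ _).trans ?_
  simp only [abs_mul]
  have h1 : |k| * (|X| * |Y - Y'|) ≤ B * (p * b) := by gcongr
  have h2 : |k - k'| * (|X| * |Y'|) ≤ B * d * (p * q) :=
    mul_le_mul hkk (mul_le_mul hX hY' (abs_nonneg _) hp) (by positivity)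
      ((abs_nonneg _).trans hkk)
  have h3 : |k'| * (|X - X'| * |Y'|) ≤ B * (a * q) := by gcongr
  linarith

/-- A Gronwall inequality for a pair of functions on the triangle `-r ≤ β ≤ α ≤ r`. -/
lemma triangle_gronwall {y z : ℝ → ℝ → ℝ} {κ : ℝ → ℝ}
    (cy : Continuous fun P : ℝ × ℝ => y P.1 P.2) (cz : Continuous fun P : ℝ × ℝ => z P.1 P.2)
    (cκ : Continuous κ) (hκ : ∀ s, 0 ≤ κ s) {r J M ε : ℝ} (hM : 0 < M) (hε : 0 ≤ ε)
    (hJ : ∫ s in (-r)..r, κ s ≤ J)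
    (hz : ∀ a b, -r ≤ b → b ≤ a → a ≤ r → z a b ≤ M * (ε + ∫ ξ in b..a, y ξ b))
    (hy : ∀ a b, -r ≤ b → b ≤ a → a ≤ r → y a b ≤ M * (ε + ∫ η in b..a, κ η * z a η))
    {a b : ℝ} (hb : -r ≤ b) (hba : b ≤ a) (ha : a ≤ r) :
    y a b ≤ 2 * M * Real.exp (4 * M * (r + J)) * ε ∧
      z a b ≤ 2 * M * Real.exp (4 * M * (r + J)) * ε := by
  set k : ℝ → ℝ := fun s => ∫ η in (-r)..s, κ η with hk
  have dk : ∀ s, HasDerivAt k (κ s) s := fun s => (cκ.integral_hasStrictDerivAt (-r) s).hasDerivAt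
  have ck : Continuous k := continuous_iff_continuousAt.2 fun s => (dk s).continuousAt
  have hkb : ∀ s, -r ≤ s → s ≤ r → 0 ≤ k s ∧ k s ≤ J := fun s hs1 hs2 =>
    ⟨intervalIntegral.integral_nonneg hs1 fun η _ => hκ η, by
      have h2 : 0 ≤ ∫ η in s..r, κ η := intervalIntegral.integral_nonneg hs2 fun η _ => hκ η
      have := intervalIntegral.integral_add_adjacent_intervals
        (cκ.intervalIntegrable (μ := volume) (-r) s) (cκ.intervalIntegrable s r)
      simp only [hk]; linarith⟩
  set L := 2 * M with hL
  have hLne : L ≠ 0 := by rw [hL]; positivity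
  -- With k a primitive of κ, the weight exp(L(α - k(β))) makes either integration gain 1/L =
  -- 1/(2M). At the maximum of the weighted functions the integral terms are thus at most half of
  -- the left-hand side and are absorbed.
  set wt : ℝ → ℝ → ℝ := fun a b => L * (a - k b) with hwt
  have cwt : Continuous fun P : ℝ × ℝ => wt P.1 P.2 := by simp only [hwt]; fun_prop
  set T : Set (ℝ × ℝ) := {P | -r ≤ P.2 ∧ P.2 ≤ P.1 ∧ P.1 ≤ r} with hT
  have hTc : IsCompact T := by
    refine (isCompact_Icc (a := ((-r, -r) : ℝ × ℝ)) (b := (r, r))).of_isClosed_subset ?_ ?_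
    · exact (isClosed_le continuous_const continuous_snd).inter
        ((isClosed_le continuous_snd continuous_fst).inter
          (isClosed_le continuous_fst continuous_const))
    · rintro ⟨a, b⟩ ⟨h1, h2, h3⟩
      exact ⟨⟨h1.trans h2, h1⟩, ⟨h3, h2.trans h3⟩⟩
  have cg : Continuous fun P : ℝ × ℝ => max (y P.1 P.2) (z P.1 P.2) * Real.exp (-wt P.1 P.2) :=
    (cy.max cz).mul (Real.continuous_exp.comp cwt.neg)
  obtain ⟨⟨a₀, b₀⟩, ⟨hb₀, hba₀, ha₀⟩, hmax⟩ := hTc.exists_isMaxOn ⟨(a, b), hb, hba, ha⟩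
    cg.continuousOn
  simp only at hb₀ hba₀ ha₀
  set m := max (y a₀ b₀) (z a₀ b₀) * Real.exp (-wt a₀ b₀) with hm
  have hle : ∀ a b, -r ≤ b → b ≤ a → a ≤ r → max (y a b) (z a b) ≤ m * Real.exp (wt a b) := by
    intro a b h1 h2 h3
    have h4 : max (y a b) (z a b) * Real.exp (-wt a b) ≤ m :=
      isMaxOn_iff.1 hmax (a, b) ⟨h1, h2, h3⟩
    calc max (y a b) (z a b) = max (y a b) (z a b) * Real.exp (-wt a b) * Real.exp (wt a b) := by
          rw [mul_assoc, ← Real.exp_add]; simp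
      _ ≤ _ := mul_le_mul_of_nonneg_right h4 (Real.exp_pos _).le
  have hexp : ∀ a b, -r ≤ b → b ≤ a → a ≤ r →
      Real.exp (wt a b) ≤ Real.exp (L * (r + J)) ∧ Real.exp (-wt a b) ≤ Real.exp (L * (r + J)) := by
    intro a b h1 h2 h3
    have h4 := hkb b h1 (h2.trans h3)
    have hL0 : 0 ≤ L := by positivity
    constructor <;> apply Real.exp_le_exp.2
    · exact mul_le_mul_of_nonneg_left (by linarith [h4.1, h4.2]) hL0
    · rw [hwt, ← mul_neg]
      exact mul_le_mul_of_nonneg_left (by linarith [h4.1, h4.2]) hL0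
  have hmε : m ≤ 2 * M * ε * Real.exp (L * (r + J)) := by
    by_cases hm0 : m ≤ 0
    · exact hm0.trans (by positivity)
    rw [not_le] at hm0
    have hzb : z a₀ b₀ ≤ M * ε + m * Real.exp (wt a₀ b₀) / 2 := by
      have i1 : ∫ ξ in b₀..a₀, y ξ b₀ ≤ ∫ ξ in b₀..a₀, m * Real.exp (wt ξ b₀) :=
        intervalIntegral.integral_mono_on hba₀
          ((continuous_fst_slice cy b₀).intervalIntegrable _ _)
          (Continuous.intervalIntegrable (by
            have := continuous_fst_slice cwt b₀; fun_prop) _ _)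
          fun ξ hξ => (le_max_left _ _).trans (hle ξ b₀ hb₀ hξ.1 (hξ.2.trans ha₀))
      have i2 : ∫ ξ in b₀..a₀, m * Real.exp (wt ξ b₀)
          = m * Real.exp (wt a₀ b₀) / L - m * Real.exp (wt b₀ b₀) / L := by
        refine integral_eq_sub_of_continuous_deriv
          (f := fun ξ => m * Real.exp (wt ξ b₀) / L) (fun ξ => ?_) (by
            have := continuous_fst_slice cwt b₀; fun_prop) b₀ a₀
        have d1 : HasDerivAt (fun ξ => wt ξ b₀) (L * 1) ξ :=
          ((hasDerivAt_id ξ).sub_const _).const_mul L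
        refine ((d1.exp.const_mul m).div_const L).congr_deriv ?_
        field_simp
      have i3 : 0 ≤ m * Real.exp (wt b₀ b₀) / L := by positivity
      calc z a₀ b₀ ≤ M * (ε + ∫ ξ in b₀..a₀, y ξ b₀) := hz a₀ b₀ hb₀ hba₀ ha₀
        _ ≤ M * (ε + m * Real.exp (wt a₀ b₀) / L) := by gcongr; linarith
        _ = _ := by rw [hL]; field_simp
    have hyb : y a₀ b₀ ≤ M * ε + m * Real.exp (wt a₀ b₀) / 2 := by
      have cwt' := continuous_snd_slice cwt a₀
      have i1 : ∫ η in b₀..a₀, κ η * z a₀ η ≤ ∫ η in b₀..a₀, κ η * (m * Real.exp (wt a₀ η)) :=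
        intervalIntegral.integral_mono_on hba₀
          ((cκ.mul (continuous_snd_slice cz a₀)).intervalIntegrable _ _)
          (Continuous.intervalIntegrable (by fun_prop) _ _)
          fun η hη => mul_le_mul_of_nonneg_left ((le_max_right _ _).trans
            (hle a₀ η (hb₀.trans hη.1) hη.2 ha₀)) (hκ η)
      have i2 : ∫ η in b₀..a₀, κ η * (m * Real.exp (wt a₀ η))
          = -(m * Real.exp (wt a₀ a₀) / L) - -(m * Real.exp (wt a₀ b₀) / L) := by
        refine integral_eq_sub_of_continuous_deriv
          (f := fun η => -(m * Real.exp (wt a₀ η) / L)) (fun η => ?_) (by fun_prop) b₀ a₀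
        have d1 : HasDerivAt (fun η => wt a₀ η) (L * (-κ η)) η :=
          ((dk η).const_sub _).const_mul L
        refine ((d1.exp.const_mul m).div_const L).neg.congr_deriv ?_
        field_simp
      have i3 : 0 ≤ m * Real.exp (wt a₀ a₀) / L := by positivity
      calc y a₀ b₀ ≤ M * (ε + ∫ η in b₀..a₀, κ η * z a₀ η) := hy a₀ b₀ hb₀ hba₀ ha₀
        _ ≤ M * (ε + m * Real.exp (wt a₀ b₀) / L) := by gcongr; linarith
        _ = _ := by rw [hL]; field_simp
    have hfin : m * Real.exp (wt a₀ b₀) ≤ M * ε + m * Real.exp (wt a₀ b₀) / 2 := by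
      have e : m * Real.exp (wt a₀ b₀) = max (y a₀ b₀) (z a₀ b₀) := by
        rw [hm, mul_assoc, ← Real.exp_add]; simp
      conv_lhs => rw [e]
      exact max_le hyb hzb
    have h5 : m * Real.exp (wt a₀ b₀) ≤ 2 * M * ε := by linarith
    calc m = m * Real.exp (wt a₀ b₀) * Real.exp (-wt a₀ b₀) := by
          rw [mul_assoc, ← Real.exp_add]; simp
      _ ≤ 2 * M * ε * Real.exp (L * (r + J)) :=
          mul_le_mul h5 (hexp a₀ b₀ hb₀ hba₀ ha₀).2 (Real.exp_pos _).le (by positivity)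
  have hfinal : max (y a b) (z a b) ≤ 2 * M * Real.exp (4 * M * (r + J)) * ε := by
    calc max (y a b) (z a b) ≤ m * Real.exp (wt a b) := hle a b hb hba ha
      _ ≤ (2 * M * ε * Real.exp (L * (r + J))) * Real.exp (wt a b) :=
          mul_le_mul_of_nonneg_right hmε (Real.exp_pos _).le
      _ ≤ (2 * M * ε * Real.exp (L * (r + J))) * Real.exp (L * (r + J)) :=
          mul_le_mul_of_nonneg_left (hexp a b hb hba ha).1 (by positivity)
      _ = _ := by rw [mul_assoc, ← Real.exp_add, hL]; ring_nf
  exact ⟨(le_max_left _ _).trans hfinal, (le_max_right _ _).trans hfinal⟩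

end RealAnalysis

/-! ### Bounds for the coefficients -/

/-- A primitive of the wave speed. -/
noncomputable def speedPrimitive (c : ℝ → ℝ) (v : ℝ) : ℝ := ∫ s in (0:ℝ)..v, c s

namespace IsSpeed

variable {K : ℝ} {c : ℝ → ℝ} (h : IsSpeed K c)
include h

lemma hasDerivAt_speedPrimitive (v : ℝ) : HasDerivAt (speedPrimitive c) (c v) v :=
  (h.continuous.integral_hasStrictDerivAt 0 v).hasDerivAt

lemma abs_sub_le_speedPrimitive (v w : ℝ) :
    |v - w| ≤ K * |speedPrimitive c v - speedPrimitive c w| := by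
  have key : ∀ v w, w ≤ v → |v - w| ≤ K * |speedPrimitive c v - speedPrimitive c w| := by
    intro v w hwv
    have hm : Monotone fun s => K * speedPrimitive c s - s :=
      monotone_of_hasDerivAt_nonneg
        (fun s => ((h.hasDerivAt_speedPrimitive s).const_mul K).sub (hasDerivAt_id s)) fun s => by
        have := mul_le_mul_of_nonneg_left (h.mem s).1 h.K_pos.le
        rw [mul_inv_cancel₀ h.K_pos.ne'] at this
        exact sub_nonneg.2 this
    have h1 := hm hwv
    simp only at h1
    rw [abs_of_nonneg (sub_nonneg.2 hwv)]
    calc v - w ≤ K * (speedPrimitive c v - speedPrimitive c w) := by linarith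
      _ ≤ _ := mul_le_mul_of_nonneg_left (le_abs_self _) h.K_pos.le
  rcases le_total w v with hwv | hwv
  · exact key v w hwv
  · rw [abs_sub_comm, abs_sub_comm (speedPrimitive c v)]
    exact key w v hwv

lemma speedPrimitive_sub_le (v w : ℝ) :
    |speedPrimitive c v - speedPrimitive c w| ≤ K * |v - w| := by
  have := (convex_univ (𝕜 := ℝ) (E := ℝ)).norm_image_sub_le_of_norm_hasDerivWithin_le
    (f := speedPrimitive c) (f' := c) (C := K) (x := w) (y := v)
    (fun x _ => (h.hasDerivAt_speedPrimitive x).hasDerivWithinAt)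
    (fun x _ => by rw [Real.norm_eq_abs, abs_of_pos (h.pos x)]; exact h.le x)
    (mem_univ _) (mem_univ _)
  simpa using this

lemma contDiff_coeff₁ : ContDiff ℝ 1 fun v => deriv c v / (8 * c v ^ 2) := by
  have h1 : ContDiff ℝ 1 c := h.smooth.of_le (by simp)
  have h2 : ContDiff ℝ 1 (deriv c) :=
    (contDiff_infty_iff_deriv.1 h.smooth).2.of_le (by simp)
  exact h2.div (contDiff_const.mul (h1.pow 2)) fun v => by
    have := h.pos v; positivity

lemma contDiff_coeff₂ : ContDiff ℝ 1 fun v => (v + v ^ 3) / (4 * c v) := by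
  have h1 : ContDiff ℝ 1 c := h.smooth.of_le (by simp)
  exact (contDiff_id.add (contDiff_id.pow 3)).div (contDiff_const.mul h1) fun v => by
    have := h.pos v; positivity

lemma contDiff_coeff₃ : ContDiff ℝ 1 fun v => 1 / (2 * c v) := by
  have h1 : ContDiff ℝ 1 c := h.smooth.of_le (by simp)
  exact contDiff_const.div (contDiff_const.mul h1) fun v => by
    have := h.pos v; positivity

/-- A common bound and Lipschitz constant for the coefficients of the system. -/
lemma exists_coeff_bound (V : ℝ) : ∃ B, 0 < B ∧ ∀ v w, |v| ≤ V → |w| ≤ V →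
    (|deriv c v / (8 * c v ^ 2)| ≤ B ∧
      |deriv c v / (8 * c v ^ 2) - deriv c w / (8 * c w ^ 2)| ≤ B * |v - w|) ∧
    (|(v + v ^ 3) / (4 * c v)| ≤ B ∧
      |(v + v ^ 3) / (4 * c v) - (w + w ^ 3) / (4 * c w)| ≤ B * |v - w|) ∧
    |1 / (2 * c v) - 1 / (2 * c w)| ≤ B * |v - w| := by
  obtain ⟨B₁, p1, h1⟩ := exists_bound_lipschitz h.contDiff_coeff₁ V
  obtain ⟨B₂, p2, h2⟩ := exists_bound_lipschitz h.contDiff_coeff₂ V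
  obtain ⟨B₃, p3, h3⟩ := exists_bound_lipschitz h.contDiff_coeff₃ V
  refine ⟨B₁ + B₂ + B₃ + 1, by positivity, fun v w hv hw => ?_⟩
  obtain ⟨a1, b1⟩ := h1 v w hv hw
  obtain ⟨a2, b2⟩ := h2 v w hv hw
  obtain ⟨-, b3⟩ := h3 v w hv hw
  have k := abs_nonneg (v - w)
  exact ⟨⟨by linarith, b1.trans (by gcongr; linarith)⟩,
    ⟨by linarith, b2.trans (by gcongr; linarith)⟩, b3.trans (by gcongr; linarith)⟩

end IsSpeed

section RealAnalysis

lemma abs_sub_le_integral {f f' g : ℝ → ℝ} (hf : ∀ x, HasDerivAt f (f' x) x) (hg : Continuous g)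
    {a b : ℝ} (hab : a ≤ b) (h : ∀ x ∈ Icc a b, |f' x| ≤ g x) :
    |f b - f a| ≤ ∫ x in a..b, g x := by
  set G : ℝ → ℝ := fun x => ∫ s in a..x, g s with hG
  have dG : ∀ x, HasDerivAt G (g x) x := fun x => (hg.integral_hasStrictDerivAt a x).hasDerivAt
  have h1 : MonotoneOn (fun x => G x - f x) (Icc a b) := by
    refine monotoneOn_of_deriv_nonneg (convex_Icc a b)
      (fun x _ => ((dG x).sub (hf x)).continuousAt.continuousWithinAt)
      (fun x _ => ((dG x).sub (hf x)).differentiableAt.differentiableWithinAt) fun x hx => ?_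
    have e : deriv (fun x => G x - f x) x = g x - f' x := ((dG x).sub (hf x)).deriv
    rw [e]
    exact sub_nonneg.2 (le_of_abs_le (h x (interior_subset hx)))
  have h2 : MonotoneOn (fun x => G x + f x) (Icc a b) := by
    refine monotoneOn_of_deriv_nonneg (convex_Icc a b)
      (fun x _ => ((dG x).add (hf x)).continuousAt.continuousWithinAt)
      (fun x _ => ((dG x).add (hf x)).differentiableAt.differentiableWithinAt) fun x hx => ?_
    have e : deriv (fun x => G x + f x) x = g x + f' x := ((dG x).add (hf x)).deriv
    rw [e]
    linarith [neg_le_of_abs_le (h x (interior_subset hx))]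
  have h3 := h1 (left_mem_Icc.2 hab) (right_mem_Icc.2 hab) hab
  have h4 := h2 (left_mem_Icc.2 hab) (right_mem_Icc.2 hab) hab
  have h5 : G a = 0 := by simp [hG]
  simp only [h5] at h3 h4
  exact abs_le.2 ⟨by linarith, by linarith⟩

end RealAnalysis

/-- Differences of the nonlinearities of the system. -/
lemma flow_coeff_sub_le {c : ℝ → ℝ} {v w m l n m' l' n' M L N M' L' N' B a b d p q : ℝ}
    (k1 : |deriv c v / (8 * c v ^ 2)| ≤ B) (k1' : |deriv c w / (8 * c w ^ 2)| ≤ B)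
    (k1d : |deriv c v / (8 * c v ^ 2) - deriv c w / (8 * c w ^ 2)| ≤ B * d)
    (k2 : |(v + v ^ 3) / (4 * c v)| ≤ B) (k2' : |(w + w ^ 3) / (4 * c w)| ≤ B)
    (k2d : |(v + v ^ 3) / (4 * c v) - (w + w ^ 3) / (4 * c w)| ≤ B * d)
    (pm : |m| ≤ p) (pl : |l| ≤ p) (pn : |n| ≤ p)
    (qm : |M'| ≤ q) (ql : |L'| ≤ q) (qn : |N'| ≤ q)
    (am : |m - M| ≤ a) (al : |l - L| ≤ a) (an : |n - N| ≤ a)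
    (bm : |m' - M'| ≤ b) (bl : |l' - L'| ≤ b) (bn : |n' - N'| ≤ b) :
    |flowΩ c v m l m' l' - flowΩ c w M L M' L'| ≤ 6 * B * (p * b + d * (p * q) + a * q) ∧
    |flowΛ c v m l n m' l' n' - flowΛ c w M L N M' L' N'|
      ≤ 6 * B * (p * b + d * (p * q) + a * q) ∧
    |flowN c v l n l' n' + (v + v ^ 3) / (2 * c v) * (l * m')
      - (flowN c w L N L' N' + (w + w ^ 3) / (2 * c w) * (L * M'))|
      ≤ 6 * B * (p * b + d * (p * q) + a * q) ∧
    |flowN c v l n l' n' - (v + v ^ 3) / (2 * c v) * (l' * m)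
      - (flowN c w L N L' N' - (w + w ^ 3) / (2 * c w) * (L' * M))|
      ≤ 6 * B * (p * b + d * (p * q) + a * q) := by
  set k := deriv c v / (8 * c v ^ 2) with hk
  set k' := deriv c w / (8 * c w ^ 2) with hk'
  set f := (v + v ^ 3) / (4 * c v) with hf
  set f' := (w + w ^ 3) / (4 * c w) with hf'
  have e1 : deriv c v / (4 * c v ^ 2) = 2 * k := by rw [hk]; ring
  have e1' : deriv c w / (4 * c w ^ 2) = 2 * k' := by rw [hk']; ring
  have e2 : (v + v ^ 3) / (2 * c v) = 2 * f := by rw [hf]; ring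
  have e2' : (w + w ^ 3) / (2 * c w) = 2 * f' := by rw [hf']; ring
  set T := p * b + d * (p * q) + a * q with hT
  have t1 := abs_le.1 (abs_mul_mul_sub_le k1 k1' k1d pl qm al bm)
  have t2 := abs_le.1 (abs_mul_mul_sub_le k1 k1' k1d pm ql am bl)
  have t3 := abs_le.1 (abs_mul_mul_sub_le k1 k1' k1d pl ql al bl)
  have t4 := abs_le.1 (abs_mul_mul_sub_le k1 k1' k1d pm qn am bn)
  have t5 := abs_le.1 (abs_mul_mul_sub_le k1 k1' k1d pn qm an bm)
  have t6 := abs_le.1 (abs_mul_mul_sub_le k2 k2' k2d pm qm am bm)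
  have t7 := abs_le.1 (abs_mul_mul_sub_le k1 k1' k1d pl qn al bn)
  have t8 := abs_le.1 (abs_mul_mul_sub_le k1 k1' k1d pn ql an bl)
  have t9 := abs_le.1 (abs_mul_mul_sub_le k2 k2' k2d pl qm al bm)
  have t10 := abs_le.1 (abs_mul_mul_sub_le k2 k2' k2d pm ql am bl)
  rw [← hT] at t1 t2 t3 t4 t5 t6 t7 t8 t9 t10
  have hB : 0 ≤ B := (abs_nonneg _).trans k1
  simp only [flowΩ, flowΛ, flowN, e1, e1', e2, e2', ← hk, ← hk', ← hf, ← hf']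
  refine ⟨abs_le.2 ⟨?_, ?_⟩, abs_le.2 ⟨?_, ?_⟩, abs_le.2 ⟨?_, ?_⟩, abs_le.2 ⟨?_, ?_⟩⟩ <;>
    linarith [t1.1, t1.2, t2.1, t2.2, t3.1, t3.2, t4.1, t4.2, t5.1, t5.2, t6.1, t6.2, t7.1, t7.2,
      t8.1, t8.2, t9.1, t9.2, t10.1, t10.2]

/-! ### A priori bounds for one flow on a triangle -/

namespace CharFlow

variable {K : ℝ} {c R S v₀ : ℝ → ℝ} (h : IsSpeed K c) (U : CharFlow c R S v₀)

lemma two_abs_l_le (a b : ℝ) : 2 * |U.l a b| ≤ U.m a b + U.n a b := by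
  have h1 : |2 * U.l a b| ≤ U.m a b + U.n a b := by
    refine abs_le_of_sq_le_sq ?_ (U.pos a b).le
    nlinarith [U.l_sq a b, sq_nonneg (U.m a b - U.n a b)]
  rwa [abs_mul, abs_two] at h1

lemma two_abs_l'_le (a b : ℝ) : 2 * |U.l' a b| ≤ U.m' a b + U.n' a b := by
  have h1 : |2 * U.l' a b| ≤ U.m' a b + U.n' a b := by
    refine abs_le_of_sq_le_sq ?_ (U.pos' a b).le
    nlinarith [U.l'_sq a b, sq_nonneg (U.m' a b - U.n' a b)]
  rwa [abs_mul, abs_two] at h1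

/-- A bound for the integrals of `m + n` and `m' + n'` along characteristics. -/
noncomputable def legBound (R S v₀ : ℝ → ℝ) (r : ℝ) : ℝ :=
  (∫ y in (-r)..r, (R y ^ 2 + S y ^ 2 + 2 * potentialF (v₀ y))) + 4 * r

lemma cont_p_slice (b : ℝ) : Continuous fun ξ => U.m ξ b + U.n ξ b :=
  (continuous_fst_slice U.cont_m b).add (continuous_fst_slice U.cont_n b)

lemma cont_q_slice (b : ℝ) : Continuous fun ξ => U.m' ξ b + U.n' ξ b :=
  (continuous_fst_slice U.cont_m' b).add (continuous_fst_slice U.cont_n' b)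

include h

/-- The integrand is at most the derivative of E + 2x along the leg. Both functions are monotone in
each coordinate, so the increment is at most that from (-r, -r) to (r, r), where x contributes 2 ·
2r. -/
lemma leg_left_le {r a b : ℝ} (hb : -r ≤ b) (hba : b ≤ a) (ha : a ≤ r) :
    ∫ ξ in b..a, (U.m ξ b + U.n ξ b) ≤ legBound R S v₀ r := by
  obtain ⟨E, hE⟩ := U.exists_isEnergy h
  have cN := continuous_fst_slice (f := fun a b => U.n a b + potentialF (U.v a b) * U.m a b) U.cont_N b
  have cm := continuous_fst_slice U.cont_m b
  have i1 : ∫ ξ in b..a, (U.m ξ b + U.n ξ b)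
      ≤ ∫ ξ in b..a, ((U.n ξ b + potentialF (U.v ξ b) * U.m ξ b) + 2 * (U.m ξ b / 2)) :=
    intervalIntegral.integral_mono_on hba ((U.cont_p_slice b).intervalIntegrable _ _)
      (Continuous.intervalIntegrable (by fun_prop) _ _) fun ξ _ => by
        have := mul_nonneg (potentialF_nonneg (U.v ξ b)) (U.m_nonneg ξ b)
        linarith
  rw [integral_eq_sub_of_continuous_deriv (f := fun ξ => E ξ b + 2 * U.x ξ b)
    (fun ξ => (hE.hasDerivAt_left ξ b).add ((U.x_a ξ b).const_mul 2)) (by fun_prop)] at i1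
  have h1 := hE.mono ha (hba.trans ha)
  have h2 := hE.mono hb hb
  have h3 := U.x_mono ha (hba.trans ha)
  have h4 := U.x_mono hb hb
  have h5 := hE.diag_sub (-r) r
  rw [U.x_diag] at h3 h4
  rw [legBound, ← h5]
  linarith

lemma abs_v_le {r a b V : ℝ} (hb : -r ≤ b) (hba : b ≤ a) (ha : a ≤ r)
    (hV : ∀ s ∈ Icc (-r) r, |v₀ s| ≤ V) : |U.v a b| ≤ V + K * legBound R S v₀ r := by
  have h1 := abs_sub_le_integral (fun ξ => U.v_a ξ b)
    ((U.cont_p_slice b).const_mul K) hba (fun ξ _ => by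
      rw [abs_div, abs_of_pos (mul_pos two_pos (h.pos _)), div_eq_mul_inv, mul_inv]
      have h2 := U.two_abs_l_le ξ b
      have h3 := h.inv_le (U.v ξ b)
      have h4 : 0 ≤ (c (U.v ξ b))⁻¹ := (inv_pos.2 (h.pos _)).le
      have h5 := mul_le_mul (show |U.l ξ b| ≤ U.m ξ b + U.n ξ b by
        linarith [abs_nonneg (U.l ξ b)]) h3 h4 (U.pos ξ b).le
      have h6 := mul_nonneg (abs_nonneg (U.l ξ b)) h4
      linarith)
  rw [intervalIntegral.integral_const_mul] at h1
  have h2 := mul_le_mul_of_nonneg_left (U.leg_left_le h hb hba ha) h.K_pos.le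
  have h3 := hV b ⟨hb, hba.trans ha⟩
  rw [U.v_diag] at h1
  have h4 := abs_sub_abs_le_abs_sub (U.v a b) (v₀ b)
  linarith

/-- The growth of `m' + n'` along characteristics. -/
lemma q_le {r a b V B : ℝ} (hb : -r ≤ b) (hba : b ≤ a) (ha : a ≤ r)
    (hV : ∀ a b, -r ≤ b → b ≤ a → a ≤ r → |U.v a b| ≤ V)
    (hB : ∀ v, |v| ≤ V → |deriv c v / (8 * c v ^ 2)| ≤ B ∧ |(v + v ^ 3) / (4 * c v)| ≤ B) :
    U.m' a b + U.n' a b ≤ (1 + S b ^ 2) * Real.exp (5 * B * legBound R S v₀ r) := by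
  have cp := U.cont_p_slice b
  have cq := U.cont_q_slice b
  have hB0 : 0 ≤ B := (abs_nonneg _).trans (hB _ (hV a b hb hba ha)).1
  have hder : ∀ ξ, b ≤ ξ → ξ ≤ r →
      |flowΩ c (U.v ξ b) (U.m ξ b) (U.l ξ b) (U.m' ξ b) (U.l' ξ b)
        + (flowN c (U.v ξ b) (U.l ξ b) (U.n ξ b) (U.l' ξ b) (U.n' ξ b)
        - (U.v ξ b + U.v ξ b ^ 3) / (2 * c (U.v ξ b)) * (U.l' ξ b * U.m ξ b))|
      ≤ 5 * B * (U.m ξ b + U.n ξ b) * (U.m' ξ b + U.n' ξ b) := by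
    intro ξ h1 h2
    obtain ⟨k1, k2⟩ := hB _ (hV ξ b hb h1 h2)
    set k := deriv c (U.v ξ b) / (8 * c (U.v ξ b) ^ 2) with hk
    set f := (U.v ξ b + U.v ξ b ^ 3) / (4 * c (U.v ξ b)) with hf
    have e1 : deriv c (U.v ξ b) / (4 * c (U.v ξ b) ^ 2) = 2 * k := by rw [hk]; ring
    have e2 : (U.v ξ b + U.v ξ b ^ 3) / (2 * c (U.v ξ b)) = 2 * f := by rw [hf]; ring
    set p := U.m ξ b + U.n ξ b with hp
    set q := U.m' ξ b + U.n' ξ b with hq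
    have p0 : 0 ≤ p := (U.pos ξ b).le
    have q0 : 0 ≤ q := (U.pos' ξ b).le
    have e : flowΩ c (U.v ξ b) (U.m ξ b) (U.l ξ b) (U.m' ξ b) (U.l' ξ b)
        + (flowN c (U.v ξ b) (U.l ξ b) (U.n ξ b) (U.l' ξ b) (U.n' ξ b)
        - (U.v ξ b + U.v ξ b ^ 3) / (2 * c (U.v ξ b)) * (U.l' ξ b * U.m ξ b))
        = k * (2 * U.l ξ b * q) - k * (p * (2 * U.l' ξ b)) - f * (2 * U.l' ξ b * U.m ξ b) := by
      simp only [flowΩ, flowN, e1, e2, hp, hq]; ring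
    have l1 : |2 * U.l ξ b| ≤ p := by rw [abs_mul, abs_two]; exact U.two_abs_l_le ξ b
    have l2 : |2 * U.l' ξ b| ≤ q := by rw [abs_mul, abs_two]; exact U.two_abs_l'_le ξ b
    have mp : |U.m ξ b| ≤ p := by
      rw [abs_of_nonneg (U.m_nonneg ξ b)]; linarith [U.n_nonneg ξ b]
    -- Each of the three terms is at most B p q; the constant 5 leaves room.
    have a1 : |k * (2 * U.l ξ b * q)| ≤ B * (p * q) := by
      rw [abs_mul, abs_mul _ q, abs_of_nonneg q0]; gcongr
    have a2 : |k * (p * (2 * U.l' ξ b))| ≤ B * (p * q) := by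
      rw [abs_mul, abs_mul p, abs_of_nonneg p0]; gcongr
    have a3 : |f * (2 * U.l' ξ b * U.m ξ b)| ≤ B * (q * p) := by
      rw [abs_mul, abs_mul _ (U.m ξ b)]; gcongr
    rw [e]
    have := abs_sub (k * (2 * U.l ξ b * q) - k * (p * (2 * U.l' ξ b))) (f * (2 * U.l' ξ b * U.m ξ b))
    have := abs_sub (k * (2 * U.l ξ b * q)) (k * (p * (2 * U.l' ξ b)))
    have : 0 ≤ B * (p * q) := by positivity
    nlinarith
  have key := le_mul_exp_of_le_integral cq (k := fun ξ => 5 * B * (U.m ξ b + U.n ξ b))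
    (h := fun _ => 0) (A := 1 + S b ^ 2) (by fun_prop) continuous_const hba
    (fun ξ _ => mul_nonneg (by positivity) (U.pos ξ b).le) (fun _ _ => le_rfl) (fun x hx => by
      have := abs_sub_le_integral (fun ξ => (U.m'_a ξ b).add (U.n'_a ξ b))
        (g := fun ξ => 5 * B * (U.m ξ b + U.n ξ b) * (U.m' ξ b + U.n' ξ b) + 0)
        (by fun_prop) hx.1
        fun ξ hξ => (hder ξ hξ.1 (hξ.2.trans (hx.2.trans ha))).trans (by simp)
      have h2 := le_of_abs_le this
      simp only [Pi.add_apply, U.m'_diag, U.n'_diag] at h2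
      linarith)
  refine key.trans ?_
  rw [intervalIntegral.integral_zero, add_zero, intervalIntegral.integral_const_mul]
  gcongr
  exact U.leg_left_le h hb hba ha

end CharFlow

section RealAnalysis

lemma continuous_integral_fst {f : ℝ → ℝ → ℝ} (hf : Continuous fun P : ℝ × ℝ => f P.1 P.2) :
    Continuous fun P : ℝ × ℝ => ∫ ξ in P.2..P.1, f ξ P.2 := by
  have cf : Continuous (Function.uncurry fun (b ξ : ℝ) => f ξ b) := hf.comp continuous_swap
  have h1 : Continuous fun P : ℝ × ℝ => ∫ ξ in (0:ℝ)..P.1, f ξ P.2 :=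
    (intervalIntegral.continuous_parametric_primitive_of_continuous (μ := volume) (a₀ := (0:ℝ))
      cf).comp continuous_swap
  have h2 : Continuous fun P : ℝ × ℝ => ∫ ξ in (0:ℝ)..P.2, f ξ P.2 :=
    h1.comp (continuous_snd.prodMk continuous_snd)
  refine (h1.sub h2).congr fun P => ?_
  have c1 := continuous_fst_slice hf P.2
  exact intervalIntegral.integral_interval_sub_left (c1.intervalIntegrable _ _)
    (c1.intervalIntegrable _ _)

lemma continuous_integral_snd {f : ℝ → ℝ → ℝ} (hf : Continuous fun P : ℝ × ℝ => f P.1 P.2) :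
    Continuous fun P : ℝ × ℝ => ∫ η in P.2..P.1, f P.1 η := by
  have h1 := (continuous_integral_fst (f := fun x y => f y x) (hf.comp continuous_swap)).comp
    continuous_swap
  refine h1.neg.congr fun P => ?_
  exact (intervalIntegral.integral_symm _ _).symm

lemma integral_subinterval_le {f : ℝ → ℝ} (hf : Continuous f) (h0 : ∀ x, 0 ≤ f x) {a b c d : ℝ}
    (hca : c ≤ a) (hab : a ≤ b) (hbd : b ≤ d) : ∫ x in a..b, f x ≤ ∫ x in c..d, f x :=
  intervalIntegral.integral_mono_interval hca hab hbd (Eventually.of_forall h0)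
    (hf.intervalIntegrable _ _)

end RealAnalysis

/-! ### Differences of two flows -/

namespace CharFlow

variable {K : ℝ} {c R S v₀ R' S' v₀' : ℝ → ℝ}

/-- Distance between the first families of unknowns of two flows. -/
noncomputable def distL (U : CharFlow c R S v₀) (W : CharFlow c R' S' v₀') (a b : ℝ) : ℝ :=
  |U.m a b - W.m a b| + |U.l a b - W.l a b| + |U.n a b - W.n a b|

/-- Distance between the second families of unknowns of two flows. -/
noncomputable def distR (U : CharFlow c R S v₀) (W : CharFlow c R' S' v₀') (a b : ℝ) : ℝ :=
  |U.m' a b - W.m' a b| + |U.l' a b - W.l' a b| + |U.n' a b - W.n' a b|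

variable (U : CharFlow c R S v₀) (W : CharFlow c R' S' v₀')

lemma distL_nonneg (a b : ℝ) : 0 ≤ distL U W a b := by unfold distL; positivity
lemma distR_nonneg (a b : ℝ) : 0 ≤ distR U W a b := by unfold distR; positivity

lemma cont_distL : Continuous fun P : ℝ × ℝ => distL U W P.1 P.2 :=
  (((U.cont_m.sub W.cont_m).abs.add (U.cont_l.sub W.cont_l).abs).add (U.cont_n.sub W.cont_n).abs)

lemma cont_distR : Continuous fun P : ℝ × ℝ => distR U W P.1 P.2 :=
  (((U.cont_m'.sub W.cont_m').abs.add (U.cont_l'.sub W.cont_l').abs).add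
    (U.cont_n'.sub W.cont_n').abs)

lemma cont_distV : Continuous fun P : ℝ × ℝ => |U.v P.1 P.2 - W.v P.1 P.2| :=
  (U.cont_v.sub W.cont_v).abs

lemma distL_diag (s : ℝ) : distL U W s s = |R s - R' s| + |R s ^ 2 - R' s ^ 2| := by
  simp [distL, m_diag, l_diag, n_diag]

lemma distR_diag (s : ℝ) : distR U W s s = |S s - S' s| + |S s ^ 2 - S' s ^ 2| := by
  simp [distR, m'_diag, l'_diag, n'_diag]

/-- The right-hand sides of the systems of two flows differ by a multiple of the distance of the
unknowns on the triangle `-r ≤ β ≤ α ≤ r`. -/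
def RhsClose (U : CharFlow c R S v₀) (W : CharFlow c R' S' v₀') (κ : ℝ → ℝ) (r M : ℝ) : Prop :=
  ∀ a b, -r ≤ b → b ≤ a → a ≤ r → ∀ D,
    D = flowΩ c (U.v a b) (U.m a b) (U.l a b) (U.m' a b) (U.l' a b)
        - flowΩ c (W.v a b) (W.m a b) (W.l a b) (W.m' a b) (W.l' a b) ∨
    D = flowΛ c (U.v a b) (U.m a b) (U.l a b) (U.n a b) (U.m' a b) (U.l' a b) (U.n' a b)
        - flowΛ c (W.v a b) (W.m a b) (W.l a b) (W.n a b) (W.m' a b) (W.l' a b) (W.n' a b) ∨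
    D = (flowN c (U.v a b) (U.l a b) (U.n a b) (U.l' a b) (U.n' a b)
      + (U.v a b + U.v a b ^ 3) / (2 * c (U.v a b)) * (U.l a b * U.m' a b))
      - (flowN c (W.v a b) (W.l a b) (W.n a b) (W.l' a b) (W.n' a b)
      + (W.v a b + W.v a b ^ 3) / (2 * c (W.v a b)) * (W.l a b * W.m' a b)) ∨
    D = (flowN c (U.v a b) (U.l a b) (U.n a b) (U.l' a b) (U.n' a b)
      - (U.v a b + U.v a b ^ 3) / (2 * c (U.v a b)) * (U.l' a b * U.m a b))
      - (flowN c (W.v a b) (W.l a b) (W.n a b) (W.l' a b) (W.n' a b)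
      - (W.v a b + W.v a b ^ 3) / (2 * c (W.v a b)) * (W.l' a b * W.m a b)) →
    |D| ≤ M * (κ b * (distL U W a b + |U.v a b - W.v a b|) + distR U W a b)

/-- Only the first flow enters through a supremum bound ρ of its densities. The second one enters
through Q κ(β), where κ is controlled by its integral alone; this asymmetry admits data that
converge merely in L². -/
lemma rhsClose {r ρ Q V B : ℝ} {κ : ℝ → ℝ} (hρ : 1 ≤ ρ) (hQ : 1 ≤ Q) (hκ : ∀ s, 0 ≤ κ s)
    (hp : ∀ a b, -r ≤ b → b ≤ a → a ≤ r → U.m a b + U.n a b ≤ ρ)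
    (hq : ∀ a b, -r ≤ b → b ≤ a → a ≤ r → W.m' a b + W.n' a b ≤ Q * κ b)
    (hU : ∀ a b, -r ≤ b → b ≤ a → a ≤ r → |U.v a b| ≤ V)
    (hW : ∀ a b, -r ≤ b → b ≤ a → a ≤ r → |W.v a b| ≤ V)
    (hB0 : 0 < B)
    (hB : ∀ v w, |v| ≤ V → |w| ≤ V →
      (|deriv c v / (8 * c v ^ 2)| ≤ B ∧
        |deriv c v / (8 * c v ^ 2) - deriv c w / (8 * c w ^ 2)| ≤ B * |v - w|) ∧
      (|(v + v ^ 3) / (4 * c v)| ≤ B ∧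
        |(v + v ^ 3) / (4 * c v) - (w + w ^ 3) / (4 * c w)| ≤ B * |v - w|)) :
    RhsClose U W κ r (6 * B * (ρ * Q)) := by
  intro a b hb hba ha D hD
  obtain ⟨⟨k1, k1d⟩, k2, k2d⟩ := hB _ _ (hU a b hb hba ha) (hW a b hb hba ha)
  obtain ⟨⟨k1', -⟩, k2', -⟩ := hB _ _ (hW a b hb hba ha) (hU a b hb hba ha)
  have p1 := hp a b hb hba ha
  have q1 := hq a b hb hba ha
  have l1 := U.two_abs_l_le a b
  have l2 := W.two_abs_l'_le a b
  have m0 := U.m_nonneg a b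
  have n0 := U.n_nonneg a b
  have m0' := W.m'_nonneg a b
  have n0' := W.n'_nonneg a b
  have key := flow_coeff_sub_le (m := U.m a b) (l := U.l a b) (n := U.n a b)
    (m' := U.m' a b) (l' := U.l' a b) (n' := U.n' a b) (M := W.m a b) (L := W.l a b) (N := W.n a b)
    (M' := W.m' a b) (L' := W.l' a b) (N' := W.n' a b) (p := ρ) (q := Q * κ b)
    (a := distL U W a b) (b := distR U W a b) k1 k1' k1d k2 k2' k2d
    (by rw [abs_of_nonneg m0]; linarith) (by linarith [abs_nonneg (U.l a b)])
    (by rw [abs_of_nonneg n0]; linarith)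
    (by rw [abs_of_nonneg m0']; linarith) (by linarith [abs_nonneg (W.l' a b)])
    (by rw [abs_of_nonneg n0']; linarith)
    (by unfold distL; linarith [abs_nonneg (U.l a b - W.l a b), abs_nonneg (U.n a b - W.n a b)])
    (by unfold distL; linarith [abs_nonneg (U.m a b - W.m a b), abs_nonneg (U.n a b - W.n a b)])
    (by unfold distL; linarith [abs_nonneg (U.l a b - W.l a b), abs_nonneg (U.m a b - W.m a b)])
    (by unfold distR; linarith [abs_nonneg (U.l' a b - W.l' a b), abs_nonneg (U.n' a b - W.n' a b)])
    (by unfold distR; linarith [abs_nonneg (U.m' a b - W.m' a b), abs_nonneg (U.n' a b - W.n' a b)])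
    (by unfold distR; linarith [abs_nonneg (U.l' a b - W.l' a b), abs_nonneg (U.m' a b - W.m' a b)])
  have fin : 6 * B * (ρ * distR U W a b + |U.v a b - W.v a b| * (ρ * (Q * κ b))
      + distL U W a b * (Q * κ b))
      ≤ 6 * B * (ρ * Q) * (κ b * (distL U W a b + |U.v a b - W.v a b|) + distR U W a b) := by
    rw [mul_assoc (6 * B)]
    refine mul_le_mul_of_nonneg_left ?_ (by positivity)
    have e1 : ρ * distR U W a b ≤ ρ * Q * distR U W a b := by
      have := mul_nonneg (mul_nonneg (by linarith : 0 ≤ ρ) (distR_nonneg U W a b))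
        (sub_nonneg.2 hQ)
      nlinarith
    have e2 : distL U W a b * (Q * κ b) ≤ ρ * Q * (κ b * distL U W a b) := by
      have := mul_nonneg (mul_nonneg (mul_nonneg (by linarith : 0 ≤ Q) (hκ b))
        (distL_nonneg U W a b)) (sub_nonneg.2 hρ)
      nlinarith
    nlinarith
  rcases hD with rfl | rfl | rfl | rfl
  · exact key.1.trans fin
  · exact key.2.1.trans fin
  · exact key.2.2.1.trans fin
  · exact key.2.2.2.trans fin

section Estimates

variable {κ : ℝ → ℝ} {r M J : ℝ}

/-- Gronwall along β, starting from the diagonal. The coefficient of `distL` is a multiple of κ,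
whose integral is at most J; the factor 3 counts the unknowns m, l, n. -/
lemma distL_le (hM : 0 ≤ M) (cκ : Continuous κ) (hκ : ∀ s, 0 ≤ κ s)
    (hJ : ∫ s in (-r)..r, κ s ≤ J) (H : RhsClose U W κ r M) {a b : ℝ}
    (hb : -r ≤ b) (hba : b ≤ a) (ha : a ≤ r) :
    distL U W a b ≤ Real.exp (3 * M * J) * (|R a - R' a| + |R a ^ 2 - R' a ^ 2|
      + 3 * M * ∫ η in b..a, (distR U W a η + κ η * |U.v a η - W.v a η|)) := by
  have c1 := continuous_snd_slice (cont_distL U W) a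
  have c2 := continuous_snd_slice (cont_distR U W) a
  have c3 := continuous_snd_slice (f := fun a b => |U.v a b - W.v a b|) (cont_distV U W) a
  have key := le_mul_exp_of_le_integral_left c1 (k := fun η => 3 * M * κ η)
    (h := fun η => 3 * M * (distR U W a η + κ η * |U.v a η - W.v a η|))
    (A := distL U W a a) (by fun_prop) (by fun_prop) hba
    (fun η _ => mul_nonneg (by positivity) (hκ η))
    (fun η _ => mul_nonneg (by positivity) (add_nonneg (distR_nonneg U W a η)
      (mul_nonneg (hκ η) (abs_nonneg _)))) fun x hx => by
    have cg : Continuous fun η =>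
        M * (κ η * (distL U W a η + |U.v a η - W.v a η|) + distR U W a η) := by fun_prop
    have i1 := abs_sub_le_integral (fun η => (U.m_b a η).sub (W.m_b a η)) cg hx.2
      fun η hη => H a η (hb.trans (hx.1.trans hη.1)) hη.2 ha _ (Or.inl rfl)
    have i2 := abs_sub_le_integral (fun η => ((U.l_b a η).sub (W.l_b a η)).neg) cg hx.2
      fun η hη => H a η (hb.trans (hx.1.trans hη.1)) hη.2 ha _ (Or.inr (Or.inl (by ring)))
    have i3 := abs_sub_le_integral (fun η => (U.n_b a η).sub (W.n_b a η)) cg hx.2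
      fun η hη => H a η (hb.trans (hx.1.trans hη.1)) hη.2 ha _ (Or.inr (Or.inr (Or.inl rfl)))
    have e : ∫ η in x..a, (3 * M * κ η * distL U W a η
        + 3 * M * (distR U W a η + κ η * |U.v a η - W.v a η|))
        = 3 * ∫ η in x..a, M * (κ η * (distL U W a η + |U.v a η - W.v a η|) + distR U W a η) := by
      rw [← intervalIntegral.integral_const_mul]
      congr 1; ext η; ring
    rw [e]
    simp only [Pi.sub_apply, Pi.neg_apply] at i1 i2 i3
    have j1 := abs_sub_abs_le_abs_sub (U.m a x - W.m a x) (U.m a a - W.m a a)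
    have j2 := abs_sub_abs_le_abs_sub (U.l a x - W.l a x) (U.l a a - W.l a a)
    have j3 := abs_sub_abs_le_abs_sub (U.n a x - W.n a x) (U.n a a - W.n a a)
    rw [abs_sub_comm] at i1 i3
    rw [neg_sub_neg] at i2
    unfold distL at *
    linarith
  rw [distL_diag, intervalIntegral.integral_const_mul, intervalIntegral.integral_const_mul] at key
  refine key.trans ?_
  rw [mul_comm]
  have hi : 0 ≤ ∫ η in b..a, (distR U W a η + κ η * |U.v a η - W.v a η|) :=
    intervalIntegral.integral_nonneg hba fun η _ => add_nonneg (distR_nonneg U W a η)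
      (mul_nonneg (hκ η) (abs_nonneg _))
  have hk := (integral_subinterval_le cκ hκ hb hba ha).trans hJ
  gcongr

/-- Gronwall along α, starting from the diagonal. Here κ(b) is a fixed factor of the forcing, and
the coefficient of `distR` is constant on an interval of length at most 2r. -/
lemma distR_le (hM : 0 ≤ M) (hκ : ∀ s, 0 ≤ κ s) (H : RhsClose U W κ r M) {a b : ℝ}
    (hb : -r ≤ b) (hba : b ≤ a) (ha : a ≤ r) :
    distR U W a b ≤ Real.exp (3 * M * (2 * r)) * (|S b - S' b| + |S b ^ 2 - S' b ^ 2|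
      + 3 * M * (κ b * ∫ ξ in b..a, (distL U W ξ b + |U.v ξ b - W.v ξ b|))) := by
  have c1 := continuous_fst_slice (cont_distL U W) b
  have c2 := continuous_fst_slice (cont_distR U W) b
  have c3 := continuous_fst_slice (f := fun a b => |U.v a b - W.v a b|) (cont_distV U W) b
  have key := le_mul_exp_of_le_integral c2 (k := fun _ => 3 * M)
    (h := fun ξ => 3 * M * (κ b * (distL U W ξ b + |U.v ξ b - W.v ξ b|)))
    (A := distR U W b b) (by fun_prop) (by fun_prop) hba
    (fun η _ => by positivity)
    (fun ξ _ => mul_nonneg (by positivity) (mul_nonneg (hκ b) (add_nonneg (distL_nonneg U W ξ b)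
      (abs_nonneg _)))) fun x hx => by
    have cg : Continuous fun ξ =>
        M * (κ b * (distL U W ξ b + |U.v ξ b - W.v ξ b|) + distR U W ξ b) := by fun_prop
    have i1 := abs_sub_le_integral (fun ξ => (U.m'_a ξ b).sub (W.m'_a ξ b)) cg hx.1
      fun ξ hξ => H ξ b hb hξ.1 (hξ.2.trans (hx.2.trans ha)) _ (Or.inl rfl)
    have i2 := abs_sub_le_integral (fun ξ => (U.l'_a ξ b).sub (W.l'_a ξ b)) cg hx.1
      fun ξ hξ => H ξ b hb hξ.1 (hξ.2.trans (hx.2.trans ha)) _ (Or.inr (Or.inl rfl))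
    have i3 := abs_sub_le_integral (fun ξ => (U.n'_a ξ b).sub (W.n'_a ξ b)) cg hx.1
      fun ξ hξ => H ξ b hb hξ.1 (hξ.2.trans (hx.2.trans ha)) _ (Or.inr (Or.inr (Or.inr rfl)))
    have e : ∫ ξ in b..x, (3 * M * distR U W ξ b
        + 3 * M * (κ b * (distL U W ξ b + |U.v ξ b - W.v ξ b|)))
        = 3 * ∫ ξ in b..x, M * (κ b * (distL U W ξ b + |U.v ξ b - W.v ξ b|) + distR U W ξ b) := by
      rw [← intervalIntegral.integral_const_mul]
      congr 1; ext ξ; ring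
    rw [e]
    simp only [Pi.sub_apply] at i1 i2 i3
    have j1 := abs_sub_abs_le_abs_sub (U.m' x b - W.m' x b) (U.m' b b - W.m' b b)
    have j2 := abs_sub_abs_le_abs_sub (U.l' x b - W.l' x b) (U.l' b b - W.l' b b)
    have j3 := abs_sub_abs_le_abs_sub (U.n' x b - W.n' x b) (U.n' b b - W.n' b b)
    unfold distR at *
    linarith
  rw [distR_diag, intervalIntegral.integral_const_mul, intervalIntegral.integral_const_mul,
    intervalIntegral.integral_const, smul_eq_mul] at key
  refine key.trans ?_
  rw [mul_comm]
  have hi : 0 ≤ ∫ ξ in b..a, (distL U W ξ b + |U.v ξ b - W.v ξ b|) :=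
    intervalIntegral.integral_nonneg hba fun ξ _ => add_nonneg (distL_nonneg U W ξ b)
      (abs_nonneg _)
  have := hκ b
  refine mul_le_mul_of_nonneg_right (Real.exp_le_exp.2 ?_) (by positivity)
  rw [mul_comm]
  exact mul_le_mul_of_nonneg_left (by linarith) (by positivity)

/-- The primitive of c at v has the α-derivative l/2, with no coefficient depending on v, so the
difference is integrated directly. Passing to the primitive and back costs a factor K each time. -/
lemma distV_le (h : IsSpeed K c) {a b : ℝ} (hba : b ≤ a) :
    |U.v a b - W.v a b| ≤ K ^ 2 * (|v₀ b - v₀' b| + ∫ ξ in b..a, distL U W ξ b) := by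
  have c1 := continuous_fst_slice (cont_distL U W) b
  have d : ∀ ξ, HasDerivAt (fun ξ => speedPrimitive c (U.v ξ b) - speedPrimitive c (W.v ξ b))
      ((U.l ξ b - W.l ξ b) / 2) ξ := fun ξ => by
    have h1 := (h.hasDerivAt_speedPrimitive (U.v ξ b)).comp ξ (U.v_a ξ b)
    have h2 := (h.hasDerivAt_speedPrimitive (W.v ξ b)).comp ξ (W.v_a ξ b)
    refine (h1.sub h2).congr_deriv ?_
    have := (h.pos (U.v ξ b)).ne'
    have := (h.pos (W.v ξ b)).ne'
    field_simp
  have i := abs_sub_le_integral d c1 hba fun ξ _ => by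
    rw [abs_div, abs_two, distL]
    linarith [abs_nonneg (U.l ξ b - W.l ξ b), abs_nonneg (U.m ξ b - W.m ξ b),
      abs_nonneg (U.n ξ b - W.n ξ b)]
  simp only [v_diag] at i
  have j := abs_sub_abs_le_abs_sub (speedPrimitive c (U.v a b) - speedPrimitive c (W.v a b))
    (speedPrimitive c (v₀ b) - speedPrimitive c (v₀' b))
  have k1 := h.abs_sub_le_speedPrimitive (U.v a b) (W.v a b)
  have k2 := h.speedPrimitive_sub_le (v₀ b) (v₀' b)
  have hi : 0 ≤ ∫ ξ in b..a, distL U W ξ b :=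
    intervalIntegral.integral_nonneg hba fun ξ _ => distL_nonneg U W ξ b
  have hK := h.one_lt
  calc _ ≤ K * |speedPrimitive c (U.v a b) - speedPrimitive c (W.v a b)| := k1
    _ ≤ K * (K * |v₀ b - v₀' b| + ∫ ξ in b..a, distL U W ξ b) :=
        mul_le_mul_of_nonneg_left (by linarith) h.K_pos.le
    _ ≤ K * (K * |v₀ b - v₀' b| + K * ∫ ξ in b..a, distL U W ξ b) := by
        gcongr; nlinarith
    _ = _ := by ring

end Estimates

end CharFlow

/-! ### Stability with respect to the data -/

namespace CharFlow

variable {K : ℝ} {c R S v₀ R' S' v₀' : ℝ → ℝ} (U : CharFlow c R S v₀) (W : CharFlow c R' S' v₀')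

section Estimates

variable {κ : ℝ → ℝ} {r M J ε : ℝ}

/-- An L¹ bound on the differences of R and R² gives no pointwise control of `distL`. Integrating
along the characteristic makes the data enter through their L¹ distance. -/
lemma integral_distL_le (hM : 0 ≤ M) (cκ : Continuous κ) (hκ : ∀ s, 0 ≤ κ s)
    (hJ : ∫ s in (-r)..r, κ s ≤ J) (H : RhsClose U W κ r M)
    (hR : ∫ s in (-r)..r, (|R s - R' s| + |R s ^ 2 - R' s ^ 2|) ≤ ε) {a b : ℝ}
    (hb : -r ≤ b) (hba : b ≤ a) (ha : a ≤ r) :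
    ∫ ξ in b..a, distL U W ξ b ≤ (1 + 3 * M) * Real.exp (3 * M * J) *
      (ε + ∫ ξ in b..a, ∫ η in b..ξ, (distR U W ξ η + κ η * |U.v ξ η - W.v ξ η|)) := by
  have c1 := continuous_fst_slice (cont_distL U W) b
  have cR := U.continuous_R
  have cR' := W.continuous_R
  have cy := continuous_fst_slice (f := fun a b =>
    ∫ η in b..a, (distR U W a η + κ η * |U.v a η - W.v a η|)) (continuous_integral_snd
    (f := fun a b => distR U W a b + κ b * |U.v a b - W.v a b|)
    ((cont_distR U W).add ((cκ.comp continuous_snd).mul (cont_distV U W)))) b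
  have cd : Continuous fun s => |R s - R' s| + |R s ^ 2 - R' s ^ 2| := by fun_prop
  have i1 := intervalIntegral.integral_mono_on (μ := volume) hba (c1.intervalIntegrable _ _)
    (Continuous.intervalIntegrable (by fun_prop) _ _)
    fun ξ hξ => distL_le U W hM cκ hκ hJ H hb hξ.1 (hξ.2.trans ha)
  rw [intervalIntegral.integral_const_mul,
    intervalIntegral.integral_add (cd.intervalIntegrable _ _)
      ((cy.const_mul _).intervalIntegrable _ _), intervalIntegral.integral_const_mul] at i1
  have i2 := (integral_subinterval_le cd (fun s => by positivity) hb hba ha).trans hR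
  have i3 : 0 ≤ ∫ ξ in b..a, ∫ η in b..ξ, (distR U W ξ η + κ η * |U.v ξ η - W.v ξ η|) :=
    intervalIntegral.integral_nonneg hba fun ξ hξ => intervalIntegral.integral_nonneg hξ.1
      fun η _ => add_nonneg (distR_nonneg U W ξ η) (mul_nonneg (hκ η) (abs_nonneg _))
  have i4 : 0 ≤ ∫ s in b..a, (|R s - R' s| + |R s ^ 2 - R' s ^ 2|) :=
    intervalIntegral.integral_nonneg hba fun s _ => by positivity
  have hε := i4.trans i2
  refine i1.trans ?_
  rw [mul_comm (1 + 3 * M), mul_assoc (Real.exp (3 * M * J))]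
  refine mul_le_mul_of_nonneg_left ?_ (Real.exp_pos _).le
  nlinarith [mul_nonneg hM hε, mul_nonneg hM i3]

/-- The counterpart of `integral_distL_le` along the other family. Differences of v are eliminated
by `distV_le`, and the weight κ that remains is the one for which `triangle_gronwall` is formulated.
-/
lemma integral_distR_le (h : IsSpeed K c) (hM : 0 ≤ M) (cκ : Continuous κ) (hκ : ∀ s, 0 ≤ κ s)
    (hJ : ∫ s in (-r)..r, κ s ≤ J) (H : RhsClose U W κ r M)
    (hS : ∫ s in (-r)..r, (|S s - S' s| + |S s ^ 2 - S' s ^ 2|) ≤ ε)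
    (hv : ∀ s ∈ Icc (-r) r, |v₀ s - v₀' s| ≤ ε) {a b : ℝ}
    (hb : -r ≤ b) (hba : b ≤ a) (ha : a ≤ r) :
    ∫ η in b..a, (distR U W a η + κ η * |U.v a η - W.v a η|) ≤
      (Real.exp (3 * M * (2 * r)) * (1 + 3 * M * (1 + 2 * r * K ^ 2)) + K ^ 2) * (1 + J) *
      (ε + ∫ η in b..a, κ η * ∫ ξ in η..a, distL U W ξ η) := by
  set z : ℝ → ℝ → ℝ := fun a b => ∫ ξ in b..a, distL U W ξ b with hz
  have hr : 0 ≤ r := by linarith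
  have hε : 0 ≤ ε := (abs_nonneg _).trans (hv b ⟨hb, hba.trans ha⟩)
  have cz := continuous_snd_slice (f := z) (continuous_integral_fst (cont_distL U W)) a
  have c2 := continuous_snd_slice (cont_distR U W) a
  have c3 := continuous_snd_slice (f := fun a b => |U.v a b - W.v a b|) (cont_distV U W) a
  have cS := U.continuous_S
  have cS' := W.continuous_S
  set δ : ℝ → ℝ := fun s => |S s - S' s| + |S s ^ 2 - S' s ^ 2| with hδ
  have cδ : Continuous δ := by fun_prop
  have δ0 : ∀ s, 0 ≤ δ s := fun s => by simp only [hδ]; positivity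
  set E := Real.exp (3 * M * (2 * r)) with hE
  have E0 : 0 < E := Real.exp_pos _
  set P := E * (1 + 3 * M * (1 + 2 * r * K ^ 2)) + K ^ 2 with hP
  have hPE : E ≤ P := by
    have : 0 ≤ E * (3 * M * (1 + 2 * r * K ^ 2)) := by positivity
    have := sq_nonneg K
    rw [hP]; nlinarith
  have P0 : 0 ≤ P := E0.le.trans hPE
  have z0 : ∀ a b, b ≤ a → 0 ≤ z a b := fun a b hab =>
    intervalIntegral.integral_nonneg hab fun ξ _ => distL_nonneg U W ξ b
  have point : ∀ η ∈ Icc b a, distR U W a η + κ η * |U.v a η - W.v a η|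
      ≤ P * (δ η + κ η * (z a η + ε)) := by
    intro η hη
    have hb' := hb.trans hη.1
    have zm : ∀ ξ, η ≤ ξ → ξ ≤ a → z ξ η ≤ z a η := fun ξ h1 h2 =>
      integral_subinterval_le (continuous_fst_slice (cont_distL U W) η)
        (fun ξ => distL_nonneg U W ξ η) le_rfl h1 h2
    have hd : ∀ ξ, η ≤ ξ → ξ ≤ a → |U.v ξ η - W.v ξ η| ≤ K ^ 2 * (ε + z a η) := fun ξ h1 h2 => by
      refine (distV_le U W h h1).trans (mul_le_mul_of_nonneg_left ?_ (sq_nonneg K))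
      exact add_le_add (hv η ⟨hb', hη.2.trans ha⟩) (zm ξ h1 h2)
    have hz0 := z0 a η hη.2
    have i1 : ∫ ξ in η..a, (distL U W ξ η + |U.v ξ η - W.v ξ η|)
        ≤ z a η + 2 * r * (K ^ 2 * (ε + z a η)) := by
      have k1 := continuous_fst_slice (cont_distL U W) η
      have k2 := continuous_fst_slice (f := fun a b => |U.v a b - W.v a b|) (cont_distV U W) η
      rw [intervalIntegral.integral_add (k1.intervalIntegrable _ _) (k2.intervalIntegrable _ _)]
      have := intervalIntegral.integral_mono_on (μ := volume) hη.2 (k2.intervalIntegrable _ _)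
        intervalIntegrable_const fun ξ hξ => hd ξ hξ.1 hξ.2
      rw [intervalIntegral.integral_const, smul_eq_mul] at this
      refine add_le_add le_rfl (this.trans (mul_le_mul_of_nonneg_right ?_ (by positivity)))
      linarith
    have i2 := distR_le U W hM hκ H hb' hη.2 ha
    have hκη := hκ η
    have i3 := hd a hη.2 le_rfl
    calc distR U W a η + κ η * |U.v a η - W.v a η|
        ≤ E * (δ η + 3 * M * (κ η * (z a η + 2 * r * (K ^ 2 * (ε + z a η)))))
          + κ η * (K ^ 2 * (ε + z a η)) := by
          refine add_le_add (i2.trans ?_) ?_ <;> gcongr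
      _ ≤ E * δ η + E * (1 + 3 * M * (1 + 2 * r * K ^ 2)) * (κ η * (z a η + ε))
          + K ^ 2 * (κ η * (z a η + ε)) := by
          have : 0 ≤ E * (1 + 3 * M) * (κ η * ε) := by positivity
          have : 0 ≤ E * (κ η * z a η) := by positivity
          nlinarith
      _ = E * δ η + P * (κ η * (z a η + ε)) := by rw [hP]; ring
      _ ≤ P * δ η + P * (κ η * (z a η + ε)) := by
          have := mul_le_mul_of_nonneg_right hPE (δ0 η)
          linarith
      _ = _ := by ring
  have i1 := intervalIntegral.integral_mono_on (μ := volume) hba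
    (Continuous.intervalIntegrable (by fun_prop) _ _)
    (Continuous.intervalIntegrable (by fun_prop) _ _) point
  refine i1.trans ?_
  have cκz : Continuous fun η => κ η * z a η := cκ.mul cz
  have e : ∫ η in b..a, P * (δ η + κ η * (z a η + ε))
      = P * ((∫ η in b..a, δ η) + (∫ η in b..a, κ η * z a η) + (∫ η in b..a, κ η) * ε) := by
    rw [← intervalIntegral.integral_mul_const, ← intervalIntegral.integral_add
      (cδ.intervalIntegrable _ _) (cκz.intervalIntegrable _ _),
      ← intervalIntegral.integral_add (Continuous.intervalIntegrable (u := fun η => δ η + κ η * z a η) (cδ.add cκz) _ _)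
      ((cκ.mul_const ε).intervalIntegrable _ _), ← intervalIntegral.integral_const_mul]
    congr 1; ext η; ring
  rw [e, mul_assoc]
  refine mul_le_mul_of_nonneg_left ?_ P0
  have j1 := (integral_subinterval_le cδ δ0 hb hba ha).trans hS
  have j2 := (integral_subinterval_le cκ hκ hb hba ha).trans hJ
  have j3 : 0 ≤ ∫ η in b..a, κ η := intervalIntegral.integral_nonneg hba fun η _ => hκ η
  have j4 : 0 ≤ ∫ η in b..a, κ η * z a η := intervalIntegral.integral_nonneg hba fun η hη =>
    mul_nonneg (hκ η) (z0 a η hη.2)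
  have j5 := mul_le_mul_of_nonneg_right j2 hε
  have j6 := mul_nonneg (j3.trans j2) j4
  linarith

end Estimates

lemma exists_bound_leg (r : ℝ) : ∃ ρ, 1 ≤ ρ ∧
    ∀ a b, -r ≤ b → b ≤ a → a ≤ r → U.m a b + U.n a b ≤ ρ := by
  obtain ⟨C, hC⟩ := (isCompact_Icc (a := ((-r, -r) : ℝ × ℝ)) (b := (r, r))).exists_bound_of_continuousOn
    (U.cont_m.add U.cont_n).continuousOn
  refine ⟨max 1 C, le_max_left _ _, fun a b hb hba ha => ?_⟩
  exact (le_of_abs_le (hC (a, b) ⟨⟨hb.trans hba, hb⟩, ⟨ha, hba.trans ha⟩⟩)).trans (le_max_right _ _)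

/-- Quantitative stability of a flow on a triangle with respect to its data. -/
theorem stability (h : IsSpeed K c) {r : ℝ} (hr : 0 ≤ r) (V₀ J : ℝ) (hV : ∀ s ∈ Icc (-r) r, |v₀ s| ≤ V₀)
    (hJ : legBound R S v₀ r ≤ J) : ∃ C, 0 ≤ C ∧ ∀ (R' S' v₀' : ℝ → ℝ) (W : CharFlow c R' S' v₀')
    (ε : ℝ), (∀ s ∈ Icc (-r) r, |v₀' s| ≤ V₀) → legBound R' S' v₀' r ≤ J →
    ∫ s in (-r)..r, (|R s - R' s| + |R s ^ 2 - R' s ^ 2|) ≤ ε →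
    ∫ s in (-r)..r, (|S s - S' s| + |S s ^ 2 - S' s ^ 2|) ≤ ε →
    (∀ s ∈ Icc (-r) r, |v₀ s - v₀' s| ≤ ε) →
    ∀ a b, -r ≤ b → b ≤ a → a ≤ r → |U.t a b - W.t a b| ≤ C * ε ∧ |U.x a b - W.x a b| ≤ C * ε ∧
      |U.v a b - W.v a b| ≤ C * ε := by
  -- The final constant depends on the first flow through ρ, but on the second one only through the
  -- common bounds V₀ and J.
  obtain ⟨ρ, hρ, hp⟩ := U.exists_bound_leg r
  obtain ⟨B, B0, hB⟩ := h.exists_coeff_bound (V₀ + K * J)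
  have hK := h.one_lt
  have hUv : ∀ a b, -r ≤ b → b ≤ a → a ≤ r → |U.v a b| ≤ V₀ + K * J := fun a b hb hba ha =>
    (U.abs_v_le h hb hba ha hV).trans (by have := h.K_pos; gcongr)
  have hJ0 : 0 ≤ J := by
    refine le_trans ?_ hJ
    unfold legBound
    have := intervalIntegral.integral_nonneg (μ := volume) (by linarith : -r ≤ r) fun y _ =>
      (by have := potentialF_nonneg (v₀ y); positivity :
        0 ≤ R y ^ 2 + S y ^ 2 + 2 * potentialF (v₀ y))
    linarith
  set Q := Real.exp (5 * B * J) with hQ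
  have hQ1 : 1 ≤ Q := Real.one_le_exp (by positivity)
  set M := 6 * B * (ρ * Q) with hM
  have M0 : 0 ≤ M := by positivity
  set M₁ := (1 + 3 * M) * Real.exp (3 * M * J) with hM₁
  set M₂ := (Real.exp (3 * M * (2 * r)) * (1 + 3 * M * (1 + 2 * r * K ^ 2)) + K ^ 2) * (1 + J)
    with hM₂
  set N := M₁ + M₂ with hN
  have M₁0 : 0 < M₁ := by positivity
  have M₂0 : 0 < M₂ := by positivity
  set C₀ := 2 * N * Real.exp (4 * N * (r + J)) with hC₀
  have C₀0 : 0 ≤ C₀ := by positivity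
  refine ⟨C₀ + K ^ 2 * (1 + C₀) + (2 * r * (ρ * B * (K ^ 2 * (1 + C₀))) + K * C₀), by positivity,
    fun R' S' v₀' W ε hV' hJ' hR hS hv a b hb hba ha => ?_⟩
  have hε : 0 ≤ ε := (abs_nonneg _).trans (hv b ⟨hb, hba.trans ha⟩)
  have hWv : ∀ a b, -r ≤ b → b ≤ a → a ≤ r → |W.v a b| ≤ V₀ + K * J := fun a b hb hba ha =>
    (W.abs_v_le h hb hba ha hV').trans (by have := h.K_pos; gcongr)
  -- The weight comes from the data of the second flow: its integral is at most J, and `q_le` bounds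
  -- m' + n' by Q κ.
  set κ : ℝ → ℝ := fun s => 1 + S' s ^ 2 with hκ
  have cS' := W.continuous_S
  have cR' := W.continuous_R
  have cv' := W.continuous_v₀
  have cκ : Continuous κ := by fun_prop
  have κ0 : ∀ s, 0 ≤ κ s := fun s => by simp only [hκ]; positivity
  have hκJ : ∫ s in (-r)..r, κ s ≤ J := by
    refine le_trans ?_ hJ'
    have i1 : ∫ s in (-r)..r, κ s ≤ ∫ s in (-r)..r,
        ((R' s ^ 2 + S' s ^ 2 + 2 * potentialF (v₀' s)) + 1) :=
      intervalIntegral.integral_mono_on (by linarith) (cκ.intervalIntegrable _ _)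
        (Continuous.intervalIntegrable (by unfold potentialF; fun_prop) _ _) fun s _ => by
          have := potentialF_nonneg (v₀' s)
          simp only [hκ]; nlinarith [sq_nonneg (R' s)]
    rw [intervalIntegral.integral_add
      (Continuous.intervalIntegrable (by unfold potentialF; fun_prop) _ _) intervalIntegrable_const,
      intervalIntegral.integral_const, smul_eq_mul] at i1
    unfold legBound
    linarith
  have hq : ∀ a b, -r ≤ b → b ≤ a → a ≤ r → W.m' a b + W.n' a b ≤ Q * κ b :=
    fun a b hb hba ha => by
      refine (W.q_le h (B := B) hb hba ha hWv fun v hv => ?_).trans ?_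
      · exact ⟨(hB v v hv hv).1.1, (hB v v hv hv).2.1.1⟩
      · rw [mul_comm]
        exact mul_le_mul_of_nonneg_right (Real.exp_le_exp.2 (by gcongr)) (κ0 b)
  have H := rhsClose U W hρ hQ1 κ0 hp hq hUv hWv B0 fun v w hv hw =>
    ⟨(hB v w hv hw).1, (hB v w hv hw).2.1⟩
  have key : ∀ a b, -r ≤ b → b ≤ a → a ≤ r → ∫ ξ in b..a, distL U W ξ b ≤ C₀ * ε := by
    intro a b hb hba ha
    have cyz := continuous_integral_snd (f := fun a b => distR U W a b + κ b * |U.v a b - W.v a b|)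
      ((cont_distR U W).add ((cκ.comp continuous_snd).mul (cont_distV U W)))
    refine (triangle_gronwall
      (y := fun a b => ∫ η in b..a, (distR U W a η + κ η * |U.v a η - W.v a η|))
      (z := fun a b => ∫ ξ in b..a, distL U W ξ b) cyz
      (continuous_integral_fst (cont_distL U W)) cκ κ0 (M := N) (by positivity) hε hκJ
      ?_ ?_ hb hba ha).2
    · intro a b hb hba ha
      refine (integral_distL_le U W M0 cκ κ0 hκJ H hR hb hba ha).trans ?_
      refine mul_le_mul_of_nonneg_right (by linarith) (add_nonneg hε ?_)
      exact intervalIntegral.integral_nonneg hba fun ξ hξ => intervalIntegral.integral_nonneg hξ.1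
        fun η _ => add_nonneg (distR_nonneg U W ξ η) (mul_nonneg (κ0 η) (abs_nonneg _))
    · intro a b hb hba ha
      refine (integral_distR_le U W h M0 cκ κ0 hκJ H hS hv hb hba ha).trans ?_
      refine mul_le_mul_of_nonneg_right (by linarith) (add_nonneg hε ?_)
      exact intervalIntegral.integral_nonneg hba fun η hη => mul_nonneg (κ0 η)
        (intervalIntegral.integral_nonneg hη.2 fun ξ _ => distL_nonneg U W ξ η)
  have kv : ∀ ξ, b ≤ ξ → ξ ≤ r → |U.v ξ b - W.v ξ b| ≤ K ^ 2 * (1 + C₀) * ε := fun ξ h1 h2 => by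
    refine (distV_le U W h h1).trans ?_
    rw [mul_assoc, add_mul, one_mul]
    gcongr
    · exact hv b ⟨hb, hba.trans ha⟩
    · exact key ξ b hb h1 h2
  have c1 := continuous_fst_slice (cont_distL U W) b
  have kx : |U.x a b - W.x a b| ≤ C₀ * ε := by
    have i := abs_sub_le_integral (fun ξ => (U.x_a ξ b).sub (W.x_a ξ b)) c1 hba fun ξ _ => by
      rw [← sub_div, abs_div, abs_two, distL]
      linarith [abs_nonneg (U.l ξ b - W.l ξ b), abs_nonneg (U.m ξ b - W.m ξ b),
        abs_nonneg (U.n ξ b - W.n ξ b)]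
    simp only [Pi.sub_apply, x_diag, sub_self, sub_zero] at i
    exact i.trans (key a b hb hba ha)
  have kt : |U.t a b - W.t a b| ≤ (2 * r * (ρ * B * (K ^ 2 * (1 + C₀))) + K * C₀) * ε := by
    have i := abs_sub_le_integral (fun ξ => (U.t_a ξ b).sub (W.t_a ξ b))
      (g := fun ξ => ρ * B * (K ^ 2 * (1 + C₀) * ε) + K * distL U W ξ b) (by fun_prop) hba
      fun ξ hξ => by
        have hξr := hξ.2.trans ha
        have e : U.m ξ b / (2 * c (U.v ξ b)) - W.m ξ b / (2 * c (W.v ξ b))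
          = U.m ξ b * (1 / (2 * c (U.v ξ b)) - 1 / (2 * c (W.v ξ b)))
            + (U.m ξ b - W.m ξ b) * (1 / (2 * c (W.v ξ b))) := by ring
        rw [e]
        refine (abs_add_le _ _).trans (add_le_add ?_ ?_)
        · rw [abs_mul, mul_assoc]
          have m1 : |U.m ξ b| ≤ ρ := by
            rw [abs_of_nonneg (U.m_nonneg ξ b)]
            linarith [hp ξ b hb hξ.1 hξr, U.n_nonneg ξ b]
          have := ((hB _ _ (hUv ξ b hb hξ.1 hξr) (hWv ξ b hb hξ.1 hξr)).2.2).trans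
            (mul_le_mul_of_nonneg_left (kv ξ hξ.1 hξr) B0.le)
          exact mul_le_mul m1 this (abs_nonneg _) (by linarith)
        · rw [abs_mul, mul_comm]
          have h1 : |1 / (2 * c (W.v ξ b))| ≤ K := by
            have := h.pos (W.v ξ b)
            rw [abs_of_pos (by positivity), one_div, mul_inv]
            have := h.inv_le (W.v ξ b)
            have := inv_pos.2 (h.pos (W.v ξ b))
            linarith
          have h2 : |U.m ξ b - W.m ξ b| ≤ distL U W ξ b := by
            unfold distL; linarith [abs_nonneg (U.l ξ b - W.l ξ b), abs_nonneg (U.n ξ b - W.n ξ b)]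
          exact mul_le_mul h1 h2 (abs_nonneg _) h.K_pos.le
    simp only [Pi.sub_apply, t_diag, sub_self, sub_zero] at i
    rw [intervalIntegral.integral_add intervalIntegrable_const
      ((c1.const_mul K).intervalIntegrable _ _), intervalIntegral.integral_const, smul_eq_mul,
      intervalIntegral.integral_const_mul] at i
    have j1 : (a - b) * (ρ * B * (K ^ 2 * (1 + C₀) * ε))
        ≤ 2 * r * (ρ * B * (K ^ 2 * (1 + C₀) * ε)) :=
      mul_le_mul_of_nonneg_right (by linarith) (by positivity)
    have j2 := mul_le_mul_of_nonneg_left (key a b hb hba ha) h.K_pos.le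
    linarith
  have n1 : 0 ≤ C₀ * ε := by positivity
  have n2 : 0 ≤ K ^ 2 * (1 + C₀) * ε := by positivity
  have n3 := (abs_nonneg _).trans kt
  refine ⟨kt.trans ?_, kx.trans ?_, (kv a hba ha).trans ?_⟩ <;> linarith

end CharFlow

/-! ### Continuous dependence and uniqueness -/

namespace CharFlow

variable {K : ℝ} {c R S v₀ : ℝ → ℝ} (h : IsSpeed K c)
include h

/-- The point (t, x) is pulled back by the n-th flow to some (a, b), at which both flows are
compared: the values of v are close, and U maps (a, b) to a point near (t, x). Uniform continuity of
u accounts for this displacement. -/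
lemma eventually_abs_sub_lt_of_nonneg (U : CharFlow c R S v₀) {u : ℝ → ℝ → ℝ}
    (hu : ∀ a b, u (U.t a b) (U.x a b) = U.v a b) {Rn Sn v₀n : ℕ → ℝ → ℝ}
    (W : ∀ n, CharFlow c (Rn n) (Sn n) (v₀n n)) {un : ℕ → ℝ → ℝ → ℝ}
    (hun : ∀ n a b, un n ((W n).t a b) ((W n).x a b) = (W n).v a b) {r : ℝ} (hr : 0 ≤ r)
    (hR : Tendsto (fun n => ∫ s in (-r)..r, (|R s - Rn n s| + |R s ^ 2 - Rn n s ^ 2|))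
      atTop (𝓝 0))
    (hS : Tendsto (fun n => ∫ s in (-r)..r, (|S s - Sn n s| + |S s ^ 2 - Sn n s ^ 2|))
      atTop (𝓝 0))
    (hv : TendstoUniformlyOn v₀n v₀ atTop (Icc (-r) r)) {η : ℝ} (hη : 0 < η) :
    ∀ᶠ n in atTop, ∀ t x, 0 ≤ t → |x| + K * |t| ≤ r → |un n t x - u t x| < η := by
  have hK := h.one_lt
  have cR := U.continuous_R
  have cS := U.continuous_S
  have cv := U.continuous_v₀
  have hrr : -r ≤ r := by linarith
  obtain ⟨V, hV⟩ := (isCompact_Icc (a := -r) (b := r)).exists_bound_of_continuousOn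
    cv.continuousOn
  -- This leaves room for the perturbed data: for ε ≤ 1 they stay below V + 1, and their integral of
  -- R² + S² exceeds I by at most 2. The level J is the resulting bound for `legBound`.
  set V₀ := V + 1 with hV₀
  have V₀1 : 1 ≤ V₀ := by
    have := (norm_nonneg _).trans (hV r ⟨hrr, le_rfl⟩)
    linarith
  set I := ∫ s in (-r)..r, (R s ^ 2 + S s ^ 2) with hI
  set J := I + 2 + 4 * r * potentialF V₀ + 4 * r with hJ
  have legB : ∀ (R' S' v' : ℝ → ℝ), Continuous R' → Continuous S' → Continuous v' →
      (∀ s ∈ Icc (-r) r, |v' s| ≤ V₀) → ∫ s in (-r)..r, (R' s ^ 2 + S' s ^ 2) ≤ I + 2 →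
      legBound R' S' v' r ≤ J := by
    intro R' S' v' cR' cS' cv' hv' hI'
    have i1 : ∫ s in (-r)..r, (R' s ^ 2 + S' s ^ 2 + 2 * potentialF (v' s))
        ≤ ∫ s in (-r)..r, ((R' s ^ 2 + S' s ^ 2) + 2 * potentialF V₀) :=
      intervalIntegral.integral_mono_on hrr
        (Continuous.intervalIntegrable (by unfold potentialF; fun_prop) _ _)
        (Continuous.intervalIntegrable (by fun_prop) _ _) fun s hs => by
          have h1 := hv' s hs
          have h2 : v' s ^ 2 ≤ V₀ ^ 2 := sq_le_sq' (by linarith [(abs_le.1 h1).1]) (abs_le.1 h1).2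
          have h3 : (v' s ^ 2) ^ 2 ≤ (V₀ ^ 2) ^ 2 := by gcongr
          unfold potentialF
          linarith
    rw [intervalIntegral.integral_add (Continuous.intervalIntegrable (by fun_prop) _ _)
      intervalIntegrable_const, intervalIntegral.integral_const, smul_eq_mul] at i1
    unfold legBound
    linarith
  have hVU : ∀ s ∈ Icc (-r) r, |v₀ s| ≤ V₀ := fun s hs => (hV s hs).trans (by linarith)
  obtain ⟨C, C0, hC⟩ := U.stability h hr V₀ J hVU
    (legB R S v₀ cR cS cv hVU (by linarith))
  have cu := U.continuous_solution h hu
  have hcpt : IsCompact (Icc ((-(r + 1), -(r + 1)) : ℝ × ℝ) (r + 1, r + 1)) := isCompact_Icc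
  obtain ⟨δ, δ0, hδ⟩ := Metric.uniformContinuousOn_iff.1
    (hcpt.uniformContinuousOn_of_continuous cu.continuousOn) (η / 2) (by positivity)
  -- The three entries serve the uniform continuity of u, the containment in the compact square of
  -- half-side r + 1, and the difference of the values of v.
  set m := min (min δ 1) (η / 2) with hm
  have m0 : 0 < m := by positivity
  set ε := min 1 (m / (C + 1) / 2) with hε
  have ε0 : 0 < ε := by positivity
  have hCε : C * ε < m := by
    have h1 : ε ≤ m / (C + 1) / 2 := min_le_right _ _
    have h2 : C * ε ≤ (C + 1) * (m / (C + 1) / 2) := by gcongr; linarith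
    have h3 : (C + 1) * (m / (C + 1) / 2) = m / 2 := by field_simp
    linarith
  filter_upwards [hR.eventually (gt_mem_nhds ε0), hS.eventually (gt_mem_nhds ε0),
    Metric.tendstoUniformlyOn_iff.1 hv ε ε0] with n h1 h2 h3 t x ht hx
  have hd : ∀ s ∈ Icc (-r) r, |v₀ s - v₀n n s| ≤ ε := fun s hs => (h3 s hs).le
  have hε1 : ε ≤ 1 := min_le_left _ _
  have hVW : ∀ s ∈ Icc (-r) r, |v₀n n s| ≤ V₀ := fun s hs => by
    have k1 := abs_sub_abs_le_abs_sub (v₀n n s) (v₀ s)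
    rw [abs_sub_comm] at k1
    have k2 : |v₀ s| ≤ V := hV s hs
    linarith [hd s hs]
  have cRn := (W n).continuous_R
  have cSn := (W n).continuous_S
  have cvn := (W n).continuous_v₀
  have hJW : legBound (Rn n) (Sn n) (v₀n n) r ≤ J := by
    refine legB _ _ _ cRn cSn cvn hVW ?_
    have i1 : ∫ s in (-r)..r, (Rn n s ^ 2 + Sn n s ^ 2) ≤ ∫ s in (-r)..r,
        ((R s ^ 2 + S s ^ 2) + ((|R s - Rn n s| + |R s ^ 2 - Rn n s ^ 2|)
          + (|S s - Sn n s| + |S s ^ 2 - Sn n s ^ 2|))) :=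
      intervalIntegral.integral_mono_on hrr (Continuous.intervalIntegrable (by fun_prop) _ _)
        (Continuous.intervalIntegrable (by fun_prop) _ _) fun s _ => by
          linarith [neg_abs_le (R s ^ 2 - Rn n s ^ 2), neg_abs_le (S s ^ 2 - Sn n s ^ 2),
            abs_nonneg (R s - Rn n s), abs_nonneg (S s - Sn n s)]
    have e : ∫ s in (-r)..r, ((R s ^ 2 + S s ^ 2) + ((|R s - Rn n s| + |R s ^ 2 - Rn n s ^ 2|)
          + (|S s - Sn n s| + |S s ^ 2 - Sn n s ^ 2|))) = I
        + ((∫ s in (-r)..r, (|R s - Rn n s| + |R s ^ 2 - Rn n s ^ 2|))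
          + ∫ s in (-r)..r, (|S s - Sn n s| + |S s ^ 2 - Sn n s ^ 2|)) := by
      rw [hI, ← intervalIntegral.integral_add (Continuous.intervalIntegrable (by fun_prop) _ _)
        (Continuous.intervalIntegrable (by fun_prop) _ _),
        ← intervalIntegral.integral_add (Continuous.intervalIntegrable (by fun_prop) _ _)
        (Continuous.intervalIntegrable (by fun_prop) _ _)]
    linarith
  obtain ⟨a, b, hba, rfl, rfl⟩ := (W n).exists_preimage_nonneg h ht x
  obtain ⟨ha, hb⟩ := (W n).abs_le_of_coord h a b
  obtain ⟨kt, kx, kv⟩ := hC _ _ _ (W n) ε hVW hJW h1.le h2.le hd a b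
    (abs_le.1 (hb.trans hx)).1 hba (abs_le.1 (ha.trans hx)).2
  have hmδ : m ≤ δ := (min_le_left _ _).trans (min_le_left _ _)
  have hm1 : m ≤ 1 := (min_le_left _ _).trans (min_le_right _ _)
  have hmη : m ≤ η / 2 := min_le_right _ _
  rw [hun]
  have hxr : |(W n).x a b| ≤ r := by nlinarith [abs_nonneg ((W n).t a b)]
  have htr : |(W n).t a b| ≤ r := by
    nlinarith [abs_nonneg ((W n).t a b), abs_nonneg ((W n).x a b)]
  have h4 := abs_le.1 hxr
  have h5 := abs_le.1 htr
  have h6 := abs_le.1 (kt.trans (hCε.le.trans hm1))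
  have h7 := abs_le.1 (kx.trans (hCε.le.trans hm1))
  have key := hδ (U.t a b, U.x a b)
    ⟨⟨by simp only; linarith, by simp only; linarith⟩,
      ⟨by simp only; linarith, by simp only; linarith⟩⟩
    ((W n).t a b, (W n).x a b) ⟨⟨by simp only; linarith, by simp only; linarith⟩,
      ⟨by simp only; linarith, by simp only; linarith⟩⟩ (by
    rw [Prod.dist_eq, Real.dist_eq, Real.dist_eq]
    exact max_lt (by simp only; linarith) (by simp only; linarith))
  simp only at key
  rw [hu, Real.dist_eq] at key
  have h8 := abs_sub_le ((W n).v a b) (U.v a b) (u ((W n).t a b) ((W n).x a b))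
  rw [abs_sub_comm] at kv
  linarith

/-- Solutions depend continuously on the data. -/
theorem tendstoUniformlyOn_solution (U : CharFlow c R S v₀) {u : ℝ → ℝ → ℝ}
    (hu : ∀ a b, u (U.t a b) (U.x a b) = U.v a b) {Rn Sn v₀n : ℕ → ℝ → ℝ}
    (W : ∀ n, CharFlow c (Rn n) (Sn n) (v₀n n)) {un : ℕ → ℝ → ℝ → ℝ}
    (hun : ∀ n a b, un n ((W n).t a b) ((W n).x a b) = (W n).v a b)
    (hR : ∀ r, 0 ≤ r → Tendsto (fun n => ∫ s in (-r)..r, (|R s - Rn n s| + |R s ^ 2 - Rn n s ^ 2|))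
      atTop (𝓝 0))
    (hS : ∀ r, 0 ≤ r → Tendsto (fun n => ∫ s in (-r)..r, (|S s - Sn n s| + |S s ^ 2 - Sn n s ^ 2|))
      atTop (𝓝 0))
    (hv : ∀ C : Set ℝ, IsCompact C → TendstoUniformlyOn v₀n v₀ atTop C) {B : Set (ℝ × ℝ)}
    (hB : Bornology.IsBounded B) :
    TendstoUniformlyOn (fun n (p : ℝ × ℝ) => un n p.1 p.2) (fun p : ℝ × ℝ => u p.1 p.2)
      atTop B := by
  obtain ⟨r₀, hr₀⟩ := hB.exists_norm_le
  set r := (1 + K) * max r₀ 0 with hr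
  have K0 := h.K_pos
  have hr0 : 0 ≤ r := by positivity
  rw [Metric.tendstoUniformlyOn_iff]
  intro η hη
  have e1 := U.eventually_abs_sub_lt_of_nonneg h hu W hun hr0 (hR r hr0) (hS r hr0)
    (hv _ isCompact_Icc) hη
  -- Negative times follow by time reversal.
  have e2 := U.rev.eventually_abs_sub_lt_of_nonneg h (u := fun t x => u (-t) x)
    (fun a b => by simpa [rev] using hu b a) (fun n => (W n).rev)
    (un := fun n t x => un n (-t) x) (fun n a b => by simpa [rev] using hun n b a) hr0
    (by
      refine (hS r hr0).congr fun n => ?_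
      congr 1; ext s; rw [← neg_sub_neg, abs_sub_comm, neg_sq, neg_sq])
    (by
      refine (hR r hr0).congr fun n => ?_
      congr 1; ext s; rw [← neg_sub_neg, abs_sub_comm, neg_sq, neg_sq])
    (hv _ isCompact_Icc) hη
  filter_upwards [e1, e2] with n h1 h2 p hp
  have hn := (hr₀ p hp).trans (le_max_left r₀ 0)
  have hpt : |p.1| ≤ max r₀ 0 := (norm_fst_le p).trans hn
  have hpx : |p.2| ≤ max r₀ 0 := (norm_snd_le p).trans hn
  have hpr : |p.2| + K * |p.1| ≤ r := by
    have := mul_le_mul_of_nonneg_left hpt K0.le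
    rw [hr]; linarith
  rw [dist_comm, Real.dist_eq]
  rcases le_total 0 p.1 with hp0 | hp0
  · exact h1 _ _ hp0 hpr
  · have := h2 (-p.1) p.2 (by linarith) (by rwa [abs_neg])
    simpa using this

/-- The solution is determined by the data. -/
theorem solution_unique (U W : CharFlow c R S v₀) {u w : ℝ → ℝ → ℝ}
    (hu : ∀ a b, u (U.t a b) (U.x a b) = U.v a b)
    (hw : ∀ a b, w (W.t a b) (W.x a b) = W.v a b) : w = u := by
  -- The second solution is regarded as a constant sequence with constant data; its limit at every
  -- point is the first solution.
  have key := fun p : ℝ × ℝ => (U.tendstoUniformlyOn_solution h hu (fun _ : ℕ => W)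
    (un := fun _ => w) (fun _ => hw) (fun r _ => by simp) (fun r _ => by simp)
    (fun C _ => by
      rw [Metric.tendstoUniformlyOn_iff]
      exact fun ε hε => Eventually.of_forall fun n x _ => by simpa using hε)
    (Bornology.isBounded_singleton (x := p))).tendsto_at (mem_singleton p)
  ext t x
  exact tendsto_nhds_unique tendsto_const_nhds (key (t, x))

end CharFlow

/-! ### Convergence of the Riemann data -/

section Data

lemma tendsto_integral_sq {f : ℕ → ℝ → ℝ} (hf : ∀ n, MemLp (f n) 2 volume)
    (ht : Tendsto (fun n => eLpNorm (f n) 2 volume) atTop (𝓝 0)) {r : ℝ} (hr : 0 ≤ r) :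
    Tendsto (fun n => ∫ s in (-r)..r, f n s ^ 2) atTop (𝓝 0) := by
  have h1 : Tendsto (fun n => (eLpNorm (f n) 2 volume).toReal ^ 2) atTop (𝓝 0) := by
    have := ((ENNReal.tendsto_toReal ENNReal.zero_ne_top).comp ht).pow 2
    simpa using this
  refine squeeze_zero (fun n => intervalIntegral.integral_nonneg (by linarith) fun s _ =>
    sq_nonneg _) (fun n => ?_) h1
  have hi : Integrable (fun s => f n s ^ 2) := (hf n).integrable_sq
  rw [intervalIntegral.integral_of_le (by linarith)]
  refine (setIntegral_le_integral hi (Eventually.of_forall fun s => sq_nonneg _)).trans_eq ?_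
  rw [(hf n).eLpNorm_eq_integral_rpow_norm two_ne_zero ENNReal.ofNat_ne_top,
    ENNReal.toReal_ofReal (by positivity)]
  have : 0 ≤ ∫ a, ‖f n a‖ ^ (2:ℝ≥0∞).toReal := integral_nonneg fun a => by positivity
  rw [← Real.rpow_natCast, ← Real.rpow_mul this]
  simp

/-- With D = gₙ - g one has |g² - gₙ²| ≤ D² + 2 sup|g| |D|. The linear terms are handled by |D| ≤
D²/δ + δ with δ fixed before n, in place of the Cauchy–Schwarz inequality. -/
lemma tendsto_integral_abs_of_sq {g : ℝ → ℝ} {gn : ℕ → ℝ → ℝ} (cg : Continuous g)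
    (cgn : ∀ n, Continuous (gn n)) {r : ℝ} (hr : 0 ≤ r)
    (h : Tendsto (fun n => ∫ s in (-r)..r, (gn n s - g s) ^ 2) atTop (𝓝 0)) :
    Tendsto (fun n => ∫ s in (-r)..r, (|g s - gn n s| + |g s ^ 2 - gn n s ^ 2|))
      atTop (𝓝 0) := by
  have hrr : -r ≤ r := by linarith
  obtain ⟨ρ, hρ⟩ := (isCompact_Icc (a := -r) (b := r)).exists_bound_of_continuousOn cg.continuousOn
  have ρ0 : 0 ≤ ρ := (norm_nonneg _).trans (hρ r ⟨hrr, le_rfl⟩)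
  have bound : ∀ δ > 0, ∀ n, ∫ s in (-r)..r, (|g s - gn n s| + |g s ^ 2 - gn n s ^ 2|)
      ≤ ((1 + 2 * ρ) / δ + 1) * (∫ s in (-r)..r, (gn n s - g s) ^ 2)
        + 2 * r * ((1 + 2 * ρ) * δ) := by
    intro δ hδ n
    have cn := cgn n
    have i1 : ∫ s in (-r)..r, (|g s - gn n s| + |g s ^ 2 - gn n s ^ 2|) ≤
        ∫ s in (-r)..r, (((1 + 2 * ρ) / δ + 1) * (gn n s - g s) ^ 2 + (1 + 2 * ρ) * δ) :=
      intervalIntegral.integral_mono_on hrr (Continuous.intervalIntegrable (by fun_prop) _ _)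
        (Continuous.intervalIntegrable (by fun_prop) _ _) fun s hs => by
          set D := gn n s - g s with hD
          have h1 : g s ^ 2 - gn n s ^ 2 = -(D ^ 2) - 2 * g s * D := by rw [hD]; ring
          have h2 : |g s| ≤ ρ := hρ s hs
          have h3 : |g s - gn n s| = |D| := by rw [abs_sub_comm]
          have h4 : |g s ^ 2 - gn n s ^ 2| ≤ D ^ 2 + 2 * ρ * |D| := by
            rw [h1]
            refine (abs_sub _ _).trans ?_
            rw [abs_neg, abs_of_nonneg (sq_nonneg D), abs_mul, abs_mul, abs_two]
            gcongr
          have h5 : |D| ≤ D ^ 2 / δ + δ := by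
            rw [← sq_abs D, div_add' _ _ _ hδ.ne', le_div_iff₀ hδ]
            nlinarith [sq_nonneg (|D| - δ), abs_nonneg D, mul_nonneg (abs_nonneg D) hδ.le]
          have h6 := mul_le_mul_of_nonneg_left h5 (by positivity : 0 ≤ 1 + 2 * ρ)
          have h7 : (1 + 2 * ρ) * (D ^ 2 / δ + δ) = (1 + 2 * ρ) / δ * D ^ 2 + (1 + 2 * ρ) * δ := by
            ring
          rw [h3]
          linarith
    rw [intervalIntegral.integral_add (Continuous.intervalIntegrable (by fun_prop) _ _)
      intervalIntegrable_const, intervalIntegral.integral_const_mul,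
      intervalIntegral.integral_const, smul_eq_mul] at i1
    linarith
  rw [Metric.tendsto_atTop'] at *
  intro η hη
  set δ := η / (2 * (2 * r * (1 + 2 * ρ) + 1)) with hδ
  have δ0 : 0 < δ := by positivity
  set P := (1 + 2 * ρ) / δ + 1 with hP
  have P0 : 0 < P := by positivity
  obtain ⟨N, hN⟩ := h (η / (2 * P)) (by positivity)
  refine ⟨N, fun n hn => ?_⟩
  have h1 := hN n hn
  rw [Real.dist_eq, sub_zero] at h1 ⊢
  have h2 := le_abs_self (∫ s in (-r)..r, (gn n s - g s) ^ 2)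
  have h3 := mul_lt_mul_of_pos_left (h2.trans_lt h1) P0
  have h4 : P * (η / (2 * P)) = η / 2 := by field_simp
  have h5 : 2 * r * ((1 + 2 * ρ) * δ) ≤ η / 2 := by
    have e : (2 * r * (1 + 2 * ρ) + 1) * δ = η / 2 := by rw [hδ]; field_simp
    nlinarith
  rw [abs_of_nonneg (intervalIntegral.integral_nonneg hrr fun s _ => by positivity)]
  linarith [bound δ δ0 n]

variable {K : ℝ} {c : ℝ → ℝ} (h : IsSpeed K c)
include h

/-- The difference splits into c(vₙ)(vₙ' - v') and (c(vₙ) - c(v)) v', where v and vₙ are the initial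
values. The first part is small by L² convergence of the derivatives, the second by uniform
convergence of vₙ on [-r, r]. -/
lemma tendsto_integral_flux_sq {v₀ v₁ : ℝ → ℝ} {v₀n v₁n : ℕ → ℝ → ℝ} (hd : AdmissibleData v₀ v₁)
    (hdn : ∀ n, AdmissibleData (v₀n n) (v₁n n))
    (h0 : Tendsto (fun n => eLpNorm (fun x => deriv (v₀n n) x - deriv v₀ x) 2 volume)
      atTop (𝓝 0))
    (hv : ∀ C : Set ℝ, IsCompact C → TendstoUniformlyOn v₀n v₀ atTop C) {r : ℝ} (hr : 0 ≤ r) :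
    Tendsto (fun n => ∫ s in (-r)..r,
      (c (v₀n n s) * deriv (v₀n n) s - c (v₀ s) * deriv v₀ s) ^ 2) atTop (𝓝 0) := by
  have hrr : -r ≤ r := by linarith
  have hK := h.K_pos
  have cv := hd.continuous
  have cd := hd.continuous_deriv
  have cc := h.continuous
  obtain ⟨V, hV⟩ := (isCompact_Icc (a := -r) (b := r)).exists_bound_of_continuousOn cv.continuousOn
  obtain ⟨L, L0, hL⟩ := exists_bound_lipschitz (h.smooth.of_le (by simp) : ContDiff ℝ 1 c) (V + 1)
  set I := ∫ s in (-r)..r, deriv v₀ s ^ 2 with hI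
  have I0 : 0 ≤ I := intervalIntegral.integral_nonneg hrr fun s _ => sq_nonneg _
  have h1 := tendsto_integral_sq (fun n => (hdn n).deriv_memH1.memLp.sub hd.deriv_memH1.memLp) h0 hr
  simp only [Pi.sub_apply] at h1
  rw [Metric.tendsto_atTop'] at h1
  rw [Metric.tendsto_nhds]
  intro η hη
  set τ := min 1 (η / (4 * (L ^ 2 * I + 1))) with hτ
  have τ0 : 0 < τ := by positivity
  have hτ1 : τ ≤ 1 := min_le_left _ _
  obtain ⟨N, hN⟩ := h1 (η / (4 * K ^ 2)) (by positivity)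
  filter_upwards [Metric.tendstoUniformlyOn_iff.1 (hv _ (isCompact_Icc (a := -r) (b := r))) τ τ0,
    eventually_gt_atTop N] with n hn hnN
  have cvn := (hdn n).continuous
  have cdn := (hdn n).continuous_deriv
  have i1 : ∫ s in (-r)..r, (c (v₀n n s) * deriv (v₀n n) s - c (v₀ s) * deriv v₀ s) ^ 2 ≤
      ∫ s in (-r)..r, (2 * K ^ 2 * (deriv (v₀n n) s - deriv v₀ s) ^ 2
        + 2 * (L * τ) ^ 2 * deriv v₀ s ^ 2) :=
    intervalIntegral.integral_mono_on hrr (Continuous.intervalIntegrable (by fun_prop) _ _)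
      (Continuous.intervalIntegrable (by fun_prop) _ _) fun s hs => by
      have k1 : |v₀ s - v₀n n s| < τ := hn s hs
      have k2 : |v₀ s| ≤ V := hV s hs
      have k3 : |v₀n n s| ≤ V + 1 := by
        have := abs_sub_abs_le_abs_sub (v₀n n s) (v₀ s)
        rw [abs_sub_comm] at this
        linarith
      have k4 := (hL (v₀n n s) (v₀ s) k3 (by linarith)).2
      rw [abs_sub_comm (v₀n n s)] at k4
      have k5 : |c (v₀n n s) - c (v₀ s)| ≤ L * τ := k4.trans (by gcongr)
      have k6 : (c (v₀n n s) - c (v₀ s)) ^ 2 ≤ (L * τ) ^ 2 :=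
        sq_le_sq' (by linarith [(abs_le.1 k5).1]) (abs_le.1 k5).2
      have k7 : c (v₀n n s) ^ 2 ≤ K ^ 2 := by
        have := h.pos (v₀n n s)
        have := h.le (v₀n n s)
        gcongr
      have k8 := mul_le_mul_of_nonneg_right k7 (sq_nonneg (deriv (v₀n n) s - deriv v₀ s))
      have k9 := mul_le_mul_of_nonneg_right k6 (sq_nonneg (deriv v₀ s))
      have k10 := sq_nonneg (c (v₀n n s) * (deriv (v₀n n) s - deriv v₀ s)
        - (c (v₀n n s) - c (v₀ s)) * deriv v₀ s)
      nlinarith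
  rw [intervalIntegral.integral_add (Continuous.intervalIntegrable (by fun_prop) _ _)
    (Continuous.intervalIntegrable (by fun_prop) _ _), intervalIntegral.integral_const_mul,
    intervalIntegral.integral_const_mul, ← hI] at i1
  have j1 := hN n hnN
  rw [Real.dist_eq, sub_zero] at j1 ⊢
  have j2 := mul_lt_mul_of_pos_left ((le_abs_self _).trans_lt j1) (by positivity : 0 < 2 * K ^ 2)
  have j3 : 2 * K ^ 2 * (η / (4 * K ^ 2)) = η / 2 := by field_simp; norm_num
  have j4 : 2 * (L * τ) ^ 2 * I ≤ η / 2 := by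
    have e1 : τ ^ 2 ≤ η / (4 * (L ^ 2 * I + 1)) := by
      have : τ ≤ η / (4 * (L ^ 2 * I + 1)) := min_le_right _ _
      nlinarith
    have e2 : 2 * (L ^ 2 * I) * τ ^ 2 ≤ 2 * (L ^ 2 * I + 1) * (η / (4 * (L ^ 2 * I + 1))) := by
      gcongr; linarith
    have e3 : 2 * (L ^ 2 * I + 1) * (η / (4 * (L ^ 2 * I + 1))) = η / 2 := by field_simp; norm_num
    nlinarith
  rw [abs_of_nonneg (intervalIntegral.integral_nonneg hrr fun s _ => sq_nonneg _)]
  linarith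

/-- Convergence of the initial values of the Riemann variables. -/
lemma tendsto_integral_init {v₀ v₁ : ℝ → ℝ} {v₀n v₁n : ℕ → ℝ → ℝ} (hd : AdmissibleData v₀ v₁)
    (hdn : ∀ n, AdmissibleData (v₀n n) (v₁n n))
    (h0 : Tendsto (fun n => eLpNorm (fun x => deriv (v₀n n) x - deriv v₀ x) 2 volume)
      atTop (𝓝 0))
    (h1 : Tendsto (fun n => eLpNorm (fun x => v₁n n x - v₁ x) 2 volume) atTop (𝓝 0))
    (hv : ∀ C : Set ℝ, IsCompact C → TendstoUniformlyOn v₀n v₀ atTop C) {r : ℝ} (hr : 0 ≤ r) :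
    Tendsto (fun n => ∫ s in (-r)..r, (|initR c v₀ v₁ s - initR c (v₀n n) (v₁n n) s|
        + |initR c v₀ v₁ s ^ 2 - initR c (v₀n n) (v₁n n) s ^ 2|)) atTop (𝓝 0) ∧
      Tendsto (fun n => ∫ s in (-r)..r, (|initS c v₀ v₁ s - initS c (v₀n n) (v₁n n) s|
        + |initS c v₀ v₁ s ^ 2 - initS c (v₀n n) (v₁n n) s ^ 2|)) atTop (𝓝 0) := by
  have hrr : -r ≤ r := by linarith
  have t1 := tendsto_integral_flux_sq h hd hdn h0 hv hr
  have t2 := tendsto_integral_sq (fun n => (hdn n).vel_memH1.memLp.sub hd.vel_memH1.memLp) h1 hr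
  simp only [Pi.sub_apply] at t2
  have t3 := (t1.const_mul 2).add (t2.const_mul 2)
  rw [mul_zero, add_zero] at t3
  have cc := h.continuous
  have cv := hd.continuous
  have cd := hd.continuous_deriv
  have cw := hd.continuous_vel
  have i1 : ∀ n, ∀ σ : ℝ, σ ^ 2 = 1 → ∫ s in (-r)..r, ((v₁n n s - v₁ s)
      + σ * (c (v₀n n s) * deriv (v₀n n) s - c (v₀ s) * deriv v₀ s)) ^ 2 ≤
      2 * (∫ s in (-r)..r, (c (v₀n n s) * deriv (v₀n n) s - c (v₀ s) * deriv v₀ s) ^ 2)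
        + 2 * ∫ s in (-r)..r, (v₁n n s - v₁ s) ^ 2 := by
    intro n σ hσ
    have cvn := (hdn n).continuous
    have cdn := (hdn n).continuous_deriv
    have cwn := (hdn n).continuous_vel
    rw [← intervalIntegral.integral_const_mul, ← intervalIntegral.integral_const_mul,
      ← intervalIntegral.integral_add (Continuous.intervalIntegrable (by fun_prop) _ _)
      (Continuous.intervalIntegrable (by fun_prop) _ _)]
    refine intervalIntegral.integral_mono_on hrr (Continuous.intervalIntegrable (by fun_prop) _ _)
      (Continuous.intervalIntegrable (by fun_prop) _ _) fun s _ => ?_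
    set A := v₁n n s - v₁ s
    set E := c (v₀n n s) * deriv (v₀n n) s - c (v₀ s) * deriv v₀ s
    have e : (σ * E) ^ 2 = E ^ 2 := by rw [mul_pow, hσ, one_mul]
    nlinarith [sq_nonneg (A - σ * E)]
  constructor
  · refine tendsto_integral_abs_of_sq (hd.continuous_initR h)
      (fun n => (hdn n).continuous_initR h) hr ?_
    refine squeeze_zero (fun n => intervalIntegral.integral_nonneg hrr fun s _ => sq_nonneg _)
      (fun n => ?_) t3
    refine Eq.trans_le ?_ (i1 n 1 (by norm_num))
    congr 1; ext s; simp only [initR]; ring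
  · refine tendsto_integral_abs_of_sq (hd.continuous_initS h)
      (fun n => (hdn n).continuous_initS h) hr ?_
    refine squeeze_zero (fun n => intervalIntegral.integral_nonneg hrr fun s _ => sq_nonneg _)
      (fun n => ?_) t3
    refine Eq.trans_le ?_ (i1 n (-1) (by norm_num))
    congr 1; ext s; simp only [initS]; ring

end Data

/-! ### A diagonal problem with locally bounded, globally Lipschitz right-hand sides -/

section Goursat

variable {E : Type*} [NormedAddCommGroup E] [NormedSpace ℝ E]

lemma norm_integral_le_exp {h : ℝ → E} {L C a b : ℝ} (hL : 0 < L) (hC : 0 ≤ C)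
    (hh : ∀ η, min a b ≤ η → η ≤ max a b → ‖h η‖ ≤ C * Real.exp (L * |η - a|)) :
    ‖∫ η in a..b, h η‖ ≤ C / L * Real.exp (L * |b - a|) := by
  have key : ∀ d, 0 ≤ d → ∀ k : ℝ → E, (∀ s ∈ Icc 0 d, ‖k s‖ ≤ C * Real.exp (L * s)) →
      ‖∫ s in (0:ℝ)..d, k s‖ ≤ C / L * Real.exp (L * d) := by
    intro d hd k hk
    have h1 := intervalIntegral.norm_integral_le_of_norm_le (μ := volume) hd
      (Eventually.of_forall fun t ht => hk t ⟨ht.1.le, ht.2⟩)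
      (Continuous.intervalIntegrable (by fun_prop) _ _)
    rw [integral_eq_sub_of_continuous_deriv (f := fun s => C / L * Real.exp (L * s))
      (fun s => ((((hasDerivAt_id s).const_mul L).exp.const_mul (C / L)).congr_deriv (by
        simp only [id]; field_simp))) (by fun_prop)] at h1
    have h2 : 0 ≤ C / L * Real.exp (L * 0) := by positivity
    linarith
  rcases le_total a b with hab | hab
  · have e : ∫ η in a..b, h η = ∫ s in (0:ℝ)..(b - a), h (s + a) := by
      rw [intervalIntegral.integral_comp_add_right]; simp
    rw [e, abs_of_nonneg (sub_nonneg.2 hab)]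
    refine key _ (sub_nonneg.2 hab) _ fun s hs => ?_
    have := hh (s + a) (by rw [min_eq_left hab]; linarith [hs.1])
      (by rw [max_eq_right hab]; linarith [hs.2])
    rwa [add_sub_cancel_right, abs_of_nonneg hs.1] at this
  · have e : ∫ η in a..b, h η = -∫ s in (0:ℝ)..(a - b), h (a - s) := by
      rw [intervalIntegral.integral_comp_sub_left, intervalIntegral.integral_symm]; simp
    rw [e, norm_neg, abs_of_nonpos (sub_nonpos.2 hab), neg_sub]
    refine key _ (sub_nonneg.2 hab) _ fun s hs => ?_
    have := hh (a - s) (by rw [min_eq_right hab]; linarith [hs.2])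
      (by rw [max_eq_left hab]; linarith [hs.1])
    rwa [sub_sub_cancel_left, abs_neg, abs_of_nonneg hs.1] at this

lemma continuous_integral_column {f : ℝ → ℝ → E} (hf : Continuous fun P : ℝ × ℝ => f P.1 P.2) :
    Continuous fun P : ℝ × ℝ => ∫ η in P.1..P.2, f P.1 η := by
  have h1 : Continuous fun P : ℝ × ℝ => ∫ η in (0:ℝ)..P.2, f P.1 η :=
    intervalIntegral.continuous_parametric_primitive_of_continuous (μ := volume) (a₀ := (0:ℝ)) hf
  have h2 : Continuous fun P : ℝ × ℝ => ∫ η in (0:ℝ)..P.1, f P.1 η :=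
    h1.comp (continuous_fst.prodMk continuous_fst)
  refine (h1.sub h2).congr fun P => ?_
  have c1 : Continuous fun η => f P.1 η := hf.comp (continuous_const.prodMk continuous_id)
  exact intervalIntegral.integral_interval_sub_left (c1.intervalIntegrable _ _)
    (c1.intervalIntegrable _ _)

lemma continuous_integral_row {f : ℝ → ℝ → E} (hf : Continuous fun P : ℝ × ℝ => f P.1 P.2) :
    Continuous fun P : ℝ × ℝ => ∫ ξ in P.2..P.1, f ξ P.2 :=
  (continuous_integral_column (f := fun x y => f y x) (hf.comp continuous_swap)).comp
    continuous_swap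

lemma abs_le_max_of_mem_segment {a b η : ℝ} (h1 : min a b ≤ η) (h2 : η ≤ max a b) :
    |η| ≤ max |a| |b| := by
  rw [abs_le]
  constructor
  · have k1 := neg_abs_le a
    have k2 := neg_abs_le b
    rcases min_choice a b with h | h <;> rw [h] at h1
    · linarith [le_max_left |a| |b|]
    · linarith [le_max_right |a| |b|]
  · have k1 := le_abs_self a
    have k2 := le_abs_self b
    rcases max_choice a b with h | h <;> rw [h] at h2
    · linarith [le_max_left |a| |b|]
    · linarith [le_max_right |a| |b|]

/-- The exponential weight with rate `2 Λ(max(|α|,|β|))` controls integration from the diagonal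
along either family of lines. -/
lemma norm_integral_column_le {Λ : ℝ → ℝ} (mono : Monotone Λ) (pos : ∀ s, 0 < Λ s) {D a b : ℝ}
    (hD : 0 ≤ D) {h : ℝ → E} (hh : ∀ η, min a b ≤ η → η ≤ max a b →
      ‖h η‖ ≤ Λ (max |a| |η|) * (D * Real.exp (2 * Λ (max |a| |η|) * |η - a|))) :
    ‖∫ η in a..b, h η‖ ≤ 1 / 2 * D * Real.exp (2 * Λ (max |a| |b|) * |b - a|) := by
  have hL := pos (max |a| |b|)
  have := norm_integral_le_exp (h := h) (L := 2 * Λ (max |a| |b|)) (C := Λ (max |a| |b|) * D)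
    (a := a) (b := b) (by positivity) (by positivity) fun η h1 h2 => by
      have h3 : Λ (max |a| |η|) ≤ Λ (max |a| |b|) :=
        mono (max_le (le_max_left _ _) (abs_le_max_of_mem_segment h1 h2))
      have h4 := (pos (max |a| |η|)).le
      refine (hh η h1 h2).trans ?_
      rw [mul_assoc (Λ (max |a| |b|))]
      gcongr
  refine this.trans_eq ?_
  field_simp

/-- Existence of a global solution of the Goursat-type problem
`∂_β A = f(α,β,A,B)`, `∂_α B = g(α,β,A,B)` with `A`, `B` prescribed on the diagonal. -/
theorem exists_diagonal_problem [CompleteSpace E] {Λ : ℝ → ℝ} (cΛ : Continuous Λ)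
    (mono : Monotone Λ) (pos : ∀ s, 0 < Λ s) {f g : ℝ → ℝ → E → E → E}
    (cf : Continuous fun Q : (ℝ × ℝ) × E × E => f Q.1.1 Q.1.2 Q.2.1 Q.2.2)
    (cg : Continuous fun Q : (ℝ × ℝ) × E × E => g Q.1.1 Q.1.2 Q.2.1 Q.2.2)
    (bf : ∀ a b x y, ‖f a b x y‖ ≤ Λ (max |a| |b|))
    (bg : ∀ a b x y, ‖g a b x y‖ ≤ Λ (max |a| |b|))
    (lf : ∀ a b x y x' y', ‖f a b x y - f a b x' y'‖
      ≤ Λ (max |a| |b|) * max ‖x - x'‖ ‖y - y'‖)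
    (lg : ∀ a b x y x' y', ‖g a b x y - g a b x' y'‖
      ≤ Λ (max |a| |b|) * max ‖x - x'‖ ‖y - y'‖)
    {φ ψ : ℝ → E} (cφ : Continuous φ) (cψ : Continuous ψ) :
    ∃ A B : ℝ → ℝ → E, (Continuous fun P : ℝ × ℝ => A P.1 P.2) ∧
      (Continuous fun P : ℝ × ℝ => B P.1 P.2) ∧ (∀ s, A s s = φ s) ∧ (∀ s, B s s = ψ s) ∧
      (∀ a b, HasDerivAt (fun y => A a y) (f a b (A a b) (B a b)) b) ∧
      ∀ a b, HasDerivAt (fun x => B x b) (g a b (A a b) (B a b)) a := by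
  set W : ℝ → ℝ → ℝ := fun a b => 2 * Λ (max |a| |b|) * |b - a| with hW
  have cW : Continuous fun P : ℝ × ℝ => W P.1 P.2 := by simp only [hW]; fun_prop
  have cE : Continuous fun P : ℝ × ℝ => Real.exp (W P.1 P.2) := Real.continuous_exp.comp cW
  have cE' : Continuous fun P : ℝ × ℝ => Real.exp (-W P.1 P.2) := Real.continuous_exp.comp cW.neg
  have W0 : ∀ a b, 0 ≤ W a b := fun a b => by
    have := (pos (max |a| |b|)).le
    simp only [hW]; positivity
  -- The unknown of the fixed-point problem is the deviation from the diagonal values divided by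
  -- exp(W). It is bounded on the whole plane although Λ may grow, so one contraction gives a global
  -- solution.
  let A : (ℝ × ℝ →ᵇ E × E) → ℝ → ℝ → E := fun Y a b => φ a + Real.exp (W a b) • (Y (a, b)).1
  let B : (ℝ × ℝ →ᵇ E × E) → ℝ → ℝ → E := fun Y a b => ψ b + Real.exp (W a b) • (Y (a, b)).2
  have cA : ∀ Y, Continuous fun P : ℝ × ℝ => A Y P.1 P.2 := fun Y =>
    (cφ.comp continuous_fst).add (cE.smul Y.continuous.fst)
  have cB : ∀ Y, Continuous fun P : ℝ × ℝ => B Y P.1 P.2 := fun Y =>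
    (cψ.comp continuous_snd).add (cE.smul Y.continuous.snd)
  let F : (ℝ × ℝ →ᵇ E × E) → ℝ → ℝ → E := fun Y a b => f a b (A Y a b) (B Y a b)
  let G : (ℝ × ℝ →ᵇ E × E) → ℝ → ℝ → E := fun Y a b => g a b (A Y a b) (B Y a b)
  have cF : ∀ Y, Continuous fun P : ℝ × ℝ => F Y P.1 P.2 := fun Y =>
    cf.comp (continuous_id.prodMk ((cA Y).prodMk (cB Y)))
  have cG : ∀ Y, Continuous fun P : ℝ × ℝ => G Y P.1 P.2 := fun Y =>
    cg.comp (continuous_id.prodMk ((cA Y).prodMk (cB Y)))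
  have swapW : ∀ a b, W a b = 2 * Λ (max |b| |a|) * |a - b| := fun a b => by
    rw [hW, max_comm, abs_sub_comm]
  have contr : ∀ (a b : ℝ) (x : E) (D : ℝ), ‖x‖ ≤ 1 / 2 * D * Real.exp (W a b) →
      ‖Real.exp (-W a b) • x‖ ≤ 1 / 2 * D := by
    intro a b x D hx
    rw [norm_smul, Real.norm_of_nonneg (Real.exp_pos _).le]
    calc _ ≤ Real.exp (-W a b) * (1 / 2 * D * Real.exp (W a b)) := by gcongr
      _ = 1 / 2 * D * Real.exp (-W a b + W a b) := by rw [Real.exp_add]; ring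
      _ = _ := by simp
  have bnd : ∀ Λ' w : ℝ, 0 < Λ' → 0 ≤ w → Λ' ≤ Λ' * (1 * Real.exp w) := fun Λ' w h1 h2 => by
    have := Real.one_le_exp h2
    nlinarith
  let T : (ℝ × ℝ →ᵇ E × E) → (ℝ × ℝ →ᵇ E × E) := fun Y =>
    BoundedContinuousFunction.ofNormedAddCommGroup
      (fun P => (Real.exp (-W P.1 P.2) • ∫ η in P.1..P.2, F Y P.1 η,
        Real.exp (-W P.1 P.2) • ∫ ξ in P.2..P.1, G Y ξ P.2))
      ((cE'.smul (continuous_integral_column (cF Y))).prodMk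
        (cE'.smul (continuous_integral_row (cG Y)))) (1 / 2 * 1) (by
      rintro ⟨a, b⟩
      refine max_le (contr a b _ _ ?_) (contr a b _ _ ?_)
      · exact norm_integral_column_le mono pos zero_le_one fun η _ _ =>
          (bf _ _ _ _).trans (bnd _ _ (pos _) (W0 a η))
      · rw [swapW]
        refine norm_integral_column_le mono pos zero_le_one fun ξ _ _ => ?_
        refine (bg _ _ _ _).trans ?_
        rw [max_comm]
        refine bnd _ _ (pos _) ?_
        have := (pos (max |b| |ξ|)).le
        positivity)
  -- The rate 2Λ of the weight against the Lipschitz constant Λ produces the factor 1/2.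
  have hT : ContractingWith (1 / 2) T := by
    refine ⟨by norm_num, LipschitzWith.of_dist_le_mul fun Y Z => ?_⟩
    have hdA : ∀ a b, ‖A Y a b - A Z a b‖ ≤ dist Y Z * Real.exp (W a b) := fun a b => by
      have : A Y a b - A Z a b = Real.exp (W a b) • (Y (a, b) - Z (a, b)).1 := by
        simp only [A, Prod.fst_sub, smul_sub]; abel
      rw [this, norm_smul, Real.norm_of_nonneg (Real.exp_pos _).le, mul_comm]
      gcongr
      exact (norm_fst_le _).trans ((dist_eq_norm (Y (a, b)) (Z (a, b))).symm.trans_le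
        (BoundedContinuousFunction.dist_coe_le_dist _))
    have hdB : ∀ a b, ‖B Y a b - B Z a b‖ ≤ dist Y Z * Real.exp (W a b) := fun a b => by
      have : B Y a b - B Z a b = Real.exp (W a b) • (Y (a, b) - Z (a, b)).2 := by
        simp only [B, Prod.snd_sub, smul_sub]; abel
      rw [this, norm_smul, Real.norm_of_nonneg (Real.exp_pos _).le, mul_comm]
      gcongr
      exact (norm_snd_le _).trans ((dist_eq_norm (Y (a, b)) (Z (a, b))).symm.trans_le
        (BoundedContinuousFunction.dist_coe_le_dist _))
    have hdF : ∀ a b, ‖F Y a b - F Z a b‖ ≤ Λ (max |a| |b|) * (dist Y Z * Real.exp (W a b)) :=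
      fun a b => (lf _ _ _ _ _ _).trans
        (mul_le_mul_of_nonneg_left (max_le (hdA a b) (hdB a b)) (pos _).le)
    have hdG : ∀ a b, ‖G Y a b - G Z a b‖ ≤ Λ (max |a| |b|) * (dist Y Z * Real.exp (W a b)) :=
      fun a b => (lg _ _ _ _ _ _).trans
        (mul_le_mul_of_nonneg_left (max_le (hdA a b) (hdB a b)) (pos _).le)
    have e : ((1 / 2 : NNReal) : ℝ) * dist Y Z = 1 / 2 * dist Y Z := by push_cast; rfl
    rw [e, BoundedContinuousFunction.dist_le (by positivity)]
    rintro ⟨a, b⟩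
    rw [dist_eq_norm]
    refine max_le ?_ ?_
    · have i : ∀ Y : ℝ × ℝ →ᵇ E × E, IntervalIntegrable (fun η => F Y a η) volume a b := fun Y =>
        ((cF Y).comp (continuous_const.prodMk continuous_id)).intervalIntegrable _ _
      change ‖Real.exp (-W a b) • (∫ η in a..b, F Y a η)
        - Real.exp (-W a b) • ∫ η in a..b, F Z a η‖ ≤ _
      rw [← smul_sub, ← intervalIntegral.integral_sub (i Y) (i Z)]
      exact contr a b _ _ (norm_integral_column_le mono pos dist_nonneg fun η _ _ => hdF a η)
    · have i : ∀ Y : ℝ × ℝ →ᵇ E × E, IntervalIntegrable (fun ξ => G Y ξ b) volume b a := fun Y =>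
        ((cG Y).comp (continuous_id.prodMk continuous_const)).intervalIntegrable _ _
      change ‖Real.exp (-W a b) • (∫ ξ in b..a, G Y ξ b)
        - Real.exp (-W a b) • ∫ ξ in b..a, G Z ξ b‖ ≤ _
      rw [← smul_sub, ← intervalIntegral.integral_sub (i Y) (i Z)]
      refine contr a b _ _ ?_
      rw [swapW]
      refine norm_integral_column_le mono pos dist_nonneg fun ξ _ _ => ?_
      have := hdG ξ b
      rwa [swapW, max_comm |ξ|] at this
  set Y := hT.fixedPoint T with hY
  have fix : T Y = Y := hT.fixedPoint_isFixedPt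
  have cancel : ∀ a b (x : E), Real.exp (W a b) • Real.exp (-W a b) • x = x := fun a b x => by
    rw [smul_smul, ← Real.exp_add]; simp
  have eA : ∀ a b, A Y a b = φ a + ∫ η in a..b, F Y a η := fun a b => by
    have : (Y (a, b)).1 = Real.exp (-W a b) • ∫ η in a..b, F Y a η := by
      conv_lhs => rw [← fix]
      rfl
    simp only [A, this, cancel]
  have eB : ∀ a b, B Y a b = ψ b + ∫ ξ in b..a, G Y ξ b := fun a b => by
    have : (Y (a, b)).2 = Real.exp (-W a b) • ∫ ξ in b..a, G Y ξ b := by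
      conv_lhs => rw [← fix]
      rfl
    simp only [B, this, cancel]
  refine ⟨A Y, B Y, cA Y, cB Y, fun s => by simp [eA], fun s => by simp [eB], fun a b => ?_,
    fun a b => ?_⟩
  · have := ((cF Y).comp (continuous_const.prodMk continuous_id :
      Continuous fun η : ℝ => (a, η))).integral_hasStrictDerivAt a b
    exact (this.hasDerivAt.const_add (φ a)).congr_of_eventuallyEq
      (Eventually.of_forall fun y => eA a y)
  · have := ((cG Y).comp (continuous_id.prodMk continuous_const :
      Continuous fun ξ : ℝ => (ξ, b))).integral_hasStrictDerivAt b a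
    exact (this.hasDerivAt.const_add (ψ b)).congr_of_eventuallyEq
      (Eventually.of_forall fun x => eB x b)

end Goursat

/-! ### Angle variables -/

section RealAnalysis

lemma eq_mul_exp_of_hasDerivAt {f f' k : ℝ → ℝ} (hf : ∀ x, HasDerivAt f (f' x) x)
    (ck : Continuous k) {a b : ℝ} (h : ∀ x ∈ uIcc a b, f' x = k x * f x) :
    f b = f a * Real.exp (∫ x in a..b, k x) := by
  set I : ℝ → ℝ := fun x => ∫ s in a..x, k s with hI
  have dI : ∀ x, HasDerivAt I (k x) x := fun x => (ck.integral_hasStrictDerivAt a x).hasDerivAt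
  have d : ∀ x, HasDerivAt (fun x => f x * Real.exp (-I x))
      ((f' x - k x * f x) * Real.exp (-I x)) x := fun x =>
    ((hf x).mul (dI x).neg.exp).congr_deriv (by simp only [Pi.neg_apply]; ring)
  have key : ∀ x y, x ≤ y → Icc x y ⊆ uIcc a b →
      f y * Real.exp (-I y) = f x * Real.exp (-I x) := fun x y hxy hs => by
    have := abs_sub_le_integral d (continuous_const (y := (0:ℝ))) hxy fun s hs' => by
      rw [h s (hs hs'), sub_self, zero_mul, abs_zero]
    rw [intervalIntegral.integral_zero] at this
    exact sub_eq_zero.1 (abs_nonpos_iff.1 this)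
  have e : f b * Real.exp (-I b) = f a * Real.exp (-I a) := by
    rcases le_total a b with hab | hab
    · exact key a b hab (Icc_subset_uIcc)
    · exact (key b a hab (Icc_subset_uIcc')).symm
  have e0 : I a = 0 := by simp [hI]
  rw [e0, neg_zero, Real.exp_zero, mul_one] at e
  rw [← e, mul_assoc, ← Real.exp_add]
  simp [hI]

/-- By cos²(arctan r) = 1/(1 + r²), the angle 2 arctan r with density 1 + r² corresponds to (m, l,
n) = (1, r, r²). This identity and the next two give the diagonal values of the bilinear variables.
-/
lemma one_add_sq_mul_one_add_cos (r : ℝ) :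
    (1 + r ^ 2) * (1 + Real.cos (2 * Real.arctan r)) / 2 = 1 := by
  rw [Real.cos_two_mul, Real.cos_sq_arctan]
  have : 1 + r ^ 2 ≠ 0 := by positivity
  field_simp; ring

lemma one_add_sq_mul_one_sub_cos (r : ℝ) :
    (1 + r ^ 2) * (1 - Real.cos (2 * Real.arctan r)) / 2 = r ^ 2 := by
  rw [Real.cos_two_mul, Real.cos_sq_arctan]
  have : 1 + r ^ 2 ≠ 0 := by positivity
  field_simp; ring

lemma one_add_sq_mul_sin (r : ℝ) : (1 + r ^ 2) * Real.sin (2 * Real.arctan r) / 2 = r := by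
  have h1 : Real.sin (Real.arctan r) = r * Real.cos (Real.arctan r) := by
    have := Real.tan_arctan r
    rw [Real.tan_eq_sin_div_cos, div_eq_iff (Real.cos_arctan_pos r).ne'] at this
    exact this
  have h2 := Real.cos_sq_arctan r
  have : 1 + r ^ 2 ≠ 0 := by positivity
  rw [Real.sin_two_mul, h1]
  calc _ = (1 + r ^ 2) * (r * Real.cos (Real.arctan r) ^ 2) := by ring
    _ = r := by rw [h2]; field_simp

end RealAnalysis

/-- The `β`-derivative of the angle `w`. -/
noncomputable def angleW (c : ℝ → ℝ) (v w z q : ℝ) : ℝ :=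
  -(q * (deriv c v / (8 * c v ^ 2) * (Real.cos z - Real.cos w)
    - (v + v ^ 3) / (8 * c v) * ((1 + Real.cos z) * (1 + Real.cos w))))

/-- The logarithmic `β`-derivative of the density `p`. -/
noncomputable def angleP (c : ℝ → ℝ) (v w z q : ℝ) : ℝ :=
  -(q * (deriv c v / (8 * c v ^ 2) * (Real.sin z - Real.sin w)
    - (v + v ^ 3) / (8 * c v) * (Real.sin w * (1 + Real.cos z))))

section Polar

variable {c : ℝ → ℝ} {v y : ℝ}

/-- This turns the angle system into the bilinear one. The relation sin² + cos² = 1 is needed only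
in the equation for l. -/
lemma hasDerivAt_polar_left {w p : ℝ → ℝ} {z q : ℝ}
    (hw : HasDerivAt w (angleW c v (w y) z q) y)
    (hp : HasDerivAt p (p y * angleP c v (w y) z q) y) :
    HasDerivAt (fun y => p y * (1 + Real.cos (w y)) / 2)
      (flowΩ c v (p y * (1 + Real.cos (w y)) / 2) (p y * Real.sin (w y) / 2)
        (q * (1 + Real.cos z) / 2) (q * Real.sin z / 2)) y ∧
    HasDerivAt (fun y => p y * Real.sin (w y) / 2)
      (-flowΛ c v (p y * (1 + Real.cos (w y)) / 2) (p y * Real.sin (w y) / 2)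
        (p y * (1 - Real.cos (w y)) / 2)
        (q * (1 + Real.cos z) / 2) (q * Real.sin z / 2) (q * (1 - Real.cos z) / 2)) y ∧
    HasDerivAt (fun y => p y * (1 - Real.cos (w y)) / 2)
      (flowN c v (p y * Real.sin (w y) / 2) (p y * (1 - Real.cos (w y)) / 2)
        (q * Real.sin z / 2) (q * (1 - Real.cos z) / 2)
        + (v + v ^ 3) / (2 * c v) * (p y * Real.sin (w y) / 2 * (q * (1 + Real.cos z) / 2))) y := by
  have e1 : deriv c v / (4 * c v ^ 2) = 2 * (deriv c v / (8 * c v ^ 2)) := by ring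
  have e2 : (v + v ^ 3) / (2 * c v) = 4 * ((v + v ^ 3) / (8 * c v)) := by ring
  have e3 : (v + v ^ 3) / (4 * c v) = 2 * ((v + v ^ 3) / (8 * c v)) := by ring
  have trig := Real.sin_sq_add_cos_sq (w y)
  refine ⟨((hp.mul (hw.cos.const_add 1)).div_const 2).congr_deriv ?_,
    ((hp.mul hw.sin).div_const 2).congr_deriv ?_,
    ((hp.mul (hw.cos.const_sub 1)).div_const 2).congr_deriv ?_⟩ <;>
    simp only [angleW, angleP, flowΩ, flowΛ, flowN, e1, e2, e3]
  · ring
  · linear_combination (p y * q / 2 * (deriv c v / (8 * c v ^ 2)) + p y * q / 2 *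
      ((v + v ^ 3) / (8 * c v)) * (1 + Real.cos z)) * trig
  · ring

lemma hasDerivAt_polar_right {z q : ℝ → ℝ} {w p : ℝ}
    (hz : HasDerivAt z (-angleW c v (z y) w p) y)
    (hq : HasDerivAt q (-(q y * angleP c v (z y) w p)) y) :
    HasDerivAt (fun y => q y * (1 + Real.cos (z y)) / 2)
      (flowΩ c v (p * (1 + Real.cos w) / 2) (p * Real.sin w / 2)
        (q y * (1 + Real.cos (z y)) / 2) (q y * Real.sin (z y) / 2)) y ∧
    HasDerivAt (fun y => q y * Real.sin (z y) / 2)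
      (flowΛ c v (p * (1 + Real.cos w) / 2) (p * Real.sin w / 2) (p * (1 - Real.cos w) / 2)
        (q y * (1 + Real.cos (z y)) / 2) (q y * Real.sin (z y) / 2)
        (q y * (1 - Real.cos (z y)) / 2)) y ∧
    HasDerivAt (fun y => q y * (1 - Real.cos (z y)) / 2)
      (flowN c v (p * Real.sin w / 2) (p * (1 - Real.cos w) / 2)
        (q y * Real.sin (z y) / 2) (q y * (1 - Real.cos (z y)) / 2)
        - (v + v ^ 3) / (2 * c v) * (q y * Real.sin (z y) / 2 * (p * (1 + Real.cos w) / 2))) y := by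
  have e1 : deriv c v / (4 * c v ^ 2) = 2 * (deriv c v / (8 * c v ^ 2)) := by ring
  have e2 : (v + v ^ 3) / (2 * c v) = 4 * ((v + v ^ 3) / (8 * c v)) := by ring
  have e3 : (v + v ^ 3) / (4 * c v) = 2 * ((v + v ^ 3) / (8 * c v)) := by ring
  have trig := Real.sin_sq_add_cos_sq (z y)
  refine ⟨((hq.mul (hz.cos.const_add 1)).div_const 2).congr_deriv ?_,
    ((hq.mul hz.sin).div_const 2).congr_deriv ?_,
    ((hq.mul (hz.cos.const_sub 1)).div_const 2).congr_deriv ?_⟩ <;>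
    simp only [angleW, angleP, flowΩ, flowΛ, flowN, e1, e2, e3]
  · ring
  · linear_combination (-(q y * p / 2 * (deriv c v / (8 * c v ^ 2)) + q y * p / 2 *
      ((v + v ^ 3) / (8 * c v)) * (1 + Real.cos w))) * trig
  · ring

end Polar

/-- A global solution of the semilinear system in angle variables, in characteristic coordinates
`(α,β)` normalized so that the initial line is the diagonal. -/
structure AngleFlow (c R S v₀ : ℝ → ℝ) where
  (w z p q v : ℝ → ℝ → ℝ)
  cont_w : Continuous fun P : ℝ × ℝ => w P.1 P.2
  cont_z : Continuous fun P : ℝ × ℝ => z P.1 P.2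
  cont_p : Continuous fun P : ℝ × ℝ => p P.1 P.2
  cont_q : Continuous fun P : ℝ × ℝ => q P.1 P.2
  cont_v : Continuous fun P : ℝ × ℝ => v P.1 P.2
  w_b : ∀ a b, HasDerivAt (fun y => w a y) (angleW c (v a b) (w a b) (z a b) (q a b)) b
  p_b : ∀ a b, HasDerivAt (fun y => p a y) (p a b * angleP c (v a b) (w a b) (z a b) (q a b)) b
  z_a : ∀ a b, HasDerivAt (fun y => z y b) (-angleW c (v a b) (z a b) (w a b) (p a b)) a
  q_a : ∀ a b, HasDerivAt (fun y => q y b)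
    (-(q a b * angleP c (v a b) (z a b) (w a b) (p a b))) a
  v_a : ∀ a b, HasDerivAt (fun y => v y b) (p a b * Real.sin (w a b) / (4 * c (v a b))) a
  v_b : ∀ a b, HasDerivAt (fun y => v a y) (-(q a b * Real.sin (z a b) / (4 * c (v a b)))) b
  w_diag : ∀ s, w s s = 2 * Real.arctan (R s)
  z_diag : ∀ s, z s s = 2 * Real.arctan (S s)
  p_diag : ∀ s, p s s = 1 + R s ^ 2
  q_diag : ∀ s, q s s = 1 + S s ^ 2
  v_diag : ∀ s, v s s = v₀ s

namespace IsSpeed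

variable {K : ℝ} {c : ℝ → ℝ} (h : IsSpeed K c) {X : Type*} [TopologicalSpace X] {v w z q : X → ℝ}
include h

lemma continuous_coeff (cv : Continuous v) :
    (Continuous fun x => deriv c (v x) / (8 * c (v x) ^ 2)) ∧
      Continuous fun x => (v x + v x ^ 3) / (8 * c (v x)) := by
  have cc := h.continuous
  have h2 : Continuous fun x => deriv c (v x) := h.continuous_deriv.comp cv
  exact ⟨h2.div (by fun_prop) fun x => by have := h.pos (v x); positivity,
    (cv.add (cv.pow 3)).div (by fun_prop) fun x => by have := h.pos (v x); positivity⟩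

lemma continuous_angleW (cv : Continuous v) (cw : Continuous w) (cz : Continuous z)
    (cq : Continuous q) : Continuous fun x => angleW c (v x) (w x) (z x) (q x) := by
  obtain ⟨h1, h2⟩ := h.continuous_coeff cv
  unfold angleW
  fun_prop

lemma continuous_angleP (cv : Continuous v) (cw : Continuous w) (cz : Continuous z)
    (cq : Continuous q) : Continuous fun x => angleP c (v x) (w x) (z x) (q x) := by
  obtain ⟨h1, h2⟩ := h.continuous_coeff cv
  unfold angleP
  fun_prop

end IsSpeed

namespace AngleFlow

variable {K : ℝ} {c R S v₀ : ℝ → ℝ} (h : IsSpeed K c) (G : AngleFlow c R S v₀)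
include h

/-- Along β the density p solves a linear homogeneous equation, and it is positive on the diagonal.
-/
lemma p_pos (a b : ℝ) : 0 < G.p a b := by
  have ck := h.continuous_angleP (continuous_snd_slice G.cont_v a)
    (continuous_snd_slice G.cont_w a) (continuous_snd_slice G.cont_z a)
    (continuous_snd_slice G.cont_q a)
  rw [eq_mul_exp_of_hasDerivAt (fun y => G.p_b a y) ck (a := a) (b := b)
    fun y _ => mul_comm _ _, G.p_diag]
  positivity

lemma q_pos (a b : ℝ) : 0 < G.q a b := by
  have ck := h.continuous_angleP (continuous_fst_slice G.cont_v b)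
    (continuous_fst_slice G.cont_z b) (continuous_fst_slice G.cont_w b)
    (continuous_fst_slice G.cont_p b)
  rw [eq_mul_exp_of_hasDerivAt (fun y => G.q_a y b) ck.neg (a := b) (b := a)
    fun y _ => by simp only [Pi.neg_apply]; ring, G.q_diag]
  positivity

/-- The flow in bilinear variables that belongs to a solution in angle variables and a coordinate
map. -/
noncomputable def toCharFlow {t x : ℝ → ℝ → ℝ}
    (t_a : ∀ a b, HasDerivAt (fun y => t y b)
      (G.p a b * (1 + Real.cos (G.w a b)) / (4 * c (G.v a b))) a)
    (t_b : ∀ a b, HasDerivAt (fun y => t a y)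
      (-(G.q a b * (1 + Real.cos (G.z a b)) / (4 * c (G.v a b)))) b)
    (x_a : ∀ a b, HasDerivAt (fun y => x y b) (G.p a b * (1 + Real.cos (G.w a b)) / 4) a)
    (x_b : ∀ a b, HasDerivAt (fun y => x a y) (G.q a b * (1 + Real.cos (G.z a b)) / 4) b)
    (t_diag : ∀ s, t s s = 0) (x_diag : ∀ s, x s s = s) : CharFlow c R S v₀ where
  m a b := G.p a b * (1 + Real.cos (G.w a b)) / 2
  l a b := G.p a b * Real.sin (G.w a b) / 2
  n a b := G.p a b * (1 - Real.cos (G.w a b)) / 2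
  m' a b := G.q a b * (1 + Real.cos (G.z a b)) / 2
  l' a b := G.q a b * Real.sin (G.z a b) / 2
  n' a b := G.q a b * (1 - Real.cos (G.z a b)) / 2
  v := G.v
  t := t
  x := x
  cont_m := by have := G.cont_p; have := G.cont_w; fun_prop
  cont_l := by have := G.cont_p; have := G.cont_w; fun_prop
  cont_n := by have := G.cont_p; have := G.cont_w; fun_prop
  cont_m' := by have := G.cont_q; have := G.cont_z; fun_prop
  cont_l' := by have := G.cont_q; have := G.cont_z; fun_prop
  cont_n' := by have := G.cont_q; have := G.cont_z; fun_prop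
  cont_v := G.cont_v
  m_nonneg a b := div_nonneg (mul_nonneg (G.p_pos h a b).le
    (by linarith [Real.neg_one_le_cos (G.w a b)])) two_pos.le
  n_nonneg a b := div_nonneg (mul_nonneg (G.p_pos h a b).le
    (by linarith [Real.cos_le_one (G.w a b)])) two_pos.le
  m'_nonneg a b := div_nonneg (mul_nonneg (G.q_pos h a b).le
    (by linarith [Real.neg_one_le_cos (G.z a b)])) two_pos.le
  n'_nonneg a b := div_nonneg (mul_nonneg (G.q_pos h a b).le
    (by linarith [Real.cos_le_one (G.z a b)])) two_pos.le
  l_sq a b := by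
    linear_combination G.p a b ^ 2 / 4 * Real.sin_sq_add_cos_sq (G.w a b)
  l'_sq a b := by
    linear_combination G.q a b ^ 2 / 4 * Real.sin_sq_add_cos_sq (G.z a b)
  pos a b := by linarith [G.p_pos h a b]
  pos' a b := by linarith [G.q_pos h a b]
  m_b a b := (hasDerivAt_polar_left (G.w_b a b) (G.p_b a b)).1
  m'_a a b := (hasDerivAt_polar_right (G.z_a a b) (G.q_a a b)).1
  l_b a b := (hasDerivAt_polar_left (G.w_b a b) (G.p_b a b)).2.1
  l'_a a b := (hasDerivAt_polar_right (G.z_a a b) (G.q_a a b)).2.1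
  n_b a b := (hasDerivAt_polar_left (G.w_b a b) (G.p_b a b)).2.2
  n'_a a b := (hasDerivAt_polar_right (G.z_a a b) (G.q_a a b)).2.2
  v_a a b := (G.v_a a b).congr_deriv (by ring)
  v_b a b := (G.v_b a b).congr_deriv (by ring)
  t_a a b := (t_a a b).congr_deriv (by ring)
  t_b a b := (t_b a b).congr_deriv (by ring)
  x_a a b := (x_a a b).congr_deriv (by ring)
  x_b a b := (x_b a b).congr_deriv (by ring)
  m_diag s := by rw [G.p_diag, G.w_diag, one_add_sq_mul_one_add_cos]
  l_diag s := by rw [G.p_diag, G.w_diag, one_add_sq_mul_sin]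
  n_diag s := by rw [G.p_diag, G.w_diag, one_add_sq_mul_one_sub_cos]
  m'_diag s := by rw [G.q_diag, G.z_diag, one_add_sq_mul_one_add_cos]
  l'_diag s := by rw [G.q_diag, G.z_diag, one_add_sq_mul_sin]
  n'_diag s := by rw [G.q_diag, G.z_diag, one_add_sq_mul_one_sub_cos]
  v_diag := G.v_diag
  t_diag := t_diag
  x_diag := x_diag

/-- A coordinate map belonging to a solution in angle variables. -/
lemma exists_coord : ∃ t x : ℝ → ℝ → ℝ,
    (∀ a b, HasDerivAt (fun y => t y b)
      (G.p a b * (1 + Real.cos (G.w a b)) / (4 * c (G.v a b))) a) ∧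
    (∀ a b, HasDerivAt (fun y => t a y)
      (-(G.q a b * (1 + Real.cos (G.z a b)) / (4 * c (G.v a b)))) b) ∧
    (∀ a b, HasDerivAt (fun y => x y b) (G.p a b * (1 + Real.cos (G.w a b)) / 4) a) ∧
    (∀ a b, HasDerivAt (fun y => x a y) (G.q a b * (1 + Real.cos (G.z a b)) / 4) b) ∧
    (∀ s, t s s = 0) ∧ ∀ s, x s s = s := by
  have cw := G.cont_w
  have cz := G.cont_z
  have cp := G.cont_p
  have cq := G.cont_q
  have cv := G.cont_v
  have cc := h.continuous
  have cc' : Continuous fun P : ℝ × ℝ => deriv c (G.v P.1 P.2) := h.continuous_deriv.comp cv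
  have c0 : ∀ P : ℝ × ℝ, c (G.v P.1 P.2) ≠ 0 := fun P => (h.pos _).ne'
  have cΩ : Continuous fun P : ℝ × ℝ => flowΩ c (G.v P.1 P.2)
      (G.p P.1 P.2 * (1 + Real.cos (G.w P.1 P.2)) / 2) (G.p P.1 P.2 * Real.sin (G.w P.1 P.2) / 2)
      (G.q P.1 P.2 * (1 + Real.cos (G.z P.1 P.2)) / 2)
      (G.q P.1 P.2 * Real.sin (G.z P.1 P.2) / 2) := by
    unfold flowΩ
    refine Continuous.mul (cc'.div (by fun_prop) fun P => ?_) (by fun_prop)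
    have := c0 P
    positivity
  obtain ⟨x, x_a, x_b⟩ := exists_potential
    (A := fun a b => G.p a b * (1 + Real.cos (G.w a b)) / 2 / 2)
    (B := fun a b => G.q a b * (1 + Real.cos (G.z a b)) / 2 / 2) (by fun_prop) (by fun_prop)
    (C := fun a b => flowΩ c (G.v a b)
      (G.p a b * (1 + Real.cos (G.w a b)) / 2) (G.p a b * Real.sin (G.w a b) / 2)
      (G.q a b * (1 + Real.cos (G.z a b)) / 2) (G.q a b * Real.sin (G.z a b) / 2) / 2)
    (cΩ.div_const 2) (fun a b => (hasDerivAt_polar_left (G.w_b a b) (G.p_b a b)).1.div_const 2)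
    (fun a b => (hasDerivAt_polar_right (G.z_a a b) (G.q_a a b)).1.div_const 2)
  have cA : Continuous fun P : ℝ × ℝ =>
      G.p P.1 P.2 * (1 + Real.cos (G.w P.1 P.2)) / 2 / (2 * c (G.v P.1 P.2)) :=
    Continuous.div (by fun_prop) (by fun_prop) fun P => by have := c0 P; positivity
  have cB : Continuous fun P : ℝ × ℝ =>
      -(G.q P.1 P.2 * (1 + Real.cos (G.z P.1 P.2)) / 2 / (2 * c (G.v P.1 P.2))) :=
    (Continuous.div (by fun_prop) (by fun_prop) fun P => by have := c0 P; positivity).neg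
  have dc : ∀ (f : ℝ → ℝ) (f' y : ℝ), HasDerivAt f f' y →
      HasDerivAt (fun y => 2 * c (f y)) (2 * (deriv c (f y) * f')) y := fun f f' y hf =>
    ((h.hasDerivAt (f y)).comp y hf).const_mul 2
  obtain ⟨t, t_a, t_b⟩ := exists_potential
    (A := fun a b => G.p a b * (1 + Real.cos (G.w a b)) / 2 / (2 * c (G.v a b)))
    (B := fun a b => -(G.q a b * (1 + Real.cos (G.z a b)) / 2 / (2 * c (G.v a b))))
    (C := fun a b => deriv c (G.v a b) / (8 * c (G.v a b) ^ 3) *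
      (G.p a b * Real.sin (G.w a b) / 2 * (G.q a b * (1 + Real.cos (G.z a b)) / 2)
        + G.p a b * (1 + Real.cos (G.w a b)) / 2 * (G.q a b * Real.sin (G.z a b) / 2))) cA cB
    (by
      refine Continuous.mul (cc'.div (by fun_prop) fun P => ?_) (by fun_prop)
      have := c0 P
      positivity)
    (fun a b => by
      have hc := c0 (a, b)
      simp only at hc
      refine ((hasDerivAt_polar_left (G.w_b a b) (G.p_b a b)).1.div (dc _ _ _ (G.v_b a b)) (by positivity)).congr_deriv ?_
      unfold flowΩ
      field_simp
      ring)
    (fun a b => by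
      have hc := c0 (a, b)
      simp only at hc
      refine ((hasDerivAt_polar_right (G.z_a a b) (G.q_a a b)).1.div (dc _ _ _ (G.v_a a b)) (by positivity)).neg.congr_deriv ?_
      unfold flowΩ
      field_simp
      ring)
  have hm : ∀ s, G.p s s * (1 + Real.cos (G.w s s)) / 2 = 1 := fun s => by
    rw [G.p_diag, G.w_diag, one_add_sq_mul_one_add_cos]
  have hm' : ∀ s, G.q s s * (1 + Real.cos (G.z s s)) / 2 = 1 := fun s => by
    rw [G.q_diag, G.z_diag, one_add_sq_mul_one_add_cos]
  -- On the diagonal m = m' = 1, so t_α + t_β = 0 and x_α + x_β = 1. Subtracting constants from the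
  -- potentials normalizes them on the whole diagonal.
  have dt : ∀ s, t s s = t 0 0 := fun s => by
    have := integral_eq_sub_of_continuous_deriv (f' := fun _ => (0:ℝ))
      (fun s => (hasDerivAt_diagonal_of_partials t_a t_b cA cB s).congr_deriv (by
        rw [hm, hm']; ring)) continuous_const 0 s
    rw [intervalIntegral.integral_zero] at this
    linarith
  have dx : ∀ s, x s s = x 0 0 + s := fun s => by
    have := integral_eq_sub_of_continuous_deriv (f' := fun _ => (1:ℝ))
      (fun s => (hasDerivAt_diagonal_of_partials x_a x_b (by fun_prop) (by fun_prop) s).congr_deriv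
        (by rw [hm, hm']; ring)) continuous_const 0 s
    rw [intervalIntegral.integral_const, smul_eq_mul] at this
    linarith
  refine ⟨fun a b => t a b - t 0 0, fun a b => x a b - x 0 0, fun a b => ?_, fun a b => ?_,
    fun a b => ?_, fun a b => ?_, fun s => by simp [dt s], fun s => by simp [dx s]⟩
  · exact ((t_a a b).sub_const _).congr_deriv (by ring)
  · exact ((t_b a b).sub_const _).congr_deriv (by ring)
  · exact ((x_a a b).sub_const _).congr_deriv (by ring)
  · exact ((x_b a b).sub_const _).congr_deriv (by ring)

end AngleFlow

/-! ### The truncated system, and why the truncation is inactive -/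

/-- Truncation to `[-M, M]`. -/
noncomputable def clip (M x : ℝ) : ℝ := max (-M) (min M x)

lemma clip_eq {M x : ℝ} (h : |x| ≤ M) : clip M x = x := by
  rw [clip, min_eq_right (abs_le.1 h).2, max_eq_right (abs_le.1 h).1]

lemma abs_clip_le {M : ℝ} (hM : 0 ≤ M) (x : ℝ) : |clip M x| ≤ M :=
  abs_le.2 ⟨le_max_left _ _, max_le (by linarith) (min_le_left _ _)⟩

lemma abs_clip_sub_le (M x y : ℝ) : |clip M x - clip M y| ≤ |x - y| := by
  have h1 := abs_max_sub_max_le_max (-M) (min M x) (-M) (min M y)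
  have h2 := abs_min_sub_min_le_max M x M y
  rw [sub_self, abs_zero, max_eq_right (a := (0:ℝ)) (abs_nonneg _)] at h1 h2
  exact h1.trans h2

/-- A function whose derivative is bounded below by a positive constant has a differentiable
inverse. -/
lemma exists_inverse_of_hasDerivAt_ge {F ρ : ℝ → ℝ} {m : ℝ} (hm : 0 < m)
    (hF : ∀ x, HasDerivAt F (ρ x) x) (hρ : ∀ x, m ≤ ρ x) :
    ∃ H : ℝ → ℝ, Continuous H ∧ (∀ y, F (H y) = y) ∧ (∀ x, H (F x) = x) ∧
      ∀ y, HasDerivAt H (ρ (H y))⁻¹ y := by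
  have mono : Monotone fun s => F s - m * s :=
    monotone_of_hasDerivAt_nonneg (fun s => (hF s).sub ((hasDerivAt_id s).const_mul m))
      fun s => by simpa using hρ s
  have le : ∀ x y, m * |x - y| ≤ |F x - F y| := fun x y => by
    rcases le_total x y with hxy | hxy <;> have := mono hxy <;> simp only at this
    · rw [abs_sub_comm x, abs_sub_comm (F x), abs_of_nonneg (by linarith)]
      exact le_trans (by linarith) (le_abs_self _)
    · rw [abs_of_nonneg (by linarith)]
      exact le_trans (by linarith) (le_abs_self _)
  have inj : Function.Injective F := fun x y hxy => by
    have := le x y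
    rw [hxy, sub_self, abs_zero] at this
    exact sub_eq_zero.1 (abs_nonpos_iff.1 (by nlinarith [abs_nonneg (x - y)]))
  have surj : Function.Surjective F := by
    refine (continuous_iff_continuousAt.2 fun v => (hF v).continuousAt).surjective ?_ ?_
    · refine tendsto_atTop_mono' _ (f₁ := fun s => F 0 + m * s) ?_
        (tendsto_atTop_add_const_left _ _ (tendsto_id.const_mul_atTop hm))
      filter_upwards [eventually_ge_atTop 0] with s hs
      have := mono hs
      simp only at this
      linarith
    · refine tendsto_atBot_mono' _ (f₂ := F) (f₁ := fun s => F 0 + m * s) ?_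
        (tendsto_atBot_add_const_left _ _ (tendsto_id.const_mul_atBot hm))
      filter_upwards [eventually_le_atBot 0] with s hs
      have := mono hs
      simp only at this
      linarith
  choose H hH using surj
  have lip : LipschitzWith (m⁻¹).toNNReal H := LipschitzWith.of_dist_le_mul fun x y => by
    have := le (H x) (H y)
    rw [hH, hH] at this
    rwa [Real.coe_toNNReal _ (inv_pos.2 hm).le, Real.dist_eq, Real.dist_eq, inv_mul_eq_div,
      le_div_iff₀' hm]
  exact ⟨H, lip.continuous, hH, fun v => inj (hH _), fun y =>
    HasDerivAt.of_local_left_inverse lip.continuous.continuousAt (hF (H y))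
      (hm.trans_le (hρ _)).ne' (Eventually.of_forall hH)⟩

namespace IsSpeed

variable {K : ℝ} {c : ℝ → ℝ} (h : IsSpeed K c)
include h

lemma exists_inverse : ∃ H : ℝ → ℝ, Continuous H ∧ (∀ y, speedPrimitive c (H y) = y) ∧
    (∀ v, H (speedPrimitive c v) = v) ∧ ∀ y, HasDerivAt H (1 / c (H y)) y := by
  simp only [one_div]
  exact exists_inverse_of_hasDerivAt_ge (inv_pos.2 h.K_pos) h.hasDerivAt_speedPrimitive
    fun s => (h.mem s).1

end IsSpeed

/-- A global solution of the truncated system in angle variables. The values `p`, `q` are truncated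
at a level that depends on the point, and `g`, `g'` are two candidates for the primitive of the
wave speed at `v`, integrated along the two families of characteristics. -/
structure ClippedFlow (c R S v₀ : ℝ → ℝ) (V : ℝ) (M : ℝ → ℝ) where
  (w p g' z q g v : ℝ → ℝ → ℝ)
  cont_w : Continuous fun P : ℝ × ℝ => w P.1 P.2
  cont_p : Continuous fun P : ℝ × ℝ => p P.1 P.2
  cont_g' : Continuous fun P : ℝ × ℝ => g' P.1 P.2
  cont_z : Continuous fun P : ℝ × ℝ => z P.1 P.2
  cont_q : Continuous fun P : ℝ × ℝ => q P.1 P.2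
  cont_g : Continuous fun P : ℝ × ℝ => g P.1 P.2
  cont_v : Continuous fun P : ℝ × ℝ => v P.1 P.2
  w_b : ∀ a b, HasDerivAt (fun y => w a y)
    (angleW c (clip V (v a b)) (w a b) (z a b) (clip (M (max |a| |b|)) (q a b))) b
  p_b : ∀ a b, HasDerivAt (fun y => p a y) (clip (M (max |a| |b|)) (p a b) *
    angleP c (clip V (v a b)) (w a b) (z a b) (clip (M (max |a| |b|)) (q a b))) b
  g'_b : ∀ a b, HasDerivAt (fun y => g' a y)
    (-(clip (M (max |a| |b|)) (q a b) * Real.sin (z a b) / 4)) b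
  z_a : ∀ a b, HasDerivAt (fun y => z y b)
    (-angleW c (clip V (v a b)) (z a b) (w a b) (clip (M (max |a| |b|)) (p a b))) a
  q_a : ∀ a b, HasDerivAt (fun y => q y b) (-(clip (M (max |a| |b|)) (q a b) *
    angleP c (clip V (v a b)) (z a b) (w a b) (clip (M (max |a| |b|)) (p a b)))) a
  g_a : ∀ a b, HasDerivAt (fun y => g y b)
    (clip (M (max |a| |b|)) (p a b) * Real.sin (w a b) / 4) a
  w_diag : ∀ s, w s s = 2 * Real.arctan (R s)
  p_diag : ∀ s, p s s = 1 + R s ^ 2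
  g'_diag : ∀ s, g' s s = speedPrimitive c (v₀ s)
  z_diag : ∀ s, z s s = 2 * Real.arctan (S s)
  q_diag : ∀ s, q s s = 1 + S s ^ 2
  g_diag : ∀ s, g s s = speedPrimitive c (v₀ s)
  speedPrimitive_v : ∀ a b, speedPrimitive c (v a b) = (g a b + g' a b) / 2

/-- Bounds for the data, and the truncation levels they lead to. -/
structure DataBounds (K : ℝ) (c R S v₀ : ℝ → ℝ) (E ρ V B : ℝ) (M : ℝ → ℝ) : Prop where
  R_le : ∀ s, 1 + R s ^ 2 ≤ ρ
  S_le : ∀ s, 1 + S s ^ 2 ≤ ρ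
  energy_le : ∀ a b, a ≤ b → ∫ s in a..b, (R s ^ 2 + S s ^ 2 + 2 * potentialF (v₀ s)) ≤ E
  v₀_lt : ∀ s, v₀ s ^ 2 + K * E < V ^ 2
  V_nonneg : 0 ≤ V
  hasDerivAt : ∀ s, HasDerivAt v₀ ((R s - S s) / (2 * c (v₀ s))) s
  continuous_R : Continuous R
  continuous_S : Continuous S
  coeff_le : ∀ v, |v| ≤ V → |deriv c v / (8 * c v ^ 2)| ≤ B ∧ |(v + v ^ 3) / (8 * c v)| ≤ B
  M_eq : ∀ s, M s = ρ * Real.exp (4 * B * (E + 4 * s)) + 1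

namespace DataBounds

variable {K : ℝ} {c R S v₀ : ℝ → ℝ} {E ρ V B : ℝ} {M : ℝ → ℝ} (D : DataBounds K c R S v₀ E ρ V B M)
include D

lemma rev : DataBounds K c (fun s => -S s) (fun s => -R s) v₀ E ρ V B M where
  R_le s := by rw [neg_sq]; exact D.S_le s
  S_le s := by rw [neg_sq]; exact D.R_le s
  energy_le a b hab := by
    simp only [neg_sq]
    simpa only [add_comm] using D.energy_le a b hab
  v₀_lt := D.v₀_lt
  V_nonneg := D.V_nonneg
  hasDerivAt s := (D.hasDerivAt s).congr_deriv (by ring)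
  continuous_R := D.continuous_S.neg
  continuous_S := D.continuous_R.neg
  coeff_le := D.coeff_le
  M_eq := D.M_eq

lemma B_nonneg : 0 ≤ B := (abs_nonneg _).trans (D.coeff_le 0 (by simpa using D.V_nonneg)).1

lemma continuous_v₀ : Continuous v₀ :=
  continuous_iff_continuousAt.2 fun s => (D.hasDerivAt s).continuousAt

end DataBounds

namespace ClippedFlow

variable {K : ℝ} {c R S v₀ : ℝ → ℝ} {E ρ V B : ℝ} {M : ℝ → ℝ}

/-- Time reversal. -/
def rev (X : ClippedFlow c R S v₀ V M) :
    ClippedFlow c (fun s => -S s) (fun s => -R s) v₀ V M where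
  w a b := -X.z b a
  p a b := X.q b a
  g' a b := X.g b a
  z a b := -X.w b a
  q a b := X.p b a
  g a b := X.g' b a
  v a b := X.v b a
  cont_w := (X.cont_z.comp continuous_swap).neg
  cont_p := X.cont_q.comp continuous_swap
  cont_g' := X.cont_g.comp continuous_swap
  cont_z := (X.cont_w.comp continuous_swap).neg
  cont_q := X.cont_p.comp continuous_swap
  cont_g := X.cont_g'.comp continuous_swap
  cont_v := X.cont_v.comp continuous_swap
  w_b a b := (X.z_a b a).neg.congr_deriv (by rw [max_comm]; simp [angleW])
  p_b a b := (X.q_a b a).congr_deriv (by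
    rw [max_comm]; simp only [angleP, Real.sin_neg, Real.cos_neg]; ring)
  g'_b a b := (X.g_a b a).congr_deriv (by rw [max_comm]; simp only [Real.sin_neg]; ring)
  z_a a b := (X.w_b b a).neg.congr_deriv (by rw [max_comm]; simp [angleW])
  q_a a b := (X.p_b b a).congr_deriv (by
    rw [max_comm]; simp only [angleP, Real.sin_neg, Real.cos_neg]; ring)
  g_a a b := (X.g'_b b a).congr_deriv (by rw [max_comm]; simp only [Real.sin_neg]; ring)
  w_diag s := by rw [X.z_diag, Real.arctan_neg]; ring
  p_diag s := by rw [X.q_diag, neg_sq]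
  g'_diag := X.g_diag
  z_diag s := by rw [X.w_diag, Real.arctan_neg]; ring
  q_diag s := by rw [X.p_diag, neg_sq]
  g_diag := X.g'_diag
  speedPrimitive_v a b := by rw [X.speedPrimitive_v]; ring

variable (X : ClippedFlow c R S v₀ V M)

/-- The truncation is inactive at `(a,b)`. -/
def Inactive (a b : ℝ) : Prop :=
  |X.v a b| ≤ V ∧ |X.p a b| ≤ M (max |a| |b|) ∧ |X.q a b| ≤ M (max |a| |b|)

/-- The truncation is inactive on the triangle with the corner `(a₀,b₀)`. -/
def InactiveBelow (a₀ b₀ : ℝ) : Prop := ∀ a b, b₀ ≤ b → b ≤ a → a ≤ a₀ → X.Inactive a b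

lemma InactiveBelow.mono {X : ClippedFlow c R S v₀ V M} {a₀ b₀ a b : ℝ}
    (hX : X.InactiveBelow a₀ b₀) (hb : b₀ ≤ b) (ha : a ≤ a₀) : X.InactiveBelow a b :=
  fun _ _ h1 h2 h3 => hX _ _ (hb.trans h1) h2 (h3.trans ha)

noncomputable def m (a b : ℝ) : ℝ := X.p a b * (1 + Real.cos (X.w a b)) / 2
noncomputable def l (a b : ℝ) : ℝ := X.p a b * Real.sin (X.w a b) / 2
noncomputable def n (a b : ℝ) : ℝ := X.p a b * (1 - Real.cos (X.w a b)) / 2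
noncomputable def m' (a b : ℝ) : ℝ := X.q a b * (1 + Real.cos (X.z a b)) / 2
noncomputable def l' (a b : ℝ) : ℝ := X.q a b * Real.sin (X.z a b) / 2
noncomputable def n' (a b : ℝ) : ℝ := X.q a b * (1 - Real.cos (X.z a b)) / 2

lemma cont_m : Continuous fun P : ℝ × ℝ => X.m P.1 P.2 := by
  have := X.cont_p; have := X.cont_w; unfold m; fun_prop
lemma cont_l : Continuous fun P : ℝ × ℝ => X.l P.1 P.2 := by
  have := X.cont_p; have := X.cont_w; unfold l; fun_prop
lemma cont_n : Continuous fun P : ℝ × ℝ => X.n P.1 P.2 := by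
  have := X.cont_p; have := X.cont_w; unfold n; fun_prop
lemma cont_m' : Continuous fun P : ℝ × ℝ => X.m' P.1 P.2 := by
  have := X.cont_q; have := X.cont_z; unfold m'; fun_prop
lemma cont_l' : Continuous fun P : ℝ × ℝ => X.l' P.1 P.2 := by
  have := X.cont_q; have := X.cont_z; unfold l'; fun_prop
lemma cont_n' : Continuous fun P : ℝ × ℝ => X.n' P.1 P.2 := by
  have := X.cont_q; have := X.cont_z; unfold n'; fun_prop

variable {X}

lemma Inactive.hasDerivAt_b {a b : ℝ} (hX : X.Inactive a b) :
    HasDerivAt (fun y => X.m a y)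
      (flowΩ c (X.v a b) (X.m a b) (X.l a b) (X.m' a b) (X.l' a b)) b ∧
    HasDerivAt (fun y => X.l a y)
      (-flowΛ c (X.v a b) (X.m a b) (X.l a b) (X.n a b) (X.m' a b) (X.l' a b) (X.n' a b)) b ∧
    HasDerivAt (fun y => X.n a y) (flowN c (X.v a b) (X.l a b) (X.n a b) (X.l' a b) (X.n' a b)
      + (X.v a b + X.v a b ^ 3) / (2 * c (X.v a b)) * (X.l a b * X.m' a b)) b ∧
    HasDerivAt (fun y => X.g' a y) (-(X.l' a b / 2)) b := by
  obtain ⟨h1, h2, h3⟩ := hX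
  have dw := X.w_b a b
  have dp := X.p_b a b
  have dg := X.g'_b a b
  rw [clip_eq h1, clip_eq h3] at dw
  rw [clip_eq h1, clip_eq h2, clip_eq h3] at dp
  rw [clip_eq h3] at dg
  obtain ⟨k1, k2, k3⟩ := hasDerivAt_polar_left dw dp
  exact ⟨k1, k2, k3, dg.congr_deriv (by rw [l']; ring)⟩

lemma Inactive.hasDerivAt_a {a b : ℝ} (hX : X.Inactive a b) :
    HasDerivAt (fun y => X.m' y b)
      (flowΩ c (X.v a b) (X.m a b) (X.l a b) (X.m' a b) (X.l' a b)) a ∧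
    HasDerivAt (fun y => X.l' y b)
      (flowΛ c (X.v a b) (X.m a b) (X.l a b) (X.n a b) (X.m' a b) (X.l' a b) (X.n' a b)) a ∧
    HasDerivAt (fun y => X.n' y b) (flowN c (X.v a b) (X.l a b) (X.n a b) (X.l' a b) (X.n' a b)
      - (X.v a b + X.v a b ^ 3) / (2 * c (X.v a b)) * (X.l' a b * X.m a b)) a ∧
    HasDerivAt (fun y => X.g y b) (X.l a b / 2) a := by
  obtain ⟨h1, h2, h3⟩ := hX
  have dz := X.z_a a b
  have dq := X.q_a a b
  have dg := X.g_a a b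
  rw [clip_eq h1, clip_eq h2] at dz
  rw [clip_eq h1, clip_eq h2, clip_eq h3] at dq
  rw [clip_eq h2] at dg
  obtain ⟨k1, k2, k3⟩ := hasDerivAt_polar_right dz dq
  exact ⟨k1, k2, k3, dg.congr_deriv (by rw [l]; ring)⟩

variable (h : IsSpeed K c) {a b : ℝ} (hX : X.InactiveBelow a b) (hba : b ≤ a)
include hX hba

/-- The form l dα - l' dβ is closed where the truncation is inactive. Green's identity equates the
increments of g and g' along the two legs with the increment of the primitive of c at v₀ along the
diagonal. -/
lemma g_eq_g' (h : IsSpeed K c) (D : DataBounds K c R S v₀ E ρ V B M) : X.g a b = X.g' a b := by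
  have cl := X.cont_l
  have cl' := X.cont_l'
  have cm := X.cont_m
  have cm' := X.cont_m'
  have cn := X.cont_n
  have cn' := X.cont_n'
  have cv := X.cont_v
  have cc := h.continuous
  have cc' := h.continuous_deriv
  have cΛ : Continuous fun P : ℝ × ℝ => -flowΛ c (X.v P.1 P.2) (X.m P.1 P.2) (X.l P.1 P.2)
      (X.n P.1 P.2) (X.m' P.1 P.2) (X.l' P.1 P.2) (X.n' P.1 P.2) := by
    unfold flowΛ
    refine (((Continuous.div (by fun_prop) (by fun_prop) fun P => ?_).mul (by fun_prop)).sub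
      ((Continuous.div (by fun_prop) (by fun_prop) fun P => ?_).mul (by fun_prop))).neg <;>
    · have := h.pos (X.v P.1 P.2)
      positivity
  have key := integral_legs_eq_integral_diagonal (A := X.l) (B := fun a b => -X.l' a b) cl cl'.neg
    (C := fun a b => -flowΛ c (X.v a b) (X.m a b) (X.l a b) (X.n a b) (X.m' a b) (X.l' a b)
      (X.n' a b)) cΛ hba (fun ξ η h1 h2 h3 => (hX ξ η h1 h2 h3).hasDerivAt_b.2.1)
    (fun ξ η h1 h2 h3 => (hX ξ η h1 h2 h3).hasDerivAt_a.2.1.neg)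
  have e1 : ∫ ξ in b..a, X.l ξ b / 2 = X.g a b - X.g b b :=
    intervalIntegral.integral_eq_sub_of_hasDerivAt (f := fun ξ => X.g ξ b) (fun ξ hξ => by
      rw [uIcc_of_le hba] at hξ
      exact (hX ξ b le_rfl hξ.1 hξ.2).hasDerivAt_a.2.2.2)
      (((continuous_fst_slice cl b).div_const 2).intervalIntegrable _ _)
  have e2 : ∫ η in b..a, -(X.l' a η / 2) = X.g' a a - X.g' a b :=
    intervalIntegral.integral_eq_sub_of_hasDerivAt (f := fun η => X.g' a η) (fun η hη => by
      rw [uIcc_of_le hba] at hη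
      exact (hX a η hη.1 hη.2 le_rfl).hasDerivAt_b.2.2.2)
      (((continuous_snd_slice cl' a).div_const 2).neg.intervalIntegrable _ _)
  have e3 : ∫ s in b..a, (R s - S s) / 2 = speedPrimitive c (v₀ a) - speedPrimitive c (v₀ b) := by
    refine integral_eq_sub_of_continuous_deriv (f := fun s => speedPrimitive c (v₀ s))
      (fun s => ?_) ((D.continuous_R.sub D.continuous_S).div_const 2) b a
    refine ((h.hasDerivAt_speedPrimitive (v₀ s)).comp s (D.hasDerivAt s)).congr_deriv ?_
    have := (h.pos (v₀ s)).ne'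
    rw [Pi.sub_apply]
    field_simp
  have e4 : ∀ s, X.l s s + -X.l' s s = R s - S s := fun s => by
    rw [l, l', X.p_diag, X.w_diag, X.q_diag, X.z_diag, one_add_sq_mul_sin, one_add_sq_mul_sin]
    ring
  simp only [e4] at key
  rw [intervalIntegral.integral_div] at e1 e3
  rw [X.g_diag] at e1
  rw [X.g'_diag] at e2
  have e5 : ∫ η in b..a, -(X.l' a η / 2) = (∫ η in b..a, -X.l' a η) / 2 := by
    rw [← intervalIntegral.integral_div]
    congr 1; ext η; ring
  rw [e5] at e2
  linarith

lemma p_eq (h : IsSpeed K c) : X.p a b = (1 + R a ^ 2) *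
    Real.exp (∫ η in a..b, angleP c (X.v a η) (X.w a η) (X.z a η) (X.q a η)) := by
  have ck := h.continuous_angleP (continuous_snd_slice X.cont_v a)
    (continuous_snd_slice X.cont_w a) (continuous_snd_slice X.cont_z a)
    (continuous_snd_slice X.cont_q a)
  rw [eq_mul_exp_of_hasDerivAt (fun y => X.p_b a y) ck (a := a) (b := b)
    (fun y hy => ?_), X.p_diag]
  rw [uIcc_of_ge hba] at hy
  obtain ⟨h1, h2, h3⟩ := hX a y hy.1 hy.2 le_rfl
  rw [clip_eq h1, clip_eq h2, clip_eq h3, mul_comm]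

lemma q_eq (h : IsSpeed K c) : X.q a b = (1 + S b ^ 2) *
    Real.exp (∫ ξ in b..a, -angleP c (X.v ξ b) (X.z ξ b) (X.w ξ b) (X.p ξ b)) := by
  have ck := h.continuous_angleP (continuous_fst_slice X.cont_v b)
    (continuous_fst_slice X.cont_z b) (continuous_fst_slice X.cont_w b)
    (continuous_fst_slice X.cont_p b)
  rw [eq_mul_exp_of_hasDerivAt (fun y => X.q_a y b) ck.neg (a := b) (b := a)
    (fun y hy => ?_), X.q_diag]
  · rfl
  rw [uIcc_of_le hba] at hy
  obtain ⟨h1, h2, h3⟩ := hX y b le_rfl hy.1 hy.2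
  rw [clip_eq h1, clip_eq h2, clip_eq h3, Pi.neg_apply]
  ring

lemma p_pos (h : IsSpeed K c) : 0 < X.p a b := by
  rw [p_eq hX hba h]; positivity

lemma q_pos (h : IsSpeed K c) : 0 < X.q a b := by
  rw [q_eq hX hba h]; positivity

end ClippedFlow

lemma abs_angleP_le {c : ℝ → ℝ} {v w z q B : ℝ} (h1 : |deriv c v / (8 * c v ^ 2)| ≤ B)
    (h2 : |(v + v ^ 3) / (8 * c v)| ≤ B) (hq : 0 ≤ q) : |angleP c v w z q| ≤ 4 * B * q := by
  have B0 := (abs_nonneg _).trans h1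
  rw [angleP, abs_neg, abs_mul, abs_of_nonneg hq, mul_comm]
  refine mul_le_mul_of_nonneg_right ?_ hq
  refine (abs_sub _ _).trans ?_
  rw [abs_mul, abs_mul]
  have k1 : |Real.sin z - Real.sin w| ≤ 2 := by
    have := Real.abs_sin_le_one z
    have := Real.abs_sin_le_one w
    linarith [abs_sub (Real.sin z) (Real.sin w)]
  have k2 : |Real.sin w * (1 + Real.cos z)| ≤ 2 := by
    rw [abs_mul]
    have h3 := Real.abs_sin_le_one w
    have h4 : |1 + Real.cos z| ≤ 2 := by
      rw [abs_of_nonneg (by linarith [Real.neg_one_le_cos z])]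
      linarith [Real.cos_le_one z]
    calc _ ≤ 1 * (2:ℝ) := mul_le_mul h3 h4 (abs_nonneg _) zero_le_one
      _ = 2 := one_mul 2
  have h3 := mul_le_mul h1 k1 (abs_nonneg _) B0
  have h4 := mul_le_mul h2 k2 (abs_nonneg _) B0
  linarith

namespace ClippedFlow

variable {K : ℝ} {c R S v₀ : ℝ → ℝ} {E ρ V B : ℝ} {M : ℝ → ℝ} {X : ClippedFlow c R S v₀ V M}
  {a b : ℝ} (hX : X.InactiveBelow a b) (hba : b ≤ a) (h : IsSpeed K c)
  (D : DataBounds K c R S v₀ E ρ V B M)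
include hX hba h D

/-- Green's identity for the energy form plus θ times the closed form m dα + m' dβ. The value θ = 0
serves the bound on v; θ = 1 serves the bounds on p and q, for which m and m' must be controlled as
well. -/
lemma energy_legs (θ : ℝ) :
    (∫ ξ in b..a, (X.n ξ b + potentialF (X.v ξ b) * X.m ξ b + θ * X.m ξ b))
      + ∫ η in b..a, (X.n' a η + potentialF (X.v a η) * X.m' a η + θ * X.m' a η)
    = (∫ s in b..a, (R s ^ 2 + S s ^ 2 + 2 * potentialF (v₀ s))) + 2 * θ * (a - b) := by
  obtain ⟨H, cH, hH, hH', dH⟩ := h.exists_inverse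
  have cl := X.cont_l
  have cl' := X.cont_l'
  have cm := X.cont_m
  have cm' := X.cont_m'
  have cn := X.cont_n
  have cn' := X.cont_n'
  have cv := X.cont_v
  have cg := X.cont_g
  have cg' := X.cont_g'
  have cc := h.continuous
  have cc' := h.continuous_deriv
  have cR := D.continuous_R
  have cS := D.continuous_S
  have cv₀ := D.continuous_v₀
  have hv : ∀ ξ η, b ≤ η → η ≤ ξ → ξ ≤ a → H (X.g ξ η) = X.v ξ η ∧ H (X.g' ξ η) = X.v ξ η := by
    intro ξ η h1 h2 h3
    have e := g_eq_g' (hX.mono h1 h3) h2 h D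
    have e2 := X.speedPrimitive_v ξ η
    have e3 : speedPrimitive c (X.v ξ η) = X.g ξ η := by rw [e2, ← e]; ring
    exact ⟨by rw [← e3, hH'], by rw [← e, ← e3, hH']⟩
  have cΩ : Continuous fun P : ℝ × ℝ => flowΩ c (X.v P.1 P.2) (X.m P.1 P.2) (X.l P.1 P.2)
      (X.m' P.1 P.2) (X.l' P.1 P.2) := by
    unfold flowΩ
    refine (Continuous.div (by fun_prop) (by fun_prop) fun P => ?_).mul (by fun_prop)
    have := h.pos (X.v P.1 P.2)
    positivity
  have cN : Continuous fun P : ℝ × ℝ => flowN c (X.v P.1 P.2) (X.l P.1 P.2) (X.n P.1 P.2)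
      (X.l' P.1 P.2) (X.n' P.1 P.2) := by
    unfold flowN
    refine (Continuous.div (by fun_prop) (by fun_prop) fun P => ?_).mul (by fun_prop)
    have := h.pos (X.v P.1 P.2)
    positivity
  have cf : Continuous fun P : ℝ × ℝ => (X.v P.1 P.2 + X.v P.1 P.2 ^ 3) / (2 * c (X.v P.1 P.2)) :=
    Continuous.div (by fun_prop) (by fun_prop) fun P => by
      have := h.pos (X.v P.1 P.2)
      positivity
  -- The values H(g) and H(g') both equal v on the triangle, but the system provides the derivative
  -- of g along α only and of g' along β only. Hence g' is used in the coefficient differentiated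
  -- along β and g in the other one.
  have key := integral_legs_eq_integral_diagonal
    (A := fun a b => X.n a b + potentialF (H (X.g' a b)) * X.m a b + θ * X.m a b)
    (B := fun a b => X.n' a b + potentialF (H (X.g a b)) * X.m' a b + θ * X.m' a b)
    (C := fun a b => flowN c (X.v a b) (X.l a b) (X.n a b) (X.l' a b) (X.n' a b)
      + (X.v a b + X.v a b ^ 3) / (2 * c (X.v a b)) * (X.l a b * X.m' a b - X.l' a b * X.m a b)
      + (potentialF (X.v a b) + θ)
        * flowΩ c (X.v a b) (X.m a b) (X.l a b) (X.m' a b) (X.l' a b))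
    (by unfold potentialF; fun_prop) (by unfold potentialF; fun_prop)
    (by unfold potentialF; fun_prop) hba (fun ξ η h1 h2 h3 => by
      obtain ⟨d1, -, d3, d4⟩ := (hX ξ η h1 h2 h3).hasDerivAt_b
      have e := (hv ξ η h1 h2 h3).2
      have dF := (hasDerivAt_potentialF (H (X.g' ξ η))).comp η ((dH (X.g' ξ η)).comp η d4)
      refine ((d3.add (dF.mul d1)).add (d1.const_mul θ)).congr_deriv ?_
      have := (h.pos (X.v ξ η)).ne'
      simp only [Function.comp, e]
      field_simp
      ring) (fun ξ η h1 h2 h3 => by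
      obtain ⟨d1, -, d3, d4⟩ := (hX ξ η h1 h2 h3).hasDerivAt_a
      have e := (hv ξ η h1 h2 h3).1
      have dF := (hasDerivAt_potentialF (H (X.g ξ η))).comp ξ ((dH (X.g ξ η)).comp ξ d4)
      refine ((d3.add (dF.mul d1)).add (d1.const_mul θ)).congr_deriv ?_
      have := (h.pos (X.v ξ η)).ne'
      simp only [Function.comp, e]
      field_simp
      ring)
  have e1 : ∫ ξ in b..a, (X.n ξ b + potentialF (X.v ξ b) * X.m ξ b + θ * X.m ξ b)
      = ∫ ξ in b..a, (X.n ξ b + potentialF (H (X.g' ξ b)) * X.m ξ b + θ * X.m ξ b) :=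
    intervalIntegral.integral_congr fun ξ hξ => by
      rw [uIcc_of_le hba] at hξ
      simp only [(hv ξ b le_rfl hξ.1 hξ.2).2]
  have e2 : ∫ η in b..a, (X.n' a η + potentialF (X.v a η) * X.m' a η + θ * X.m' a η)
      = ∫ η in b..a, (X.n' a η + potentialF (H (X.g a η)) * X.m' a η + θ * X.m' a η) :=
    intervalIntegral.integral_congr fun η hη => by
      rw [uIcc_of_le hba] at hη
      simp only [(hv a η hη.1 hη.2 le_rfl).1]
  rw [e1, e2, key]
  have hd : ∀ s, X.m s s = 1 ∧ X.m' s s = 1 ∧ X.n s s = R s ^ 2 ∧ X.n' s s = S s ^ 2 := fun s => by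
    simp only [m, m', n, n', X.p_diag, X.w_diag, X.q_diag, X.z_diag, one_add_sq_mul_one_add_cos,
      one_add_sq_mul_one_sub_cos, and_self]
  have e3 : ∫ s in b..a, ((X.n s s + potentialF (H (X.g' s s)) * X.m s s + θ * X.m s s)
      + (X.n' s s + potentialF (H (X.g s s)) * X.m' s s + θ * X.m' s s))
      = ∫ s in b..a, ((R s ^ 2 + S s ^ 2 + 2 * potentialF (v₀ s)) + 2 * θ) := by
    congr 1; ext s
    obtain ⟨h1, h2, h3, h4⟩ := hd s
    rw [h1, h2, h3, h4, X.g_diag, X.g'_diag, hH']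
    ring
  rw [e3, intervalIntegral.integral_add (Continuous.intervalIntegrable
    (by unfold potentialF; fun_prop) _ _) intervalIntegrable_const,
    intervalIntegral.integral_const, smul_eq_mul]
  ring

omit hba D in
lemma nonneg_of_inactive {θ : ℝ} (hθ : 0 ≤ θ) {ξ η : ℝ} (h1 : b ≤ η) (h2 : η ≤ ξ) (h3 : ξ ≤ a) :
    0 ≤ X.m ξ η ∧ 0 ≤ X.n ξ η ∧ 0 ≤ X.m' ξ η ∧ 0 ≤ X.n' ξ η ∧
      0 ≤ X.n ξ η + potentialF (X.v ξ η) * X.m ξ η + θ * X.m ξ η ∧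
      0 ≤ X.n' ξ η + potentialF (X.v ξ η) * X.m' ξ η + θ * X.m' ξ η := by
  have hp := (p_pos (hX.mono h1 h3) h2 h).le
  have hq := (q_pos (hX.mono h1 h3) h2 h).le
  have k1 : 0 ≤ X.m ξ η :=
    div_nonneg (mul_nonneg hp (by linarith [Real.neg_one_le_cos (X.w ξ η)])) two_pos.le
  have k2 : 0 ≤ X.n ξ η :=
    div_nonneg (mul_nonneg hp (by linarith [Real.cos_le_one (X.w ξ η)])) two_pos.le
  have k3 : 0 ≤ X.m' ξ η :=
    div_nonneg (mul_nonneg hq (by linarith [Real.neg_one_le_cos (X.z ξ η)])) two_pos.le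
  have k4 : 0 ≤ X.n' ξ η :=
    div_nonneg (mul_nonneg hq (by linarith [Real.cos_le_one (X.z ξ η)])) two_pos.le
  have hF := potentialF_nonneg (X.v ξ η)
  exact ⟨k1, k2, k3, k4, by positivity, by positivity⟩

lemma energy_left_le {θ : ℝ} (hθ : 0 ≤ θ) :
    ∫ ξ in b..a, (X.n ξ b + potentialF (X.v ξ b) * X.m ξ b + θ * X.m ξ b)
      ≤ E + 2 * θ * (a - b) := by
  have h1 := energy_legs hX hba h D θ
  have h2 := D.energy_le b a hba
  have h3 : 0 ≤ ∫ η in b..a, (X.n' a η + potentialF (X.v a η) * X.m' a η + θ * X.m' a η) :=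
    intervalIntegral.integral_nonneg hba fun η hη =>
      (nonneg_of_inactive hX h hθ hη.1 hη.2 le_rfl).2.2.2.2.2
  linarith

lemma energy_right_le {θ : ℝ} (hθ : 0 ≤ θ) :
    ∫ η in b..a, (X.n' a η + potentialF (X.v a η) * X.m' a η + θ * X.m' a η)
      ≤ E + 2 * θ * (a - b) := by
  have h1 := energy_legs hX hba h D θ
  have h2 := D.energy_le b a hba
  have h3 : 0 ≤ ∫ ξ in b..a, (X.n ξ b + potentialF (X.v ξ b) * X.m ξ b + θ * X.m ξ b) :=
    intervalIntegral.integral_nonneg hba fun ξ hξ =>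
      (nonneg_of_inactive hX h hθ le_rfl hξ.1 hξ.2).2.2.2.2.1
  linarith

/-- Along a characteristic the derivative of v² is v l / c, at most K(n + F m) in absolute value,
because 2|v l| ≤ v² m + n and v²/2 ≤ F. Hence v² exceeds v₀² by at most K E, and `v₀_lt` makes the
conclusion strict. -/
lemma abs_v_lt : |X.v a b| < V := by
  obtain ⟨H, cH, hH, hH', dH⟩ := h.exists_inverse
  have hv : ∀ ξ, b ≤ ξ → ξ ≤ a → H (X.g ξ b) = X.v ξ b := fun ξ h1 h2 => by
    have e := g_eq_g' (hX.mono le_rfl h2) h1 h D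
    have e2 := X.speedPrimitive_v ξ b
    have e3 : speedPrimitive c (X.v ξ b) = X.g ξ b := by rw [e2, ← e]; ring
    rw [← e3, hH']
  have cm := continuous_fst_slice X.cont_m b
  have cn := continuous_fst_slice X.cont_n b
  have cv := continuous_fst_slice X.cont_v b
  have i := abs_sub_le_integral (f := fun ξ => H (X.g ξ b) ^ 2)
    (fun ξ => ((dH (X.g ξ b)).comp ξ (X.g_a ξ b)).pow 2)
    (g := fun ξ => K * (X.n ξ b + potentialF (X.v ξ b) * X.m ξ b + 0 * X.m ξ b))
    (by unfold potentialF; fun_prop) hba fun ξ hξ => by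
      have e := hv ξ hξ.1 hξ.2
      have e2 : clip (M (max |ξ| |b|)) (X.p ξ b) * Real.sin (X.w ξ b) / 4 = X.l ξ b / 2 := by
        rw [clip_eq (hX ξ b le_rfl hξ.1 hξ.2).2.1, l]; ring
      have hm := (nonneg_of_inactive hX h le_rfl le_rfl hξ.1 hξ.2).1
      have hn := (nonneg_of_inactive hX h le_rfl le_rfl hξ.1 hξ.2).2.1
      have hl : X.l ξ b ^ 2 = X.m ξ b * X.n ξ b := by
        simp only [l, m, n]
        linear_combination X.p ξ b ^ 2 / 4 * Real.sin_sq_add_cos_sq (X.w ξ b)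
      have hF := potentialF_nonneg (X.v ξ b)
      have hF2 : X.v ξ b ^ 2 / 2 ≤ potentialF (X.v ξ b) := by
        unfold potentialF
        have : 0 ≤ X.v ξ b ^ 4 := by positivity
        linarith
      have e3 : |2 * (X.v ξ b * X.l ξ b)| ≤ X.v ξ b ^ 2 * X.m ξ b + X.n ξ b := by
        refine abs_le_of_sq_le_sq ?_ (by positivity)
        nlinarith [sq_nonneg (X.v ξ b ^ 2 * X.m ξ b - X.n ξ b)]
      have e4 := mul_le_mul_of_nonneg_right hF2 hm
      have e5 : |X.v ξ b * X.l ξ b| ≤ X.n ξ b + potentialF (X.v ξ b) * X.m ξ b := by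
        rw [abs_mul, abs_two] at e3
        linarith
      rw [e, e2]
      have e6 : ((2:ℕ):ℝ) * X.v ξ b ^ (2 - 1) * (1 / c (X.v ξ b) * (X.l ξ b / 2))
          = (c (X.v ξ b))⁻¹ * (X.v ξ b * X.l ξ b) := by
        push_cast; ring
      have c0 := h.pos (X.v ξ b)
      rw [Function.comp, e, e6, abs_mul, abs_of_pos (inv_pos.2 c0), zero_mul, add_zero]
      exact mul_le_mul (h.inv_le _) e5 (abs_nonneg _) h.K_pos.le
  rw [intervalIntegral.integral_const_mul] at i
  have i2 := mul_le_mul_of_nonneg_left (energy_left_le hX hba h D le_rfl) h.K_pos.le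
  have i3 := D.v₀_lt b
  rw [hv a hba le_rfl] at i
  rw [X.g_diag, hH'] at i
  have i4 := le_of_abs_le i
  refine abs_lt_of_sq_lt_sq ?_ D.V_nonneg
  linarith

/-- The logarithmic derivative of p is at most 4 B q, and the integral of q = m' + n' is at most E +
2(a - b) ≤ E + 4 max(|a|, |b|) by `energy_right_le` with θ = 1. This explains the exponent in
`M_eq`; the summand 1 there makes the bound strict. -/
lemma p_lt : |X.p a b| < M (max |a| |b|) := by
  rw [abs_of_pos (p_pos hX hba h), p_eq hX hba h, D.M_eq]
  have cm' := continuous_snd_slice X.cont_m' a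
  have cn' := continuous_snd_slice X.cont_n' a
  have cv := continuous_snd_slice X.cont_v a
  have ck := h.continuous_angleP cv (continuous_snd_slice X.cont_w a)
    (continuous_snd_slice X.cont_z a) (continuous_snd_slice X.cont_q a)
  have i1 : |∫ η in b..a, angleP c (X.v a η) (X.w a η) (X.z a η) (X.q a η)|
      ≤ ∫ η in b..a, 4 * B * (X.n' a η + potentialF (X.v a η) * X.m' a η + 1 * X.m' a η) := by
    rw [← Real.norm_eq_abs]
    refine intervalIntegral.norm_integral_le_of_norm_le hba (Eventually.of_forall fun η hη => ?_)
      (Continuous.intervalIntegrable (by unfold potentialF; fun_prop) _ _)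
    have hη1 := hη.1.le
    obtain ⟨k1, k2⟩ := D.coeff_le _ (hX a η hη1 hη.2 le_rfl).1
    obtain ⟨-, -, k3, k4, -, -⟩ := nonneg_of_inactive hX h zero_le_one hη1 hη.2 le_rfl
    have hq := (q_pos (hX.mono hη1 le_rfl) hη.2 h).le
    refine (abs_angleP_le k1 k2 hq).trans (mul_le_mul_of_nonneg_left ?_ ?_)
    · have e : X.q a η = X.m' a η + X.n' a η := by simp only [m', n']; ring
      have := mul_nonneg (potentialF_nonneg (X.v a η)) k3
      linarith
    · have := D.B_nonneg; positivity
  rw [intervalIntegral.integral_const_mul] at i1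
  have i2 := energy_right_le hX hba h D zero_le_one
  have i3 : a - b ≤ 2 * max |a| |b| := by
    linarith [le_abs_self a, neg_abs_le b, le_max_left |a| |b|, le_max_right |a| |b|]
  have B0 := D.B_nonneg
  have i4 : 4 * B * (∫ η in b..a, (X.n' a η + potentialF (X.v a η) * X.m' a η + 1 * X.m' a η))
      ≤ 4 * B * (E + 4 * max |a| |b|) := by
    gcongr; linarith
  rw [intervalIntegral.integral_symm]
  have i5 : (1 + R a ^ 2) * Real.exp (-∫ η in b..a,
      angleP c (X.v a η) (X.w a η) (X.z a η) (X.q a η))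
      ≤ ρ * Real.exp (4 * B * (E + 4 * max |a| |b|)) := by
    have := D.R_le a
    gcongr
    · linarith [sq_nonneg (R a)]
    · linarith [(abs_le.1 i1).1]
  linarith

lemma q_lt : |X.q a b| < M (max |a| |b|) := by
  rw [abs_of_pos (q_pos hX hba h), q_eq hX hba h, D.M_eq]
  have cm := continuous_fst_slice X.cont_m b
  have cn := continuous_fst_slice X.cont_n b
  have cv := continuous_fst_slice X.cont_v b
  have i1 : |∫ ξ in b..a, -angleP c (X.v ξ b) (X.z ξ b) (X.w ξ b) (X.p ξ b)|
      ≤ ∫ ξ in b..a, 4 * B * (X.n ξ b + potentialF (X.v ξ b) * X.m ξ b + 1 * X.m ξ b) := by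
    rw [← Real.norm_eq_abs]
    refine intervalIntegral.norm_integral_le_of_norm_le hba (Eventually.of_forall fun ξ hξ => ?_)
      (Continuous.intervalIntegrable (by unfold potentialF; fun_prop) _ _)
    have hξ1 := hξ.1.le
    obtain ⟨k1, k2⟩ := D.coeff_le _ (hX ξ b le_rfl hξ1 hξ.2).1
    obtain ⟨k3, k4, -, -, -, -⟩ := nonneg_of_inactive hX h zero_le_one le_rfl hξ1 hξ.2
    have hp := (p_pos (hX.mono le_rfl hξ.2) hξ1 h).le
    rw [norm_neg]
    refine (abs_angleP_le k1 k2 hp).trans (mul_le_mul_of_nonneg_left ?_ ?_)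
    · have e : X.p ξ b = X.m ξ b + X.n ξ b := by simp only [m, n]; ring
      have := mul_nonneg (potentialF_nonneg (X.v ξ b)) k3
      linarith
    · have := D.B_nonneg; positivity
  rw [intervalIntegral.integral_const_mul] at i1
  have i2 := energy_left_le hX hba h D zero_le_one
  have i3 : a - b ≤ 2 * max |a| |b| := by
    linarith [le_abs_self a, neg_abs_le b, le_max_left |a| |b|, le_max_right |a| |b|]
  have B0 := D.B_nonneg
  have i4 : 4 * B * (∫ ξ in b..a, (X.n ξ b + potentialF (X.v ξ b) * X.m ξ b + 1 * X.m ξ b))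
      ≤ 4 * B * (E + 4 * max |a| |b|) := by
    gcongr; linarith
  have i5 : (1 + S b ^ 2) * Real.exp (∫ ξ in b..a,
      -angleP c (X.v ξ b) (X.z ξ b) (X.w ξ b) (X.p ξ b))
      ≤ ρ * Real.exp (4 * B * (E + 4 * max |a| |b|)) := by
    have := D.S_le b
    gcongr
    · linarith [sq_nonneg (S b)]
    · linarith [(abs_le.1 i1).2]
  linarith

end ClippedFlow

lemma nonneg_of_continuous_of_Ioc {f : ℝ → ℝ} (cf : Continuous f) {a b : ℝ} (hab : b < a)
    (hf : ∀ η ∈ Ioc b a, 0 ≤ f η) : 0 ≤ f b :=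
  ge_of_tendsto (cf.continuousAt.tendsto.mono_left nhdsWithin_le_nhds : Tendsto f (𝓝[>] b) _)
    (by filter_upwards [Ioc_mem_nhdsGT hab] with η hη using hf η hη)

lemma continuous_clip : Continuous fun P : ℝ × ℝ => clip P.1 P.2 := by
  unfold clip; fun_prop

namespace DataBounds

variable {K : ℝ} {c R S v₀ : ℝ → ℝ} {E ρ V B : ℝ} {M : ℝ → ℝ} (D : DataBounds K c R S v₀ E ρ V B M)
include D

lemma continuous_M : Continuous M := by
  rw [show M = _ from funext D.M_eq]; fun_prop

lemma ρ_pos : 0 < ρ := by have := D.R_le 0; nlinarith [sq_nonneg (R 0)]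

lemma one_le_M (s : ℝ) : 1 ≤ M s := by
  have := D.ρ_pos
  rw [D.M_eq, le_add_iff_nonneg_left]
  positivity

lemma monotone_M : Monotone M := fun s t hst => by
  have h1 := D.ρ_pos.le
  have h2 := D.B_nonneg
  rw [D.M_eq, D.M_eq]
  gcongr

lemma lt_M {s : ℝ} (hs : 0 ≤ s) : ρ < M s := by
  have h1 : 0 ≤ E := by simpa using D.energy_le 0 0 le_rfl
  have h2 := D.B_nonneg
  have h3 := Real.one_le_exp (by positivity : 0 ≤ 4 * B * (E + 4 * s))
  rw [D.M_eq]
  nlinarith [D.ρ_pos]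

end DataBounds

namespace ClippedFlow

variable {K : ℝ} {c R S v₀ : ℝ → ℝ} {E ρ V B : ℝ} {M : ℝ → ℝ} (X : ClippedFlow c R S v₀ V M)
  (h : IsSpeed K c) (D : DataBounds K c R S v₀ E ρ V B M)
include h D

omit D in
lemma v_diag (s : ℝ) : X.v s s = v₀ s := by
  obtain ⟨H, -, -, hH', -⟩ := h.exists_inverse
  have := X.speedPrimitive_v s s
  rw [X.g_diag, X.g'_diag, add_self_div_two] at this
  rw [← hH' (X.v s s), this, hH']

/-- A continuity argument: among the points where one of the strict bounds fails, one is taken with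
minimal a - b. On its triangle the truncation is inactive, so the a priori estimates give the strict
bounds at that point, a contradiction. -/
lemma inactive_of_le {a₁ b₁ : ℝ} (hba₁ : b₁ ≤ a₁) : X.Inactive a₁ b₁ := by
  have K0 := h.K_pos
  have cv := X.cont_v
  have cp := X.cont_p
  have cq := X.cont_q
  have cM := D.continuous_M
  by_contra hcon
  set r := max |a₁| |b₁| with hr
  set Z : Set (ℝ × ℝ) := {P | P.2 ≤ P.1 ∧ (V ≤ |X.v P.1 P.2| ∨
    M (max |P.1| |P.2|) ≤ |X.p P.1 P.2| ∨ M (max |P.1| |P.2|) ≤ |X.q P.1 P.2|)}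
    ∩ Icc ((-r, -r) : ℝ × ℝ) (r, r) with hZ
  have hZc : IsCompact Z := by
    refine isCompact_Icc.inter_left ((isClosed_le continuous_snd continuous_fst).inter
      ((isClosed_le continuous_const cv.abs).union
        ((isClosed_le (by fun_prop) cp.abs).union (isClosed_le (by fun_prop) cq.abs))))
  have ha₁ := abs_le.1 (le_max_left |a₁| |b₁|)
  have hb₁ := abs_le.1 (le_max_right |a₁| |b₁|)
  have hZn : Z.Nonempty := by
    refine ⟨(a₁, b₁), ⟨hba₁, ?_⟩, ⟨ha₁.1, hb₁.1⟩, ⟨ha₁.2, hb₁.2⟩⟩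
    by_contra! h3
    exact hcon ⟨h3.1.le, h3.2.1.le, h3.2.2.le⟩
  obtain ⟨⟨a, b⟩, ⟨⟨hba, hbad⟩, hbox⟩, hmin⟩ := hZc.exists_isMinOn hZn
    (continuous_fst.sub continuous_snd).continuousOn
  simp only at hba hbad
  have strict : ∀ a' b', b ≤ b' → b' ≤ a' → a' ≤ a → a' - b' < a - b → |X.v a' b'| < V ∧
      |X.p a' b'| < M (max |a'| |b'|) ∧ |X.q a' b'| < M (max |a'| |b'|) := by
    intro a' b' h1 h2 h3 h4
    by_contra hn
    have : (a', b') ∈ Z := by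
      refine ⟨⟨h2, ?_⟩, ⟨hbox.1.2.trans (h1.trans h2), hbox.1.2.trans h1⟩,
        ⟨h3.trans hbox.2.1, h2.trans (h3.trans hbox.2.1)⟩⟩
      by_contra! h5
      exact hn h5
    have h5 := isMinOn_iff.1 hmin _ this
    simp only [Pi.sub_apply] at h5
    linarith
  -- At the corner itself the weak bounds are limits along the column above it or, when the triangle
  -- is a point, come directly from the data.
  have corner : X.Inactive a b := by
    rcases hba.eq_or_lt with rfl | hlt
    · have hρ : ρ < M (max |b| |b|) := D.lt_M (by positivity)
      refine ⟨?_, ?_, ?_⟩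
      · rw [v_diag X h]
        have h1 := D.v₀_lt b
        have h2 : 0 ≤ E := by simpa using D.energy_le 0 0 le_rfl
        refine abs_le_of_sq_le_sq ?_ D.V_nonneg
        nlinarith [mul_nonneg K0.le h2]
      · rw [X.p_diag, abs_of_nonneg (by positivity)]
        exact (D.R_le b).trans hρ.le
      · rw [X.q_diag, abs_of_nonneg (by positivity)]
        exact (D.S_le b).trans hρ.le
    · have cv' := continuous_snd_slice cv a
      have cp' := continuous_snd_slice cp a
      have cq' := continuous_snd_slice cq a
      have st : ∀ η ∈ Ioc b a, _ := fun η hη =>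
        strict a η hη.1.le hη.2 le_rfl (by linarith [hη.1])
      refine ⟨?_, ?_, ?_⟩
      · exact sub_nonneg.1 (nonneg_of_continuous_of_Ioc (f := fun η => V - |X.v a η|)
          (by fun_prop) hlt fun η hη => sub_nonneg.2 (st η hη).1.le)
      · exact sub_nonneg.1 (nonneg_of_continuous_of_Ioc
          (f := fun η => M (max |a| |η|) - |X.p a η|)
          (by fun_prop) hlt fun η hη => sub_nonneg.2 (st η hη).2.1.le)
      · exact sub_nonneg.1 (nonneg_of_continuous_of_Ioc
          (f := fun η => M (max |a| |η|) - |X.q a η|)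
          (by fun_prop) hlt fun η hη => sub_nonneg.2 (st η hη).2.2.le)
  have below : X.InactiveBelow a b := by
    intro a' b' h1 h2 h3
    rcases h1.eq_or_lt with rfl | h1'
    · rcases h3.eq_or_lt with rfl | h3'
      · exact corner
      · obtain ⟨k1, k2, k3⟩ := strict a' b le_rfl h2 h3 (by linarith)
        exact ⟨k1.le, k2.le, k3.le⟩
    · obtain ⟨k1, k2, k3⟩ := strict a' b' h1 h2 h3 (by linarith)
      exact ⟨k1.le, k2.le, k3.le⟩
  rcases hbad with h1 | h1 | h1
  · exact absurd (abs_v_lt below hba h D) (not_lt.2 h1)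
  · exact absurd (p_lt below hba h D) (not_lt.2 h1)
  · exact absurd (q_lt below hba h D) (not_lt.2 h1)

/-- The truncation is nowhere active. -/
lemma inactive (a b : ℝ) : X.Inactive a b := by
  rcases le_total b a with hba | hab
  · exact X.inactive_of_le h D hba
  · obtain ⟨h1, h2, h3⟩ := X.rev.inactive_of_le h D.rev hab
    rw [max_comm] at h2 h3
    exact ⟨h1, h3, h2⟩

lemma g_eq (a b : ℝ) : X.g a b = X.g' a b := by
  rcases le_total b a with hba | hab
  · exact g_eq_g' (fun _ _ _ _ _ => X.inactive h D _ _) hba h D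
  · exact (g_eq_g' (X := X.rev) (fun _ _ _ _ _ => X.rev.inactive h D.rev _ _) hab h D.rev).symm

include X in
-- Once g = g', the function v equals both H(g) and H(g'), which provides its derivatives along α
-- and β respectively.
lemma nonempty_angleFlow : Nonempty (AngleFlow c R S v₀) := by
  obtain ⟨H, cH, hH, hH', dH⟩ := h.exists_inverse
  have hg : ∀ a b, X.v a b = H (X.g a b) := fun a b => by
    rw [← hH' (X.v a b), X.speedPrimitive_v, ← X.g_eq h D, add_self_div_two]
  have hg' : ∀ a b, X.v a b = H (X.g' a b) := fun a b => by rw [hg, X.g_eq h D]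
  refine ⟨⟨X.w, X.z, X.p, X.q, X.v, X.cont_w, X.cont_z, X.cont_p, X.cont_q, X.cont_v,
    fun a b => ?_, fun a b => ?_, fun a b => ?_, fun a b => ?_, fun a b => ?_, fun a b => ?_,
    X.w_diag, X.z_diag, X.p_diag, X.q_diag, X.v_diag h⟩⟩ <;>
    obtain ⟨h1, h2, h3⟩ := X.inactive h D a b
  · have := X.w_b a b
    rwa [clip_eq h1, clip_eq h3] at this
  · have := X.p_b a b
    rwa [clip_eq h1, clip_eq h2, clip_eq h3] at this
  · have := X.z_a a b
    rwa [clip_eq h1, clip_eq h2] at this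
  · have := X.q_a a b
    rwa [clip_eq h1, clip_eq h2, clip_eq h3] at this
  · have := X.g_a a b
    rw [clip_eq h2] at this
    have d := (dH (X.g a b)).comp a this
    rw [← hg] at d
    exact (d.congr_of_eventuallyEq (Eventually.of_forall fun y => hg y b)).congr_deriv (by ring)
  · have := X.g'_b a b
    rw [clip_eq h3] at this
    have d := (dH (X.g' a b)).comp b this
    rw [← hg'] at d
    exact (d.congr_of_eventuallyEq (Eventually.of_forall fun y => hg' a y)).congr_deriv (by ring)

end ClippedFlow

/-! ### Solving the truncated system -/

/-- `u` is bounded by `C` and Lipschitz with constant `C`. -/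
def BddLip {X : Type*} [PseudoMetricSpace X] (C : ℝ) (u : X → ℝ) : Prop :=
  ∀ P, |u P| ≤ C ∧ ∀ Q, |u P - u Q| ≤ C * dist P Q

namespace BddLip

variable {X : Type*} [PseudoMetricSpace X] {C D : ℝ} {u v : X → ℝ}

lemma mono (hu : BddLip C u) (hCD : C ≤ D) : BddLip D u := fun P =>
  ⟨(hu P).1.trans hCD, fun Q => ((hu P).2 Q).trans (by gcongr)⟩

lemma neg (hu : BddLip C u) : BddLip C fun P => -u P := fun P =>
  ⟨by rw [abs_neg]; exact (hu P).1, fun Q => by rw [neg_sub_neg, abs_sub_comm]; exact (hu P).2 Q⟩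

lemma const (a : ℝ) : BddLip |a| fun _ : X => a := fun P =>
  ⟨le_rfl, fun Q => by rw [sub_self, abs_zero]; positivity⟩

lemma add (hu : BddLip C u) (hv : BddLip D v) : BddLip (C + D) fun P => u P + v P := fun P =>
  ⟨(abs_add_le _ _).trans (add_le_add (hu P).1 (hv P).1), fun Q => by
    rw [add_sub_add_comm, add_mul]
    exact (abs_add_le _ _).trans (add_le_add ((hu P).2 Q) ((hv P).2 Q))⟩

lemma sub (hu : BddLip C u) (hv : BddLip D v) : BddLip (C + D) fun P => u P - v P := by
  simpa only [sub_eq_add_neg] using hu.add hv.neg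

lemma mul (hu : BddLip C u) (hv : BddLip D v) : BddLip (2 * (C * D)) fun P => u P * v P := fun P => by
  have C0 : 0 ≤ C := (abs_nonneg _).trans (hu P).1
  have D0 : 0 ≤ D := (abs_nonneg _).trans (hv P).1
  constructor
  · rw [abs_mul]
    have := mul_le_mul (hu P).1 (hv P).1 (abs_nonneg _) C0
    have := mul_nonneg C0 D0
    linarith
  · intro Q
    have e : u P * v P - u Q * v Q = u P * (v P - v Q) + (u P - u Q) * v Q := by ring
    have h1 := mul_le_mul (hu P).1 ((hv P).2 Q) (abs_nonneg _) C0
    have h2 := mul_le_mul ((hu P).2 Q) (hv Q).1 (abs_nonneg _) (by positivity)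
    rw [e]
    refine (abs_add_le _ _).trans ?_
    rw [abs_mul, abs_mul]
    linarith

lemma cos {f : X → ℝ} (hf : LipschitzWith 1 f) : BddLip 1 fun P => Real.cos (f P) := fun P =>
  ⟨Real.abs_cos_le_one _, fun Q => by
    simpa [Real.dist_eq] using (Real.lipschitzWith_cos.comp hf).dist_le_mul P Q⟩

lemma sin {f : X → ℝ} (hf : LipschitzWith 1 f) : BddLip 1 fun P => Real.sin (f P) := fun P =>
  ⟨Real.abs_sin_le_one _, fun Q => by
    simpa [Real.dist_eq] using (Real.lipschitzWith_sin.comp hf).dist_le_mul P Q⟩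

lemma clip {f : X → ℝ} (hf : LipschitzWith 1 f) {N : ℝ} (hN : 1 ≤ N) :
    BddLip N fun P => clip N (f P) := fun P =>
  ⟨abs_clip_le (by linarith) _, fun Q => by
    have h1 := hf.dist_le_mul P Q
    rw [Real.dist_eq, NNReal.coe_one, one_mul] at h1
    have := abs_clip_sub_le N (f P) (f Q)
    have := dist_nonneg (x := P) (y := Q)
    nlinarith⟩

lemma comp_clip {f : X → ℝ} {φ : ℝ → ℝ} {V K : ℝ} (hV : 0 ≤ V) (hC : 0 ≤ C) (hK : 1 ≤ K)
    (hf : ∀ P Q, |f P - f Q| ≤ K * dist P Q)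
    (hφ : ∀ v w, |v| ≤ V → |w| ≤ V → |φ v| ≤ C ∧ |φ v - φ w| ≤ C * |v - w|) :
    BddLip (C * K) fun P => φ (_root_.clip V (f P)) := fun P => by
  have h1 := abs_clip_le hV (f P)
  refine ⟨(hφ _ _ h1 h1).1.trans (le_mul_of_one_le_right hC hK), fun Q => ?_⟩
  refine (hφ _ _ h1 (abs_clip_le hV (f Q))).2.trans ?_
  rw [mul_assoc]
  exact mul_le_mul_of_nonneg_left ((abs_clip_sub_le _ _ _).trans (hf P Q)) hC

end BddLip

section Existence

variable {K : ℝ} {c : ℝ → ℝ}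

/-- The right-hand side of the truncated system as a function of the two triples of unknowns, where
`H` is the inverse of the primitive of the wave speed. -/
noncomputable def clippedRhs (c H : ℝ → ℝ) (V N : ℝ) (x y : Fin 3 → ℝ) : Fin 3 → ℝ :=
  ![angleW c (clip V (H ((x 2 + y 2) / 2))) (x 0) (y 0) (clip N (y 1)),
    clip N (x 1) * angleP c (clip V (H ((x 2 + y 2) / 2))) (x 0) (y 0) (clip N (y 1)),
    -(clip N (y 1) * Real.sin (y 0) / 4)]

/-- Truncating v makes the coefficients bounded and Lipschitz, and the inverse H has Lipschitz
constant K. The truncated densities contribute at most two factors of size N, hence the growth N².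
-/
lemma exists_bddLip_clippedRhs (h : IsSpeed K c) {H : ℝ → ℝ}
    (hH : ∀ y, speedPrimitive c (H y) = y) {V : ℝ} (hV : 0 ≤ V) :
    ∃ C, 0 < C ∧ ∀ N, 1 ≤ N → ∀ i, BddLip (C * N ^ 2)
      fun P : (Fin 3 → ℝ) × (Fin 3 → ℝ) => clippedRhs c H V N P.1 P.2 i := by
  obtain ⟨C₁, C₁0, hC₁⟩ := exists_bound_lipschitz h.contDiff_coeff₁ V
  obtain ⟨C₂, C₂0, hC₂⟩ := exists_bound_lipschitz (h.contDiff_coeff₂.div_const 2) V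
  have hK := h.one_lt.le
  have K0 := h.K_pos
  have lx : ∀ i, LipschitzWith 1 fun P : (Fin 3 → ℝ) × (Fin 3 → ℝ) => P.1 i := fun i =>
    LipschitzWith.of_dist_le_mul fun P Q => by
      rw [NNReal.coe_one, one_mul]
      exact (dist_le_pi_dist P.1 Q.1 i).trans (le_max_left _ _)
  have ly : ∀ i, LipschitzWith 1 fun P : (Fin 3 → ℝ) × (Fin 3 → ℝ) => P.2 i := fun i =>
    LipschitzWith.of_dist_le_mul fun P Q => by
      rw [NNReal.coe_one, one_mul]
      exact (dist_le_pi_dist P.2 Q.2 i).trans (le_max_right _ _)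
  have hf : ∀ P Q : (Fin 3 → ℝ) × (Fin 3 → ℝ),
      |H ((P.1 2 + P.2 2) / 2) - H ((Q.1 2 + Q.2 2) / 2)| ≤ K * dist P Q := fun P Q => by
    refine (h.abs_sub_le_speedPrimitive _ _).trans (mul_le_mul_of_nonneg_left ?_ K0.le)
    rw [hH, hH]
    have h1 := (lx 2).dist_le_mul P Q
    have h2 := (ly 2).dist_le_mul P Q
    rw [Real.dist_eq, NNReal.coe_one, one_mul] at h1 h2
    have e : (P.1 2 + P.2 2) / 2 - (Q.1 2 + Q.2 2) / 2
      = ((P.1 2 - Q.1 2) + (P.2 2 - Q.2 2)) / 2 := by ring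
    rw [e, abs_div, abs_two]
    linarith [abs_add_le (P.1 2 - Q.1 2) (P.2 2 - Q.2 2)]
  have bk := BddLip.comp_clip hV C₁0 hK hf hC₁
  have bf := BddLip.comp_clip hV C₂0 hK hf hC₂
  have e2 : ∀ v, (v + v ^ 3) / (4 * c v) / 2 = (v + v ^ 3) / (8 * c v) := fun v => by ring
  simp only [e2] at bf
  have b1 := BddLip.const (X := (Fin 3 → ℝ) × (Fin 3 → ℝ)) 1
  have bcx := BddLip.cos (lx 0)
  have bcy := BddLip.cos (ly 0)
  have bsx := BddLip.sin (lx 0)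
  have bsy := BddLip.sin (ly 0)
  have bW := ((bk.mul (bcy.sub bcx)).sub (bf.mul ((b1.add bcy).mul (b1.add bcx))))
  have bP := ((bk.mul (bsy.sub bsx)).sub (bf.mul (bsx.mul (b1.add bcy))))
  rw [abs_one] at bW bP
  set DW := 2 * (C₁ * K * (1 + 1)) + 2 * (C₂ * K * (2 * ((1 + 1) * (1 + 1)))) with hDW
  set DP := 2 * (C₁ * K * (1 + 1)) + 2 * (C₂ * K * (2 * (1 * (1 + 1)))) with hDP
  have DW0 : 0 ≤ DW := by positivity
  have DP0 : 0 ≤ DP := by positivity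
  refine ⟨2 * DW + 4 * DP + 1, by positivity, fun N hN i => ?_⟩
  have bx := BddLip.clip (lx 1) hN
  have by' := BddLip.clip (ly 1) hN
  have N0 : 0 ≤ N := by linarith
  have hN2 : N ≤ N ^ 2 := by nlinarith
  have k1 : 0 ≤ DW * N ^ 2 := by positivity
  have k2 : 0 ≤ DP * N ^ 2 := by positivity
  fin_cases i
  · refine (by'.mul bW).neg.mono ?_
    have := mul_le_mul_of_nonneg_left hN2 DW0
    nlinarith
  · refine (bx.mul (by'.mul bP).neg).mono ?_
    nlinarith
  · have b4 := BddLip.const (X := (Fin 3 → ℝ) × (Fin 3 → ℝ)) (1 / 4)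
    rw [abs_of_pos (by norm_num)] at b4
    have := ((by'.mul bsy).mul b4).neg
    simp only [mul_one_div] at this
    refine this.mono ?_
    nlinarith

lemma continuous_clippedRhs (h : IsSpeed K c) {H : ℝ → ℝ} (cH : Continuous H) (V : ℝ)
    {X : Type*} [TopologicalSpace X] {N : X → ℝ} {x y : X → Fin 3 → ℝ} (cN : Continuous N)
    (cx : Continuous x) (cy : Continuous y) :
    Continuous fun P => clippedRhs c H V (N P) (x P) (y P) := by
  have hx := fun i => (continuous_apply i).comp cx
  have hy := fun i => (continuous_apply i).comp cy
  have cv : Continuous fun P => clip V (H ((x P 2 + y P 2) / 2)) :=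
    continuous_clip.comp (continuous_const.prodMk (cH.comp (((hx 2).add (hy 2)).div_const 2)))
  have cX : Continuous fun P => clip (N P) (x P 1) := continuous_clip.comp (cN.prodMk (hx 1))
  have cY : Continuous fun P => clip (N P) (y P 1) := continuous_clip.comp (cN.prodMk (hy 1))
  refine continuous_pi fun i => ?_
  fin_cases i
  · exact h.continuous_angleW cv (hx 0) (hy 0) cY
  · exact cX.mul (h.continuous_angleP cv (hx 0) (hy 0) cY)
  · exact ((cY.mul (Real.continuous_sin.comp (hy 0))).div_const 4).neg

lemma nonempty_clippedFlow (h : IsSpeed K c) {R S v₀ : ℝ → ℝ} {E ρ V B : ℝ} {M : ℝ → ℝ}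
    (D : DataBounds K c R S v₀ E ρ V B M) : Nonempty (ClippedFlow c R S v₀ V M) := by
  obtain ⟨H, cH, hH, hH', dH⟩ := h.exists_inverse
  obtain ⟨C, C0, hC⟩ := exists_bddLip_clippedRhs h hH D.V_nonneg
  have cR := D.continuous_R
  have cS := D.continuous_S
  have cv₀ := D.continuous_v₀
  have cM := D.continuous_M
  have cG : Continuous fun s => speedPrimitive c (v₀ s) := continuous_iff_continuousAt.2 fun s =>
    ((h.hasDerivAt_speedPrimitive (v₀ s)).comp s (D.hasDerivAt s)).continuousAt
  have Λ0 : ∀ s, 0 < C * M s ^ 2 := fun s => by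
    have := D.one_le_M s
    positivity
  have bd : ∀ s x y, ‖clippedRhs c H V (M s) x y‖ ≤ C * M s ^ 2 := fun s x y =>
    (pi_norm_le_iff_of_nonneg (Λ0 s).le).2 fun i => (hC _ (D.one_le_M s) i (x, y)).1
  have lp : ∀ s x y x' y', ‖clippedRhs c H V (M s) x y - clippedRhs c H V (M s) x' y'‖
      ≤ C * M s ^ 2 * max ‖x - x'‖ ‖y - y'‖ := fun s x y x' y' => by
    have := (Λ0 s).le
    refine (pi_norm_le_iff_of_nonneg (by positivity)).2 fun i => ?_
    have := (hC _ (D.one_le_M s) i (x, y)).2 (x', y')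
    rwa [Prod.dist_eq, dist_eq_norm, dist_eq_norm] at this
  obtain ⟨A, B', cA, cB, hA, hB, dA, dB⟩ := exists_diagonal_problem (E := Fin 3 → ℝ)
    (Λ := fun s => C * M s ^ 2) (by fun_prop)
    (fun s t hst => by
      have := D.monotone_M hst
      have := D.one_le_M s
      simp only
      gcongr) Λ0
    (f := fun a b x y => clippedRhs c H V (M (max |a| |b|)) x y)
    -- The triples are (w, p, g') and (z, q, g). The second obeys the same law with the roles
    -- exchanged and the opposite sign, as t increases in α and decreases in β.
    (g := fun a b x y => -clippedRhs c H V (M (max |a| |b|)) y x)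
    (continuous_clippedRhs h cH V (by fun_prop) (by fun_prop) (by fun_prop))
    (continuous_clippedRhs h cH V (by fun_prop) (by fun_prop) (by fun_prop)).neg
    (fun a b x y => bd _ x y) (fun a b x y => by rw [norm_neg]; exact bd _ y x)
    (fun a b x y x' y' => lp _ x y x' y')
    (fun a b x y x' y' => by
      rw [neg_sub_neg, norm_sub_rev, max_comm ‖x - x'‖]
      exact lp _ y x y' x')
    (φ := fun s => ![2 * Real.arctan (R s), 1 + R s ^ 2, speedPrimitive c (v₀ s)])
    (ψ := fun s => ![2 * Real.arctan (S s), 1 + S s ^ 2, speedPrimitive c (v₀ s)])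
    (by
      refine continuous_pi fun i => ?_
      fin_cases i
      · exact (Real.continuous_arctan.comp cR).const_mul 2
      · exact (cR.pow 2).const_add 1
      · exact cG)
    (by
      refine continuous_pi fun i => ?_
      fin_cases i
      · exact (Real.continuous_arctan.comp cS).const_mul 2
      · exact (cS.pow 2).const_add 1
      · exact cG)
  have pA := fun i => (continuous_apply i).comp cA
  have pB := fun i => (continuous_apply i).comp cB
  have qA := fun a b => hasDerivAt_pi.1 (dA a b)
  have qB := fun a b => hasDerivAt_pi.1 (dB a b)
  refine ⟨⟨fun a b => A a b 0, fun a b => A a b 1, fun a b => A a b 2, fun a b => B' a b 0,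
    fun a b => B' a b 1, fun a b => B' a b 2, fun a b => H ((A a b 2 + B' a b 2) / 2),
    pA 0, pA 1, pA 2, pB 0, pB 1, pB 2, cH.comp (((pA 2).add (pB 2)).div_const 2),
    fun a b => qA a b 0, fun a b => qA a b 1, fun a b => qA a b 2,
    fun a b => (qB a b 0).congr_deriv ?_, fun a b => (qB a b 1).congr_deriv ?_,
    fun a b => (qB a b 2).congr_deriv ?_, fun s => by rw [hA]; rfl, fun s => by rw [hA]; rfl,
    fun s => by rw [hA]; rfl, fun s => by rw [hB]; rfl, fun s => by rw [hB]; rfl,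
    fun s => by rw [hB]; rfl, fun a b => by rw [hH, add_comm]⟩⟩
  · rw [add_comm (A a b 2)]; rfl
  · rw [add_comm (A a b 2)]; rfl
  · simp [clippedRhs]

end Existence

/-! ### From the data to flows, and from flows to constructed solutions -/

/-- A function in `H¹(ℝ)` is bounded. -/
lemma MemH1.exists_abs_le {f : ℝ → ℝ} (hf : MemH1 f) : ∃ C, ∀ x, |f x| ≤ C := by
  have cf := continuous_of_absolutelyContinuous hf.absolutelyContinuous
  have i1 := hf.memLp.integrable_sq
  have i2 := hf.memLp_deriv.integrable_sq
  refine ⟨2 + (∫ y, f y ^ 2) + ∫ y, deriv f y ^ 2, fun x => ?_⟩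
  have hx : x ≤ x + 1 := by linarith
  have j2 : ∫ y in x..x + 1, (1 + deriv f y ^ 2) ≤ 1 + ∫ y, deriv f y ^ 2 := by
    rw [intervalIntegral.integral_add intervalIntegrable_const i2.intervalIntegrable,
      intervalIntegral.integral_const, intervalIntegral.integral_of_le hx]
    have := setIntegral_le_integral (s := Ioc x (x + 1)) i2
      (Eventually.of_forall fun y => sq_nonneg _)
    simp only [smul_eq_mul]
    linarith
  -- The value at x is compared with f(y) for y in the adjacent unit interval, and the bound is then
  -- averaged over y. The inequality |s| ≤ 1 + s² replaces the Cauchy–Schwarz inequality.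
  have key : ∀ y ∈ Icc x (x + 1), |f x| ≤ 1 + f y ^ 2 + (1 + ∫ y, deriv f y ^ 2) := by
    intro y hy
    have h1 := (hf.absolutelyContinuous x y).integral_deriv_eq_sub
    have h2 : |∫ s in x..y, deriv f s| ≤ ∫ s in x..y, (1 + deriv f s ^ 2) := by
      rw [← Real.norm_eq_abs]
      refine intervalIntegral.norm_integral_le_of_norm_le hy.1
        (Eventually.of_forall fun s _ => ?_)
        (intervalIntegrable_const.add i2.intervalIntegrable)
      rw [Real.norm_eq_abs, ← sq_abs]
      nlinarith [sq_nonneg (|deriv f s| - 1)]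
    have h3 : ∫ s in x..y, (1 + deriv f s ^ 2) ≤ ∫ y in x..x + 1, (1 + deriv f y ^ 2) :=
      intervalIntegral.integral_mono_interval le_rfl hy.1 hy.2
        (Eventually.of_forall fun s => by simp only [Pi.zero_apply]; positivity)
        (intervalIntegrable_const.add i2.intervalIntegrable)
    have h4 : |f x| ≤ |f y| + |f y - f x| := by
      have := abs_sub_abs_le_abs_sub (f x) (f y)
      rw [abs_sub_comm] at this
      linarith
    rw [h1] at h2
    have h5 : |f y| ≤ 1 + f y ^ 2 := by
      rw [← sq_abs]
      nlinarith [sq_nonneg (|f y| - 1)]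
    linarith
  have := intervalIntegral.integral_mono_on hx (intervalIntegrable_const (c := |f x|) (μ := volume))
    (Continuous.intervalIntegrable (by fun_prop) _ _) key
  rw [intervalIntegral.integral_add (Continuous.intervalIntegrable (by fun_prop) _ _)
    intervalIntegrable_const, intervalIntegral.integral_add intervalIntegrable_const
    (Continuous.intervalIntegrable (by fun_prop) _ _)] at this
  have j1 := setIntegral_le_integral (s := Ioc x (x + 1)) i1
    (Eventually.of_forall fun y => sq_nonneg _)
  rw [← intervalIntegral.integral_of_le hx] at j1
  simp only [intervalIntegral.integral_const, smul_eq_mul, add_sub_cancel_left, one_mul] at this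
  linarith

namespace AdmissibleData

variable {K : ℝ} {c v₀ v₁ : ℝ → ℝ} (hd : AdmissibleData v₀ v₁) (h : IsSpeed K c)
include hd h

lemma exists_dataBounds : ∃ E ρ V B M,
    DataBounds K c (initR c v₀ v₁) (initS c v₀ v₁) v₀ E ρ V B M := by
  have K0 := h.K_pos
  obtain ⟨C₀, hC₀⟩ := MemH1.exists_abs_le
    ⟨hd.memLp_two, hd.absolutelyContinuous, hd.deriv_memH1.memLp⟩
  obtain ⟨C₁, hC₁⟩ := hd.deriv_memH1.exists_abs_le
  obtain ⟨C₂, hC₂⟩ := hd.vel_memH1.exists_abs_le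
  have hI := hd.integrable_dataEnergy h
  set I := ∫ y, CharFlow.dataEnergy (initR c v₀ v₁) (initS c v₀ v₁) v₀ y with hI'
  have I0 : 0 ≤ I := integral_nonneg CharFlow.dataEnergy_nonneg
  -- V² is a bound for v₀² plus K E with E = 4 I; the extra 1 gives the strict inequality `v₀_lt`.
  set V := √(C₀ ^ 2 + K * (4 * I) + 1) with hV
  obtain ⟨B, B0, hB⟩ := h.exists_coeff_bound V
  have hflux : ∀ s, |c (v₀ s) * deriv v₀ s| ≤ K * C₁ := fun s => by
    rw [abs_mul, abs_of_pos (h.pos _)]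
    exact mul_le_mul (h.le _) (hC₁ s) (abs_nonneg _) K0.le
  -- The factor 4 undoes the 1/4 in `dataEnergy`, and C₂ + K C₁ bounds both |R| and |S|. The levels
  -- M are fixed by the closing `rfl`.
  refine ⟨4 * I, 1 + (C₂ + K * C₁) ^ 2, V, B, _, fun s => ?_, fun s => ?_, fun a b hab => ?_,
    fun s => ?_, Real.sqrt_nonneg _, fun s => ?_, hd.continuous_initR h, hd.continuous_initS h,
    fun v hv => ?_, fun s => rfl⟩
  · have : |initR c v₀ v₁ s| ≤ C₂ + K * C₁ := (abs_add_le _ _).trans (add_le_add (hC₂ s) (hflux s))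
    rw [← sq_abs]
    gcongr
  · have : |initS c v₀ v₁ s| ≤ C₂ + K * C₁ := (abs_sub _ _).trans (add_le_add (hC₂ s) (hflux s))
    rw [← sq_abs]
    gcongr
  · have h1 := setIntegral_le_integral (s := Ioc a b) hI
      (Eventually.of_forall CharFlow.dataEnergy_nonneg)
    rw [← intervalIntegral.integral_of_le hab] at h1
    unfold CharFlow.dataEnergy at h1
    rw [intervalIntegral.integral_div] at h1
    unfold CharFlow.dataEnergy at hI'
    linarith
  · rw [hV, Real.sq_sqrt (by positivity)]
    have : v₀ s ^ 2 ≤ C₀ ^ 2 := by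
      rw [← sq_abs]
      exact pow_le_pow_left₀ (abs_nonneg _) (hC₀ s) 2
    linarith
  · refine (hd.hasDerivAt s).congr_deriv ?_
    have := (h.pos (v₀ s)).ne'
    simp only [initR, initS]
    field_simp
    ring
  · obtain ⟨⟨b1, -⟩, ⟨b2, -⟩, -⟩ := hB v v hv hv
    refine ⟨b1, ?_⟩
    rw [show (v + v ^ 3) / (8 * c v) = (v + v ^ 3) / (4 * c v) / 2 by ring, abs_div, abs_two]
    linarith [abs_nonneg ((v + v ^ 3) / (4 * c v))]

lemma nonempty_angleFlow : Nonempty (AngleFlow c (initR c v₀ v₁) (initS c v₀ v₁) v₀) := by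
  obtain ⟨E, ρ, V, B, M, D⟩ := hd.exists_dataBounds h
  obtain ⟨X⟩ := nonempty_clippedFlow h D
  exact X.nonempty_angleFlow h D

lemma hasDerivAt_initX (s : ℝ) : HasDerivAt (initX c v₀ v₁) (1 + initR c v₀ v₁ s ^ 2) s := by
  have := hd.continuous_initR h
  exact ((by fun_prop : Continuous fun y => 1 + initR c v₀ v₁ y ^ 2).integral_hasStrictDerivAt
    0 s).hasDerivAt

lemma hasDerivAt_initY (s : ℝ) : HasDerivAt (initY c v₀ v₁) (-(1 + initS c v₀ v₁ s ^ 2)) s := by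
  have := hd.continuous_initS h
  have := ((by fun_prop : Continuous fun y => 1 + initS c v₀ v₁ y ^ 2).integral_hasStrictDerivAt
    0 s).hasDerivAt.neg
  exact this.congr_of_eventuallyEq
    (Eventually.of_forall fun y => intervalIntegral.integral_symm _ _)

lemma exists_inverse_initX : ∃ α : ℝ → ℝ, Continuous α ∧ (∀ X, initX c v₀ v₁ (α X) = X) ∧
    (∀ s, α (initX c v₀ v₁ s) = s) ∧ ∀ X, HasDerivAt α (1 + initR c v₀ v₁ (α X) ^ 2)⁻¹ X :=
  exists_inverse_of_hasDerivAt_ge one_pos (hd.hasDerivAt_initX h)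
    fun _ => le_add_of_nonneg_right (sq_nonneg _)

lemma exists_inverse_initY : ∃ β : ℝ → ℝ, Continuous β ∧ (∀ Y, initY c v₀ v₁ (β Y) = Y) ∧
    (∀ s, β (initY c v₀ v₁ s) = s) ∧ ∀ Y, HasDerivAt β (-(1 + initS c v₀ v₁ (β Y) ^ 2)⁻¹) Y := by
  obtain ⟨H, cH, h1, h2, h3⟩ := exists_inverse_of_hasDerivAt_ge (ρ := fun s =>
      1 + initS c v₀ v₁ s ^ 2) one_pos
    (fun s => (hd.hasDerivAt_initY h s).neg.congr_deriv (neg_neg _))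
    fun _ => le_add_of_nonneg_right (sq_nonneg _)
  refine ⟨fun Y => H (-Y), cH.comp continuous_neg, fun Y => ?_, h2, fun Y => ?_⟩
  · have := h1 (-Y)
    exact neg_inj.1 this
  · exact ((h3 (-Y)).scomp Y (hasDerivAt_neg Y)).congr_deriv (by simp)

/-- The passage from a constructed solution to a solution in the coordinates in which the initial
curve is the diagonal. -/
lemma exists_charFlow {u : ℝ → ℝ → ℝ} (hu : IsConstructedSolution c v₀ v₁ u) :
    ∃ U : CharFlow c (initR c v₀ v₁) (initS c v₀ v₁) v₀,
      ∀ a b, u (U.t a b) (U.x a b) = U.v a b := by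
  obtain ⟨w, z, p, q, v, t, x, A, M, huv⟩ := hu
  have dX := hd.hasDerivAt_initX h
  have dY := hd.hasDerivAt_initY h
  set ξ := initX c v₀ v₁
  set η := initY c v₀ v₁
  have cR := hd.continuous_initR h
  have cS := hd.continuous_initS h
  set R := initR c v₀ v₁
  set S := initS c v₀ v₁
  have cX : Continuous ξ := continuous_iff_continuousAt.2 fun s => (dX s).continuousAt
  have cY : Continuous η := continuous_iff_continuousAt.2 fun s => (dY s).continuousAt
  have cXY : Continuous fun P : ℝ × ℝ => (ξ P.1, η P.2) :=
    (cX.comp continuous_fst).prodMk (cY.comp continuous_snd)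
  -- The densities acquire the factors dX/dα = 1 + R² and |dY/dβ| = 1 + S². Since Y decreases in β,
  -- derivatives along β change sign.
  let G : AngleFlow c R S v₀ :=
    { w := fun a b => w (ξ a) (η b)
      z := fun a b => z (ξ a) (η b)
      p := fun a b => p (ξ a) (η b) * (1 + R a ^ 2)
      q := fun a b => q (ξ a) (η b) * (1 + S b ^ 2)
      v := fun a b => v (ξ a) (η b)
      cont_w := A.continuous_w.comp cXY
      cont_z := A.continuous_z.comp cXY
      cont_p := (A.continuous_p.comp cXY).mul (((cR.comp continuous_fst).pow 2).const_add 1)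
      cont_q := (A.continuous_q.comp cXY).mul (((cS.comp continuous_snd).pow 2).const_add 1)
      cont_v := A.continuous_v.comp cXY
      w_b := fun a b => ((A.w_Y (ξ a) (η b)).comp b (dY b)).congr_deriv
        (by simp only [angleW]; ring)
      p_b := fun a b => (((A.p_Y (ξ a) (η b)).comp b (dY b)).mul_const (1 + R a ^ 2)).congr_deriv
        (by simp only [angleP]; ring)
      z_a := fun a b => ((A.z_X (ξ a) (η b)).comp a (dX a)).congr_deriv
        (by simp only [angleW]; ring)
      q_a := fun a b => (((A.q_X (ξ a) (η b)).comp a (dX a)).mul_const (1 + S b ^ 2)).congr_deriv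
        (by simp only [angleP]; ring)
      v_a := fun a b => ((A.v_X (ξ a) (η b)).comp a (dX a)).congr_deriv (by ring)
      v_b := fun a b => ((A.v_Y (ξ a) (η b)).comp b (dY b)).congr_deriv (by ring)
      w_diag := A.boundary_w
      z_diag := A.boundary_z
      p_diag := fun s => by rw [A.boundary_p, one_mul]
      q_diag := fun s => by rw [A.boundary_q, one_mul]
      v_diag := A.boundary_v }
  exact ⟨G.toCharFlow h (t := fun a b => t (ξ a) (η b)) (x := fun a b => x (ξ a) (η b))
    (fun a b => ((M.t_X (ξ a) (η b)).comp a (dX a)).congr_deriv (by simp only [G]; ring))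
    (fun a b => ((M.t_Y (ξ a) (η b)).comp b (dY b)).congr_deriv (by simp only [G]; ring))
    (fun a b => ((M.x_X (ξ a) (η b)).comp a (dX a)).congr_deriv (by simp only [G]; ring))
    (fun a b => ((M.x_Y (ξ a) (η b)).comp b (dY b)).congr_deriv (by simp only [G]; ring))
    M.boundary_t M.boundary_x, fun a b => huv _ _⟩

/-- The passage of `exists_charFlow` is inverted: α and β are recovered from X and Y, and division
by 1 + R² and 1 + S² restores p = q = 1 on the initial curve. -/
lemma exists_isConstructedSolution : ∃ u, IsConstructedSolution c v₀ v₁ u := by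
  obtain ⟨α, cα, -, hα, dα⟩ := hd.exists_inverse_initX h
  obtain ⟨β, cβ, -, hβ, dβ⟩ := hd.exists_inverse_initY h
  have cR := hd.continuous_initR h
  have cS := hd.continuous_initS h
  set R := initR c v₀ v₁
  set S := initS c v₀ v₁
  obtain ⟨G⟩ : Nonempty (AngleFlow c R S v₀) := hd.nonempty_angleFlow h
  obtain ⟨t, x, ta, tb, xa, xb, td, xd⟩ := G.exists_coord h
  obtain ⟨u, hu⟩ := (G.toCharFlow h ta tb xa xb td xd).exists_solution h
  have hR : ∀ s, 1 + R s ^ 2 ≠ 0 := fun s => by positivity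
  have hS : ∀ s, 1 + S s ^ 2 ≠ 0 := fun s => by positivity
  have cαβ : Continuous fun P : ℝ × ℝ => (α P.1, β P.2) :=
    (cα.comp continuous_fst).prodMk (cβ.comp continuous_snd)
  have cRα : Continuous fun P : ℝ × ℝ => 1 + R (α P.1) ^ 2 :=
    (((cR.comp cα).comp continuous_fst).pow 2).const_add 1
  have cSβ : Continuous fun P : ℝ × ℝ => 1 + S (β P.2) ^ 2 :=
    (((cS.comp cβ).comp continuous_snd).pow 2).const_add 1
  refine ⟨u, fun X Y => G.w (α X) (β Y), fun X Y => G.z (α X) (β Y),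
    fun X Y => G.p (α X) (β Y) / (1 + R (α X) ^ 2), fun X Y => G.q (α X) (β Y) / (1 + S (β Y) ^ 2),
    fun X Y => G.v (α X) (β Y), fun X Y => t (α X) (β Y), fun X Y => x (α X) (β Y),
    { continuous_w := G.cont_w.comp cαβ
      continuous_z := G.cont_z.comp cαβ
      continuous_p := (G.cont_p.comp cαβ).div cRα fun _ => hR _
      continuous_q := (G.cont_q.comp cαβ).div cSβ fun _ => hS _
      continuous_v := G.cont_v.comp cαβ
      w_Y := fun X Y => ((G.w_b (α X) (β Y)).comp Y (dβ Y)).congr_deriv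
        (by simp only [angleW]; ring)
      z_X := fun X Y => ((G.z_a (α X) (β Y)).comp X (dα X)).congr_deriv
        (by simp only [angleW]; ring)
      p_Y := fun X Y => (((G.p_b (α X) (β Y)).comp Y (dβ Y)).div_const _).congr_deriv
        (by simp only [angleP]; ring)
      q_X := fun X Y => (((G.q_a (α X) (β Y)).comp X (dα X)).div_const _).congr_deriv
        (by simp only [angleP]; ring)
      v_X := fun X Y => ((G.v_a (α X) (β Y)).comp X (dα X)).congr_deriv (by ring)
      v_Y := fun X Y => ((G.v_b (α X) (β Y)).comp Y (dβ Y)).congr_deriv (by ring)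
      boundary_w := fun s => by rw [hα, hβ, G.w_diag]
      boundary_z := fun s => by rw [hα, hβ, G.z_diag]
      boundary_p := fun s => by rw [hα, hβ, G.p_diag, div_self (hR s)]
      boundary_q := fun s => by rw [hα, hβ, G.q_diag, div_self (hS s)]
      boundary_v := fun s => by rw [hα, hβ, G.v_diag] },
    { t_X := fun X Y => ((ta (α X) (β Y)).comp X (dα X)).congr_deriv (by ring)
      t_Y := fun X Y => ((tb (α X) (β Y)).comp Y (dβ Y)).congr_deriv (by ring)
      x_X := fun X Y => ((xa (α X) (β Y)).comp X (dα X)).congr_deriv (by ring)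
      x_Y := fun X Y => ((xb (α X) (β Y)).comp Y (dβ Y)).congr_deriv (by ring)
      boundary_t := fun s => by rw [hα, hβ, td]
      boundary_x := fun s => by rw [hα, hβ, xd] }, fun X Y => hu _ _⟩

end AdmissibleData

/-! ### The main theorem -/

theorem theorem1p2 (K : ℝ) (hK : 1 < K) (c : ℝ → ℝ) (hc : ContDiff ℝ ∞ c)
    (hcK : ∀ s, c s ∈ Icc K⁻¹ K) :
    -- the construction yields exactly one function for each choice of initial data
    (∀ v₀ v₁ : ℝ → ℝ, AdmissibleData v₀ v₁ → ∃! u, IsConstructedSolution c v₀ v₁ u) ∧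
    -- it is a weak solution of the Cauchy problem and satisfies the energy inequality
    (∀ (v₀ v₁ : ℝ → ℝ) (u : ℝ → ℝ → ℝ), AdmissibleData v₀ v₁ →
      IsConstructedSolution c v₀ v₁ u →
        IsWeakSolution c v₀ v₁ u ∧
        (∀ t, ∀ᵐ x : ℝ, DifferentiableAt ℝ (fun p : ℝ × ℝ => u p.1 p.2) (t, x)) ∧
        initialEnergy c v₀ v₁ < ⊤ ∧
        ∀ t, energy c u t ≤ initialEnergy c v₀ v₁) ∧
    -- continuous dependence on the initial data
    (∀ (v₀ v₁ : ℝ → ℝ) (u : ℝ → ℝ → ℝ) (v₀n v₁n : ℕ → ℝ → ℝ) (un : ℕ → ℝ → ℝ → ℝ),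
      AdmissibleData v₀ v₁ → IsConstructedSolution c v₀ v₁ u →
      (∀ n, AdmissibleData (v₀n n) (v₁n n)) →
      (∀ n, IsConstructedSolution c (v₀n n) (v₁n n) (un n)) →
      Tendsto (fun n => eLpNorm (fun x => deriv (v₀n n) x - deriv v₀ x) 2 volume)
        atTop (𝓝 0) →
      Tendsto (fun n => eLpNorm (fun x => v₁n n x - v₁ x) 2 volume) atTop (𝓝 0) →
      (∀ C : Set ℝ, IsCompact C → TendstoUniformlyOn v₀n v₀ atTop C) →
      ∀ B : Set (ℝ × ℝ), Bornology.IsBounded B →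
        TendstoUniformlyOn (fun n (p : ℝ × ℝ) => un n p.1 p.2)
          (fun p : ℝ × ℝ => u p.1 p.2) atTop B) := by
  have h : IsSpeed K c := ⟨hK, hc, hcK⟩
  refine ⟨fun v₀ v₁ hd => ?_, fun v₀ v₁ u hd hu => ?_,
    fun v₀ v₁ u v₀n v₁n un hd hu hdn hun h0 h1 hv B hB => ?_⟩
  · obtain ⟨u, hu⟩ := hd.exists_isConstructedSolution h
    obtain ⟨U, hU⟩ := hd.exists_charFlow h hu
    refine ⟨u, hu, fun w hw => ?_⟩
    obtain ⟨W, hW⟩ := hd.exists_charFlow h hw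
    exact U.solution_unique h W hU hW
  · obtain ⟨U, hU⟩ := hd.exists_charFlow h hu
    rw [hd.initialEnergy_eq_ofReal h]
    exact ⟨U.isWeakSolution h hU hd, U.ae_differentiableAt h hU, ENNReal.ofReal_lt_top,
      U.energy_le h hU (hd.integrable_dataEnergy h)⟩
  · obtain ⟨U, hU⟩ := hd.exists_charFlow h hu
    choose W hW using fun n => (hdn n).exists_charFlow h (hun n)
    exact U.tendstoUniformlyOn_solution h hU W hW
      (fun r hr => (tendsto_integral_init h hd hdn h0 h1 hv hr).1)
      (fun r hr => (tendsto_integral_init h hd hdn h0 h1 hv hr).2) hv hB
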